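/- Definitions. Let $k\ge 1$ and $n\ge 0$ be integers. For a permutation $\sigma$ of $\{1,\dots,n\}$ let $m_k(\sigma)$ be the number of monotone (increasing or decreasing) subsequences of $\sigma$ of length $k+1$. Let $\tau_{k,n}$ be the permutation of $\{1,\dots,n\}$ obtained by concatenating, for $j=k-1,k-2,\dots,0$ in this order, the increasing runs $\lfloor jn/k\rfloor+1,\ \lfloor jn/k\rfloor+2,\ \dots,\ \lfloor (j+1)n/k\rfloor$. For a finite poset $P$ let $h_k(P)$ be the number of $(k+1)$-element subsets of $P$ that are chains or antichains. A poset has order dimension at most two if its order is the intersection of two linear orders. Write $\hat P$ for $P$ with the order reversed. A dual $P^*$ of $P$ is any poset on the same set such that every two distinct elements are comparable in exactly one of $P$ and $P^*$. A decomposition into $k$ chains (or antichains) is a partition of the ground set into $k$ pairwise disjoint, possibly empty, chains (or antichains). Special posets. A poset $P$ with $k^2+k+1$ elements is called special if the following holds. Let $A_1$ be the set of minimal elements of $P$ and $A_2$ the set of minimal elements of $P\setminus A_1$. Then $|A_1|=k+1$, $|A_2|=k$, the poset $P\setminus A_1$ can be decomposed into $k$ chains as well as into $k$ antichains, $P\setminus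 A_1$ contains exactly $k$ chains with $k$ elements, and the comparability graph of the subposet induced by $A_1\cup A_2$ is either (i) a path with $2k+1$ vertices, or (ii) the disjoint union of a path with $2k-1$ vertices and an edge. Moreover, in case (ii), if $z$ is the element of $A_2$ that does not belong to the path and $C$ is the $k$-element chain in $P\setminus A_1$ with smallest element $z$, then some element of $A_1$ that belongs to the path is smaller than the second smallest element of $C$. Theorem. There exist an integer $k_0$ and a real number $c>0$ such that the following holds for all integers $k\ge k_0$ and $n\ge 0$ with $n\le k^2+ck^{3/2}/\log k$. If $P$ is an $n$-element poset of order dimension at most two, then $$h_k(P)\ \ge\ m_k(\tau_{k,n}).$$ Moreover, if equality holds, then $P$ can be decomposed into $k$ chains or into $k$ antichains, and if in addition $n\ge k^2-2$, then such a decomposition exists in which every part has $\lfloor n/k\rfloor$ or $\lceil n/k\rceil$ elements; the only exception is that $n=k^2+k+1$ and $P$, or $\hat P$, or some dual $P^*$ of $P$, is special. -/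

import Mathlib

/-! Posets of order dimension at most two, homogenous sets, and the permutation `τ_{k,n}`. -/

namespace MonoPosets

/-! ### Monotone subsequences and the permutation `τ_{k,n}` -/

/-- `m_k(σ)`: the number of monotone (increasing or decreasing) subsequences of length `k + 1` of
a sequence `σ` of numbers. `List.sublistsLen` lists the subsequences of the given length, one for
each choice of positions. -/
def monotoneCount (k : ℕ) (σ : List ℕ) : ℕ :=
  (σ.sublistsLen (k + 1)).countP
    fun s => decide (s.Pairwise (· < ·) ∨ s.Pairwise (· > ·))

/-- The permutation `τ_{k,n}` of `{1, …, n}` in one-line notation: the concatenation, for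
`j = k - 1, k - 2, …, 0` in this order, of the increasing runs
`⌊j n / k⌋ + 1, ⌊j n / k⌋ + 2, …, ⌊(j + 1) n / k⌋`. -/
def tau (k n : ℕ) : List ℕ :=
  (List.range k).reverse.flatMap
    fun j => List.range' (j * n / k + 1) ((j + 1) * n / k - j * n / k)

/-- `τ_{k,n}` is indeed a permutation of `{1, …, n}`. -/
theorem tau_perm (k n : ℕ) (hk : 1 ≤ k) : (tau k n).Perm (List.range' 1 n) := by
  have key : ∀ m : ℕ, ((List.range m).reverse.flatMap
      fun j => List.range' (j * n / k + 1) ((j + 1) * n / k - j * n / k)).Perm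
        (List.range' 1 (m * n / k)) := by
    intro m
    induction m with
    | zero => simp
    | succ m ih =>
      rw [List.range_succ, List.reverse_append]
      simp only [List.reverse_cons, List.reverse_nil, List.nil_append, List.singleton_append,
        List.flatMap_cons]
      have hle : m * n / k ≤ (m + 1) * n / k :=
        Nat.div_le_div_right (Nat.mul_le_mul_right n (Nat.le_succ m))
      have hsplit : List.range' 1 ((m + 1) * n / k) =
          List.range' 1 (m * n / k) ++
            List.range' (m * n / k + 1) ((m + 1) * n / k - m * n / k) := by
        have h := List.range'_append_1 (s := 1) (m := m * n / k)
          (n := (m + 1) * n / k - m * n / k)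
        rw [Nat.add_sub_cancel' hle, Nat.add_comm 1] at h
        exact h.symm
      rw [hsplit]
      exact List.perm_append_comm.trans (List.Perm.append_right _ ih)
  have h := key k
  rwa [Nat.mul_div_cancel_left n hk] at h

/-! ### Posets -/

/-- The order dimension of `P` is at most `d`: the order of `P` is the intersection of `d` linear
orders (not necessarily distinct). -/
def OrderDimLE (P : Type*) [PartialOrder P] (d : ℕ) : Prop :=
  ∃ L : Fin d → LinearOrder P, ∀ x y : P, x ≤ y ↔ ∀ i, (L i).le x y

/-- `h_k(P)`: the number of homogenous sets (chains or antichains) with `k + 1` elements. -/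
noncomputable def homogenousCount (k : ℕ) (P : Type*) [PartialOrder P] : ℕ :=
  {s : Set P | s.ncard = k + 1 ∧ (IsChain (· ≤ ·) s ∨ IsAntichain (· ≤ ·) s)}.ncard

/-- The sets `C 0, …, C (k - 1)` are pairwise disjoint and have union `S`. -/
def IsDecomposition {P : Type*} {k : ℕ} (S : Set P) (C : Fin k → Set P) : Prop :=
  Pairwise (fun i j => Disjoint (C i) (C j)) ∧ ⋃ i, C i = S

/-- Two elements are comparable with respect to the order `o`. -/
def Comparable {P : Type*} (o : PartialOrder P) (x y : P) : Prop :=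
  o.le x y ∨ o.le y x

/-- `o'` is a dual `P*` of the poset `(P, o)`: it is an order on the same set, and every pair of
distinct elements is comparable in exactly one of the two orders. -/
def IsDualOrder {P : Type*} (o o' : PartialOrder P) : Prop :=
  ∀ x y : P, x ≠ y → (Comparable o' x y ↔ ¬ Comparable o x y)

/-- The comparability graph of a poset. -/
def comparabilityGraph (P : Type*) [PartialOrder P] : SimpleGraph P where
  Adj x y := x < y ∨ y < x
  symm := ⟨fun _ _ h => h.symm⟩
  loopless := ⟨fun x h => h.elim (lt_irrefl x) (lt_irrefl x)⟩

/-- The set `A₁` of minimal elements of `P`. -/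
def firstLevel (P : Type*) [PartialOrder P] : Set P :=
  {x | Minimal (fun _ => True) x}

/-- The set `A₂` of minimal elements of `P \ A₁`. -/
def secondLevel (P : Type*) [PartialOrder P] : Set P :=
  {x | Minimal (fun y => y ∉ firstLevel P) x}

/-- The comparability graph of the subposet of `P` induced by `A₁ ∪ A₂`. -/
def lowGraph (P : Type*) [PartialOrder P] : SimpleGraph ↥(firstLevel P ∪ secondLevel P) :=
  (comparabilityGraph P).induce (firstLevel P ∪ secondLevel P)

/-- Alternative (i): the graph on `A₁ ∪ A₂` is a path with `2k + 1` vertices. -/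
def LowGraphIsPath (k : ℕ) (P : Type*) [PartialOrder P] : Prop :=
  Nonempty (lowGraph P ≃g SimpleGraph.pathGraph (2 * k + 1))

/-- Alternative (ii): the graph on `A₁ ∪ A₂` is the disjoint union of a path with `2k - 1` vertices
and an edge; moreover, if `z` is the element of `A₂` that does not belong to the path, `C` is the
`k`-element chain in `P \ A₁` with smallest element `z`, and `c` is the second smallest
element of `C`, then some element of `A₁` belonging to the path is smaller than `c`. -/
def LowGraphIsPathAndEdge (k : ℕ) (P : Type*) [PartialOrder P] : Prop :=
  ∃ e : lowGraph P ≃g SimpleGraph.pathGraph (2 * k - 1) ⊕g SimpleGraph.pathGraph 2,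
    ∃ z : ↥(firstLevel P ∪ secondLevel P), z.1 ∈ secondLevel P ∧ (e z).isRight = true ∧
    ∃ C : Set P, C ⊆ (firstLevel P)ᶜ ∧ IsChain (· ≤ ·) C ∧ C.ncard = k ∧ IsLeast C z.1 ∧
    ∃ c : P, IsLeast (C \ {z.1}) c ∧
    ∃ x : ↥(firstLevel P ∪ secondLevel P),
      x.1 ∈ firstLevel P ∧ (e x).isLeft = true ∧ x.1 < c

/-- The special posets with `k² + k + 1` elements. -/
structure IsSpecial (k : ℕ) (P : Type*) [PartialOrder P] : Prop where
  card_eq : Nat.card P = k ^ 2 + k + 1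
  card_firstLevel : (firstLevel P).ncard = k + 1
  chains : ∃ C : Fin k → Set P,
    IsDecomposition (firstLevel P)ᶜ C ∧ ∀ i, IsChain (· ≤ ·) (C i)
  antichains : ∃ C : Fin k → Set P,
    IsDecomposition (firstLevel P)ᶜ C ∧ ∀ i, IsAntichain (· ≤ ·) (C i)
  card_chains :
    {C : Set P | C ⊆ (firstLevel P)ᶜ ∧ IsChain (· ≤ ·) C ∧ C.ncard = k}.ncard = k
  card_secondLevel : (secondLevel P).ncard = k
  lowGraph_eq : LowGraphIsPath k P ∨ LowGraphIsPathAndEdge k P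

end MonoPosets

/-!
A *homogeneous* set is a chain or an antichain with `k + 1` elements. The order of a poset of
dimension two is the intersection of two linear orders; reversing one of them yields a *conjugate*
order `r'` whose comparable pairs are the incomparable pairs of `r` (`OrderDimLE.exists_conj`).
Passing from `r` to `r'` exchanges chains and antichains, so that it suffices to study the number of
chains. All arguments concern strict orders `r` on a type and finite subsets `S` of it, decomposed
into the levels of elements of equal height.

If there are no large antichains, or no large chains, then the set splits into `k` chains or into
`k` antichains, and the convexity of binomial coefficients gives the bound
(`opt_le_hom_of_not_both`). So let both kinds be present, and let the set have `k² + ak + b`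
elements, `1 ≤ b ≤ k`. For `a = 0` the bound is `b`, and removing elements one at a time is enough
(`lt_hom_of_both`). If the width or the height exceeds `k + a`, a large antichain or chain contains
an element in so many homogeneous sets that one can remove it and use induction
(`BothBound.of_large_anti`).

Otherwise the height and the width are at most `k + a`. Suppose that there are few homogeneous sets,
fewer than `2 ^ g` for some `g` of order `a log k`. Two exchange arguments are used all the time. If
an antichain contains `g` elements each of which can be moved in or out independently, there are
`2 ^ g` antichains (`two_pow_le_antis`); hence all but `g` elements above a level with more than `k`
elements have two lower neighbours. And if all elements of a level outside a set `B` are the tops of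
`θ` chains through chosen lower levels, then at the next level either the same holds for an
exceptional set that grows no faster than the levels shrink, or the bound doubles
(`Consec.keep_or_double`). It follows that a few elements meet all the chains of length `h` if the
set has noticeably more than `h k` elements, and so the height of one of the two orders equals
`k + a` even after removing any `k / 8` elements, as otherwise one could reduce both the height and
the width to `k` (`robust_or_robust`).

Let `r` be that order. There are `k + a` levels, and the chains are counted over all choices of
`k + 1` of these. A level is *good* if it has more than `k` elements. Along a choice of levels, the
number of chains that end in a typical element grows by one at every good level, by two at the
second one if that has `k + 2` elements, and doubles if exceptional sets grow
(`Tower.state_induction`, `Robust.of_second_level`). Since there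
are at least `⌈b / a⌉` good levels, this already yields more chains than needed, except when the
level sizes are `k` and `k + a` in one of the two directions, with `a = 1` or a single good level
(`Robust.main`, `Tie`). In this case Hall's theorem provides `k` disjoint chains through all the
levels (`Tie.exists_strands`), for a violation of Hall's condition would produce further chains.
Every lower neighbour of such a strand off the strand yields additional chains, and the absence of
lower neighbours yields additional antichains. The sum exceeds the bound if `2 ≤ a`
(`Robust.target_lt_of_two_le`). For `a = 1` it is exactly the bound at worst, and then all the
relations are determined: `b = 1`, and the only good level is the lowest one
(`Tie.target_le_or_tight`).

In such a *tight* poset the lower neighbours of the elements of the second level are intervals of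
the lowest level, which is linearly ordered by `r'`; they have one or two elements, any two of them
have three elements in their union, and at most one is a singleton. So the two lowest levels form a
path, or a path and an edge (`Tight.isSpecial`).

The number of monotone subsequences of `τ_{k,n}` need only be bounded from above, by the number of
`(k + 1)`-subsets of its increasing runs (`monotoneCount_tau_le`).
-/

namespace MonoPosets

open Finset
open scoped Classical

universe u

variable {α : Type u}

/-! ### Chains, antichains and levels of a strict order -/

/-- `r` is a strict partial order. -/
structure StrictRel (r : α → α → Prop) : Prop where
  irrefl : ∀ x, ¬ r x x
  trans : ∀ {x y z}, r x y → r y z → r x z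

/-- The finite set `T` is a chain of the strict order `r`. -/
def ChainOn (r : α → α → Prop) (T : Finset α) : Prop :=
  ∀ x ∈ T, ∀ y ∈ T, x ≠ y → r x y ∨ r y x

/-- The finite set `T` is an antichain of the strict order `r`. -/
def AntiOn (r : α → α → Prop) (T : Finset α) : Prop :=
  ∀ x ∈ T, ∀ y ∈ T, ¬ r x y

/-- The `m`-element chains contained in `S`. -/
noncomputable def chains (r : α → α → Prop) (m : ℕ) (S : Finset α) : Finset (Finset α) :=
  (S.powersetCard m).filter (ChainOn r)

/-- The `m`-element antichains contained in `S`. -/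
noncomputable def antis (r : α → α → Prop) (m : ℕ) (S : Finset α) : Finset (Finset α) :=
  (S.powersetCard m).filter (AntiOn r)

section basic
variable {r : α → α → Prop} {S T U : Finset α} {m : ℕ}

theorem mem_chains : T ∈ chains r m S ↔ T ⊆ S ∧ T.card = m ∧ ChainOn r T := by
  simp [chains, mem_powersetCard, and_assoc]

theorem mem_antis : T ∈ antis r m S ↔ T ⊆ S ∧ T.card = m ∧ AntiOn r T := by
  simp [antis, mem_powersetCard, and_assoc]

theorem ChainOn.mono (h : ChainOn r T) (hU : U ⊆ T) : ChainOn r U :=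
  fun x hx y hy => h x (hU hx) y (hU hy)

theorem AntiOn.mono (h : AntiOn r T) (hU : U ⊆ T) : AntiOn r U :=
  fun x hx y hy => h x (hU hx) y (hU hy)

theorem chains_mono (h : S ⊆ T) : chains r m S ⊆ chains r m T := fun U hU => by
  rw [mem_chains] at *
  exact ⟨hU.1.trans h, hU.2⟩

theorem antis_mono (h : S ⊆ T) : antis r m S ⊆ antis r m T := fun U hU => by
  rw [mem_antis] at *
  exact ⟨hU.1.trans h, hU.2⟩

theorem StrictRel.flip (hr : StrictRel r) : StrictRel (flip r) :=
  ⟨fun x h => hr.irrefl x h, fun h1 h2 => hr.trans h2 h1⟩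

theorem StrictRel.asymm (hr : StrictRel r) {x y : α} (h : r x y) : ¬ r y x :=
  fun h' => hr.irrefl _ (hr.trans h h')

theorem StrictRel.ne (hr : StrictRel r) {x y : α} (h : r x y) : x ≠ y := by
  rintro rfl; exact hr.irrefl _ h

theorem chainOn_flip : ChainOn (flip r) T ↔ ChainOn r T := by
  unfold ChainOn flip
  exact ⟨fun h x hx y hy hne => (h x hx y hy hne).symm,
    fun h x hx y hy hne => (h x hx y hy hne).symm⟩

theorem antiOn_flip : AntiOn (flip r) T ↔ AntiOn r T := by
  unfold AntiOn flip
  exact ⟨fun h x hx y hy => h y hy x hx, fun h x hx y hy => h y hy x hx⟩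

theorem chains_flip : chains (flip r) m S = chains r m S := by
  ext T; simp only [mem_chains, chainOn_flip]

theorem antis_flip : antis (flip r) m S = antis r m S := by
  ext T; simp only [mem_antis, antiOn_flip]

theorem chainOn_empty : ChainOn r ∅ := by intro x hx; simp at hx

theorem chainOn_singleton (x : α) : ChainOn r {x} := by
  intro y hy z hz h
  rw [mem_singleton] at hy hz
  exact absurd (hy.trans hz.symm) h

theorem ChainOn.insert_top (h : ChainOn r T) {v : α} (hv : ∀ x ∈ T, r x v) :
    ChainOn r (insert v T) := by
  intro x hx y hy hne
  rw [mem_insert] at hx hy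
  rcases hx with rfl | hx
  · rcases hy with rfl | hy
    · exact absurd rfl hne
    · exact Or.inr (hv y hy)
  · rcases hy with rfl | hy
    · exact Or.inl (hv x hx)
    · exact h x hx y hy hne

theorem ChainOn.card_inter_le (hc : ChainOn r T) (ha : AntiOn r U) : (T ∩ U).card ≤ 1 := by
  rw [card_le_one]
  intro x hx y hy
  rw [mem_inter] at hx hy
  by_contra hne
  rcases hc x hx.1 y hy.1 hne with h | h
  · exact ha _ hx.2 _ hy.2 h
  · exact ha _ hy.2 _ hx.2 h

theorem ChainOn.exists_max (hr : StrictRel r) (hc : ChainOn r T) (hT : T.Nonempty) :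
    ∃ v ∈ T, ∀ x ∈ T, x ≠ v → r x v := by
  induction T using Finset.induction_on with
  | empty => exact absurd hT (by simp)
  | insert a T ha ih =>
    rcases T.eq_empty_or_nonempty with rfl | hne
    · exact ⟨a, by simp, by simp⟩
    obtain ⟨v, hv, hmax⟩ := ih (hc.mono (subset_insert _ _)) hne
    have hav : a ≠ v := fun h => ha (h ▸ hv)
    rcases hc a (mem_insert_self _ _) v (mem_insert_of_mem hv) hav with h | h
    · refine ⟨v, mem_insert_of_mem hv, fun x hx hxv => ?_⟩
      rcases mem_insert.1 hx with rfl | hx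
      · exact h
      · exact hmax x hx hxv
    · refine ⟨a, mem_insert_self _ _, fun x hx hxa => ?_⟩
      rcases mem_insert.1 hx with rfl | hx
      · exact absurd rfl hxa
      · rcases eq_or_ne x v with rfl | hxv
        · exact h
        · exact hr.trans (hmax x hx hxv) h

/-- The length of the longest chain of `S` strictly below `v`. -/
noncomputable def lev (r : α → α → Prop) (S : Finset α) (v : α) : ℕ :=
  (S.powerset.filter fun T => ChainOn r T ∧ ∀ x ∈ T, r x v).sup card

/-- The elements of height `j` in `S`, heights being counted from `0`. -/
noncomputable def level (r : α → α → Prop) (S : Finset α) (j : ℕ) : Finset α :=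
  S.filter fun v => lev r S v = j

theorem le_lev {v : α} (hT : T ⊆ S) (hc : ChainOn r T) (hv : ∀ x ∈ T, r x v) :
    T.card ≤ lev r S v :=
  le_sup (f := card) (by simp [hT, hc]; exact hv)

theorem exists_chain_lev (r : α → α → Prop) (S : Finset α) (v : α) :
    ∃ T ⊆ S, ChainOn r T ∧ (∀ x ∈ T, r x v) ∧ T.card = lev r S v := by
  have hne : (S.powerset.filter fun T => ChainOn r T ∧ ∀ x ∈ T, r x v).Nonempty :=
    ⟨∅, by simp [chainOn_empty]⟩
  obtain ⟨T, hT, h⟩ := exists_mem_eq_sup _ hne card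
  simp only [mem_filter, mem_powerset] at hT
  exact ⟨T, hT.1, hT.2.1, hT.2.2, h.symm⟩

theorem lev_lt (hr : StrictRel r) {u v : α} (hu : u ∈ S) (h : r u v) : lev r S u < lev r S v := by
  obtain ⟨T, hT, hc, hb, hcard⟩ := exists_chain_lev r S u
  have hn : u ∉ T := fun hu => hr.irrefl _ (hb u hu)
  have := le_lev (r := r) (S := S) (T := insert u T) (v := v) (insert_subset hu hT)
    (hc.insert_top hb) (by
      intro x hx
      rcases mem_insert.1 hx with rfl | hx
      · exact h
      · exact hr.trans (hb x hx) h)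
  rw [card_insert_of_notMem hn] at this
  omega

theorem exists_below (hr : StrictRel r) {v : α} {j : ℕ} (h : lev r S v = j + 1) :
    ∃ u ∈ S, r u v ∧ lev r S u = j := by
  obtain ⟨T, hT, hc, hb, hcard⟩ := exists_chain_lev r S v
  have hne : T.Nonempty := by rw [← card_pos]; omega
  obtain ⟨u, hu, hmax⟩ := hc.exists_max hr hne
  refine ⟨u, hT hu, hb u hu, ?_⟩
  have h1 := lev_lt hr (hT hu) (hb u hu)
  have h2 := le_lev (r := r) (S := S) (T := T.erase u) (v := u) ((erase_subset _ _).trans hT)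
    (hc.mono (erase_subset _ _)) (fun x hx => hmax x (mem_of_mem_erase hx) (ne_of_mem_erase hx))
  rw [card_erase_of_mem hu] at h2
  omega

theorem exists_below_of_lt (hr : StrictRel r) {v : α} {i j : ℕ} (h : lev r S v = j) (hij : i < j) :
    ∃ u ∈ S, r u v ∧ lev r S u = i := by
  induction j generalizing v with
  | zero => omega
  | succ j ih =>
    obtain ⟨u, hu, huv, hl⟩ := exists_below hr h
    rcases Nat.lt_or_ge i j with hij' | hij'
    · obtain ⟨w, hw, hwu, hlw⟩ := ih hl hij'
      exact ⟨w, hw, hr.trans hwu huv, hlw⟩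
    · exact ⟨u, hu, huv, by omega⟩

theorem mem_level {v : α} {j : ℕ} : v ∈ level r S j ↔ v ∈ S ∧ lev r S v = j := by
  simp [level]

theorem level_subset (r : α → α → Prop) (S : Finset α) (j : ℕ) : level r S j ⊆ S :=
  filter_subset _ _

theorem antiOn_level (hr : StrictRel r) (j : ℕ) : AntiOn r (level r S j) := by
  intro x hx y hy h
  rw [mem_level] at hx hy
  have := lev_lt hr hx.1 h
  omega

theorem level_disjoint {i j : ℕ} (h : i ≠ j) : Disjoint (level r S i) (level r S j) := by
  rw [disjoint_left]
  intro x hx hy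
  rw [mem_level] at hx hy
  omega

/-- No chain of `S` has more than `h` elements. -/
def HeightLE (r : α → α → Prop) (S : Finset α) (h : ℕ) : Prop :=
  ∀ T ⊆ S, ChainOn r T → T.card ≤ h

/-- No antichain of `S` has more than `w` elements. -/
def WidthLE (r : α → α → Prop) (S : Finset α) (w : ℕ) : Prop :=
  ∀ T ⊆ S, AntiOn r T → T.card ≤ w

theorem HeightLE.mono {h : ℕ} (hh : HeightLE r T h) (hS : S ⊆ T) : HeightLE r S h :=
  fun U hU => hh U (hU.trans hS)

theorem WidthLE.mono {h : ℕ} (hh : WidthLE r T h) (hS : S ⊆ T) : WidthLE r S h :=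
  fun U hU => hh U (hU.trans hS)

theorem HeightLE.lev_lt (hr : StrictRel r) {h : ℕ} (hh : HeightLE r S h) {v : α} (hv : v ∈ S) :
    lev r S v < h := by
  obtain ⟨T, hT, hc, hb, hcard⟩ := exists_chain_lev r S v
  have hn : v ∉ T := fun hu => hr.irrefl _ (hb v hu)
  have := hh (insert v T) (insert_subset hv hT) (hc.insert_top hb)
  rw [card_insert_of_notMem hn] at this
  omega

theorem sum_card_level (hr : StrictRel r) {h : ℕ} (hh : HeightLE r S h) :
    ∑ j ∈ range h, (level r S j).card = S.card := by
  rw [card_eq_sum_card_fiberwise (f := lev r S) (t := range h)]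
  · rfl
  · intro v hv
    simpa using hh.lev_lt hr hv

theorem card_le_mul (hr : StrictRel r) {h w : ℕ} (hh : HeightLE r S h) (hw : WidthLE r S w) :
    S.card ≤ h * w := by
  rw [← sum_card_level hr hh]
  calc _ ≤ ∑ j ∈ range h, w :=
        sum_le_sum fun j _ => hw _ (level_subset _ _ _) (antiOn_level hr j)
    _ = h * w := by simp

theorem ChainOn.lev_inj (hr : StrictRel r) (hc : ChainOn r T) (hT : T ⊆ S) :
    Set.InjOn (lev r S) T := by
  intro x hx y hy h
  by_contra hne
  rcases hc x hx y hy hne with h' | h'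
  · have := lev_lt hr (hT hx) h'; omega
  · have := lev_lt hr (hT hy) h'; omega

/-- A chain of maximal size meets every level. -/
theorem ChainOn.image_lev (hr : StrictRel r) {h : ℕ} (hh : HeightLE r S h) (hc : ChainOn r T)
    (hT : T ⊆ S) (hcard : T.card = h) : T.image (lev r S) = range h := by
  apply eq_of_subset_of_card_le
  · intro i hi
    obtain ⟨x, hx, rfl⟩ := mem_image.1 hi
    simpa using hh.lev_lt hr (hT hx)
  · rw [card_image_of_injOn (hc.lev_inj hr hT)]
    simp [hcard]

theorem exists_chain_of_not_heightLE {h : ℕ} (hh : ¬ HeightLE r S h) :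
    ∃ T ⊆ S, ChainOn r T ∧ T.card = h + 1 := by
  unfold HeightLE at hh
  push Not at hh
  obtain ⟨T, hT, hc, hcard⟩ := hh
  obtain ⟨U, hU, hUc⟩ := exists_subset_card_eq (show h + 1 ≤ T.card from hcard)
  exact ⟨U, hU.trans hT, hc.mono hU, hUc⟩

end basic

/-! ### Exchanging elements between two antichains -/

section swap
variable {r : α → α → Prop} {S X Y : Finset α} {k a g : ℕ}

/-- The neighbours of `y` in `X` that lie below `y`. -/
noncomputable def below (r : α → α → Prop) (X : Finset α) (y : α) : Finset α :=
  X.filter fun x => r x y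

theorem mem_below {x y : α} : x ∈ below r X y ↔ x ∈ X ∧ r x y := by simp [below]

theorem below_subset (r : α → α → Prop) (X : Finset α) (y : α) : below r X y ⊆ X :=
  filter_subset _ _

/-- Replacing part of an antichain by every subset of a set `Y₀` yields exponentially many
antichains. -/
theorem two_pow_le_antis (hX : X ⊆ S) (hXa : AntiOn r X) (hY : Y ⊆ S) (hYa : AntiOn r Y)
    (hd : Disjoint X Y) {B Y₀ : Finset α} (hB : B ⊆ Y) (hY₀ : Y₀ ⊆ Y \ B) (hc : Y₀.card ≤ k)
    (hU : ∀ U ⊆ Y₀, ∃ X' ⊆ X, (∀ x ∈ X', ∀ y ∈ B ∪ U, ¬ r x y ∧ ¬ r y x) ∧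
      k ≤ X'.card + B.card + U.card) :
    2 ^ Y₀.card ≤ (antis r k S).card := by
  have hY₀Y : Y₀ ⊆ Y := hY₀.trans sdiff_subset
  have hdB : Disjoint B Y₀ := disjoint_of_subset_right hY₀ disjoint_sdiff
  have key : ∀ U ⊆ Y₀, ∃ T ∈ antis r k S, T ∩ Y₀ = U := by
    intro U hUY
    obtain ⟨X', hX'X, hX', hkU⟩ := hU U hUY
    have hBU : Disjoint B U := disjoint_of_subset_right hUY hdB
    have hXBU : Disjoint X' (B ∪ U) := disjoint_of_subset_left hX'X
      (disjoint_of_subset_right (union_subset hB (hUY.trans hY₀Y)) hd)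
    have hcard : k ≤ (X' ∪ (B ∪ U)).card := by
      rw [card_union_of_disjoint hXBU, card_union_of_disjoint hBU]
      omega
    obtain ⟨T, hUT, hT, hTc⟩ := exists_subsuperset_card_eq
      (show U ⊆ X' ∪ (B ∪ U) from subset_union_right.trans subset_union_right)
      ((card_le_card hUY).trans hc) hcard
    refine ⟨T, mem_antis.2 ⟨?_, hTc, ?_⟩, ?_⟩
    · refine hT.trans (union_subset (hX'X.trans hX) ?_)
      exact union_subset (hB.trans hY) ((hUY.trans hY₀Y).trans hY)
    · have : AntiOn r (X' ∪ (B ∪ U)) := by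
        intro x hx y hy
        have hsub : B ∪ U ⊆ Y := union_subset hB (hUY.trans hY₀Y)
        rcases mem_union.1 hx with hx | hx <;> rcases mem_union.1 hy with hy | hy
        · exact hXa x (hX'X hx) y (hX'X hy)
        · exact (hX' x hx y hy).1
        · exact (hX' y hy x hx).2
        · exact hYa x (hsub hx) y (hsub hy)
      exact this.mono hT
    · apply Subset.antisymm
      · intro x hx
        rw [mem_inter] at hx
        rcases mem_union.1 (hT hx.1) with h | h
        · exact absurd (hY₀Y hx.2) (disjoint_left.1 hd (hX'X h))
        · rcases mem_union.1 h with h | h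
          · exact absurd hx.2 (disjoint_left.1 hdB h)
          · exact h
      · exact subset_inter hUT hUY
  choose! F hF1 hF2 using key
  rw [← card_powerset]
  apply card_le_card_of_injOn F
  · intro U hU; exact hF1 U (mem_powerset.1 hU)
  · intro U hU V hV h
    rw [← hF2 U (mem_powerset.1 hU), ← hF2 V (mem_powerset.1 hV), h]

/-- If exchanging is possible, then only few elements have at most one neighbour outside `W`. -/
theorem card_lt_of_card_below_le_one (hX : X ⊆ S) (hXa : AntiOn r X) (hY : Y ⊆ S)
    (hYa : AntiOn r Y) (hd : Disjoint X Y) (hup : ∀ x ∈ X, ∀ y ∈ Y, ¬ r y x)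
    (hg : g ≤ k + 1) (hN : (antis r (k + 1) S).card < 2 ^ g) {W B D : Finset α}
    (hB : B ⊆ Y) (hBW : ∀ y ∈ B, below r X y ⊆ W) (hD : D ⊆ Y \ B)
    (hD1 : ∀ y ∈ D, (below r X y \ W).card ≤ 1) (hk : k + 1 ≤ (X \ W).card + B.card) :
    D.card < g := by
  by_contra hcon
  push Not at hcon
  obtain ⟨Y₀, hY₀, hY₀c⟩ := exists_subset_card_eq hcon
  have := two_pow_le_antis (k := k + 1) hX hXa hY hYa hd hB (hY₀.trans hD) (by omega) (by
    intro U hU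
    refine ⟨(X \ W) \ U.biUnion (fun y => below r X y \ W), sdiff_subset.trans sdiff_subset, ?_, ?_⟩
    · intro x hx y hy
      simp only [mem_sdiff, mem_biUnion, not_exists, not_and] at hx
      have hyY : y ∈ Y := by
        rcases mem_union.1 hy with h | h
        · exact hB h
        · exact (mem_sdiff.1 (hD (hY₀ (hU h)))).1
      refine ⟨fun hxy => ?_, hup x hx.1.1 y hyY⟩
      rcases mem_union.1 hy with h | h
      · exact hx.1.2 (hBW y h (mem_below.2 ⟨hx.1.1, hxy⟩))
      · exact hx.2 y h (mem_below.2 ⟨hx.1.1, hxy⟩) hx.1.2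
    · have h2 : (U.biUnion (fun y => below r X y \ W)).card ≤ U.card := by
        refine card_biUnion_le.trans ?_
        calc _ ≤ ∑ y ∈ U, 1 := sum_le_sum fun y hy => hD1 y (hY₀ (hU hy))
          _ = U.card := by simp
      have h3 := le_card_sdiff (U.biUnion (fun y => below r X y \ W)) (X \ W)
      omega)
  rw [hY₀c] at this
  omega

/-- Standing assumptions: `S` has width at most `k + a` and fewer than `2 ^ g` antichains with
`k + 1` elements. -/
structure Scarce (r : α → α → Prop) (S : Finset α) (k a g : ℕ) : Prop where
  strict : StrictRel r
  width : WidthLE r S (k + a)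
  few : (antis r (k + 1) S).card < 2 ^ g
  le : g ≤ k + 1

/-- `X` and `Y` are disjoint antichains of `S` such that every element of `Y` is above some element
of `X`, and none is below an element of `X`. -/
structure Consec (r : α → α → Prop) (S X Y : Finset α) : Prop where
  subX : X ⊆ S
  subY : Y ⊆ S
  antiX : AntiOn r X
  antiY : AntiOn r Y
  disj : Disjoint X Y
  not_lt : ∀ x ∈ X, ∀ y ∈ Y, ¬ r y x
  cover : ∀ y ∈ Y, ∃ x ∈ X, r x y

variable {f : α → ℕ} {θ : ℕ} {B : Finset α}

/-- The sum of `f` over the elements of `X` below `y`. -/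
noncomputable def push (r : α → α → Prop) (X : Finset α) (f : α → ℕ) (y : α) : ℕ :=
  ∑ x ∈ below r X y, f x

/-- The elements of `Y` all of whose lower neighbours in `X` belong to `B`. -/
noncomputable def shadow (r : α → α → Prop) (X Y B : Finset α) : Finset α :=
  Y.filter fun y => below r X y ⊆ B

theorem le_push_of_subset {y : α} {Z : Finset α} (hZ : Z ⊆ below r X y) :
    ∑ x ∈ Z, f x ≤ push r X f y :=
  sum_le_sum_of_subset hZ

/-- The width bound for the antichain formed by the shadow of `B` and the elements outside `B`. -/
theorem Consec.card_shadow_le (hc : Consec r S X Y) (hs : Scarce r S k a g) (hB : B ⊆ X) :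
    (shadow r X Y B).card + X.card ≤ B.card + k + a := by
  have hd : Disjoint (X \ B) (shadow r X Y B) :=
    disjoint_of_subset_left sdiff_subset (disjoint_of_subset_right (filter_subset _ _) hc.disj)
  have := hs.width ((X \ B) ∪ shadow r X Y B)
    (union_subset (sdiff_subset.trans hc.subX) ((filter_subset _ _).trans hc.subY)) (by
      intro x hx y hy
      rcases mem_union.1 hx with hx | hx <;> rcases mem_union.1 hy with hy | hy
      · exact hc.antiX x (mem_sdiff.1 hx).1 y (mem_sdiff.1 hy).1
      · intro h
        exact (mem_sdiff.1 hx).2 ((mem_filter.1 hy).2 (mem_below.2 ⟨(mem_sdiff.1 hx).1, h⟩))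
      · exact hc.not_lt y (mem_sdiff.1 hy).1 x (mem_filter.1 hx).1
      · exact hc.antiY x (mem_filter.1 hx).1 y (mem_filter.1 hy).1)
  rw [card_union_of_disjoint hd, card_sdiff_of_subset hB] at this
  have := card_le_card hB
  omega

theorem Consec.push_ge_of_notMem_shadow (hf : ∀ x ∈ X \ B, θ ≤ f x) {y : α}
    (hyY : y ∈ Y) (hy : y ∉ shadow r X Y B) : θ ≤ push r X f y := by
  have : ¬ below r X y ⊆ B := fun h => hy (mem_filter.2 ⟨hyY, h⟩)
  obtain ⟨x, hx, hxB⟩ := not_subset.1 this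
  calc θ ≤ f x := hf x (mem_sdiff.2 ⟨below_subset _ _ _ hx, hxB⟩)
    _ ≤ push r X f y := single_le_sum (f := f) (fun _ _ => Nat.zero_le _) hx

/-- Either the bad set does not grow faster than the levels do, or the bound doubles. -/
theorem Consec.keep_or_double (hc : Consec r S X Y) (hs : Scarce r S k a g) (hB : B ⊆ X)
    (hf : ∀ x ∈ X \ B, θ ≤ f x) :
    (∃ B' ⊆ Y, B'.card + X.card ≤ B.card + k ∧ ∀ y ∈ Y \ B', θ ≤ push r X f y) ∨
    (∃ B' ⊆ Y, B'.card + X.card ≤ B.card + k + (a + g) ∧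
      ∀ y ∈ Y \ B', 2 * θ ≤ push r X f y) := by
  have hsh : shadow r X Y B ⊆ Y := filter_subset _ _
  by_cases ht : (shadow r X Y B).card + X.card ≤ B.card + k
  · refine Or.inl ⟨_, hsh, ht, fun y hy => ?_⟩
    exact Consec.push_ge_of_notMem_shadow hf (mem_sdiff.1 hy).1 (mem_sdiff.1 hy).2
  right
  set D := (Y \ shadow r X Y B).filter fun y => (below r X y \ B).card ≤ 1 with hD
  have hDY : D ⊆ Y := (filter_subset _ _).trans sdiff_subset
  have hDg : D.card < g := by
    refine card_lt_of_card_below_le_one hc.subX hc.antiX hc.subY hc.antiY hc.disj hc.not_lt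
      hs.le hs.few (W := B) (B := shadow r X Y B) hsh ?_ (filter_subset _ _) ?_ ?_
    · intro y hy; exact (mem_filter.1 hy).2
    · intro y hy; exact (mem_filter.1 hy).2
    · rw [card_sdiff_of_subset hB]; have := card_le_card hB; omega
  refine ⟨shadow r X Y B ∪ D, union_subset hsh hDY, ?_, fun y hy => ?_⟩
  · have := hc.card_shadow_le hs hB
    have := card_union_le (shadow r X Y B) D
    omega
  · simp only [mem_sdiff, mem_union, not_or, hD, mem_filter, not_and, not_le] at hy
    have h2 := hy.2.2 ⟨hy.1, hy.2.1⟩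
    calc 2 * θ ≤ (below r X y \ B).card * θ := Nat.mul_le_mul_right _ h2
      _ = ∑ x ∈ below r X y \ B, θ := by simp
      _ ≤ ∑ x ∈ below r X y \ B, f x := sum_le_sum fun x hx =>
          hf x (mem_sdiff.2 ⟨below_subset _ _ _ (mem_sdiff.1 hx).1, (mem_sdiff.1 hx).2⟩)
      _ ≤ _ := le_push_of_subset sdiff_subset

/-- Above a level with more than `k` elements, all but few elements have two lower neighbours. -/
theorem Consec.card_below_le_one (hc : Consec r S X Y) (hs : Scarce r S k a g)
    (hX : k + 1 ≤ X.card) : (Y.filter fun y => (below r X y).card ≤ 1).card < g := by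
  refine card_lt_of_card_below_le_one hc.subX hc.antiX hc.subY hc.antiY hc.disj hc.not_lt
      hs.le hs.few (W := ∅) (B := ∅) (by simp) (by simp) (by simp) ?_ (by simpa using hX)
  intro y hy
  simpa using (mem_filter.1 hy).2

/-- Above a level with more than `k` elements the bound grows by one. -/
theorem Consec.add_one (hc : Consec r S X Y) (hs : Scarce r S k a g) (hB : B ⊆ X)
    (hf : ∀ x ∈ X \ B, θ ≤ f x) (hf1 : ∀ x ∈ X, 1 ≤ f x) (hX : k + 1 ≤ X.card) :
    ∃ B' ⊆ Y, B'.card + X.card ≤ B.card + k + (a + g) ∧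
      ∀ y ∈ Y \ B', θ + 1 ≤ push r X f y := by
  have hsh : shadow r X Y B ⊆ Y := filter_subset _ _
  set D := Y.filter fun y => (below r X y).card ≤ 1 with hD
  have hDg : D.card < g := hc.card_below_le_one hs hX
  refine ⟨shadow r X Y B ∪ D, union_subset hsh (filter_subset _ _), ?_, fun y hy => ?_⟩
  · have := hc.card_shadow_le hs hB
    have := card_union_le (shadow r X Y B) D
    omega
  · simp only [mem_sdiff, mem_union, not_or, hD, mem_filter, not_and, not_le] at hy
    have h2 := hy.2.2 hy.1
    have hn : ¬ below r X y ⊆ B := fun h => hy.2.1 (mem_filter.2 ⟨hy.1, h⟩)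
    obtain ⟨x, hx, hxB⟩ := not_subset.1 hn
    obtain ⟨x', hx', hne⟩ := exists_mem_ne h2 x
    have : ∑ z ∈ {x, x'}, f z ≤ push r X f y := le_push_of_subset (by
      intro z hz; simp only [mem_insert, mem_singleton] at hz
      rcases hz with rfl | rfl <;> assumption)
    rw [sum_pair hne.symm] at this
    have h3 := hf x (mem_sdiff.2 ⟨below_subset _ _ _ hx, hxB⟩)
    have h4 := hf1 x' (below_subset _ _ _ hx')
    omega

/-- Above a level with more than `k + 1` elements the bound grows by two, at the price of a larger
exceptional set. -/
theorem Consec.add_two (hc : Consec r S X Y) (hs : Scarce r S k a g) (hB : B ⊆ X)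
    (hf : ∀ x ∈ X \ B, θ ≤ f x) (hf1 : ∀ x ∈ X, 1 ≤ f x) (hX : k + 2 ≤ X.card) (hθ : 2 ≤ θ) :
    ∃ B' ⊆ Y, B'.card + X.card ≤ B.card + k + (a + (B.card + 1) * g) ∧
      ∀ y ∈ Y \ B', θ + 2 ≤ push r X f y := by
  have hsh : shadow r X Y B ⊆ Y := filter_subset _ _
  set D := Y.filter fun y => (below r X y).card ≤ 1 with hD
  have hDg : D.card < g := hc.card_below_le_one hs (by omega)
  -- `E v` consists of the `y` that have at most one lower neighbour besides `v`. An element `y`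
  -- outside these sets has two lower neighbours outside `B`, or at least three altogether.
  let E : α → Finset α := fun v => Y.filter fun y => (below r X y \ {v}).card ≤ 1
  have hEg : ∀ v ∈ B, (E v).card < g := by
    intro v hv
    refine card_lt_of_card_below_le_one hc.subX hc.antiX hc.subY hc.antiY hc.disj hc.not_lt
      hs.le hs.few (W := {v}) (B := ∅) (by simp) (by simp) (D := E v) ?_ ?_ ?_
    · rw [sdiff_empty]; exact filter_subset _ _
    · intro y hy; exact (mem_filter.1 hy).2
    · have := card_sdiff_of_subset (singleton_subset_iff.2 (hB hv))
      rw [this]; simp; omega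
  refine ⟨shadow r X Y B ∪ D ∪ B.biUnion E, union_subset (union_subset hsh (filter_subset _ _))
    (biUnion_subset.2 fun v _ => filter_subset _ _), ?_, fun y hy => ?_⟩
  · have := hc.card_shadow_le hs hB
    have := card_union_le (shadow r X Y B) D
    have := card_union_le (shadow r X Y B ∪ D) (B.biUnion E)
    have : (B.biUnion E).card ≤ B.card * g := by
      refine card_biUnion_le.trans ?_
      calc _ ≤ ∑ v ∈ B, g := sum_le_sum fun v hv => (hEg v hv).le
        _ = B.card * g := by simp
    nlinarith
  · simp only [mem_sdiff, mem_union, not_or, hD, mem_filter, not_and, not_le, mem_biUnion,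
      not_exists, E] at hy
    obtain ⟨hyY, ⟨hy1, hy2⟩, hy3⟩ := hy
    have h2 := hy2 hyY
    have hn : ¬ below r X y ⊆ B := fun h => hy1 (mem_filter.2 ⟨hyY, h⟩)
    obtain ⟨x, hx, hxB⟩ := not_subset.1 hn
    obtain ⟨x', hx', hne⟩ := exists_mem_ne h2 x
    have h3 := hf x (mem_sdiff.2 ⟨below_subset _ _ _ hx, hxB⟩)
    by_cases hxB' : x' ∈ B
    · have h5 := hy3 x' hxB' hyY
      have hx'2 : x ∈ below r X y \ {x'} := by simp [hx, hne.symm]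
      obtain ⟨x'', hx'', hne'⟩ := exists_mem_ne h5 x
      simp only [mem_sdiff, mem_singleton] at hx''
      have : ∑ z ∈ {x, x', x''}, f z ≤ push r X f y := le_push_of_subset (by
        intro z hz; simp only [mem_insert, mem_singleton] at hz
        rcases hz with rfl | rfl | rfl
        · exact hx
        · exact hx'
        · exact hx''.1)
      rw [sum_insert (by simp [hne.symm, hne'.symm]), sum_pair (Ne.symm hx''.2)] at this
      have h4 := hf1 x' (below_subset _ _ _ hx')
      have h6 := hf1 x'' (below_subset _ _ _ hx''.1)
      omega
    · have : ∑ z ∈ {x, x'}, f z ≤ push r X f y := le_push_of_subset (by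
        intro z hz; simp only [mem_insert, mem_singleton] at hz
        rcases hz with rfl | rfl <;> assumption)
      rw [sum_pair hne.symm] at this
      have h4 := hf x' (mem_sdiff.2 ⟨below_subset _ _ _ hx', hxB'⟩)
      omega

end swap

/-! ### Counting chains through a sequence of levels -/

section tower
variable {r : α → α → Prop} {S : Finset α} {Λ : ℕ → Finset α} {k a g l : ℕ}

/-- The number of chains `v₀ < v₁ < ⋯ < vᵢ = v` with `vⱼ ∈ Λ j` for `j < i`. -/
noncomputable def pathCount (r : α → α → Prop) (Λ : ℕ → Finset α) : ℕ → α → ℕ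
  | 0 => fun _ => 1
  | i + 1 => push r (Λ i) (pathCount r Λ i)

/-- The chains counted by `pathCount`, as sets. -/
noncomputable def pathSets (r : α → α → Prop) (Λ : ℕ → Finset α) : ℕ → α → Finset (Finset α)
  | 0 => fun v => {{v}}
  | i + 1 => fun v => (below r (Λ i) v).biUnion fun u => (pathSets r Λ i u).image (insert v)

theorem mem_pathSets (hr : StrictRel r) {i : ℕ} {v : α} {T : Finset α}
    (hT : T ∈ pathSets r Λ i v) :
    v ∈ T ∧ ChainOn r T ∧ (∀ x ∈ T, x ≠ v → r x v) ∧ T.card = i + 1 ∧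
      (∀ x ∈ T, x = v ∨ ∃ j < i, x ∈ Λ j) ∧ ∀ j < i, ∃ x ∈ T, x ∈ Λ j := by
  induction i generalizing v T with
  | zero =>
    simp only [pathSets, mem_singleton] at hT
    subst hT
    exact ⟨by simp, chainOn_singleton v, by simp, by simp, by simp, by simp⟩
  | succ i ih =>
    simp only [pathSets, mem_biUnion, mem_image, mem_below] at hT
    obtain ⟨u, ⟨hu, huv⟩, T', hT', rfl⟩ := hT
    obtain ⟨h1, h2, h3, h4, h5, h6⟩ := ih hT'
    have hb : ∀ x ∈ T', r x v := by
      intro x hx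
      rcases eq_or_ne x u with rfl | hne
      · exact huv
      · exact hr.trans (h3 x hx hne) huv
    have hn : v ∉ T' := fun h => hr.irrefl _ (hb v h)
    refine ⟨mem_insert_self _ _, h2.insert_top hb, ?_, ?_, ?_, ?_⟩
    · intro x hx hne
      exact hb x ((mem_insert.1 hx).resolve_left hne)
    · rw [card_insert_of_notMem hn, h4]
    · intro x hx
      rcases mem_insert.1 hx with rfl | hx
      · exact Or.inl rfl
      · right
        rcases h5 x hx with rfl | ⟨j, hj, hxj⟩
        · exact ⟨i, by omega, hu⟩
        · exact ⟨j, by omega, hxj⟩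
    · intro j hj
      rcases Nat.lt_succ_iff_lt_or_eq.1 hj with hj | rfl
      · obtain ⟨x, hx, hxj⟩ := h6 j hj
        exact ⟨x, mem_insert_of_mem hx, hxj⟩
      · exact ⟨u, mem_insert_of_mem h1, hu⟩

theorem pathSets_disjoint (hr : StrictRel r) {i : ℕ} {u v : α} (h : u ≠ v) :
    Disjoint (pathSets r Λ i u) (pathSets r Λ i v) := by
  rw [disjoint_left]
  intro T hu hv
  obtain ⟨h1, -, h3, -⟩ := mem_pathSets hr hu
  obtain ⟨h1', -, h3', -⟩ := mem_pathSets hr hv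
  exact hr.asymm (h3 v h1' h.symm) (h3' u h1 h)

theorem card_pathSets (hr : StrictRel r) (i : ℕ) (v : α) :
    (pathSets r Λ i v).card = pathCount r Λ i v := by
  induction i generalizing v with
  | zero => simp [pathSets, pathCount]
  | succ i ih =>
    have hn : ∀ u ∈ below r (Λ i) v, ∀ T ∈ pathSets r Λ i u, v ∉ T := by
      intro u hu T hT hvT
      obtain ⟨-, -, h3, -⟩ := mem_pathSets hr hT
      have huv := (mem_below.1 hu).2
      exact hr.asymm (h3 v hvT (hr.ne huv).symm) huv
    simp only [pathSets, pathCount, push]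
    rw [card_biUnion]
    · refine sum_congr rfl fun u hu => ?_
      rw [card_image_of_injOn, ih]
      intro T hT T' hT' h
      have := congrArg (fun U => U.erase v) h
      simpa [erase_insert (hn u hu T hT), erase_insert (hn u hu T' hT')] using this
    · intro u hu u' hu' hne
      rw [Function.onFun, disjoint_left]
      intro T hT hT'
      obtain ⟨U, hU, rfl⟩ := mem_image.1 hT
      obtain ⟨U', hU', h⟩ := mem_image.1 hT'
      have := congrArg (fun U => U.erase v) h
      simp only [erase_insert (hn u hu U hU), erase_insert (hn u' hu' U' hU')] at this
      subst this
      exact disjoint_left.1 (pathSets_disjoint hr hne) hU hU'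

/-- The number of chains `v₀ < ⋯ < vₗ` with `vⱼ ∈ Λ j`. -/
noncomputable def numPaths (r : α → α → Prop) (Λ : ℕ → Finset α) (l : ℕ) : ℕ :=
  ∑ v ∈ Λ l, pathCount r Λ l v

/-- The chains counted by `numPaths`, as sets. -/
noncomputable def paths (r : α → α → Prop) (Λ : ℕ → Finset α) (l : ℕ) : Finset (Finset α) :=
  (Λ l).biUnion (pathSets r Λ l)

theorem card_paths (hr : StrictRel r) (l : ℕ) : (paths r Λ l).card = numPaths r Λ l := by
  rw [paths, card_biUnion (fun u _ v _ h => pathSets_disjoint hr h), numPaths]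
  exact sum_congr rfl fun v _ => card_pathSets hr l v

theorem mem_paths (hr : StrictRel r) {T : Finset α} (hT : T ∈ paths r Λ l) :
    ChainOn r T ∧ T.card = l + 1 ∧ (∀ x ∈ T, ∃ j ≤ l, x ∈ Λ j) ∧ ∀ j ≤ l, ∃ x ∈ T, x ∈ Λ j := by
  obtain ⟨v, hv, hT⟩ := mem_biUnion.1 hT
  obtain ⟨h1, h2, -, h4, h5, h6⟩ := mem_pathSets hr hT
  refine ⟨h2, h4, fun x hx => ?_, fun j hj => ?_⟩
  · rcases h5 x hx with rfl | ⟨j, hj, hx⟩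
    · exact ⟨l, le_rfl, hv⟩
    · exact ⟨j, hj.le, hx⟩
  · rcases Nat.lt_or_eq_of_le hj with hj | rfl
    · exact h6 j hj
    · exact ⟨v, h1, hv⟩

/-- `Λ 0, …, Λ l` are subsets of `S`, any two successive ones being as in `Consec`. -/
structure Tower (r : α → α → Prop) (S : Finset α) (Λ : ℕ → Finset α) (l : ℕ) : Prop where
  sub : ∀ i ≤ l, Λ i ⊆ S
  anti : ∀ i ≤ l, AntiOn r (Λ i)
  consec : ∀ i < l, Consec r S (Λ i) (Λ (i + 1))

theorem Tower.one_le_pathCount (ht : Tower r S Λ l) {i : ℕ} (hi : i ≤ l) {v : α} (hv : v ∈ Λ i) :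
    1 ≤ pathCount r Λ i v := by
  induction i generalizing v with
  | zero => simp [pathCount]
  | succ i ih =>
    obtain ⟨u, hu, huv⟩ := (ht.consec i (by omega)).cover v hv
    calc 1 ≤ pathCount r Λ i u := ih (by omega) hu
      _ ≤ _ := single_le_sum (f := pathCount r Λ i) (fun _ _ => Nat.zero_le _)
        (mem_below.2 ⟨hu, huv⟩)

/-- A chain that meets all the sets `Λ j`. -/
structure Thread (r : α → α → Prop) (Λ : ℕ → Finset α) (l : ℕ) (w : ℕ → α) : Prop where
  mem : ∀ i ≤ l, w i ∈ Λ i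
  lt : ∀ i < l, r (w i) (w (i + 1))

theorem Thread.pathCount_le {w : ℕ → α} (hw : Thread r Λ l w) {i : ℕ} (hi : i ≤ l) :
    pathCount r Λ i (w i) ≤ numPaths r Λ l := by
  have key : ∀ d, i + d ≤ l → pathCount r Λ i (w i) ≤ pathCount r Λ (i + d) (w (i + d)) := by
    intro d
    induction d with
    | zero => intro _; exact le_rfl
    | succ d ih =>
      intro hd
      refine (ih (by omega)).trans ?_
      exact single_le_sum (f := pathCount r Λ (i + d)) (fun _ _ => Nat.zero_le _)
        (mem_below.2 ⟨hw.mem (i + d) (by omega), hw.lt (i + d) (by omega)⟩)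
  have h := key (l - i) (by omega)
  rw [Nat.add_sub_cancel' hi] at h
  exact h.trans (single_le_sum (f := pathCount r Λ l) (fun _ _ => Nat.zero_le _)
    (hw.mem l le_rfl))

theorem le_numPaths {θ : ℕ} {B : Finset α} (hB : B ⊆ Λ l)
    (hf : ∀ v ∈ Λ l \ B, θ ≤ pathCount r Λ l v) :
    θ * ((Λ l).card - B.card) ≤ numPaths r Λ l := by
  calc θ * ((Λ l).card - B.card) = ∑ v ∈ Λ l \ B, θ := by
        rw [sum_const, card_sdiff_of_subset hB, smul_eq_mul, mul_comm]
    _ ≤ ∑ v ∈ Λ l \ B, pathCount r Λ l v := sum_le_sum hf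
    _ ≤ _ := sum_le_sum_of_subset sdiff_subset

/-- The excess of `Λ i` over `k` elements. -/
def exc (k : ℕ) (Λ : ℕ → Finset α) (i : ℕ) : ℤ := (Λ i).card - k

theorem exc_le (ht : Tower r S Λ l) (hs : Scarce r S k a g) {i : ℕ} (hi : i ≤ l) :
    exc k Λ i ≤ a := by
  have := hs.width _ (ht.sub i hi) (ht.anti i hi)
  unfold exc
  omega

/-- The number of chains doubles until a small set catches all the chains, or the levels do not
exceed `k` elements by much. -/
theorem Tower.exists_two_pow (ht : Tower r S Λ l) (hs : Scarce r S k a g) {i₀ T : ℕ} (hi₀ : i₀ ≤ l)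
    (hpos : ∀ i, i₀ ≤ i → i ≤ l → 0 ≤ ∑ j ∈ Ico i₀ i, exc k Λ j)
    (hsum : (T * (a + g) + a + 1 : ℤ) ≤ ∑ j ∈ Ico i₀ (l + 1), exc k Λ j) :
    ∃ i ≤ l, ∃ B ⊆ Λ i, B.card ≤ T * (a + g) ∧ ∀ v ∈ Λ i \ B, 2 ^ T ≤ pathCount r Λ i v := by
  by_contra hcon
  have key : ∀ d, i₀ + d ≤ l → ∃ t < T, ∃ B ⊆ Λ (i₀ + d),
      (B.card : ℤ) + ∑ j ∈ Ico i₀ (i₀ + d), exc k Λ j ≤ t * (a + g) ∧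
      ∀ v ∈ Λ (i₀ + d) \ B, 2 ^ t ≤ pathCount r Λ (i₀ + d) v := by
    intro d
    induction d with
    | zero =>
      intro h
      have hT : 0 < T := by
        rcases Nat.eq_zero_or_pos T with rfl | hT
        · exact absurd ⟨i₀, hi₀, ∅, by simp, by simp, fun v hv => by
            simpa using ht.one_le_pathCount hi₀ (mem_sdiff.1 hv).1⟩ hcon
        · exact hT
      refine ⟨0, hT, ∅, by simp, by simp, fun v hv => ?_⟩
      simpa using ht.one_le_pathCount h (mem_sdiff.1 hv).1
    | succ d ih =>
      intro h
      obtain ⟨t, htT, B, hB, hBc, hf⟩ := ih (by omega)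
      have hsum' : ∑ j ∈ Ico i₀ (i₀ + d + 1), exc k Λ j =
          ∑ j ∈ Ico i₀ (i₀ + d), exc k Λ j + ((Λ (i₀ + d)).card - k) :=
        sum_Ico_succ_top (by omega) _
      rcases (ht.consec (i₀ + d) (by omega)).keep_or_double hs hB hf with
        ⟨B', hB', hc, hf'⟩ | ⟨B', hB', hc, hf'⟩
      · refine ⟨t, htT, B', hB', ?_, hf'⟩
        rw [← add_assoc, hsum']
        push_cast [← @Nat.cast_le ℤ] at hc
        linarith
      · have hle : (B'.card : ℤ) + ∑ j ∈ Ico i₀ (i₀ + (d + 1)), exc k Λ j ≤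
            ((t + 1 : ℕ) : ℤ) * (a + g) := by
          rw [← add_assoc, hsum']
          push_cast [← @Nat.cast_le ℤ] at hc ⊢
          linarith
        have hf'' : ∀ v ∈ Λ (i₀ + (d + 1)) \ B', 2 ^ (t + 1) ≤ pathCount r Λ (i₀ + (d + 1)) v := by
          intro v hv
          rw [pow_succ, mul_comm]
          exact hf' v hv
        rcases Nat.lt_or_ge (t + 1) T with hlt | hge
        · exact ⟨t + 1, hlt, B', hB', hle, hf''⟩
        · have : t + 1 = T := by omega
          subst this
          refine absurd ⟨i₀ + (d + 1), h, B', hB', ?_, hf''⟩ hcon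
          have := hpos (i₀ + (d + 1)) (by omega) h
          zify
          push_cast at hle
          linarith
  -- With fewer than `T` doublings up to the top, the total surplus would be too small.
  obtain ⟨t, htT, B, hB, hBc, -⟩ := key (l - i₀) (by omega)
  rw [Nat.add_sub_cancel' hi₀] at hBc
  rw [sum_Ico_succ_top hi₀] at hsum
  have h1 := exc_le ht hs le_rfl
  have h2 : (t : ℤ) * (a + g) ≤ T * (a + g) := by
    have : (t : ℤ) ≤ T := by exact_mod_cast htT.le
    nlinarith
  linarith [(Nat.cast_nonneg B.card : (0 : ℤ) ≤ B.card)]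

/-- The version of `Tower.exists_two_pow` without the assumption on partial sums. -/
theorem Tower.exists_two_pow' (ht : Tower r S Λ l) (hs : Scarce r S k a g) {i₁ T : ℕ} (hi₁ : i₁ ≤ l)
    (hsum : (T * (a + g) + a + 1 : ℤ) ≤ ∑ j ∈ Ico i₁ (l + 1), exc k Λ j) :
    ∃ i ≤ l, ∃ B ⊆ Λ i, B.card ≤ T * (a + g) ∧ ∀ v ∈ Λ i \ B, 2 ^ T ≤ pathCount r Λ i v := by
  -- Starting where the sum of the excesses up to the top is largest keeps all partial sums
  -- nonnegative.
  obtain ⟨i₀, hi₀, hmax⟩ := exists_max_image (range (l + 1))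
    (fun i => ∑ j ∈ Ico i (l + 1), exc k Λ j) ⟨i₁, by simp; omega⟩
  have hi₀' : i₀ ≤ l := by simpa [Nat.lt_succ_iff] using hi₀
  refine ht.exists_two_pow hs hi₀' (fun i h1 h2 => ?_) (hsum.trans (hmax i₁ (by simp; omega)))
  have h3 := hmax i (by simp; omega)
  have h4 := sum_Ico_consecutive (exc k Λ) h1 (show i ≤ l + 1 by omega)
  linarith

/-- If the levels exceed `k` by enough in total, then there are many chains or a small set meets
all of them. -/
theorem Tower.two_pow_le_or_hit (ht : Tower r S Λ l) (hs : Scarce r S k a g) {i₁ T : ℕ}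
    (hi₁ : i₁ ≤ l) (hsum : (T * (a + g) + a + 1 : ℤ) ≤ ∑ j ∈ Ico i₁ (l + 1), exc k Λ j) :
    2 ^ T ≤ numPaths r Λ l ∨ ∃ i ≤ l, ∃ B ⊆ Λ i, B.card ≤ T * (a + g) ∧
      ∀ w, Thread r Λ l w → w i ∈ B := by
  obtain ⟨i, hi, B, hB, hBc, hf⟩ := ht.exists_two_pow' hs hi₁ hsum
  by_cases h : ∀ w, Thread r Λ l w → w i ∈ B
  · exact Or.inr ⟨i, hi, B, hB, hBc, h⟩
  · push Not at h
    obtain ⟨w, hw, hwB⟩ := h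
    exact Or.inl ((hf (w i) (mem_sdiff.2 ⟨hw.mem i hi, hwB⟩)).trans (hw.pathCount_le hi))

/-- The number of indices of `G` in `[i₀, i)`. -/
noncomputable def cnt (G : Finset ℕ) (i₀ i : ℕ) : ℕ := (G.filter fun j => i₀ ≤ j ∧ j < i).card

theorem cnt_self (G : Finset ℕ) (i : ℕ) : cnt G i i = 0 := by
  rw [cnt, card_eq_zero, filter_eq_empty_iff]
  intro j _ h; omega

theorem cnt_succ {G : Finset ℕ} {i₀ i : ℕ} (h : i₀ ≤ i) :
    cnt G i₀ (i + 1) = cnt G i₀ i + if i ∈ G then 1 else 0 := by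
  unfold cnt
  split_ifs with hi
  · rw [← card_insert_of_notMem (a := i) (by simp)]
    congr 1
    ext j; simp only [mem_filter, mem_insert]
    constructor
    · rintro ⟨h1, h2, h3⟩
      rcases Nat.lt_succ_iff_lt_or_eq.1 h3 with h | h
      · exact Or.inr ⟨h1, h2, h⟩
      · exact Or.inl h
    · rintro (rfl | ⟨h1, h2, h3⟩)
      · exact ⟨hi, h, by omega⟩
      · exact ⟨h1, h2, by omega⟩
  · rw [add_zero]
    congr 1
    ext j; simp only [mem_filter]
    constructor
    · rintro ⟨h1, h2, h3⟩
      refine ⟨h1, h2, ?_⟩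
      rcases Nat.lt_succ_iff_lt_or_eq.1 h3 with h | h
      · exact h
      · subst h; exact absurd h1 hi
    · rintro ⟨h1, h2, h3⟩
      exact ⟨h1, h2, by omega⟩

/-- Outside a small set `B`, the elements of `Λ i` are the tops of at least `2 ^ t` chains, and of
at least `φ` chains (`φ + 1` if a doubling has taken place). The size of `B` is measured relative to
the surplus of the levels from `i₀` on, since `B` shrinks when a level exceeds `k` elements and
grows when a level falls short of them. -/
def State (r : α → α → Prop) (k : ℕ) (Λ : ℕ → Finset α) (i₀ i t φ : ℕ) (c : ℤ) : Prop :=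
  ∃ B ⊆ Λ i, (B.card : ℤ) + ∑ j ∈ Ico i₀ i, exc k Λ j ≤ c ∧
    ∀ v ∈ Λ i \ B, 2 ^ t ≤ pathCount r Λ i v ∧ φ ≤ pathCount r Λ i v ∧
      (1 ≤ t → φ + 1 ≤ pathCount r Λ i v)

/-- Following the levels, the bound grows by one at each index of `G` and doubles at the indices
where the bad set would grow. -/
theorem Tower.state_induction (ht : Tower r S Λ l) (hs : Scarce r S k a g) {G : Finset ℕ}
    (hG : ∀ i ∈ G, k + 1 ≤ (Λ i).card) {i₀ φ : ℕ} {c : ℤ} (hφ : 1 ≤ φ) (hg : 0 < g)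
    (h0 : State r k Λ i₀ i₀ 0 φ c) :
    (∃ i, i₀ ≤ i ∧ i ≤ l ∧ State r k Λ i₀ i g (φ + cnt G i₀ i) (c + (g + cnt G i₀ i) * (a + g))) ∨
    ∀ i, i₀ ≤ i → i ≤ l → ∃ t < g,
      State r k Λ i₀ i t (φ + cnt G i₀ i) (c + (t + cnt G i₀ i) * (a + g)) := by
  -- Otherwise the number `t` of doublings stays below `g`, and the state passes on level by level.
  by_contra hcon
  push Not at hcon
  obtain ⟨hnotfull, i₁, hi₁, hi₁l, hno⟩ := hcon
  have key : ∀ d, i₀ + d ≤ l → ∃ t < g,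
      State r k Λ i₀ (i₀ + d) t (φ + cnt G i₀ (i₀ + d))
        (c + (t + cnt G i₀ (i₀ + d)) * (a + g)) := by
    intro d
    induction d with
    | zero =>
      intro _
      refine ⟨0, hg, ?_⟩
      simpa [cnt_self] using h0
    | succ d ih =>
      intro h
      obtain ⟨t, htg, B, hB, hBc, hf⟩ := ih (by omega)
      have hsum' : ∑ j ∈ Ico i₀ (i₀ + d + 1), exc k Λ j =
          ∑ j ∈ Ico i₀ (i₀ + d), exc k Λ j + ((Λ (i₀ + d)).card - k) :=
        sum_Ico_succ_top (by omega) _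
      have hcons := ht.consec (i₀ + d) (by omega)
      set m := cnt G i₀ (i₀ + d) with hm
      set θ := max (2 ^ t) (φ + m + if 1 ≤ t then 1 else 0) with hθ
      have hfθ : ∀ x ∈ Λ (i₀ + d) \ B, θ ≤ pathCount r Λ (i₀ + d) x := by
        intro x hx
        obtain ⟨h1, h2, h3⟩ := hf x hx
        refine max_le h1 ?_
        split_ifs with ht1
        · exact h3 ht1
        · exact h2
      by_cases hi : i₀ + d ∈ G
      · obtain ⟨B', hB', hc, hf'⟩ := hcons.add_one hs hB hfθ
          (fun x hx => ht.one_le_pathCount (by omega) hx) (hG _ hi)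
        have hcnt : cnt G i₀ (i₀ + (d + 1)) = m + 1 := by
          rw [← add_assoc, cnt_succ (by omega), if_pos hi]
        refine ⟨t, htg, B', hB', ?_, fun v hv => ?_⟩
        · rw [← add_assoc, hsum', add_assoc, hcnt]
          push_cast [← @Nat.cast_le ℤ] at hc ⊢
          linarith
        · have h1 : θ + 1 ≤ pathCount r Λ (i₀ + (d + 1)) v := hf' v hv
          rw [hcnt]
          refine ⟨by omega, by omega, fun ht1 => ?_⟩
          rw [if_pos ht1] at hθ
          omega
      · have hcnt : cnt G i₀ (i₀ + (d + 1)) = m := by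
          rw [← add_assoc, cnt_succ (by omega), if_neg hi, add_zero]
        -- Away from `G`, the bound is kept or doubled.
        rcases hcons.keep_or_double hs hB hfθ with ⟨B', hB', hc, hf'⟩ | ⟨B', hB', hc, hf'⟩
        · refine ⟨t, htg, B', hB', ?_, fun v hv => ?_⟩
          · rw [← add_assoc, hsum', add_assoc, hcnt]
            push_cast [← @Nat.cast_le ℤ] at hc ⊢
            linarith
          · have h1 : θ ≤ pathCount r Λ (i₀ + (d + 1)) v := hf' v hv
            rw [hcnt]
            refine ⟨by omega, by omega, fun ht1 => ?_⟩
            rw [if_pos ht1] at hθ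
            omega
        · have hst : State r k Λ i₀ (i₀ + (d + 1)) (t + 1) (φ + cnt G i₀ (i₀ + (d + 1)))
              (c + ((t + 1 : ℕ) + cnt G i₀ (i₀ + (d + 1))) * (a + g)) := by
            refine ⟨B', hB', ?_, fun v hv => ?_⟩
            · rw [← add_assoc, hsum', add_assoc, hcnt]
              push_cast [← @Nat.cast_le ℤ] at hc ⊢
              linarith
            · have h1 : 2 * θ ≤ pathCount r Λ (i₀ + (d + 1)) v := hf' v hv
              rw [hcnt, pow_succ]
              refine ⟨by omega, by omega, fun _ => ?_⟩
              omega
          rcases Nat.lt_or_ge (t + 1) g with hlt | hge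
          · exact ⟨t + 1, hlt, hst⟩
          · have : t + 1 = g := by omega
            subst this
            exact absurd hst (hnotfull _ (by omega) h)
  obtain ⟨t, htg, hst⟩ := key (i₁ - i₀) (by omega)
  rw [Nat.add_sub_cancel' hi₁] at hst
  exact hno t htg hst

end tower

/-! ### Selecting `k + 1` of the levels -/

/-- The increasing enumeration of `J`. -/
noncomputable def enum (J : Finset ℕ) : ℕ → ℕ := Nat.nth (· ∈ J)

section enum
variable {J : Finset ℕ} {k : ℕ}

theorem enum_toFinset (hf : (Set.ofPred (· ∈ J)).Finite) : hf.toFinset = J := by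
  ext x; simp

theorem enum_mem {i : ℕ} (hi : i < J.card) : enum J i ∈ J := by
  have hf : (Set.ofPred (· ∈ J)).Finite := J.finite_toSet
  exact Nat.nth_mem_of_lt_card hf (by rwa [enum_toFinset])

theorem enum_lt {i j : ℕ} (hij : i < j) (hj : j < J.card) : enum J i < enum J j := by
  have hf : (Set.ofPred (· ∈ J)).Finite := J.finite_toSet
  exact Nat.nth_lt_nth_of_lt_card hf hij (by rwa [enum_toFinset])

theorem enum_injOn : Set.InjOn (enum J) (range J.card : Set ℕ) := by
  intro i hi j hj h
  simp only [coe_range, Set.mem_Iio] at hi hj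
  rcases lt_trichotomy i j with h' | h' | h'
  · have := enum_lt h' hj; omega
  · exact h'
  · have := enum_lt h' hi; omega

theorem image_enum (J : Finset ℕ) : (range J.card).image (enum J) = J := by
  apply eq_of_subset_of_card_le
  · intro x hx
    obtain ⟨i, hi, rfl⟩ := mem_image.1 hx
    exact enum_mem (mem_range.1 hi)
  · rw [card_image_of_injOn enum_injOn, card_range]

theorem exists_enum {j : ℕ} (hj : j ∈ J) : ∃ i < J.card, enum J i = j := by
  rw [← image_enum J] at hj
  simpa using hj

theorem sum_enum (F : ℕ → ℤ) (P : ℕ → Prop) [DecidablePred P]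
    (I : Finset ℕ) (hI : I ⊆ range J.card)
    (hP : ∀ i < J.card, i ∈ I ↔ P (enum J i)) :
    ∑ i ∈ I, F (enum J i) = ∑ j ∈ J.filter P, F j := by
  rw [← sum_image (f := F) (g := enum J) (s := I)]
  · congr 1
    ext j
    simp only [mem_image, mem_filter]
    constructor
    · rintro ⟨i, hi, rfl⟩
      have := mem_range.1 (hI hi)
      exact ⟨enum_mem this, (hP i this).1 hi⟩
    · rintro ⟨hj, hPj⟩
      obtain ⟨i, hi, rfl⟩ := exists_enum hj
      exact ⟨i, (hP i hi).2 hPj, rfl⟩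
  · intro i hi j hj h
    exact enum_injOn (hI hi) (hI hj) h

theorem sum_enum_range (F : ℕ → ℤ) {i : ℕ} (hi : i < J.card) :
    ∑ i' ∈ Ico 0 i, F (enum J i') = ∑ j ∈ J.filter (· < enum J i), F j := by
  refine sum_enum F _ _ ?_ ?_
  · intro x hx; simp at hx ⊢; omega
  · intro i' hi'
    simp only [mem_Ico, Nat.zero_le, true_and]
    constructor
    · intro h; exact enum_lt h hi
    · intro h
      by_contra hcon
      rcases Nat.lt_or_eq_of_le (not_lt.1 hcon) with h' | h'
      · have := enum_lt h' hi'; omega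
      · subst h'; omega

theorem sum_enum_all (F : ℕ → ℤ) (hJ : J.card = k + 1) :
    ∑ i ∈ Ico 0 (k + 1), F (enum J i) = ∑ j ∈ J, F j := by
  have := sum_enum (J := J) F (fun _ => True) (Ico 0 (k + 1)) (by
    intro x hx; simp at hx ⊢; omega) (by intro i hi; simp; omega)
  simpa using this

theorem exists_sum_enum_Ico (F : ℕ → ℤ) (j₀ : ℕ) :
    ∃ i₀, ∑ i ∈ Ico i₀ J.card, F (enum J i) = ∑ j ∈ J.filter (j₀ ≤ ·), F j := by
  have hex : ∃ i, J.card ≤ i ∨ j₀ ≤ enum J i := ⟨J.card, Or.inl le_rfl⟩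
  refine ⟨Nat.find hex, sum_enum F _ _ ?_ ?_⟩
  · intro x hx; simp at hx ⊢; omega
  · intro i hi
    simp only [mem_Ico, hi, and_true]
    constructor
    · intro h
      rcases Nat.find_spec hex with h' | h'
      · omega
      · rcases Nat.lt_or_eq_of_le h with h'' | h''
        · exact h'.trans (enum_lt h'' hi).le
        · rwa [h''] at h'
    · intro h
      exact Nat.find_min' hex (Or.inr h)

end enum

section levels
variable {r : α → α → Prop} {S : Finset α} {k a g : ℕ}

theorem level_consec (hr : StrictRel r) {i j : ℕ} (hij : i < j) :
    Consec r S (level r S i) (level r S j) where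
  subX := level_subset _ _ _
  subY := level_subset _ _ _
  antiX := antiOn_level hr _
  antiY := antiOn_level hr _
  disj := level_disjoint hij.ne
  not_lt := by
    intro x hx y hy h
    rw [mem_level] at hx hy
    have := lev_lt hr hy.1 h
    omega
  cover := by
    intro y hy
    rw [mem_level] at hy
    obtain ⟨u, hu, huy, hl⟩ := exists_below_of_lt hr hy.2 hij
    exact ⟨u, mem_level.2 ⟨hu, hl⟩, huy⟩

theorem tower_level (hr : StrictRel r) {e : ℕ → ℕ} {l : ℕ} (he : ∀ i < l, e i < e (i + 1)) :
    Tower r S (fun i => level r S (e i)) l where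
  sub := fun _ _ => level_subset _ _ _
  anti := fun _ _ => antiOn_level hr _
  consec := fun i hi => level_consec hr (he i hi)

/-- The levels of `S` with index in `J`. -/
noncomputable def sel (r : α → α → Prop) (S : Finset α) (J : Finset ℕ) (i : ℕ) : Finset α :=
  level r S (enum J i)

theorem tower_sel (hr : StrictRel r) {J : Finset ℕ} (hJ : J.card = k + 1) :
    Tower r S (sel r S J) k :=
  tower_level hr fun i hi => enum_lt (Nat.lt_succ_self i) (by omega)

theorem image_lev_of_mem_paths (hr : StrictRel r) {J : Finset ℕ} (hJ : J.card = k + 1)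
    {T : Finset α} (hT : T ∈ paths r (sel r S J) k) : T.image (lev r S) = J := by
  obtain ⟨-, -, h1, h2⟩ := mem_paths hr hT
  ext j
  rw [mem_image]
  constructor
  · rintro ⟨x, hx, rfl⟩
    obtain ⟨i, hi, hxi⟩ := h1 x hx
    rw [(mem_level.1 hxi).2]
    exact enum_mem (by omega)
  · intro hj
    obtain ⟨i, hi, rfl⟩ := exists_enum hj
    obtain ⟨x, hx, hxi⟩ := h2 i (by omega)
    exact ⟨x, hx, (mem_level.1 hxi).2⟩

theorem paths_subset_chains (hr : StrictRel r) {Λ : ℕ → Finset α} {l : ℕ}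
    (hΛ : ∀ i ≤ l, Λ i ⊆ S) : paths r Λ l ⊆ chains r (l + 1) S := by
  intro T hT
  obtain ⟨h1, h2, h3, -⟩ := mem_paths hr hT
  refine mem_chains.2 ⟨fun x hx => ?_, h2, h1⟩
  obtain ⟨j, hj, hxj⟩ := h3 x hx
  exact hΛ j hj hxj

theorem sum_numPaths_le (hr : StrictRel r) {𝒥 : Finset (Finset ℕ)}
    (h𝒥 : ∀ J ∈ 𝒥, J.card = k + 1) :
    ∑ J ∈ 𝒥, numPaths r (sel r S J) k ≤ (chains r (k + 1) S).card := by
  calc ∑ J ∈ 𝒥, numPaths r (sel r S J) k = ∑ J ∈ 𝒥, (paths r (sel r S J) k).card :=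
        sum_congr rfl fun J _ => (card_paths hr k).symm
    _ = (𝒥.biUnion fun J => paths r (sel r S J) k).card := by
        rw [card_biUnion]
        intro J hJ J' hJ' hne
        rw [Function.onFun, disjoint_left]
        intro T hT hT'
        exact hne ((image_lev_of_mem_paths hr (h𝒥 J hJ) hT).symm.trans
          (image_lev_of_mem_paths hr (h𝒥 J' hJ') hT'))
    _ ≤ _ := card_le_card (biUnion_subset.2 fun J hJ =>
        paths_subset_chains hr fun i hi => level_subset _ _ _)

theorem exists_thread (hr : StrictRel r) {h : ℕ} (hh : HeightLE r S h) {T : Finset α} (hT : T ⊆ S)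
    (hc : ChainOn r T) (hcard : T.card = h) {e : ℕ → ℕ} {l : ℕ} (he : ∀ i < l, e i < e (i + 1))
    (hel : ∀ i ≤ l, e i < h) :
    ∃ w, Thread r (fun i => level r S (e i)) l w ∧ ∀ i ≤ l, w i ∈ T := by
  have him := hc.image_lev hr hh hT hcard
  have hex : ∀ i, i ≤ l → ∃ x, x ∈ T ∧ lev r S x = e i := by
    intro i hi
    have : e i ∈ T.image (lev r S) := by rw [him]; exact mem_range.2 (hel i hi)
    simpa using this
  have hTne : ∃ x, x ∈ T := by
    obtain ⟨x, hx, -⟩ := hex 0 (Nat.zero_le _); exact ⟨x, hx⟩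
  have : Nonempty α := ⟨hTne.choose⟩
  choose! w hw1 hw2 using hex
  refine ⟨w, ⟨fun i hi => mem_level.2 ⟨hT (hw1 i hi), hw2 i hi⟩, fun i hi => ?_⟩, hw1⟩
  have h1 := he i hi
  have h2 := hw2 i hi.le
  have h3 := hw2 (i + 1) hi
  rcases hc _ (hw1 i hi.le) _ (hw1 (i + 1) hi) (by intro h; rw [h] at h2; omega) with h' | h'
  · exact h'
  · have := lev_lt hr (hT (hw1 (i + 1) hi)) h'
    omega

/-- The excess of the `j`-th level over `k` elements. -/
noncomputable def sx (r : α → α → Prop) (S : Finset α) (k j : ℕ) : ℤ := (level r S j).card - k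

theorem sx_le (hs : Scarce r S k a g) (j : ℕ) : sx r S k j ≤ a := by
  have := hs.width _ (level_subset r S j) (antiOn_level hs.strict j)
  unfold sx; omega

theorem sum_sx (hr : StrictRel r) {h : ℕ} (hh : HeightLE r S h) :
    ∑ j ∈ range h, sx r S k j = S.card - h * k := by
  rw [← sum_card_level hr hh]
  simp [sx]

theorem Scarce.mono {S' : Finset α} (hs : Scarce r S k a g) (h : S' ⊆ S) : Scarce r S' k a g :=
  ⟨hs.strict, hs.width.mono h, (card_le_card (antis_mono h)).trans_lt hs.few, hs.le⟩

/-- A set whose size is well above `k` times its height has its longest chains caught by a few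
elements, unless there are many chains with `k + 1` elements. -/
theorem Scarce.exists_height_drop (hs : Scarce r S k a g)
    (hN : (chains r (k + 1) S).card < 2 ^ g) {h : ℕ} (hk : k ≤ h) (hka : h + 1 ≤ k + a)
    (hh : HeightLE r S (h + 1))
    (hS : (h + 1) * k + (g * (a + g) + a + 1 + a * a) ≤ S.card) :
    ∃ V ⊆ S, V.card ≤ g * (a + g) ∧ HeightLE r (S \ V) h := by
  have ht : Tower r S (fun i => level r S i) k :=
    tower_level hs.strict fun i _ => Nat.lt_succ_self i
  have hsum : (g * (a + g) + a + 1 : ℤ) ≤ ∑ j ∈ Ico 0 (k + 1), exc k (fun i => level r S i) j := by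
    have h1 := sum_sx (k := k) hs.strict hh
    have h2 := sum_range_add_sum_Ico (fun j => sx r S k j) (show k + 1 ≤ h + 1 by omega)
    have h3 : ∑ j ∈ Ico (k + 1) (h + 1), sx r S k j ≤ a * a := by
      calc _ ≤ ∑ j ∈ Ico (k + 1) (h + 1), (a : ℤ) := sum_le_sum fun j _ => sx_le hs j
        _ = ((h - k : ℕ) : ℤ) * a := by simp
        _ ≤ a * a := by
          have : ((h - k : ℕ) : ℤ) ≤ a := by exact_mod_cast (by omega)
          exact mul_le_mul_of_nonneg_right this (by positivity)
    have h4 : ∑ j ∈ Ico 0 (k + 1), exc k (fun i => level r S i) j =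
      ∑ j ∈ range (k + 1), sx r S k j := by rw [range_eq_Ico]; rfl
    rw [h4]
    zify at hS
    push_cast at h1
    linarith
  rcases ht.two_pow_le_or_hit hs (Nat.zero_le _) hsum with h1 | ⟨i, hi, B, hB, hBc, hw⟩
  · rw [← card_paths hs.strict] at h1
    exact absurd hN (not_lt.2 (h1.trans (card_le_card
      (paths_subset_chains hs.strict (fun i hi => ht.sub i hi)))))
  · refine ⟨B, hB.trans (level_subset _ _ _), hBc, ?_⟩
    by_contra hcon
    obtain ⟨T, hT, hc, hcard⟩ := exists_chain_of_not_heightLE hcon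
    obtain ⟨w, hwt, hwT⟩ := exists_thread hs.strict hh (hT.trans sdiff_subset) hc hcard
      (e := id) (l := k) (fun i _ => Nat.lt_succ_self i) (fun i hi => by simp; omega)
    exact (mem_sdiff.1 (hT (hwT i hi))).2 (hw w hwt)

theorem Scarce.exists_height_le (hs : Scarce r S k a g)
    (hN : (chains r (k + 1) S).card < 2 ^ g) (hgk : g * (a + g) ≤ k) {d : ℕ} (hd : d ≤ a)
    {S' : Finset α} (hS' : S' ⊆ S) (hh : HeightLE r S' (k + d))
    (hcard : d ≠ 0 → (k + d) * k + (g * (a + g) + a + 1 + a * a) + g * (a + g) ≤ S'.card) :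
    ∃ V ⊆ S', V.card ≤ d * (g * (a + g)) ∧ HeightLE r (S' \ V) k := by
  induction d generalizing S' with
  | zero => exact ⟨∅, by simp, by simp, by simpa using hh⟩
  | succ d ih =>
    have hcard := hcard (by omega)
    have hN' : (chains r (k + 1) S').card < 2 ^ g :=
      (card_le_card (chains_mono hS')).trans_lt hN
    obtain ⟨V, hV, hVc, hVh⟩ := (hs.mono hS').exists_height_drop hN' (h := k + d) (by omega)
      (by omega) hh (by rw [add_assoc]; omega)
    have hc1 : (S' \ V).card = S'.card - V.card := card_sdiff_of_subset hV
    obtain ⟨V', hV', hVc', hVh'⟩ := ih (by omega) (sdiff_subset.trans hS') hVh (fun _ => by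
      rw [hc1]
      have : (k + (d + 1)) * k = (k + d) * k + k := by ring
      omega)
    refine ⟨V ∪ V', union_subset hV (hV'.trans sdiff_subset), ?_, ?_⟩
    · have := card_union_le V V'
      rw [add_mul]; omega
    · rwa [← sup_eq_union, ← sdiff_sdiff_left]

end levels

/-! ### Choosing among the sets of `k + 1` levels -/

theorem card_powersetCard_notMem {A : Finset ℕ} {m x : ℕ} (hx : x ∈ A) :
    ((A.powersetCard m).filter (x ∉ ·)).card = (A.card - 1).choose m := by
  rw [← card_erase_of_mem hx, ← card_powersetCard]
  congr 1
  ext J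
  simp only [mem_filter, mem_powersetCard]
  constructor
  · rintro ⟨⟨h1, h2⟩, h3⟩
    exact ⟨subset_erase.2 ⟨h1, h3⟩, h2⟩
  · rintro ⟨h1, h2⟩
    exact ⟨⟨h1.trans (erase_subset _ _), h2⟩, (subset_erase.1 h1).2⟩

theorem card_powersetCard_mem {h k x : ℕ} (hx : x ∈ range (h + 1)) :
    (((range (h + 1)).powersetCard (k + 1)).filter (x ∈ ·)).card = h.choose k := by
  have h1 := card_filter_add_card_filter_not (s := (range (h + 1)).powersetCard (k + 1)) (x ∈ ·)
  rw [card_powersetCard_notMem hx, card_powersetCard, card_range, Nat.choose_succ_succ'] at h1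
  simp only [Nat.add_sub_cancel] at h1
  omega

theorem card_powersetCard_superset (h m : ℕ) {W : Finset ℕ} (hW : W ⊆ range h) :
    h.choose m ≤ (((range h).powersetCard m).filter (W ⊆ ·)).card + W.card * (h - 1).choose m := by
  have h1 := card_filter_add_card_filter_not (s := (range h).powersetCard m) (W ⊆ ·)
  rw [card_powersetCard, card_range] at h1
  have h2 : ((range h).powersetCard m).filter (¬ W ⊆ ·) ⊆
      W.biUnion fun x => ((range h).powersetCard m).filter (x ∉ ·) := by
    intro J hJ
    rw [mem_filter] at hJ
    obtain ⟨x, hx, hxJ⟩ := not_subset.1 hJ.2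
    exact mem_biUnion.2 ⟨x, hx, mem_filter.2 ⟨hJ.1, hxJ⟩⟩
  have h3 : (((range h).powersetCard m).filter (¬ W ⊆ ·)).card ≤ W.card * (h - 1).choose m := by
    refine (card_le_card h2).trans (card_biUnion_le.trans ?_)
    rw [← smul_eq_mul, ← sum_const]
    refine sum_le_sum fun x hx => ?_
    rw [card_powersetCard_notMem (hW hx), card_range]
  omega

/-- The relations between the parameters: `n = k² + ak + b`, and `g` bounds the logarithm of the
number of chains to be found. -/
structure Params (k a b l g : ℕ) : Prop where
  one_le_a : 1 ≤ a
  one_le_b : 1 ≤ b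
  b_le : b ≤ k
  hl : 2 * (k + 1) ≤ 2 ^ l
  hg : g = l * (a + 2)
  hg2 : 10 ^ 6 * g ^ 2 ≤ k
  hl4 : 10 ^ 8 * l ^ 4 * g ≤ k

/-- The number of monotone subsequences of `τ_{k,n}` for `n = k² + ak + b`. -/
def target (k a b : ℕ) : ℕ := k * (k + a).choose (k + 1) + b * (k + a).choose k

namespace Params
variable {k a b l g : ℕ}

theorem one_le_l (hp : Params k a b l g) : 1 ≤ l := by
  rcases Nat.eq_zero_or_pos l with h | h
  · have := hp.hl; rw [h] at this; simp at this; omega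
  · exact h

theorem l_mul_a_le (hp : Params k a b l g) : l * a ≤ g := by
  rw [hp.hg]; exact Nat.mul_le_mul_left _ (by omega)

theorem l_le (hp : Params k a b l g) : 3 * l ≤ g := by
  rw [hp.hg, mul_comm]; exact Nat.mul_le_mul_left _ (by have := hp.one_le_a; omega)

theorem a_le (hp : Params k a b l g) : a ≤ g := by
  have := hp.l_mul_a_le
  have := hp.one_le_l
  nlinarith

theorem g_le (hp : Params k a b l g) : 10 ^ 6 * g ≤ k := by
  have := hp.hg2
  have := hp.l_le
  have := hp.one_le_l
  nlinarith

theorem g_pos (hp : Params k a b l g) : 0 < g := by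
  have := hp.l_le
  have := hp.one_le_l
  omega

theorem choose_pos (_hp : Params k a b l g) : 0 < (k + a).choose (k + 1) :=
  Nat.choose_pos (by have := _hp.one_le_a; omega)

theorem a_mul_choose (k a : ℕ) : a * (k + a).choose k = (k + 1) * (k + a).choose (k + 1) := by
  have := Nat.choose_succ_right_eq (k + a) k
  rw [Nat.add_sub_cancel_left] at this
  linarith

theorem a_mul_target (k a b : ℕ) :
    a * target k a b = (k + a).choose (k + 1) * (a * k + b * (k + 1)) := by
  have := a_mul_choose k a
  unfold target
  calc a * (k * (k + a).choose (k + 1) + b * (k + a).choose k)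
      = a * k * (k + a).choose (k + 1) + b * (a * (k + a).choose k) := by ring
    _ = _ := by rw [this]; ring

theorem choose_pred (k : ℕ) {a : ℕ} (ha : 1 ≤ a) :
    (k + a) * (k + a - 1).choose (k + 1) = (a - 1) * (k + a).choose (k + 1) := by
  obtain ⟨c, rfl⟩ : ∃ c, a = c + 1 := ⟨a - 1, by omega⟩
  have := Nat.choose_mul_succ_eq (k + c) (k + 1)
  have h2 : k + c + 1 - (k + 1) = c := by omega
  rw [h2] at this
  have h3 : k + (c + 1) - 1 = k + c := by omega
  rw [h3, Nat.add_sub_cancel, ← add_assoc]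
  linarith

theorem target_lt (hp : Params k a b l g) : target k a b < 2 ^ g := by
  have h1 : target k a b ≤ k * (k + a + 1).choose (k + 1) := by
    rw [Nat.choose_succ_succ]
    unfold target
    have := Nat.mul_le_mul_right ((k + a).choose k) hp.b_le
    nlinarith
  have hak : a ≤ k := by
    have := hp.a_le; have := hp.g_le; omega
  have h2 : (k + a + 1).choose (k + 1) ≤ (k + a + 1) ^ a := by
    have := Nat.choose_symm_of_eq_add (show k + a + 1 = a + (k + 1) by omega)
    rw [← this]
    exact Nat.choose_le_pow _ _
  have h3 : (k + a + 1) ^ a ≤ (2 ^ l) ^ a := Nat.pow_le_pow_left (by have := hp.hl; omega) _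
  have h4 : k * (2 ^ l) ^ a < 2 ^ l * (2 ^ l) ^ a := by
    apply Nat.mul_lt_mul_of_pos_right
    · have := hp.hl; omega
    · positivity
  calc target k a b ≤ k * (2 ^ l) ^ a := h1.trans (Nat.mul_le_mul_left _ (h2.trans h3))
    _ < 2 ^ l * (2 ^ l) ^ a := h4
    _ = 2 ^ (l * (a + 1)) := by rw [← pow_mul, ← pow_add]; ring_nf
    _ ≤ 2 ^ g := by
      rw [hp.hg]
      exact Nat.pow_le_pow_right (by norm_num) (Nat.mul_le_mul_left _ (by omega))

end Params

/-- The situation in which `S` has height exactly `k + a`, robustly so: no set of at most `k / 8`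
elements meets all the chains with `k + a` elements. The number of `(k + 1)`-chains is bounded too,
as nothing is to be shown otherwise. -/
structure Robust (r : α → α → Prop) (S : Finset α) (k a b g : ℕ) : Prop where
  scarce : Scarce r S k a g
  height : HeightLE r S (k + a)
  robust : ∀ V ⊆ S, 8 * V.card ≤ k → ¬ HeightLE r (S \ V) (k + a - 1)
  few : (chains r (k + 1) S).card < 2 ^ g
  card : S.card = k ^ 2 + a * k + b

/-! ### Sets of robust height -/

section robust
variable {r : α → α → Prop} {S : Finset α} {k a b l g : ℕ}

/-- The sets of `k + 1` levels. -/
def levelSets (k a : ℕ) : Finset (Finset ℕ) := (range (k + a)).powersetCard (k + 1)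

theorem mem_levelSets {J : Finset ℕ} : J ∈ levelSets k a ↔ J ⊆ range (k + a) ∧ J.card = k + 1 := by
  simp [levelSets, mem_powersetCard]

/-- If the elements outside a small set at some level top many chains, then there are many chains
in total, since some longest chain avoids the small set. -/
theorem Robust.le_numPaths (hm : Robust r S k a b g) (ha : 1 ≤ a) {J : Finset ℕ}
    (hJ : J ∈ levelSets k a) {i θ : ℕ} (hi : i ≤ k) {B : Finset α} (hB : B ⊆ sel r S J i)
    (hBc : 8 * B.card ≤ k) (hf : ∀ v ∈ sel r S J i \ B, θ ≤ pathCount r (sel r S J) i v) :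
    θ ≤ numPaths r (sel r S J) k := by
  rw [mem_levelSets] at hJ
  obtain ⟨T, hT, hc, hcard⟩ := exists_chain_of_not_heightLE
    (hm.robust B (hB.trans (level_subset _ _ _)) hBc)
  obtain ⟨w, hw, hwT⟩ := exists_thread hm.scarce.strict hm.height (hT.trans sdiff_subset) hc
    (by omega) (e := enum J) (l := k) (fun i hi => enum_lt (Nat.lt_succ_self i) (by omega))
    (fun i hi => mem_range.1 (hJ.1 (enum_mem (by omega))))
  exact (hf (w i) (mem_sdiff.2 ⟨hw.mem i hi, (mem_sdiff.1 (hT (hwT i hi))).2⟩)).trans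
    (hw.pathCount_le hi)

theorem Robust.numPaths_lt (hm : Robust r S k a b g) {J : Finset ℕ} (hJ : J ∈ levelSets k a) :
    numPaths r (sel r S J) k < 2 ^ g := by
  have := sum_numPaths_le (S := S) hm.scarce.strict (𝒥 := {J}) (k := k)
    (by simpa using (mem_levelSets.1 hJ).2)
  rw [sum_singleton] at this
  exact this.trans_lt hm.few

theorem Robust.sum_sx (hm : Robust r S k a b g) : ∑ j ∈ range (k + a), sx r S k j = b := by
  rw [MonoPosets.sum_sx hm.scarce.strict hm.height, hm.card]
  push_cast
  ring

/-- If the levels from some level on exceed `k` elements by a lot in total, then so do the chosen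
levels for many choices of `k + 1` levels, each of which contributes many chains. -/
theorem Robust.target_lt_of_surplus (hm : Robust r S k a b g) (hp : Params k a b l g) {j₀ : ℕ}
    (hj₀ : (16 * l * (a + g) : ℤ) ≤ ∑ j ∈ Ico j₀ (k + a), sx r S k j) :
    target k a b < (chains r (k + 1) S).card := by
  have ha := hp.one_le_a
  have hl := hp.one_le_l
  have hlg := hp.l_le
  have hag := hp.a_le
  have hgk := hp.g_le
  set good := (levelSets k a).filter fun J =>
    (3 * l * (a + g) + a + 1 : ℤ) ≤ ∑ j ∈ J.filter (j₀ ≤ ·), sx r S k j with hgood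
  have hmany : ∀ J ∈ good, 2 ^ (3 * l) ≤ numPaths r (sel r S J) k := by
    intro J hJ
    obtain ⟨hJ, hsum⟩ := mem_filter.1 hJ
    have hJ' := mem_levelSets.1 hJ
    obtain ⟨i₀, hi₀⟩ := exists_sum_enum_Ico (J := J) (sx r S k) j₀
    rw [hJ'.2] at hi₀
    have hi₀k : i₀ ≤ k := by
      by_contra hcon
      rw [Ico_eq_empty (by omega), sum_empty] at hi₀
      rw [← hi₀] at hsum
      have : (0 : ℤ) ≤ 3 * l * (a + g) := by positivity
      linarith
    obtain ⟨i, hi, B, hB, hBc, hf⟩ := (tower_sel (S := S) hm.scarce.strict hJ'.2).exists_two_pow'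
      hm.scarce (T := 3 * l) hi₀k (by
        rw [← hi₀] at hsum
        push_cast
        exact hsum)
    refine hm.le_numPaths ha hJ hi hB ?_ hf
    have h1 : 3 * l * (a + g) ≤ g * (2 * g) := Nat.mul_le_mul hlg (by omega)
    have := hp.hg2
    nlinarith
  -- the average over all choices
  have hdc : ∑ J ∈ levelSets k a, ∑ j ∈ J.filter (j₀ ≤ ·), sx r S k j =
      ((k + a - 1).choose k : ℤ) * ∑ j ∈ Ico j₀ (k + a), sx r S k j := by
    have h1 : ∀ J ∈ levelSets k a, ∑ j ∈ J.filter (j₀ ≤ ·), sx r S k j =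
        ∑ j ∈ Ico j₀ (k + a), if j ∈ J then sx r S k j else 0 := by
      intro J hJ
      rw [← sum_filter]
      refine sum_congr ?_ fun _ _ => rfl
      ext j
      simp only [mem_filter, mem_Ico]
      constructor
      · rintro ⟨h1, h2⟩
        exact ⟨⟨h2, mem_range.1 ((mem_levelSets.1 hJ).1 h1)⟩, h1⟩
      · rintro ⟨⟨h1, -⟩, h2⟩
        exact ⟨h2, h1⟩
    rw [sum_congr rfl h1, sum_comm, mul_sum]
    refine sum_congr rfl fun j hj => ?_
    rw [← sum_filter, sum_const, nsmul_eq_mul]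
    congr 2
    obtain ⟨h, hh⟩ : ∃ h, k + a = h + 1 := ⟨k + a - 1, by omega⟩
    rw [levelSets, hh]
    exact card_powersetCard_mem (by rw [mem_Ico] at hj; rw [mem_range]; omega)
  have hub : ∑ J ∈ levelSets k a, ∑ j ∈ J.filter (j₀ ≤ ·), sx r S k j ≤
      (good.card : ℤ) * ((k + 1) * a) + (k + a).choose (k + 1) * (4 * l * (a + g)) := by
    have h1 : ∀ J ∈ levelSets k a, ∑ j ∈ J.filter (j₀ ≤ ·), sx r S k j ≤
        (if J ∈ good then ((k + 1) * a : ℤ) else 0) + 4 * l * (a + g) := by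
      intro J hJ
      split_ifs with hJg
      · have h2 : ∑ j ∈ J.filter (j₀ ≤ ·), sx r S k j ≤ ∑ j ∈ J.filter (j₀ ≤ ·), (a : ℤ) :=
          sum_le_sum fun j _ => sx_le hm.scarce j
        have h3 : (J.filter (j₀ ≤ ·)).card ≤ k + 1 := by
          rw [← (mem_levelSets.1 hJ).2]; exact card_filter_le _ _
        rw [sum_const, nsmul_eq_mul] at h2
        have h4 : ((J.filter (j₀ ≤ ·)).card : ℤ) * a ≤ (k + 1) * a := by
          have : ((J.filter (j₀ ≤ ·)).card : ℤ) ≤ k + 1 := by exact_mod_cast h3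
          exact mul_le_mul_of_nonneg_right this (by positivity)
        have : (0 : ℤ) ≤ 4 * l * (a + g) := by positivity
        linarith
      · have h2 : ¬ (3 * l * (a + g) + a + 1 : ℤ) ≤ ∑ j ∈ J.filter (j₀ ≤ ·), sx r S k j :=
          fun h => hJg (mem_filter.2 ⟨hJ, h⟩)
        have h3 : (a + 1 : ℤ) ≤ l * (a + g) := by
          have : a + 1 ≤ l * (a + g) := by nlinarith
          exact_mod_cast this
        linarith
    refine (sum_le_sum h1).trans ?_
    rw [sum_add_distrib, ← sum_filter, sum_const, sum_const, nsmul_eq_mul, nsmul_eq_mul]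
    have h2 : (levelSets k a).filter (· ∈ good) = good := by
      ext J; simp only [mem_filter, hgood]; tauto
    have h3 : (levelSets k a).card = (k + a).choose (k + 1) := by
      rw [levelSets, card_powersetCard, card_range]
    rw [h2, h3]
  have hlow : good.card * 2 ^ (3 * l) ≤ (chains r (k + 1) S).card := by
    refine le_trans ?_ (sum_numPaths_le (S := S) hm.scarce.strict (𝒥 := good) (k := k)
      fun J hJ => (mem_levelSets.1 (mem_filter.1 hJ).1).2)
    rw [← smul_eq_mul, ← sum_const]
    exact sum_le_sum hmany
  set C := (k + a).choose (k + 1) with hC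
  have hCpos : 0 < C := hp.choose_pos
  have hhalf : C ≤ 2 * (k + a - 1).choose k := by
    have h1 := Params.choose_pred k ha
    have h2 : (k + a).choose (k + 1) = (k + a - 1).choose k + (k + a - 1).choose (k + 1) := by
      obtain ⟨h, hh⟩ : ∃ h, k + a = h + 1 := ⟨k + a - 1, by omega⟩
      rw [hh, Nat.choose_succ_succ, Nat.add_sub_cancel]
    rw [← hC] at h1 h2
    have h3 : (a - 1) * C ≤ k * C := Nat.mul_le_mul_right _ (by omega)
    have h4 : 2 * ((a - 1) * C) ≤ (k + a) * C := by
      have : 2 * (a - 1) ≤ k + a := by omega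
      nlinarith
    have h5 : 2 * (k + a - 1).choose (k + 1) ≤ C := by
      have : (k + a) * (2 * (k + a - 1).choose (k + 1)) ≤ (k + a) * C := by
        calc _ = 2 * ((k + a) * (k + a - 1).choose (k + 1)) := by ring
          _ ≤ _ := by rw [h1]; exact h4
      exact Nat.le_of_mul_le_mul_left this (by omega)
    omega
  rw [hdc] at hub
  have hx : 4 * C ≤ good.card * (k + 1) := by
    set β := ∑ j ∈ Ico j₀ (k + a), sx r S k j with hβ
    set X : ℤ := (l : ℤ) * (a + g) with hX
    have hXa : (a : ℤ) ≤ X := by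
      have : a ≤ l * (a + g) := by nlinarith
      rw [hX]; exact_mod_cast this
    have hβX : 16 * X ≤ β := by rw [hX]; linarith
    have h1 : (C : ℤ) ≤ 2 * (k + a - 1).choose k := by exact_mod_cast hhalf
    have h2 : (C : ℤ) * β ≤ 2 * (((k + a - 1).choose k : ℤ) * β) := by
      have : (0 : ℤ) ≤ β := by nlinarith [(Nat.cast_nonneg a : (0 : ℤ) ≤ a)]
      nlinarith
    have h3 : (C : ℤ) * (4 * l * (a + g)) = 4 * (C * X) := by rw [hX]; ring
    rw [h3] at hub
    have h4 : (C : ℤ) * (16 * X) ≤ C * β := mul_le_mul_of_nonneg_left hβX (by positivity)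
    have h5 : 4 * ((C : ℤ) * a) ≤ 4 * (C * X) := by
      have := mul_le_mul_of_nonneg_left hXa (show (0 : ℤ) ≤ C by positivity)
      linarith
    have h6 : (a : ℤ) * (4 * C) ≤ a * (good.card * (k + 1)) := by linarith
    have h7 : 4 * (C : ℤ) ≤ good.card * (k + 1) :=
      le_of_mul_le_mul_left h6 (by exact_mod_cast ha)
    exact_mod_cast h7
  have h8 : 8 * (k + 1) ^ 3 ≤ 2 ^ (3 * l) := by
    rw [mul_comm 3 l, pow_mul]
    calc 8 * (k + 1) ^ 3 = (2 * (k + 1)) ^ 3 := by ring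
      _ ≤ _ := Nat.pow_le_pow_left hp.hl 3
  have h9 : 32 * (k + 1) ^ 2 * C ≤ (chains r (k + 1) S).card := by
    calc 32 * (k + 1) ^ 2 * C = 8 * (k + 1) ^ 2 * (4 * C) := by ring
      _ ≤ 8 * (k + 1) ^ 2 * (good.card * (k + 1)) := Nat.mul_le_mul_left _ hx
      _ = good.card * (8 * (k + 1) ^ 3) := by ring
      _ ≤ _ := (Nat.mul_le_mul_left _ h8).trans hlow
  refine lt_of_lt_of_le ?_ h9
  have h10 : (k + a).choose k ≤ (k + 1) * C := by
    have := Params.a_mul_choose k a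
    calc (k + a).choose k ≤ a * (k + a).choose k := Nat.le_mul_of_pos_left _ ha
      _ = _ := this
  have h11 : b * (k + a).choose k ≤ k * ((k + 1) * C) := Nat.mul_le_mul hp.b_le h10
  unfold target
  rw [← hC]
  nlinarith

end robust

section
variable {r : α → α → Prop} {S : Finset α} {k a b l g : ℕ}

namespace Params

theorem surplus_le (hp : Params k a b l g) : 16 * l * (a + g) + a * a ≤ 12 * g ^ 2 := by
  have h1 := hp.l_le
  have h2 := hp.a_le
  have h3 : (3 * l) * (a + g) ≤ g * (2 * g) := Nat.mul_le_mul h1 (by omega)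
  have h4 : a * a ≤ g * g := Nat.mul_le_mul h2 h2
  nlinarith

theorem l2_mul_g_le (hp : Params k a b l g) : 10 ^ 4 * ((100 * l ^ 2) ^ 2 * g) ≤ k := by
  have := hp.hl4
  calc 10 ^ 4 * ((100 * l ^ 2) ^ 2 * g) = 10 ^ 8 * l ^ 4 * g := by ring
    _ ≤ k := this

theorem l2_mul_a2_le (hp : Params k a b l g) : 10 ^ 4 * ((100 * l ^ 2) * (a * a)) ≤ k := by
  have h1 := hp.l_mul_a_le
  have h2 : (l * a) * (l * a) ≤ g * g := Nat.mul_le_mul h1 h1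
  have := hp.hg2
  nlinarith

theorem l2_le (hp : Params k a b l g) : 10 ^ 6 * (100 * l ^ 2) ≤ k := by
  have h1 := hp.l2_mul_g_le
  have h2 := hp.g_pos
  have h3 := hp.one_le_l
  have h4 : 100 ≤ 100 * l ^ 2 := by nlinarith
  have h5 : 100 * (100 * l ^ 2) ≤ (100 * l ^ 2) ^ 2 * g := by
    calc 100 * (100 * l ^ 2) ≤ (100 * l ^ 2) * (100 * l ^ 2) := Nat.mul_le_mul_right _ h4
      _ = (100 * l ^ 2) ^ 2 * 1 := by ring
      _ ≤ _ := Nat.mul_le_mul_left _ h2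
  omega

end Params

theorem Robust.target_lt_of_forall (hm : Robust r S k a b g) (hp : Params k a b l g)
    {W : Finset ℕ} (hW : W ⊆ range (k + a)) {A : ℕ}
    (hA : ∀ J ∈ levelSets k a, W ⊆ J → A ≤ 2 * numPaths r (sel r S J) k)
    (h : 2 * (k + a) * (a * k + b * (k + 1)) + a * A * (W.card * (a - 1)) < a * A * (k + a)) :
    target k a b < (chains r (k + 1) S).card := by
  have ha := hp.one_le_a
  set 𝒥 := (levelSets k a).filter (W ⊆ ·) with h𝒥
  have h1 : 𝒥.card * A ≤ 2 * (chains r (k + 1) S).card := by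
    calc 𝒥.card * A = ∑ J ∈ 𝒥, A := by simp
      _ ≤ ∑ J ∈ 𝒥, 2 * numPaths r (sel r S J) k :=
          sum_le_sum fun J hJ => hA J (mem_filter.1 hJ).1 (mem_filter.1 hJ).2
      _ = 2 * ∑ J ∈ 𝒥, numPaths r (sel r S J) k := by rw [mul_sum]
      _ ≤ _ := Nat.mul_le_mul_left _ (sum_numPaths_le hm.scarce.strict
          fun J hJ => (mem_levelSets.1 (mem_filter.1 hJ).1).2)
  have h2 : (k + a).choose (k + 1) ≤ 𝒥.card + W.card * (k + a - 1).choose (k + 1) :=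
    card_powersetCard_superset (k + a) (k + 1) hW
  have h3 := Params.choose_pred k ha
  have h4 := Params.a_mul_target k a b
  set C := (k + a).choose (k + 1) with hC
  have hCpos : 0 < C := hp.choose_pos
  have h5 : (k + a) * C ≤ (k + a) * 𝒥.card + W.card * ((a - 1) * C) := by
    rw [← h3]; nlinarith
  have h6 : a * A * ((k + a) * C) ≤
      a * A * ((k + a) * 𝒥.card) + a * A * (W.card * ((a - 1) * C)) := by
    rw [← mul_add]; exact Nat.mul_le_mul_left _ h5
  have h7 : a * (k + a) * (𝒥.card * A) ≤ a * (k + a) * (2 * (chains r (k + 1) S).card) :=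
    Nat.mul_le_mul_left _ h1
  have h8 := Nat.mul_lt_mul_of_pos_right h hCpos
  have h9 : 2 * (a * (k + a)) * target k a b < 2 * (a * (k + a)) * (chains r (k + 1) S).card := by
    have : 2 * (a * (k + a)) * target k a b = 2 * (k + a) * (C * (a * k + b * (k + 1))) := by
      rw [← h4]; ring
    rw [this]
    nlinarith
  exact lt_of_mul_lt_mul_left h9 (Nat.zero_le _)

/-- The choices of levels that contain all the good ones contribute enough chains if each of them
contributes about `(ρ + 3 / 2) k` chains. -/
theorem Robust.target_lt_of_forall' (hm : Robust r S k a b g) (hp : Params k a b l g) {ρ : ℕ}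
    (hρ : b ≤ ρ * a) (hρl : ρ + 10 ≤ 100 * l ^ 2)
    {W : Finset ℕ} (hW : W ⊆ range (k + a)) (hWc : W.card ≤ ρ + 3)
    (hA : ∀ J ∈ levelSets k a, W ⊆ J → (2 * ρ + 3) * k ≤ 2 * numPaths r (sel r S J) k) :
    target k a b < (chains r (k + 1) S).card := by
  have ha := hp.one_le_a
  have hag := hp.a_le
  refine hm.target_lt_of_forall hp hW hA ?_
  have h1 := hp.l2_mul_g_le
  have h2 := hp.l2_le
  set R := 100 * l ^ 2 with hR
  have h3 : (2 * ρ + 3) * ((ρ + 3) * a) ≤ 2 * (R ^ 2 * g) := by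
    calc (2 * ρ + 3) * ((ρ + 3) * a) ≤ (2 * R) * (R * g) :=
          Nat.mul_le_mul (by omega) (Nat.mul_le_mul (by omega) hag)
      _ = _ := by ring
  have h4 : a * ((2 * ρ + 3) * k) * (W.card * (a - 1)) ≤ a * k * ((2 * ρ + 3) * ((ρ + 3) * a)) := by
    have : W.card * (a - 1) ≤ (ρ + 3) * a := Nat.mul_le_mul hWc (by omega)
    calc _ ≤ a * ((2 * ρ + 3) * k) * ((ρ + 3) * a) := Nat.mul_le_mul_left _ this
      _ = _ := by ring
  have h5 : a * k + b * (k + 1) ≤ a * ((ρ + 1) * k + ρ) := by nlinarith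
  have h6 : 2 * (k + a) * (a * k + b * (k + 1)) ≤ 2 * (k + a) * (a * ((ρ + 1) * k + ρ)) :=
    Nat.mul_le_mul_left _ h5
  have h7 : 2 * (k + a) * ((ρ + 1) * k + ρ) + k * ((2 * ρ + 3) * ((ρ + 3) * a)) <
      (2 * ρ + 3) * k * (k + a) := by
    have hk : 0 < k := by have := hp.g_le; have := hp.g_pos; omega
    have h8 : 2 * ρ + (2 * ρ + 3) * ((ρ + 3) * a) < k := by omega
    have h9 : 2 * ρ * (k + a) ≤ 2 * ρ * (k + k) := Nat.mul_le_mul_left _ (by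
      have := hp.g_le; omega)
    nlinarith
  calc _ ≤ a * (2 * (k + a) * ((ρ + 1) * k + ρ) + k * ((2 * ρ + 3) * ((ρ + 3) * a))) := by
        nlinarith
    _ < a * ((2 * ρ + 3) * k * (k + a)) := Nat.mul_lt_mul_of_pos_left h7 ha
    _ = _ := by ring

theorem State.mul_le {Λ : ℕ → Finset α} {i₀ t φ θ : ℕ} {c : ℤ} (hi₀ : i₀ ≤ k)
    (hst : State r k Λ i₀ k t φ c) (hθ : θ ≤ 2 ^ t ∨ θ ≤ φ ∨ 1 ≤ t ∧ θ ≤ φ + 1) :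
    (θ : ℤ) * (k + ∑ i ∈ Ico i₀ (k + 1), exc k Λ i - c) ≤ numPaths r Λ k := by
  obtain ⟨B, hB, hBc, hf⟩ := hst
  have h1 : θ * ((Λ k).card - B.card) ≤ numPaths r Λ k := by
    refine le_numPaths hB fun v hv => ?_
    obtain ⟨h1, h2, h3⟩ := hf v hv
    rcases hθ with h | h | ⟨h, h'⟩
    · exact h.trans h1
    · exact h.trans h2
    · exact h'.trans (h3 h)
  have h2 := card_le_card hB
  zify [h2] at h1
  refine le_trans (mul_le_mul_of_nonneg_left ?_ (by positivity)) h1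
  rw [sum_Ico_succ_top hi₀]
  have : exc k Λ k = (Λ k).card - k := rfl
  linarith

theorem State.of_two_pow (hp : Params k a b l g) {Λ : ℕ → Finset α} {i₀ t φ m ρ : ℕ} {c : ℤ}
    (hi₀ : i₀ ≤ k) (hρl : ρ + 10 ≤ 100 * l ^ 2) (htg : t < g) (hm : m ≤ ρ + 1)
    (hsuf : -((a * a : ℕ) : ℤ) ≤ ∑ i ∈ Ico i₀ (k + 1), exc k Λ i)
    (hc : c ≤ 20 * g ^ 2 + 10 * (100 * l ^ 2 * g))
    (hst : State r k Λ i₀ k t φ (c + (t + m) * (a + g)))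
    (hθ : 2 * (ρ + 2) ≤ 2 ^ t ∨ 2 * (ρ + 2) ≤ φ) :
    (2 * ρ + 3) * k ≤ 2 * numPaths r Λ k := by
  have h1 := hst.mul_le (θ := 2 * (ρ + 2)) hi₀ (by tauto)
  have hag := hp.a_le
  have h2 : (t + m) * (a + g) ≤ (g + 100 * l ^ 2) * (2 * g) :=
    Nat.mul_le_mul (by omega) (by omega)
  have h3 := hp.l2_mul_g_le
  have h4 := hp.hg2
  have h5 : a * a ≤ g * g := Nat.mul_le_mul hag hag
  set R := 100 * l ^ 2 with hR
  have h6 : R * g ≤ R ^ 2 * g := Nat.mul_le_mul_right _ (Nat.le_self_pow two_ne_zero _)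
  have h7 : (g + R) * (2 * g) = 2 * g ^ 2 + 2 * (R * g) := by ring
  have h8 : g * g = g ^ 2 := by ring
  rw [h7] at h2
  have h9 : 8 * (20 * g ^ 2 + 10 * (R * g) + (2 * g ^ 2 + 2 * (R * g)) + g ^ 2) ≤ k := by omega
  have hRz : (R : ℤ) = 100 * l ^ 2 := by rw [hR]; push_cast; ring
  rw [← hRz] at hc
  zify at h2 h5 h8 h9 ⊢
  push_cast at h1 hsuf
  set X := ∑ i ∈ Ico i₀ (k + 1), exc k Λ i
  have h10 : (7 * k : ℤ) ≤ 8 * (k + X - (c + (t + m) * (a + g))) := by linarith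
  have h11 : (0 : ℤ) ≤ k := by positivity
  have h12 : (0 : ℤ) ≤ ρ := by positivity
  nlinarith

theorem State.of_add_two (hp : Params k a b l g) {Λ : ℕ → Finset α} {i₀ t φ m ρ : ℕ} {c : ℤ}
    (hi₀ : i₀ ≤ k) (hρl : ρ + 10 ≤ 100 * l ^ 2) (htg : t < g) (hm : m ≤ ρ + 1)
    (hsuf : -((a * a : ℕ) : ℤ) ≤ ∑ i ∈ Ico i₀ (k + 1), exc k Λ i)
    (hc : c ≤ 10 * (100 * l ^ 2 * g))
    (hst : State r k Λ i₀ k t φ (c + (t + m) * (a + g)))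
    (hθ : ρ + 2 ≤ φ ∨ 1 ≤ t ∧ ρ + 2 ≤ φ + 1) :
    (2 * ρ + 3) * k ≤ 2 * numPaths r Λ k := by
  by_cases ht : 2 * (ρ + 2) ≤ 2 ^ t
  · refine State.of_two_pow hp hi₀ hρl htg hm hsuf ?_ hst (Or.inl ht)
    have : (0 : ℤ) ≤ g ^ 2 := by positivity
    linarith
  have h1 := hst.mul_le (θ := ρ + 2) hi₀ (by tauto)
  have ht' : t < 2 ^ t := Nat.lt_two_pow_self
  have hag := hp.a_le
  have h2 : (t + m) * (a + g) ≤ (3 * (100 * l ^ 2)) * (2 * g) :=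
    Nat.mul_le_mul (by omega) (by omega)
  have h3 := hp.l2_mul_g_le
  have h4 := hp.l2_mul_a2_le
  set R := 100 * l ^ 2 with hR
  have h9 : 2 * (R * (10 * (R * g) + 6 * (R * g) + a * a)) ≤ k := by
    have : R * (10 * (R * g) + 6 * (R * g) + a * a) = 16 * (R ^ 2 * g) + R * (a * a) := by ring
    omega
  zify at h2 h9 hρl ⊢
  push_cast at h1 hsuf
  set X := ∑ i ∈ Ico i₀ (k + 1), exc k Λ i
  have hRz : (R : ℤ) = 100 * l ^ 2 := by rw [hR]; push_cast; ring
  rw [← hRz] at hc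
  set Y : ℤ := 10 * (R * g) + 6 * (R * g) + a * a with hY
  have hY0 : 0 ≤ Y := by positivity
  have h10 : (k - Y : ℤ) ≤ k + X - (c + (t + m) * (a + g)) := by linarith
  have h12 : (0 : ℤ) ≤ ρ := by positivity
  have h13 : ((ρ : ℤ) + 2) * Y ≤ R * Y := mul_le_mul_of_nonneg_right (by linarith) hY0
  have h14 := mul_le_mul_of_nonneg_left h10 (show (0 : ℤ) ≤ ρ + 2 by positivity)
  linarith

/-- The indices of the chosen levels that belong to `G`. -/
noncomputable def idx (J G : Finset ℕ) (k : ℕ) : Finset ℕ := (range k).filter (enum J · ∈ G)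

theorem cnt_idx_lt {J G : Finset ℕ} (hJ : J.card = k + 1) (hG : G ⊆ J) {i : ℕ} (hi : i ≤ k) :
    cnt (idx J G k) 0 i = (G.filter (· < enum J i)).card := by
  have h : ((idx J G k).filter fun j => 0 ≤ j ∧ j < i).image (enum J) =
      G.filter (· < enum J i) := by
    ext j
    simp only [idx, mem_image, mem_filter, mem_range, Nat.zero_le, true_and]
    constructor
    · rintro ⟨x, ⟨⟨-, h⟩, hx⟩, rfl⟩
      exact ⟨h, enum_lt hx (by omega)⟩
    · rintro ⟨hj, hlt⟩
      obtain ⟨x, hx, rfl⟩ := exists_enum (hG hj)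
      have : x < i := by
        by_contra hcon
        rcases Nat.lt_or_eq_of_le (not_lt.1 hcon) with h' | rfl
        · have := enum_lt h' hx; omega
        · omega
      exact ⟨x, ⟨⟨by omega, hj⟩, this⟩, rfl⟩
  have h2 : Set.InjOn (enum J) ((idx J G k).filter fun j => 0 ≤ j ∧ j < i : Finset ℕ) := by
    intro x hx y hy hxy
    refine enum_injOn (J := J) ?_ ?_ hxy
    · simp [idx] at hx ⊢; omega
    · simp [idx] at hy ⊢; omega
  have h3 := card_image_of_injOn h2
  rw [h] at h3
  exact h3.symm

theorem cnt_idx {J G : Finset ℕ} (hJ : J.card = k + 1) (hG : G ⊆ J) (htop : enum J k ∉ G) :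
    cnt (idx J G k) 0 k = G.card := by
  rw [cnt_idx_lt hJ hG le_rfl, filter_true_of_mem]
  intro j hj
  obtain ⟨x, hx, rfl⟩ := exists_enum (hG hj)
  refine enum_lt (lt_of_le_of_ne (by omega) ?_) (by omega)
  rintro rfl; exact htop hj

theorem cnt_mono (G : Finset ℕ) {i₀ i i' : ℕ} (h : i ≤ i') : cnt G i₀ i ≤ cnt G i₀ i' := by
  refine card_le_card fun j hj => ?_
  simp only [mem_filter] at hj ⊢
  exact ⟨hj.1, hj.2.1, by omega⟩

theorem cnt_add (G : Finset ℕ) {i₀ i i' : ℕ} (h0 : i₀ ≤ i) (h : i ≤ i') :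
    cnt G i₀ i + cnt G i i' = cnt G i₀ i' := by
  induction i', h using Nat.le_induction with
  | base => simp [cnt_self]
  | succ n hn ih => rw [cnt_succ hn, cnt_succ (h0.trans hn), ← ih, add_assoc]

theorem idx_good {J G : Finset ℕ} (hG : ∀ j ∈ G, 1 ≤ sx r S k j) {i : ℕ} (hi : i ∈ idx J G k) :
    k + 1 ≤ (sel r S J i).card := by
  have := hG _ (mem_filter.1 hi).2
  unfold sx at this
  unfold sel
  omega

theorem enum_top {J : Finset ℕ} (hJ : J ∈ levelSets k a) (h : k + a - 1 ∈ J) :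
    enum J k = k + a - 1 := by
  obtain ⟨h1, h2⟩ := mem_levelSets.1 hJ
  obtain ⟨i, hi, he⟩ := exists_enum h
  have h3 := mem_range.1 (h1 (enum_mem (J := J) (i := k) (by omega)))
  rcases Nat.lt_or_eq_of_le (show i ≤ k by omega) with h4 | rfl
  · have := enum_lt h4 (show k < J.card by omega)
    omega
  · exact he

theorem card_compl_levelSet {J : Finset ℕ} (hJ : J ∈ levelSets k a) (ha : 1 ≤ a) :
    (range (k + a) \ J).card = a - 1 := by
  rw [card_sdiff_of_subset (mem_levelSets.1 hJ).1, (mem_levelSets.1 hJ).2, card_range]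
  omega

/-- From a state at level `i₀` on, the bound grows by one at each good level up to the top, and no
partial sum being very negative, the robustness of the height rules out too many doublings. -/
theorem Robust.states (hm : Robust r S k a b g) (hp : Params k a b l g) {J G : Finset ℕ}
    (hJ : J ∈ levelSets k a) (hG : ∀ j ∈ G, 1 ≤ sx r S k j)
    {i₀ φ : ℕ} {c : ℤ} (hφ : 1 ≤ φ)
    (hc : c ≤ 20 * g ^ 2 + 10 * (100 * l ^ 2 * g))
    (hcnt : cnt (idx J G k) i₀ k ≤ 100 * l ^ 2)
    (hlow : ∀ i, i₀ ≤ i → i ≤ k → -(12 * g ^ 2 : ℤ) ≤ ∑ j ∈ Ico i₀ i, exc k (sel r S J) j)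
    (h0 : State r k (sel r S J) i₀ i₀ 0 φ c) :
    ∀ i, i₀ ≤ i → i ≤ k → ∃ t < g, State r k (sel r S J) i₀ i t (φ + cnt (idx J G k) i₀ i)
      (c + (t + cnt (idx J G k) i₀ i) * (a + g)) := by
  have ht := tower_sel (S := S) hm.scarce.strict (mem_levelSets.1 hJ).2
  rcases ht.state_induction hm.scarce (G := idx J G k) (fun i hi => idx_good hG hi) hφ
    hp.g_pos h0 with ⟨i, hi, hik, hst⟩ | h
  · exfalso
    obtain ⟨B, hB, hBc, hf⟩ := hst
    have h1 := hlow i hi hik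
    have h2 : (g + cnt (idx J G k) i₀ i) * (a + g) ≤ (g + 100 * l ^ 2) * (2 * g) :=
      Nat.mul_le_mul (Nat.add_le_add_left ((cnt_mono _ hik).trans hcnt) _)
        (by have := hp.a_le; omega)
    have h3 := hp.l2_mul_g_le
    have h4 := hp.hg2
    have h8 : 8 * B.card ≤ k := by
      set R := 100 * l ^ 2 with hR
      have h6 : R * g ≤ R ^ 2 * g := Nat.mul_le_mul_right _ (Nat.le_self_pow two_ne_zero _)
      have h7 : (g + R) * (2 * g) = 2 * g ^ 2 + 2 * (R * g) := by ring
      rw [h7] at h2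
      have hRz : (R : ℤ) = 100 * l ^ 2 := by rw [hR]; push_cast; ring
      rw [← hRz] at hc
      have h9 : B.card ≤ 20 * g ^ 2 + 10 * (R * g) + (2 * g ^ 2 + 2 * (R * g)) + 12 * g ^ 2 := by
        zify at h2 ⊢
        linarith
      omega
    have h9 := hm.le_numPaths hp.one_le_a hJ hik hB h8 (fun v hv => (hf v hv).1)
    exact absurd (hm.numPaths_lt hJ) (not_lt.2 h9)
  · exact h

theorem Robust.sum_eq (hm : Robust r S k a b g) {K : Finset ℕ} (hK : K ⊆ range (k + a)) :
    ∑ j ∈ K, sx r S k j = b - ∑ j ∈ range (k + a) \ K, sx r S k j := by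
  have := sum_sdiff (f := sx r S k) hK
  rw [hm.sum_sx] at this
  linarith

theorem Robust.sum_levelSet_ge (hm : Robust r S k a b g) (ha : 1 ≤ a) {J : Finset ℕ}
    (hJ : J ∈ levelSets k a) : -((a * a : ℕ) : ℤ) ≤ ∑ i ∈ Ico 0 (k + 1), exc k (sel r S J) i := by
  have h1 : ∑ i ∈ Ico 0 (k + 1), exc k (sel r S J) i = ∑ j ∈ J, sx r S k j :=
    sum_enum_all (sx r S k) (mem_levelSets.1 hJ).2
  rw [h1, hm.sum_eq (mem_levelSets.1 hJ).1]
  have h2 : ∑ j ∈ range (k + a) \ J, sx r S k j ≤ ∑ j ∈ range (k + a) \ J, (a : ℤ) :=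
    sum_le_sum fun j _ => sx_le hm.scarce j
  rw [sum_const, card_compl_levelSet hJ ha, nsmul_eq_mul] at h2
  have h3 : ((a - 1 : ℕ) : ℤ) * a ≤ a * a :=
    mul_le_mul_of_nonneg_right (by exact_mod_cast (Nat.sub_le a 1)) (by positivity)
  push_cast
  have : (0 : ℤ) ≤ b := by positivity
  linarith

theorem Robust.sum_prefix_ge (hm : Robust r S k a b g) (hp : Params k a b l g) {J : Finset ℕ}
    (hJ : J ∈ levelSets k a)
    (hsur : ∀ j₀, ∑ j ∈ Ico j₀ (k + a), sx r S k j < 16 * l * (a + g)) {i : ℕ} (hi : i ≤ k) :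
    -(12 * g ^ 2 : ℤ) ≤ ∑ j ∈ Ico 0 i, exc k (sel r S J) j := by
  have ha := hp.one_le_a
  have hJc := (mem_levelSets.1 hJ).2
  have h1 : ∑ j ∈ Ico 0 i, exc k (sel r S J) j = ∑ j ∈ J.filter (· < enum J i), sx r S k j :=
    sum_enum_range (sx r S k) (by omega)
  set e := enum J i with he
  have hek : e < k + a := mem_range.1 ((mem_levelSets.1 hJ).1 (enum_mem (by omega)))
  have h2 := sum_range_add_sum_Ico (sx r S k) hek.le
  rw [hm.sum_sx] at h2
  have h3 : J.filter (· < e) ⊆ range e := fun x hx => by simp at hx ⊢; exact hx.2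
  have h4 := sum_sdiff (f := sx r S k) h3
  have h5 : ∑ j ∈ range e \ J.filter (· < e), sx r S k j ≤
      ∑ j ∈ range e \ J.filter (· < e), (a : ℤ) := sum_le_sum fun j _ => sx_le hm.scarce j
  have h6 : (range e \ J.filter (· < e)).card ≤ a := by
    calc _ ≤ (range (k + a) \ J).card := card_le_card fun x hx => by
          simp only [mem_sdiff, mem_range, mem_filter, not_and] at hx ⊢
          exact ⟨by omega, fun h => hx.2 h hx.1⟩
      _ ≤ a := by rw [card_compl_levelSet hJ ha]; omega
  rw [sum_const, nsmul_eq_mul] at h5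
  have h7 : ((range e \ J.filter (· < e)).card : ℤ) * a ≤ a * a :=
    mul_le_mul_of_nonneg_right (by exact_mod_cast h6) (by positivity)
  have h8 := hsur e
  have h9 := hp.surplus_le
  zify at h9
  rw [h1]
  have : (0 : ℤ) ≤ b := by positivity
  linarith

end

section
variable {r : α → α → Prop} {S : Finset α} {k a b l g : ℕ}

theorem two_tier {Λ : ℕ → Finset α} {θ : ℕ} {B₁ B₂ : Finset α} (hB₁ : B₁ ⊆ Λ k)
    (hf₁ : ∀ v ∈ Λ k \ B₁, θ ≤ pathCount r Λ k v)
    (hf₂ : ∀ v ∈ Λ k \ B₂, θ + 1 ≤ pathCount r Λ k v) :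
    (θ : ℤ) * ((Λ k).card - B₁.card) + ((Λ k).card - B₁.card - B₂.card) ≤ numPaths r Λ k := by
  have h1 : ∑ v ∈ Λ k \ B₁, (θ + if v ∈ B₂ then 0 else 1) ≤ numPaths r Λ k := by
    refine le_trans (sum_le_sum fun v hv => ?_) (sum_le_sum_of_subset (sdiff_subset (t := B₁)))
    split_ifs with h
    · exact hf₁ v hv
    · exact hf₂ v (mem_sdiff.2 ⟨(mem_sdiff.1 hv).1, h⟩)
  have h2 : ∑ v ∈ Λ k \ B₁, (if v ∈ B₂ then 0 else 1) = ((Λ k \ B₁) \ B₂).card := by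
    rw [card_eq_sum_ones, sdiff_eq_filter (Λ k \ B₁) B₂, sum_filter]
    exact sum_congr rfl fun v _ => by split_ifs <;> simp_all
  have h3 := le_card_sdiff B₂ (Λ k \ B₁)
  rw [sum_add_distrib, h2, sum_const, smul_eq_mul, card_sdiff_of_subset hB₁] at h1
  rw [card_sdiff_of_subset hB₁] at h3
  have h4 := card_le_card hB₁
  zify [h4] at h1 h3
  have h5 : ((Λ k).card : ℤ) - B₁.card - B₂.card ≤ (((Λ k \ B₁) \ B₂).card : ℤ) := by
    omega
  linarith

theorem sum_sel_ge {J : Finset ℕ} (hJ : J ∈ levelSets k a) {x : ℤ}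
    (hint : ∀ K ⊆ range (k + a), -x ≤ ∑ j ∈ K, sx r S k j) (i₀ i : ℕ) (hi : i ≤ k + 1) :
    -x ≤ ∑ j ∈ Ico i₀ i, exc k (sel r S J) j := by
  obtain ⟨h1, h2⟩ := mem_levelSets.1 hJ
  have hsub : Ico i₀ i ⊆ range J.card := fun x hx => by simp at hx ⊢; omega
  have h3 : ∑ j ∈ Ico i₀ i, exc k (sel r S J) j =
      ∑ j ∈ (Ico i₀ i).image (enum J), sx r S k j := by
    rw [sum_image fun x hx y hy h => enum_injOn (hsub hx) (hsub hy) h]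
    rfl
  rw [h3]
  apply hint
  intro j hj
  obtain ⟨x, hx, rfl⟩ := mem_image.1 hj
  exact h1 (enum_mem (mem_range.1 (hsub hx)))

/-! ### Level sizes that do not suffice, with a top level of at most `k` elements -/

theorem state_zero (hr : StrictRel r) {J : Finset ℕ} (hJ : J ∈ levelSets k a) :
    State r k (sel r S J) 0 0 0 1 0 := by
  have ht := tower_sel (S := S) hr (mem_levelSets.1 hJ).2
  refine ⟨∅, by simp, by simp, fun v hv => ?_⟩
  have := ht.one_le_pathCount (Nat.zero_le _) (mem_sdiff.1 hv).1
  exact ⟨by simpa using this, this, by omega⟩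

set_option maxHeartbeats 400000 in
/-- When the second good level has at least `k + 2` elements, it makes the bound grow by two. -/
theorem Robust.of_second_level (hm : Robust r S k a b g) (hp : Params k a b l g)
    (hint : ∀ K ⊆ range (k + a), -(a : ℤ) ≤ ∑ j ∈ K, sx r S k j) {J G : Finset ℕ}
    (hJ : J ∈ levelSets k a) (hGJ : G ⊆ J) (hG : ∀ j ∈ G, 1 ≤ sx r S k j) {ρ : ℕ}
    (hρl : ρ + 10 ≤ 100 * l ^ 2) (hGc : G.card = ρ) (hJG : enum J k ∉ G) {m : ℕ}
    (hmG : m ∈ G) (hm2 : 2 ≤ sx r S k m) (hone : (G.filter (· < m)).card = 1) :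
    (2 * ρ + 3) * k ≤ 2 * numPaths r (sel r S J) k := by
  have ha := hp.one_le_a
  have hag := hp.a_le
  have hgpos := hp.g_pos
  obtain ⟨hJs, hJc⟩ := mem_levelSets.1 hJ
  have hcntk := cnt_idx hJc hGJ hJG
  obtain ⟨i, hi, him⟩ := exists_enum (hGJ hmG)
  have hik : i < k := lt_of_le_of_ne (by omega) (by rintro rfl; exact hJG (him ▸ hmG))
  have hcnti : cnt (idx J G k) 0 i = 1 := by rw [cnt_idx_lt hJc hGJ hik.le, him, hone]
  have hmemi : i ∈ idx J G k := mem_filter.2 ⟨mem_range.2 hik, him ▸ hmG⟩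
  have hcnt1 : cnt (idx J G k) i (i + 1) = 1 := by rw [cnt_succ le_rfl, cnt_self, if_pos hmemi]
  have hadd := cnt_add (idx J G k) (Nat.zero_le i) hik.le
  have hadd2 : cnt (idx J G k) i (i + 1) + cnt (idx J G k) (i + 1) k = cnt (idx J G k) i k :=
    cnt_add (idx J G k) (Nat.le_succ i) hik
  have hag2 : a ≤ 12 * g ^ 2 := by nlinarith
  have hlow : ∀ i₀ i, i₀ ≤ i → i ≤ k → -(12 * g ^ 2 : ℤ) ≤ ∑ j ∈ Ico i₀ i, exc k (sel r S J) j := by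
    intro i₀ i _ hik
    have := sum_sel_ge hJ hint i₀ i (by omega)
    zify at hag2
    linarith
  have hsuf : ∀ i₀, -((a * a : ℕ) : ℤ) ≤ ∑ j ∈ Ico i₀ (k + 1), exc k (sel r S J) j := by
    intro i₀
    have := sum_sel_ge hJ hint i₀ (k + 1) le_rfl
    have h2 : a ≤ a * a := Nat.le_mul_of_pos_left _ ha
    have : (a : ℤ) ≤ (a * a : ℕ) := by exact_mod_cast h2
    linarith
  have hst := hm.states hp hJ hG (c := 0) le_rfl (by positivity) (by omega)
    (hlow 0) (state_zero hm.scarce.strict hJ)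
  obtain ⟨t, htg, hstk⟩ := hst k (Nat.zero_le _) le_rfl
  obtain ⟨t', htg', hsti⟩ := hst i (Nat.zero_le _) hik.le
  rw [hcntk] at hstk
  rw [hcnti] at hsti
  have hg1 : g ≤ g ^ 2 := by nlinarith
  -- A doubling on the way to the top yields the additional `1` that is needed.
  rcases Nat.eq_zero_or_pos t with rfl | htpos
  swap
  · exact State.of_add_two hp (Nat.zero_le _) hρl htg (by omega) (hsuf 0) (by positivity) hstk
      (Or.inr ⟨htpos, by omega⟩)
  obtain ⟨B, hB, hBc, hf⟩ := hsti
  have hpre := sum_sel_ge hJ hint 0 i (by omega)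
  rcases Nat.eq_zero_or_pos t' with rfl | htpos'
  · -- no doubling below the second good level: use it to gain two at once
    have hBc' : B.card ≤ 3 * g := by
      push_cast at hBc
      zify at hag ⊢
      linarith
    have ht := tower_sel (S := S) hm.scarce.strict hJc
    have hcard : k + 2 ≤ (sel r S J i).card := by
      unfold sx at hm2
      unfold sel
      rw [him]
      omega
    obtain ⟨B', hB', hBc2, hf'⟩ := (ht.consec i hik).add_two hm.scarce hB (θ := 2)
      (fun x hx => (hf x hx).2.1) (fun x hx => ht.one_le_pathCount hik.le hx) hcard le_rfl
    have hB'c : B'.card ≤ 10 * g ^ 2 := by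
      have : (B.card + 1) * g ≤ (3 * g + 1) * g := Nat.mul_le_mul_right _ (by omega)
      nlinarith
    have h0 : State r k (sel r S J) (i + 1) (i + 1) 0 4 (10 * g ^ 2) := by
      refine ⟨B', hB', ?_, fun v hv => ?_⟩
      · rw [Ico_self, sum_empty, add_zero]; exact_mod_cast hB'c
      · have h4 : 4 ≤ pathCount r (sel r S J) (i + 1) v := hf' v hv
        exact ⟨by rw [pow_zero]; omega, h4, by omega⟩
    obtain ⟨t₂, ht₂, hst₂⟩ := hm.states hp hJ hG (by norm_num) (by
        have : (0 : ℤ) ≤ g ^ 2 := by positivity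
        have : (0 : ℤ) ≤ 100 * l ^ 2 * g := by positivity
        linarith) (by omega) (hlow (i + 1)) h0 k hik le_rfl
    have hc4 : 4 + cnt (idx J G k) (i + 1) k = ρ + 2 := by omega
    rw [hc4] at hst₂
    by_cases hbig : 2 * (ρ + 2) ≤ 2 ^ t₂
    · exact State.of_two_pow hp hik hρl ht₂ (m := cnt (idx J G k) (i + 1) k) (by omega)
        (hsuf (i + 1)) (by have : (0 : ℤ) ≤ g ^ 2 := by positivity
                           have : (0 : ℤ) ≤ 100 * l ^ 2 * g := by positivity
                           linarith) hst₂ (Or.inl hbig)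
    have ht₂' : t₂ < 2 ^ t₂ := Nat.lt_two_pow_self
    obtain ⟨B₁, hB₁, hB₁c, hf₁⟩ := hstk
    obtain ⟨B₂, hB₂, hB₂c, hf₂⟩ := hst₂
    -- All but few elements of the top level have the value `ρ + 1`, and all but a larger set of
    -- exceptions have the value `ρ + 2`.
    have h1 := two_tier hB₁ (θ := ρ + 1) (B₂ := B₂) (fun v hv => by
      have := (hf₁ v hv).2.1; omega) (fun v hv => (hf₂ v hv).2.1)
    have h2 : (t₂ + cnt (idx J G k) (i + 1) k) * (a + g) ≤ 3 * (100 * l ^ 2) * (2 * g) :=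
      Nat.mul_le_mul (by omega) (by omega)
    have h3 := hp.l2_mul_g_le
    have h4 := hp.hg2
    have h5 : ρ * (a + g) ≤ (100 * l ^ 2) * (2 * g) := Nat.mul_le_mul (by omega) (by omega)
    have h6 := sum_sel_ge hJ hint (i + 1) k (by omega)
    have h7 := sum_sel_ge hJ hint 0 (k + 1) (by omega)
    rw [sum_Ico_succ_top (Nat.zero_le _)] at h7
    have h7' : exc k (sel r S J) k = (sel r S J k).card - k := rfl
    set R := 100 * l ^ 2 with hR
    have h8 : (ρ + 2) * (ρ * (a + g) + a) ≤ 3 * (R ^ 2 * g) := by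
      calc _ ≤ R * (R * (2 * g) + g) := Nat.mul_le_mul (by omega) (by omega)
        _ ≤ R * (R * (2 * g) + R * g) := Nat.mul_le_mul_left _
            (Nat.add_le_add_left (Nat.le_mul_of_pos_left _ (by omega)) _)
        _ = _ := by ring
    have h9 : R * g ≤ R ^ 2 * g := Nat.mul_le_mul_right _ (Nat.le_self_pow two_ne_zero _)
    zify at h2 h3 h4 h5 h8 h9 hag hg1 ⊢
    push_cast at h1 hB₁c
    rw [zero_add, zero_add, hGc] at hB₁c
    set L : ℤ := ((sel r S J k).card : ℤ)
    set p : ℤ := (ρ : ℤ) * (a + g) with hpdef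
    have h10 : (k : ℤ) - (p + a) ≤ L - B₁.card := by linarith
    have h11 : (B₂.card : ℤ) ≤ 10 * g ^ 2 + 3 * R * (2 * g) + a := by linarith
    have h12 : ((ρ : ℤ) + 2) * (k - (p + a)) ≤ (ρ + 2) * (L - B₁.card) :=
      mul_le_mul_of_nonneg_left h10 (by positivity)
    have h13 : ((ρ : ℤ) + 2) * (k - (p + a)) = (ρ + 2) * k - (ρ + 2) * (p + a) := by ring
    have h14 : 3 * (R : ℤ) * (2 * g) = 6 * (R * g) := by ring
    linarith
  · -- a doubling took place below the second good level
    have hBt : (B.card : ℤ) ≤ (t' + 1) * (a + g) + a := by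
      push_cast at hBc
      linarith
    have hc1 : ((t' + 1) * (a + g) + a : ℕ) ≤ 20 * g ^ 2 + 10 * (100 * l ^ 2 * g) := by
      have : (t' + 1) * (a + g) ≤ g * (2 * g) := Nat.mul_le_mul (by omega) (by omega)
      have h2 : g * (2 * g) = 2 * g ^ 2 := by ring
      omega
    have h0 : ∀ φ : ℕ, φ ≤ 2 ^ t' ∨ φ ≤ 3 →
        State r k (sel r S J) i i 0 φ (((t' + 1) * (a + g) + a : ℕ) : ℤ) := by
      intro φ hφ
      refine ⟨B, hB, ?_, fun v hv => ?_⟩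
      · rw [Ico_self, sum_empty, add_zero]; push_cast; exact hBt
      · obtain ⟨h1, h2, h3⟩ := hf v hv
        have h3 := h3 htpos'
        refine ⟨by rw [pow_zero]; omega, ?_, by omega⟩
        rcases hφ with h | h <;> omega
    by_cases hbig : 2 * (ρ + 2) ≤ 2 ^ t'
    · obtain ⟨t₂, ht₂, hst₂⟩ := hm.states hp hJ hG (φ := 2 ^ t') Nat.one_le_two_pow
        (by exact_mod_cast hc1) (by omega) (hlow i) (h0 _ (Or.inl le_rfl)) k hik.le le_rfl
      exact State.of_two_pow hp hik.le hρl ht₂ (m := cnt (idx J G k) i k) (by omega)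
        (hsuf i) (by exact_mod_cast hc1) hst₂ (Or.inr (by omega))
    · have ht' : t' < 2 ^ t' := Nat.lt_two_pow_self
      obtain ⟨t₂, ht₂, hst₂⟩ := hm.states hp hJ hG (φ := 3) (by norm_num)
        (by exact_mod_cast hc1) (by omega) (hlow i) (h0 _ (Or.inr le_rfl)) k hik.le le_rfl
      refine State.of_add_two hp hik.le hρl ht₂ (m := cnt (idx J G k) i k) (by omega)
        (hsuf i) ?_ hst₂ (Or.inl (by omega))
      have h1 : (t' + 1) * (a + g) ≤ (3 * (100 * l ^ 2)) * (2 * g) :=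
        Nat.mul_le_mul (by omega) (by omega)
      have h2 : a ≤ 100 * l ^ 2 * g := hag.trans (Nat.le_mul_of_pos_left _ (by omega))
      have : (t' + 1) * (a + g) + a ≤ 10 * (100 * l ^ 2 * g) := by
        have : 3 * (100 * l ^ 2) * (2 * g) = 6 * (100 * l ^ 2 * g) := by ring
        omega
      exact_mod_cast this

/-- The level sizes for which the count of chains does not by itself exceed the target: no level
has fewer than `k` elements, the top level has `k`, and either `a = 1`, or `b = a` and all the
surplus sits in a single level. -/
structure Tie (r : α → α → Prop) (S : Finset α) (k a b : ℕ) : Prop where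
  nonneg : ∀ j < k + a, 0 ≤ sx r S k j
  top : sx r S k (k + a - 1) = 0
  shape : a = 1 ∨ b = a ∧ ∃ m < k + a - 1, sx r S k m = a ∧ ∀ j < k + a, j ≠ m → sx r S k j = 0

/-- The levels with more than `k` elements. -/
noncomputable def goodLevels (r : α → α → Prop) (S : Finset α) (k a : ℕ) : Finset ℕ :=
  (range (k + a)).filter fun j => 1 ≤ sx r S k j

theorem mem_goodLevels {j : ℕ} : j ∈ goodLevels r S k a ↔ j < k + a ∧ 1 ≤ sx r S k j := by
  simp [goodLevels]

theorem Robust.sum_goodLevels (hm : Robust r S k a b g) {K : Finset ℕ}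
    (hK : K ⊆ range (k + a)) (hGK : goodLevels r S k a ⊆ K) : (b : ℤ) ≤ ∑ j ∈ K, sx r S k j := by
  rw [hm.sum_eq hK]
  have : ∑ j ∈ range (k + a) \ K, sx r S k j ≤ ∑ j ∈ range (k + a) \ K, (0 : ℤ) := by
    refine sum_le_sum fun j hj => ?_
    rw [mem_sdiff, mem_range] at hj
    by_contra hcon
    exact hj.2 (hGK (mem_goodLevels.2 ⟨hj.1, by omega⟩))
  simp at this
  linarith

theorem Robust.b_le_card (hm : Robust r S k a b g) : b ≤ (goodLevels r S k a).card * a := by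
  have h1 := hm.sum_goodLevels (filter_subset _ _) Subset.rfl
  have h2 : ∑ j ∈ goodLevels r S k a, sx r S k j ≤ ∑ j ∈ goodLevels r S k a, (a : ℤ) :=
    sum_le_sum fun j _ => sx_le hm.scarce j
  rw [sum_const, nsmul_eq_mul] at h2
  exact_mod_cast h1.trans h2

theorem Params.rho_le (hp : Params k a b l g) (hb : b < 16 * l * (a + g)) {ρ : ℕ}
    (hρ : ρ * a < b + a) : ρ + 10 ≤ 100 * l ^ 2 := by
  have ha := hp.one_le_a
  have hl := hp.one_le_l
  have h1 : g ≤ 3 * l * a := by rw [hp.hg]; nlinarith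
  have h2 : a + g ≤ 4 * l * a := by nlinarith
  have h3 : 16 * l * (a + g) ≤ 16 * l * (4 * l * a) := Nat.mul_le_mul_left _ h2
  have h4 : ρ * a < (64 * l ^ 2 + 1) * a := by nlinarith
  have h5 := lt_of_mul_lt_mul_right h4 (Nat.zero_le _)
  nlinarith

end

section
variable {r : α → α → Prop} {S : Finset α} {k a b l g : ℕ}

/-- If there are more good levels than needed, the choices of levels that contain `ρ + 1` of them
and the top level suffice. -/
theorem Robust.of_many_good (hm : Robust r S k a b g) (hp : Params k a b l g)
    (hsur : ∀ j₀, ∑ j ∈ Ico j₀ (k + a), sx r S k j < 16 * l * (a + g)) {ρ : ℕ}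
    (hρ : b ≤ ρ * a) (hρl : ρ + 10 ≤ 100 * l ^ 2) (htop : k + a - 1 ∉ goodLevels r S k a)
    (hc : ρ + 1 ≤ (goodLevels r S k a).card) : target k a b < (chains r (k + 1) S).card := by
  have ha := hp.one_le_a
  obtain ⟨G, hG, hGc⟩ := exists_subset_card_eq hc
  have hGr : G ⊆ range (k + a) := hG.trans (filter_subset _ _)
  refine hm.target_lt_of_forall' hp hρ hρl (W := insert (k + a - 1) G)
    (insert_subset (by simp; omega) hGr) ?_ fun J hJ hW => ?_
  · have := card_insert_le (k + a - 1) G; omega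
  · have hJc := (mem_levelSets.1 hJ).2
    have htopJ := enum_top hJ (hW (mem_insert_self _ _))
    have hGJ : G ⊆ J := (subset_insert _ _).trans hW
    have hcnt := cnt_idx hJc hGJ (by rw [htopJ]; exact fun h => htop (hG h))
    obtain ⟨t, htg, hst⟩ := hm.states hp hJ (G := G) (c := 0)
      (fun j hj => (mem_goodLevels.1 (hG hj)).2) le_rfl (by positivity) (by omega)
      (fun i _ hi => hm.sum_prefix_ge hp hJ hsur hi) (state_zero hm.scarce.strict hJ) k
      (Nat.zero_le _) le_rfl
    rw [hcnt, hGc] at hst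
    exact State.of_add_two hp (Nat.zero_le _) hρl htg le_rfl (hm.sum_levelSet_ge ha hJ)
      (by positivity) hst (Or.inl (by omega))

/-- If all the good levels are chosen and there are only `ρ` of them, then either the bound
exceeds `ρ + 1` or no doubling takes place at all. -/
theorem Robust.of_few_good (hm : Robust r S k a b g) (hp : Params k a b l g)
    (hsur : ∀ j₀, ∑ j ∈ Ico j₀ (k + a), sx r S k j < 16 * l * (a + g)) {ρ : ℕ}
    (hρl : ρ + 10 ≤ 100 * l ^ 2) (htop : k + a - 1 ∉ goodLevels r S k a)
    (hc : (goodLevels r S k a).card = ρ) {J : Finset ℕ} (hJ : J ∈ levelSets k a)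
    (hW : insert (k + a - 1) (goodLevels r S k a) ⊆ J) :
    (2 * ρ + 3) * k ≤ 2 * numPaths r (sel r S J) k ∨
      ((ρ : ℤ) + 1) * (k + b - ρ * (a + g)) ≤ numPaths r (sel r S J) k := by
  have ha := hp.one_le_a
  have hJc := (mem_levelSets.1 hJ).2
  have htopJ := enum_top hJ (hW (mem_insert_self _ _))
  have hGJ : goodLevels r S k a ⊆ J := (subset_insert _ _).trans hW
  have hcnt := cnt_idx hJc hGJ (by rwa [htopJ])
  obtain ⟨t, htg, hst⟩ := hm.states hp hJ (G := goodLevels r S k a) (c := 0)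
    (fun j hj => (mem_goodLevels.1 hj).2) le_rfl (by positivity) (by omega)
    (fun i _ hi => hm.sum_prefix_ge hp hJ hsur hi) (state_zero hm.scarce.strict hJ) k
    (Nat.zero_le _) le_rfl
  rw [hcnt, hc] at hst
  rcases Nat.eq_zero_or_pos t with rfl | htpos
  · right
    have h1 := hst.mul_le (Nat.zero_le _) (θ := ρ + 1) (Or.inr (Or.inl (by omega)))
    have h2 : ∑ i ∈ Ico 0 (k + 1), exc k (sel r S J) i = ∑ j ∈ J, sx r S k j :=
      sum_enum_all (sx r S k) hJc
    have h3 := hm.sum_goodLevels (mem_levelSets.1 hJ).1 hGJ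
    refine le_trans ?_ h1
    push_cast
    refine mul_le_mul_of_nonneg_left ?_ (by positivity)
    rw [h2]; linarith
  · left
    exact State.of_add_two hp (Nat.zero_le _) hρl htg (by omega) (hm.sum_levelSet_ge ha hJ)
      (by positivity) hst (Or.inr ⟨htpos, by omega⟩)

theorem Robust.sum_ge_neg (hm : Robust r S k a b g) {ρ : ℕ} (hρ2 : ρ * a < b + a)
    (hc : (goodLevels r S k a).card = ρ) (K : Finset ℕ) (hK : K ⊆ range (k + a)) :
    -(a : ℤ) ≤ ∑ j ∈ K, sx r S k j := by
  rw [hm.sum_eq hK]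
  have h1 : ∑ j ∈ range (k + a) \ K, sx r S k j ≤
      ∑ j ∈ range (k + a) \ K, if j ∈ goodLevels r S k a then (a : ℤ) else 0 := by
    refine sum_le_sum fun j hj => ?_
    split_ifs with h
    · exact sx_le hm.scarce j
    · by_contra hcon
      exact h (mem_goodLevels.2 ⟨mem_range.1 (mem_sdiff.1 hj).1, by omega⟩)
  rw [← sum_filter, sum_const, nsmul_eq_mul] at h1
  have h2 : (((range (k + a) \ K).filter (· ∈ goodLevels r S k a)).card : ℤ) * a ≤ ρ * a := by
    refine mul_le_mul_of_nonneg_right ?_ (by positivity)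
    rw [← hc]
    exact_mod_cast card_le_card fun x hx => (mem_filter.1 hx).2
  zify at hρ2
  linarith

theorem Params.few_good_ineq (hp : Params k a b l g) (ha2 : 2 ≤ a) {ρ w : ℕ}
    (hρl : ρ + 10 ≤ 100 * l ^ 2) (hρ : 1 < ρ) (hbound : b ≤ (ρ - 1) * a + 1) (hw : w ≤ ρ + 1) :
    2 * (k + a) * (a * k + b * (k + 1)) +
      a * (2 * (ρ + 1) * k - 4 * ((100 * l ^ 2) ^ 2 * g)) * (w * (a - 1)) <
      a * (2 * (ρ + 1) * k - 4 * ((100 * l ^ 2) ^ 2 * g)) * (k + a) := by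
  have hag := hp.a_le
  have h1 := hp.l2_mul_g_le
  have h2 := hp.l2_le
  set R := 100 * l ^ 2
  have hA0 : 4 * (R ^ 2 * g) ≤ 2 * (ρ + 1) * k := by nlinarith
  obtain ⟨A, hA⟩ : ∃ A, A + 4 * (R ^ 2 * g) = 2 * (ρ + 1) * k := ⟨_, Nat.sub_add_cancel hA0⟩
  have hA' : 2 * (ρ + 1) * k - 4 * (R ^ 2 * g) = A := by omega
  rw [hA']
  obtain ⟨σ, rfl⟩ : ∃ σ, ρ = σ + 1 := ⟨ρ - 1, by omega⟩
  rw [Nat.add_sub_cancel] at hbound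
  have h4 : a * k + b * (k + 1) ≤ a * k + (σ * a + 1) * (k + 1) :=
    Nat.add_le_add_left (Nat.mul_le_mul_right _ hbound) _
  have h5 : w * (a - 1) ≤ R * g := Nat.mul_le_mul (by omega) (by omega)
  have h6 : A * (w * (a - 1)) ≤ 2 * k * (R ^ 2 * g) := by
    calc _ ≤ (2 * R * k) * (R * g) := Nat.mul_le_mul
          ((by omega : A ≤ 2 * (σ + 1 + 1) * k).trans (Nat.mul_le_mul_right _ (by omega))) h5
      _ = _ := by ring
  have h7 : 2 * (a * k + (σ * a + 1) * (k + 1)) + a * (2 * (R ^ 2 * g)) < a * A := by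
    have e1 : a * A + a * (4 * (R ^ 2 * g)) = a * (2 * (σ + 1 + 1) * k) := by
      rw [← mul_add, hA]
    have e2 : 2 * k ≤ a * k := Nat.mul_le_mul_right _ ha2
    have e3 : a * (2 * σ + 2 + 6 * (R ^ 2 * g)) < a * k :=
      Nat.mul_lt_mul_of_pos_left (by omega) (by omega)
    have e4 : a * (2 * (σ + 1 + 1) * k) = 2 * (a * (σ * k)) + 4 * (a * k) := by ring
    have e5 : 2 * (a * k + (σ * a + 1) * (k + 1)) =
      2 * (a * k) + 2 * (a * (σ * k)) + 2 * (σ * a) + 2 * k + 2 := by ring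
    have e6 : a * (2 * σ + 2 + 6 * (R ^ 2 * g)) = 2 * (σ * a) + 2 * a + 6 * (a * (R ^ 2 * g)) := by
      ring
    linarith
  calc _ ≤ 2 * (k + a) * (a * k + (σ * a + 1) * (k + 1)) + a * (2 * k * (R ^ 2 * g)) := by
        rw [mul_assoc a A]
        exact Nat.add_le_add (Nat.mul_le_mul_left _ h4) (Nat.mul_le_mul_left _ h6)
    _ ≤ (2 * (a * k + (σ * a + 1) * (k + 1)) + a * (2 * (R ^ 2 * g))) * (k + a) := by
        have : a * (2 * k * (R ^ 2 * g)) ≤ a * (2 * (k + a) * (R ^ 2 * g)) :=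
          Nat.mul_le_mul_left _ (Nat.mul_le_mul_right _ (by omega))
        linarith
    _ < a * A * (k + a) := Nat.mul_lt_mul_of_pos_right h7 (by omega)

theorem Params.one_good_ineq (hp : Params k a b l g) (hba : b < a) {w : ℕ} (hw : w ≤ 1 + 1) :
    2 * (k + a) * (a * k + b * (k + 1)) + a * (4 * k - 4 * (a + g)) * (w * (a - 1)) <
      a * (4 * k - 4 * (a + g)) * (k + a) := by
  have hag := hp.a_le
  have hgk := hp.g_le
  have h3 := hp.hg2
  have hga : a * g ≤ g ^ 2 := by rw [pow_two]; exact Nat.mul_le_mul_right _ hag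
  have haa : a * a ≤ g ^ 2 := by rw [pow_two]; exact Nat.mul_le_mul hag hag
  have hgpos := hp.g_pos
  have hA0 : 4 * (a + g) ≤ 4 * k := by omega
  obtain ⟨A, hA⟩ : ∃ A, A + 4 * (a + g) = 4 * k := ⟨_, Nat.sub_add_cancel hA0⟩
  have hA' : 4 * k - 4 * (a + g) = A := by omega
  rw [hA']
  obtain ⟨c, rfl⟩ : ∃ c, a = c + 1 := ⟨a - 1, by omega⟩
  rw [Nat.add_sub_cancel]
  have h4 : b * (k + 1) ≤ c * (k + 1) := Nat.mul_le_mul_right _ (by omega)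
  have h5 : w * c ≤ 2 * (c + 1) := Nat.mul_le_mul hw (by omega)
  have h6 : (c + 1) * A * (w * c) ≤ (c + 1) * (4 * k) * (2 * (c + 1)) :=
    Nat.mul_le_mul (Nat.mul_le_mul_left _ (by omega)) h5
  have h8 : 2 * ((c + 1) * k + c * (k + 1)) + 8 * ((c + 1) * (c + 1)) < (c + 1) * A := by
    have e1 : (c + 1) * A + 4 * ((c + 1) * (c + 1)) + 4 * ((c + 1) * g) = (c + 1) * (4 * k) := by
      rw [← hA]; ring
    have e2 : 2 * c + 12 * ((c + 1) * (c + 1)) + 4 * ((c + 1) * g) < 2 * k := by omega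
    have e3 : (c + 1) * (4 * k) = 4 * (c * k) + 4 * k := by ring
    have e4 : 2 * ((c + 1) * k + c * (k + 1)) = 4 * (c * k) + 2 * k + 2 * c := by ring
    linarith
  calc _ ≤ 2 * (k + (c + 1)) * ((c + 1) * k + c * (k + 1)) +
        (c + 1) * (4 * k) * (2 * (c + 1)) := Nat.add_le_add (Nat.mul_le_mul_left _ (by omega)) h6
    _ ≤ (2 * ((c + 1) * k + c * (k + 1)) + 8 * ((c + 1) * (c + 1))) * (k + (c + 1)) := by
        have e1 : (c + 1) * (4 * k) * (2 * (c + 1)) + 8 * ((c + 1) * (c + 1)) * (c + 1) =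
          8 * ((c + 1) * (c + 1)) * (k + (c + 1)) := by ring
        linarith [Nat.zero_le (8 * ((c + 1) * (c + 1)) * (c + 1))]
    _ < _ := Nat.mul_lt_mul_of_pos_right h8 (by omega)

/-- The count of chains when the top level is not a good one. -/
theorem Robust.target_lt_or_tie (hm : Robust r S k a b g) (hp : Params k a b l g)
    (htop0 : sx r S k (k + a - 1) ≤ 0) :
    target k a b < (chains r (k + 1) S).card ∨ Tie r S k a b := by
  have ha := hp.one_le_a
  have hb := hp.one_le_b
  have hag := hp.a_le
  have hgk := hp.g_le
  by_cases hsur : ∀ j₀, ∑ j ∈ Ico j₀ (k + a), sx r S k j < 16 * l * (a + g)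
  swap
  · push Not at hsur
    obtain ⟨j₀, hj₀⟩ := hsur
    exact Or.inl (hm.target_lt_of_surplus hp hj₀)
  have hbl : b < 16 * l * (a + g) := by
    have := hsur 0
    rw [← range_eq_Ico, hm.sum_sx] at this
    exact_mod_cast this
  have htop : k + a - 1 ∉ goodLevels r S k a := fun h => by
    have := (mem_goodLevels.1 h).2; omega
  obtain ⟨ρ, hρ1, hρ2⟩ : ∃ ρ, b ≤ ρ * a ∧ ρ * a < b + a := by
    refine ⟨(b + a - 1) / a, ?_, ?_⟩
    · have h1 := Nat.div_add_mod (b + a - 1) a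
      have h2 := Nat.mod_lt (b + a - 1) ha
      rw [mul_comm a] at h1
      omega
    · have := Nat.div_mul_le_self (b + a - 1) a
      omega
  have hρl := hp.rho_le hbl hρ2
  have hcard : ρ ≤ (goodLevels r S k a).card := by
    have h1 := hm.b_le_card
    have h2 : ρ * a < ((goodLevels r S k a).card + 1) * a := by
      rw [add_mul]; omega
    have := lt_of_mul_lt_mul_right h2 (Nat.zero_le _)
    omega
  -- At least `ρ = ⌈b / a⌉` levels are good, as no level exceeds `k` elements by more than `a`.
  rcases Nat.lt_or_eq_of_le hcard with hmany | hc
  · exact Or.inl (hm.of_many_good hp hsur hρ1 hρl htop hmany)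
  have hc := hc.symm
  have hfew := fun J hJ hW => hm.of_few_good hp hsur hρl htop hc (J := J) hJ hW
  have hGr : goodLevels r S k a ⊆ range (k + a) := filter_subset _ _
  have hWr : insert (k + a - 1) (goodLevels r S k a) ⊆ range (k + a) :=
    insert_subset (by simp; omega) hGr
  have hWc : (insert (k + a - 1) (goodLevels r S k a)).card ≤ ρ + 1 := by
    have := card_insert_le (k + a - 1) (goodLevels r S k a); omega
  have hint := hm.sum_ge_neg hρ2 hc
  have hgood : (b : ℤ) ≤ ∑ j ∈ goodLevels r S k a, sx r S k j := hm.sum_goodLevels hGr Subset.rfl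
  have hρpos : 1 ≤ ρ := by
    rcases Nat.eq_zero_or_pos ρ with rfl | h
    · omega
    · exact h
  -- the level sizes are forced once the good levels contribute exactly `b`
  have hzero : ∑ j ∈ goodLevels r S k a, sx r S k j ≤ b →
      ∀ j < k + a, j ∉ goodLevels r S k a → sx r S k j = 0 := by
    intro hle j hj hjG
    have h1 : sx r S k j ≤ 0 := by
      by_contra hcon
      exact hjG (mem_goodLevels.2 ⟨hj, by omega⟩)
    have h2 := hm.sum_goodLevels (K := insert j (goodLevels r S k a))
      (insert_subset (mem_range.2 hj) hGr) (subset_insert _ _)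
    rw [sum_insert hjG] at h2
    omega
  have hupper : ∑ j ∈ goodLevels r S k a, sx r S k j ≤ ρ * a := by
    have : ∑ j ∈ goodLevels r S k a, sx r S k j ≤ ∑ j ∈ goodLevels r S k a, (a : ℤ) :=
      sum_le_sum fun j _ => sx_le hm.scarce j
    rw [sum_const, nsmul_eq_mul, hc] at this
    exact this
  have htie : b = ρ * a → (a = 1 ∨ ρ = 1) → Tie r S k a b := by
    intro hba hor
    have hz := hzero (by rw [hba]; exact_mod_cast hupper)
    refine ⟨fun j hj => ?_, hz _ (by omega) htop, ?_⟩
    · by_cases hjG : j ∈ goodLevels r S k a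
      · have := (mem_goodLevels.1 hjG).2; omega
      · rw [hz j hj hjG]
    · rcases hor with h | h
      · exact Or.inl h
      · right
        subst h
        obtain ⟨m, hmG⟩ := card_eq_one.1 hc
        have hmmem : m ∈ goodLevels r S k a := by rw [hmG]; simp
        refine ⟨by omega, m, ?_, ?_, fun j hj hjm => hz j hj (by rw [hmG]; simpa using hjm)⟩
        · have h1 := (mem_goodLevels.1 hmmem).1
          have h2 : m ≠ k + a - 1 := by rintro rfl; exact htop hmmem
          omega
        · rw [hmG, sum_singleton] at hgood
          have := sx_le hm.scarce (S := S) (k := k) m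
          rw [one_mul] at hba
          omega
  have h1 := hp.l2_mul_g_le
  have h2 := hp.l2_le
  have h3 := hp.hg2
  have hga : a * g ≤ g ^ 2 := by rw [pow_two]; exact Nat.mul_le_mul_right _ hag
  have hgg : g ≤ g ^ 2 := Nat.le_self_pow two_ne_zero _
  have haa : a * a ≤ g ^ 2 := by rw [pow_two]; exact Nat.mul_le_mul hag hag
  rcases Nat.lt_or_eq_of_le hρpos with hρ2' | rfl
  · rcases Nat.lt_or_eq_of_le ha with ha2 | ha1
    swap
    · refine Or.inr (htie ?_ (Or.inl ha1.symm))
      rw [← ha1] at hρ1 hρ2 ⊢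
      omega
    · left
      -- the second good level
      set G := goodLevels r S k a with hG
      have hGne : G.Nonempty := card_pos.1 (by omega)
      set m₁ := G.min' hGne with hm₁
      have hGne' : (G.erase m₁).Nonempty := by
        rw [← card_pos, card_erase_of_mem (min'_mem _ _)]; omega
      set m₂ := (G.erase m₁).min' hGne' with hm₂
      have hm₂mem : m₂ ∈ G.erase m₁ := min'_mem _ _
      have hm₂G : m₂ ∈ G := mem_of_mem_erase hm₂mem
      have hone : (G.filter (· < m₂)).card = 1 := by
        rw [card_eq_one]
        refine ⟨m₁, ?_⟩
        ext j
        rw [mem_filter, mem_singleton]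
        constructor
        · rintro ⟨hj, hlt⟩
          by_contra hne
          have := min'_le (G.erase m₁) j (mem_erase.2 ⟨hne, hj⟩)
          omega
        · rintro rfl
          have h4 : m₁ ≤ m₂ := min'_le _ _ hm₂G
          have h5 := ne_of_mem_erase hm₂mem
          exact ⟨min'_mem _ _, by omega⟩
      have hm₂1 := (mem_goodLevels.1 hm₂G).2
      rcases lt_or_ge (sx r S k m₂) 2 with hlt | hge
      · -- all the surplus sits in the other good levels
        have hbound : b ≤ (ρ - 1) * a + 1 := by
          have h4 := add_sum_erase G (sx r S k) hm₂G
          have h5 : ∑ j ∈ G.erase m₂, sx r S k j ≤ ∑ j ∈ G.erase m₂, (a : ℤ) :=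
            sum_le_sum fun j _ => sx_le hm.scarce j
          rw [sum_const, nsmul_eq_mul, card_erase_of_mem hm₂G, hc] at h5
          zify
          linarith
        set R := 100 * l ^ 2 with hR
        have hRg : ρ * (a + g) ≤ 2 * (R * g) := by
          calc ρ * (a + g) ≤ R * (2 * g) := Nat.mul_le_mul (by omega) (by omega)
            _ = _ := by ring
        have hRR : (ρ + 1) * (2 * (R * g)) ≤ 2 * (R ^ 2 * g) := by
          calc (ρ + 1) * (2 * (R * g)) ≤ R * (2 * (R * g)) :=
                Nat.mul_le_mul_right _ (by omega)
            _ = _ := by ring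
        have hA0 : 4 * (R ^ 2 * g) ≤ 2 * (ρ + 1) * k := by nlinarith
        refine hm.target_lt_of_forall hp hWr (A := 2 * (ρ + 1) * k - 4 * (R ^ 2 * g))
          (fun J hJ hW => ?_) ?_
        · rcases hfew J hJ hW with h | h
          · have : 2 * (ρ + 1) * k ≤ (2 * ρ + 3) * k := Nat.mul_le_mul_right _ (by omega)
            omega
          · zify [hA0] at hRg hRR ⊢
            set p : ℤ := (ρ : ℤ) * (a + g)
            have h4 : (0 : ℤ) ≤ (ρ + 1) * b := by positivity
            have h5 : ((ρ : ℤ) + 1) * p ≤ (ρ + 1) * (2 * (R * g)) :=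
              mul_le_mul_of_nonneg_left hRg (by positivity)
            linarith
        · exact hp.few_good_ineq ha2 hρl hρ2' hbound hWc
      · refine hm.target_lt_of_forall' hp hρ1 hρl hWr (by omega) fun J hJ hW => ?_
        refine hm.of_second_level hp hint hJ ((subset_insert _ _).trans hW)
          (fun j hj => (mem_goodLevels.1 hj).2) hρl hc ?_ hm₂G hge hone
        rw [enum_top hJ (hW (mem_insert_self _ _))]
        exact htop
  · rcases Nat.lt_or_ge b a with hba | hba
    swap
    · exact Or.inr (htie (by omega) (Or.inr rfl))
    left
    have hA0 : 4 * (a + g) ≤ 4 * k := by omega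
    refine hm.target_lt_of_forall hp hWr (A := 4 * k - 4 * (a + g)) (fun J hJ hW => ?_) ?_
    · rcases hfew J hJ hW with h | h
      · omega
      · push_cast at h
        zify [hA0]
        linarith
    · exact hp.one_good_ineq hba hWc

end

section
variable {r : α → α → Prop} {S : Finset α} {k a b l g : ℕ}

/-! ### Level sizes that do not suffice, with a large top level -/

theorem enum_pred_top {J : Finset ℕ} (hk : 1 ≤ k) (hJ : J ∈ levelSets k a) (h : k + a - 1 ∈ J)
    (h' : k + a - 2 ∈ J) (ha : 2 ≤ k + a) : enum J (k - 1) = k + a - 2 := by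
  have hJc := (mem_levelSets.1 hJ).2
  have h1 := enum_top hJ h
  obtain ⟨i, hi, he⟩ := exists_enum h'
  have h2 := enum_lt (J := J) (show k - 1 < k by omega) (by omega)
  rcases lt_trichotomy i (k - 1) with h3 | rfl | h3
  · have := enum_lt h3 (show k - 1 < J.card by omega); omega
  · exact he
  · have : i = k := by omega
    subst this; omega

/-- Counting the chains through the second highest chosen level by their upper ends as well. -/
theorem two_mul_le_numPaths (hs : Scarce r S k a g) {Λ : ℕ → Finset α} {l : ℕ}
    (hc : Consec r S (Λ l) (Λ (l + 1))) (hcard : k + 1 ≤ (Λ (l + 1)).card) {θ : ℕ} {B : Finset α}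
    (hB : B ⊆ Λ l) (hf : ∀ v ∈ Λ l \ B, θ ≤ pathCount r Λ l v) :
    2 * (θ : ℤ) * ((Λ l).card - B.card - g) ≤ numPaths r Λ (l + 1) := by
  set D := (Λ l).filter fun u => (below (flip r) (Λ (l + 1)) u).card ≤ 1 with hD
  have hDg : D.card < g := by
    refine card_lt_of_card_below_le_one (r := flip r) (W := ∅) (B := ∅) (k := k) hc.subY
      (antiOn_flip.2 hc.antiY) hc.subX (antiOn_flip.2 hc.antiX) hc.disj.symm
      (fun x hx y hy h => hc.not_lt y hy x hx h) hs.le (by rw [antis_flip]; exact hs.few)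
      (by simp) (by simp) (by rw [sdiff_empty]; exact filter_subset _ _) ?_ (by simpa using hcard)
    intro y hy
    simpa using (mem_filter.1 hy).2
  have h1 : numPaths r Λ (l + 1) =
      ∑ u ∈ Λ l, pathCount r Λ l u * (below (flip r) (Λ (l + 1)) u).card := by
    simp only [numPaths, pathCount, push, below, sum_filter]
    rw [sum_comm]
    refine sum_congr rfl fun u _ => ?_
    rw [← sum_filter, sum_const, smul_eq_mul, mul_comm]
    rfl
  have h2 : ∑ u ∈ (Λ l \ B) \ D, θ * 2 ≤ numPaths r Λ (l + 1) := by
    rw [h1]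
    refine le_trans (sum_le_sum fun u hu => ?_)
      (sum_le_sum_of_subset ((sdiff_subset (t := D)).trans (sdiff_subset (t := B))))
    obtain ⟨huB, huD⟩ := mem_sdiff.1 hu
    refine Nat.mul_le_mul (hf u huB) ?_
    by_contra hcon
    exact huD (mem_filter.2 ⟨(mem_sdiff.1 huB).1, by omega⟩)
  rw [sum_const, smul_eq_mul] at h2
  have h3 := le_card_sdiff D (Λ l \ B)
  rw [card_sdiff_of_subset hB] at h3
  have h4 := card_le_card hB
  have h5 : ((Λ l).card : ℤ) - B.card - g ≤ (((Λ l \ B) \ D).card : ℤ) := by omega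
  zify at h2
  have h6 := mul_le_mul_of_nonneg_left h5 (show (0 : ℤ) ≤ 2 * θ by positivity)
  linarith

theorem Robust.caseB_value (hm : Robust r S k a b g) (hp : Params k a b l g)
    (hsur : ∀ j₀, ∑ j ∈ Ico j₀ (k + a), sx r S k j < 16 * l * (a + g))
    (htop : 1 ≤ sx r S k (k + a - 1)) {J G : Finset ℕ} (hJ : J ∈ levelSets k a)
    (h1 : k + a - 1 ∈ J) (h2 : k + a - 2 ∈ J) (hG : G ⊆ J) (hGs : ∀ j ∈ G, 1 ≤ sx r S k j)
    (hGlt : ∀ j ∈ G, j < k + a - 2) (hGc : G.card ≤ 100 * l ^ 2) :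
    ∃ t < g, ∀ θ : ℕ, (θ ≤ 2 ^ t ∨ θ ≤ 1 + G.card ∨ 1 ≤ t ∧ θ ≤ 2 + G.card) →
      2 * (θ : ℤ) * (k + ∑ j ∈ J.erase (k + a - 1), sx r S k j - (t + G.card) * (a + g) - g) ≤
        numPaths r (sel r S J) k := by
  have ha := hp.one_le_a
  have hk : 1 ≤ k := by have := hp.g_le; have := hp.g_pos; omega
  obtain ⟨hJs, hJc⟩ := mem_levelSets.1 hJ
  have he1 := enum_top hJ h1
  have he2 := enum_pred_top hk hJ h1 h2 (by omega)
  have hcnt : cnt (idx J G k) 0 (k - 1) = G.card := by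
    rw [cnt_idx_lt hJc hG (by omega), he2, filter_true_of_mem hGlt]
  have hcnt' : cnt (idx J G k) 0 k = G.card :=
    cnt_idx hJc hG (by rw [he1]; intro h; have := hGlt _ h; omega)
  obtain ⟨t, htg, B, hB, hBc, hf⟩ := hm.states hp hJ hGs (c := 0) le_rfl (by positivity) (by omega)
    (fun i _ hi => hm.sum_prefix_ge hp hJ hsur hi) (state_zero hm.scarce.strict hJ) (k - 1)
    (Nat.zero_le _) (by omega)
  rw [hcnt] at hBc hf
  refine ⟨t, htg, fun θ hθ => ?_⟩
  have ht := tower_sel (S := S) hm.scarce.strict hJc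
  obtain ⟨l', rfl⟩ : ∃ l', k = l' + 1 := ⟨k - 1, by omega⟩
  rw [Nat.add_sub_cancel] at *
  have h3 := two_mul_le_numPaths hm.scarce (ht.consec l' (by omega)) (by
    unfold sx at htop; unfold sel; rw [he1]; omega) hB (θ := θ) (fun v hv => by
      obtain ⟨e1, e2, e3⟩ := hf v hv
      rcases hθ with h | h | ⟨h, h'⟩
      · exact h.trans e1
      · exact h.trans e2
      · have := e3 h; omega)
  refine le_trans (mul_le_mul_of_nonneg_left ?_ (by positivity)) h3
  have h4 : ∑ i ∈ Ico 0 (l' + 1 + 1), exc (l' + 1) (sel r S J) i = ∑ j ∈ J, sx r S (l' + 1) j :=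
    sum_enum_all (sx r S (l' + 1)) hJc
  rw [sum_Ico_succ_top (Nat.zero_le _), sum_Ico_succ_top (Nat.zero_le _),
    ← add_sum_erase J _ h1] at h4
  have h5 : exc (l' + 1) (sel r S J) (l' + 1) = sx r S (l' + 1) (l' + 1 + a - 1) := by
    rw [← he1]; rfl
  have h6 : exc (l' + 1) (sel r S J) l' = (sel r S J l').card - ((l' + 1 : ℕ) : ℤ) := rfl
  push_cast at *
  linarith

theorem Params.three_good_ineq (hp : Params k a b l g) (hba : b < 3 * a) {w : ℕ} (hw : w ≤ 3) :
    2 * (k + a) * (a * k + b * (k + 1)) + a * (8 * k - 8 * (a + 2 * g)) * (w * (a - 1)) <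
      a * (8 * k - 8 * (a + 2 * g)) * (k + a) := by
  have hag := hp.a_le
  have ha := hp.one_le_a
  have hgk := hp.g_le
  have h3 := hp.hg2
  have hga : a * g ≤ g ^ 2 := by rw [pow_two]; exact Nat.mul_le_mul_right _ hag
  have haa : a * a ≤ g ^ 2 := by rw [pow_two]; exact Nat.mul_le_mul hag hag
  have hgpos := hp.g_pos
  have hA0 : 8 * (a + 2 * g) ≤ 8 * k := by omega
  obtain ⟨A, hA⟩ : ∃ A, A + 8 * (a + 2 * g) = 8 * k := ⟨_, Nat.sub_add_cancel hA0⟩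
  have hA' : 8 * k - 8 * (a + 2 * g) = A := by omega
  rw [hA']
  have h4 : b * (k + 1) + (k + 1) ≤ 3 * a * (k + 1) := by
    calc b * (k + 1) + (k + 1) = (b + 1) * (k + 1) := by ring
      _ ≤ _ := Nat.mul_le_mul_right _ hba
  have h5 : w * (a - 1) ≤ 3 * a := Nat.mul_le_mul hw (by omega)
  have h6 : a * A * (w * (a - 1)) ≤ a * (8 * k) * (3 * a) :=
    Nat.mul_le_mul (Nat.mul_le_mul_left _ (by omega)) h5
  have h8 : 2 * (a * k + b * (k + 1)) + 24 * (a * a) < a * A := by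
    have e1 : a * A + 8 * (a * a) + 16 * (a * g) = a * (8 * k) := by
      rw [← hA]; ring
    have e3 : 3 * a * (k + 1) = 3 * (a * k) + 3 * a := by ring
    have e4 : a * (8 * k) = 8 * (a * k) := by ring
    omega
  calc _ ≤ 2 * (k + a) * (a * k + b * (k + 1)) + a * (8 * k) * (3 * a) := Nat.add_le_add_left h6 _
    _ ≤ (2 * (a * k + b * (k + 1)) + 24 * (a * a)) * (k + a) := by
        have e1 : a * (8 * k) * (3 * a) + 24 * (a * a) * a = 24 * (a * a) * (k + a) := by ring
        linarith [Nat.zero_le (24 * (a * a) * a)]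
    _ < _ := Nat.mul_lt_mul_of_pos_right h8 (by omega)

/-- The value of the bound when the second highest level is used as well. -/
theorem Params.caseB_ineq (hp : Params k a b l g) {ρ t m N : ℕ} {X : ℤ}
    (hρl : ρ + 10 ≤ 100 * l ^ 2) (htg : t < g) (hm : m ≤ ρ + 1)
    (hX : -((a * a + a : ℕ) : ℤ) ≤ X)
    (h : ∀ θ : ℕ, (θ ≤ 2 ^ t ∨ θ ≤ 1 + m ∨ 1 ≤ t ∧ θ ≤ 2 + m) →
      2 * (θ : ℤ) * (k + X - (t + m) * (a + g) - g) ≤ N)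
    (hm2 : ρ ≤ 2 * m ∨ 1 ≤ t ∧ ρ ≤ 2 * m + 2) : (2 * ρ + 3) * k ≤ 2 * N := by
  have hag := hp.a_le
  have h3 := hp.l2_mul_g_le
  have h4 := hp.hg2
  have h4' := hp.l2_mul_a2_le
  have h5 : a * a ≤ g ^ 2 := by rw [pow_two]; exact Nat.mul_le_mul hag hag
  have hgg : g ≤ g ^ 2 := Nat.le_self_pow two_ne_zero _
  set R := 100 * l ^ 2 with hR
  have h6 : R * g ≤ R ^ 2 * g := Nat.mul_le_mul_right _ (Nat.le_self_pow two_ne_zero _)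
  have h12 : (0 : ℤ) ≤ ρ := by positivity
  by_cases ht : 2 * (ρ + 2) ≤ 2 ^ t
  · have h1 := h (2 * (ρ + 2)) (Or.inl ht)
    have h2 : (t + m) * (a + g) ≤ (g + R) * (2 * g) := Nat.mul_le_mul (by omega) (by omega)
    have h7 : (g + R) * (2 * g) = 2 * g ^ 2 + 2 * (R * g) := by ring
    rw [h7] at h2
    have h9 : 8 * (2 * g ^ 2 + 2 * (R * g) + 3 * g ^ 2) ≤ k := by omega
    zify at h2 h5 h9 hgg hag ⊢
    push_cast at h1 hX
    have h10 : (7 * k : ℤ) ≤ 8 * (k + X - (t + m) * (a + g) - g) := by linarith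
    have h11 : (0 : ℤ) ≤ k := by positivity
    have h13 := mul_le_mul_of_nonneg_left h10 (show (0 : ℤ) ≤ ρ + 2 by positivity)
    have h14 : 0 ≤ (ρ : ℤ) * k := by positivity
    linarith
  · have ht' : t < 2 ^ t := Nat.lt_two_pow_self
    have h2 : (t + m) * (a + g) ≤ (3 * R) * (2 * g) := Nat.mul_le_mul (by omega) (by omega)
    have key : ∃ θ : ℕ, ρ + 2 ≤ 2 * θ ∧ θ ≤ R ∧ (θ ≤ 2 ^ t ∨ θ ≤ 1 + m ∨ 1 ≤ t ∧ θ ≤ 2 + m) := by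
      rcases hm2 with h | ⟨h, h'⟩
      · exact ⟨1 + m, by omega, by omega, Or.inr (Or.inl le_rfl)⟩
      · exact ⟨2 + m, by omega, by omega, Or.inr (Or.inr ⟨h, le_rfl⟩)⟩
    obtain ⟨θ, hθ1, hθ2, hθ3⟩ := key
    have h1 := h θ hθ3
    have hgR : g ≤ R * g := Nat.le_mul_of_pos_left _ (by omega)
    have h9 : 4 * (R * (8 * (R * g) + a * a)) ≤ k := by
      have : R * (8 * (R * g) + a * a) = 8 * (R ^ 2 * g) + R * (a * a) := by ring
      omega
    zify at h2 h9 hθ1 hθ2 hgR hag ⊢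
    push_cast at h1 hX
    set Y : ℤ := 8 * (R * g) + a * a with hY
    have hY0 : 0 ≤ Y := by positivity
    have h10 : (k - Y : ℤ) ≤ k + X - (t + m) * (a + g) - g := by linarith
    have h13 : (θ : ℤ) * Y ≤ R * Y := mul_le_mul_of_nonneg_right hθ2 hY0
    have h14 := mul_le_mul_of_nonneg_left h10 (show (0 : ℤ) ≤ 2 * θ by positivity)
    have h15 := mul_le_mul_of_nonneg_right hθ1 (show (0 : ℤ) ≤ k by positivity)
    linarith

/-- The level sizes for which the count of chains does not exceed the target although the lowest
and the highest level are good. -/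
structure TieB (r : α → α → Prop) (S : Finset α) (k a : ℕ) : Prop where
  top : sx r S k (k + a - 1) = a
  pred : sx r S k (k + a - 2) = a
  zero : sx r S k 0 = a
  other : ∀ j < k + a, j ≠ 0 → j ≠ k + a - 1 → j ≠ k + a - 2 → sx r S k j = 0

/-- The count of chains when the lowest and the highest level are good. The elements of the second
highest level have two upper neighbours each, up to few exceptions, so that the bound there counts
twice; this makes up for the levels at which it cannot grow any more. -/
theorem Robust.target_lt_or_tieB (hm : Robust r S k a b g) (hp : Params k a b l g)
    (htop : 1 ≤ sx r S k (k + a - 1)) (hbot : 1 ≤ sx r S k 0) :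
    target k a b < (chains r (k + 1) S).card ∨ TieB r S k a := by
  have ha := hp.one_le_a
  have hb := hp.one_le_b
  have hag := hp.a_le
  have hgk := hp.g_le
  have hgpos := hp.g_pos
  by_cases hsur : ∀ j₀, ∑ j ∈ Ico j₀ (k + a), sx r S k j < 16 * l * (a + g)
  swap
  · push Not at hsur
    obtain ⟨j₀, hj₀⟩ := hsur
    exact Or.inl (hm.target_lt_of_surplus hp hj₀)
  have hbl : b < 16 * l * (a + g) := by
    have := hsur 0
    rw [← range_eq_Ico, hm.sum_sx] at this
    exact_mod_cast this
  obtain ⟨ρ, hρ1, hρ2⟩ : ∃ ρ, b ≤ ρ * a ∧ ρ * a < b + a := by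
    refine ⟨(b + a - 1) / a, ?_, ?_⟩
    · have h1 := Nat.div_add_mod (b + a - 1) a
      have h2 := Nat.mod_lt (b + a - 1) ha
      rw [mul_comm a] at h1
      omega
    · have := Nat.div_mul_le_self (b + a - 1) a
      omega
  have hρl := hp.rho_le hbl hρ2
  have hcard : ρ ≤ (goodLevels r S k a).card := by
    have h1 := hm.b_le_card
    have h2 : ρ * a < ((goodLevels r S k a).card + 1) * a := by
      rw [add_mul]; omega
    have := lt_of_mul_lt_mul_right h2 (Nat.zero_le _)
    omega
  -- `G₂` consists of the good levels at which the bound grows before it is doubled at the top.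
  set G₂ := (goodLevels r S k a).filter (· < k + a - 2) with hG₂
  have hG₂sub : G₂ ⊆ goodLevels r S k a := filter_subset _ _
  have hsplit : goodLevels r S k a ⊆ insert (k + a - 1) (insert (k + a - 2) G₂) := by
    intro j hj
    have h1 := (mem_goodLevels.1 hj).1
    simp only [mem_insert, hG₂, mem_filter]
    by_cases h2 : j < k + a - 2
    · exact Or.inr (Or.inr ⟨hj, h2⟩)
    · omega
  have hcard2 : (goodLevels r S k a).card ≤ G₂.card + 2 := by
    have h1 := card_le_card hsplit
    have h2 := card_insert_le (k + a - 1) (insert (k + a - 2) G₂)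
    have h3 := card_insert_le (k + a - 2) G₂
    omega
  have h0G₂ : 0 ∈ G₂ := mem_filter.2 ⟨mem_goodLevels.2 ⟨by omega, hbot⟩, by omega⟩
  have hG₂pos : 1 ≤ G₂.card := card_pos.2 ⟨0, h0G₂⟩
  have hWr : ∀ G ⊆ G₂, insert (k + a - 1) (insert (k + a - 2) G) ⊆ range (k + a) := by
    intro G hG
    refine insert_subset (by simp; omega) (insert_subset (by simp; omega) ?_)
    exact (hG.trans hG₂sub).trans (filter_subset _ _)
  have hval := fun J hJ (G : Finset ℕ) (hG : G ⊆ G₂)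
      (hW : insert (k + a - 1) (insert (k + a - 2) G) ⊆ J) hGc =>
    hm.caseB_value hp hsur htop (J := J) (G := G) hJ (hW (mem_insert_self _ _))
      (hW (mem_insert_of_mem (mem_insert_self _ _)))
      ((subset_insert _ _).trans ((subset_insert _ _).trans hW))
      (fun j hj => (mem_goodLevels.1 (hG₂sub (hG hj))).2)
      (fun j hj => (mem_filter.1 (hG hj)).2) hGc
  have hXJ : ∀ J ∈ levelSets k a, k + a - 1 ∈ J →
      -((a * a + a : ℕ) : ℤ) ≤ ∑ j ∈ J.erase (k + a - 1), sx r S k j := by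
    intro J hJ hJt
    have h1 := hm.sum_levelSet_ge ha hJ
    have h2 : ∑ i ∈ Ico 0 (k + 1), exc k (sel r S J) i = ∑ j ∈ J, sx r S k j :=
      sum_enum_all (sx r S k) (mem_levelSets.1 hJ).2
    rw [h2, ← add_sum_erase J _ hJt] at h1
    have h3 := sx_le hm.scarce (S := S) (k := k) (k + a - 1)
    push_cast at h1 ⊢
    linarith
  -- Doubling at the top is enough if half of the `ρ` good levels lie below the two highest ones.
  by_cases hhalf : ρ ≤ 2 * G₂.card
  · left
    obtain ⟨G, hG, hGc⟩ := exists_subset_card_eq (show min G₂.card ρ ≤ G₂.card from min_le_left _ _)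
    refine hm.target_lt_of_forall' hp hρ1 hρl (hWr G hG) ?_ fun J hJ hW => ?_
    · have h2 := card_insert_le (k + a - 1) (insert (k + a - 2) G)
      have h3 := card_insert_le (k + a - 2) G
      omega
    · obtain ⟨t, htg, h⟩ := hval J hJ G hG hW (by omega)
      exact hp.caseB_ineq hρl htg (by omega) (hXJ J hJ (hW (mem_insert_self _ _))) h
        (Or.inl (by omega))
  · -- only the lowest and the two highest levels are good, and `ρ = 3`
    have hG₂1 : G₂.card = 1 := by omega
    have hρ3 : ρ = 3 := by omega
    subst hρ3
    have hG₂0 : G₂ = {0} := by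
      obtain ⟨x, hx⟩ := card_eq_one.1 hG₂1
      rw [hx] at h0G₂ ⊢
      rw [mem_singleton.1 h0G₂]
    rw [hG₂0] at hsplit
    have hvals : ∀ J ∈ levelSets k a, insert (k + a - 1) (insert (k + a - 2) G₂) ⊆ J →
        8 * k - 8 * (a + 2 * g) ≤ 2 * numPaths r (sel r S J) k := by
      intro J hJ hW
      obtain ⟨t, htg, h⟩ := hval J hJ G₂ Subset.rfl hW (by omega)
      rcases Nat.eq_zero_or_pos t with rfl | ht
      · have h1 := h 2 (Or.inr (Or.inl (by omega)))
        have h2 : (b : ℤ) ≤ ∑ j ∈ J, sx r S k j :=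
          hm.sum_goodLevels (mem_levelSets.1 hJ).1 (by rw [hG₂0] at hW; exact hsplit.trans hW)
        rw [← add_sum_erase J _ (hW (mem_insert_self _ _))] at h2
        have h3 := sx_le hm.scarce (S := S) (k := k) (k + a - 1)
        rw [hG₂1] at h1
        push_cast at h1
        have h4 : (2 * a : ℤ) < b := by zify at hρ2; linarith
        have hle : 8 * (a + 2 * g) ≤ 8 * k := by omega
        zify [hle]
        have h5 : (0 : ℤ) ≤ a := by positivity
        linarith
      · have h1 := hp.caseB_ineq hρl htg (by omega) (hXJ J hJ (hW (mem_insert_self _ _))) h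
          (Or.inr ⟨ht, by omega⟩)
        omega
    rcases Nat.lt_or_ge b (3 * a) with hb3 | hb3
    · left
      refine hm.target_lt_of_forall hp (hWr G₂ Subset.rfl) hvals (hp.three_good_ineq hb3 ?_)
      have h2 := card_insert_le (k + a - 1) (insert (k + a - 2) G₂)
      have h3 := card_insert_le (k + a - 2) G₂
      omega
    · right
      have hb3' : b = 3 * a := by omega
      have h1 := hm.sum_goodLevels (K := insert (k + a - 1) (insert (k + a - 2) {0}))
        (by have := hWr G₂ Subset.rfl; rwa [hG₂0] at this) hsplit
      rw [sum_insert (by simp; omega), sum_insert (by simp; omega), sum_singleton, hb3'] at h1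
      have e1 := sx_le hm.scarce (S := S) (k := k) (k + a - 1)
      have e2 := sx_le hm.scarce (S := S) (k := k) (k + a - 2)
      have e3 := sx_le hm.scarce (S := S) (k := k) 0
      push_cast at h1
      refine ⟨by omega, by omega, by omega, fun j hj hj0 hj1 hj2 => ?_⟩
      have h2 : sx r S k j ≤ 0 := by
        by_contra hcon
        have := hsplit (mem_goodLevels.2 ⟨hj, by omega⟩)
        simp only [mem_insert, mem_singleton] at this
        omega
      have h3 := hm.sum_goodLevels (K := insert j (insert (k + a - 1) (insert (k + a - 2) {0})))
        (insert_subset (mem_range.2 hj) (by have := hWr G₂ Subset.rfl; rwa [hG₂0] at this))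
        (hsplit.trans (subset_insert _ _))
      rw [sum_insert (by simp; omega), sum_insert (by simp; omega), sum_insert (by simp; omega),
        sum_singleton, hb3'] at h3
      push_cast at h3
      omega

/-- A chain below `v`, the element `v`, and a chain above `v` form a chain. -/
theorem lev_add_lev_flip_lt (hr : StrictRel r) {h : ℕ} (hh : HeightLE r S h) {v : α} (hv : v ∈ S) :
    lev r S v + lev (flip r) S v < h := by
  obtain ⟨T, hT, hc, hb, hcard⟩ := exists_chain_lev r S v
  obtain ⟨U, hU, hc', hb', hcard'⟩ := exists_chain_lev (flip r) S v
  have hvT : v ∉ T := fun h => hr.irrefl _ (hb v h)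
  have hch : ChainOn r (insert v T ∪ U) := by
    have h1 := hc.insert_top hb
    have h2 := chainOn_flip.1 hc'
    have h3 : ∀ x ∈ insert v T, ∀ y ∈ U, r x y := by
      intro x hx y hy
      rcases mem_insert.1 hx with rfl | hx
      · exact hb' y hy
      · exact hr.trans (hb x hx) (hb' y hy)
    intro x hx y hy hne
    rcases mem_union.1 hx with hx | hx <;> rcases mem_union.1 hy with hy | hy
    · exact h1 x hx y hy hne
    · exact Or.inl (h3 x hx y hy)
    · exact Or.inr (h3 y hy x hx)
    · exact h2 x hx y hy hne
  have hdisj : Disjoint (insert v T) U := by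
    rw [disjoint_left]
    intro x hx hxU
    have h1 : r v x := hb' x hxU
    rcases mem_insert.1 hx with rfl | hx
    · exact hr.irrefl _ h1
    · exact hr.asymm h1 (hb x hx)
  have := hh _ (union_subset (insert_subset hv hT) hU) hch
  rw [card_union_of_disjoint hdisj, card_insert_of_notMem hvT] at this
  omega

theorem heightLE_flip {h : ℕ} : HeightLE (flip r) S h ↔ HeightLE r S h := by
  simp only [HeightLE, chainOn_flip]

theorem widthLE_flip {h : ℕ} : WidthLE (flip r) S h ↔ WidthLE r S h := by
  simp only [WidthLE, antiOn_flip]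

theorem Robust.reverse (hm : Robust r S k a b g) : Robust (flip r) S k a b g where
  scarce := ⟨hm.scarce.strict.flip, widthLE_flip.2 hm.scarce.width,
    by rw [antis_flip]; exact hm.scarce.few, hm.scarce.le⟩
  height := heightLE_flip.2 hm.height
  robust := fun V hV hc h => hm.robust V hV hc (heightLE_flip.1 h)
  few := by rw [chains_flip]; exact hm.few
  card := hm.card

/-- A set of robust height `k + a` has many chains with `k + 1` elements, unless the level sizes
in one of the two directions are exceptional. -/
theorem Robust.main (hm : Robust r S k a b g) (hp : Params k a b l g) :
    target k a b < (chains r (k + 1) S).card ∨ Tie r S k a b ∨ Tie (flip r) S k a b := by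
  have ha := hp.one_le_a
  have hgk := hp.g_le
  have hgpos := hp.g_pos
  have hr := hm.scarce.strict
  by_cases h1 : sx r S k (k + a - 1) ≤ 0
  · exact (hm.target_lt_or_tie hp h1).imp_right Or.inl
  by_cases h2 : sx (flip r) S k (k + a - 1) ≤ 0
  · rw [← chains_flip (r := r)]
    exact (hm.reverse.target_lt_or_tie hp h2).imp_right Or.inr
  have hsub : ∀ (r' : α → α → Prop), Robust r' S k a b g →
      level r' S (k + a - 1) ⊆ level (flip r') S 0 := by
    intro r' hm' v hv
    rw [mem_level] at hv ⊢
    have := lev_add_lev_flip_lt hm'.scarce.strict hm'.height hv.1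
    exact ⟨hv.1, by omega⟩
  have h3 : 1 ≤ sx r S k 0 := by
    have := card_le_card (hsub _ hm.reverse)
    unfold sx at h2 ⊢
    change _ ≤ (level r S 0).card at this
    omega
  have h4 : 1 ≤ sx (flip r) S k 0 := by
    have := card_le_card (hsub _ hm)
    unfold sx at h1 ⊢
    omega
  -- Both directions cannot be exceptional: the two highest levels of the reversed order have
  -- `2 (k + a)` elements and are contained in the two lowest levels of `r`, which have `2 k + a`.
  rcases hm.target_lt_or_tieB hp (by omega) h3 with h | h
  · exact Or.inl h
  rcases hm.reverse.target_lt_or_tieB hp (by omega) h4 with h' | h'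
  · rw [chains_flip] at h'; exact Or.inl h'
  exfalso
  have hsub2 : level (flip r) S (k + a - 1) ∪ level (flip r) S (k + a - 2) ⊆
      level r S 0 ∪ level r S 1 := by
    intro v hv
    simp only [mem_union, mem_level] at hv ⊢
    have hvS : v ∈ S := by tauto
    have := lev_add_lev_flip_lt hr hm.height hvS
    have : lev r S v = 0 ∨ lev r S v = 1 := by omega
    tauto
  have h5 := card_le_card hsub2
  rw [card_union_of_disjoint (level_disjoint (by omega))] at h5
  have h6 := card_union_le (level r S 0) (level r S 1)
  have e1 := h.zero
  have e2 := h.other 1 (by omega) (by omega) (by omega) (by omega)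
  have e3 := h'.top
  have e4 := h'.pred
  unfold sx at e1 e2 e3 e4
  omega

end

section
variable {r : α → α → Prop} {S : Finset α} {k a b l g : ℕ}

/-! ### Disjoint chains through all the levels -/

theorem Tie.sx_eq (ht : Tie r S k a b) (hs : Scarce r S k a g) {j : ℕ} (hj : j < k + a) :
    sx r S k j = 0 ∨ sx r S k j = a := by
  have h1 := ht.nonneg j hj
  have h2 := sx_le hs (S := S) (k := k) j
  rcases ht.shape with rfl | ⟨-, m, -, hm, h⟩
  · push_cast at *; omega
  · by_cases hjm : j = m
    · subst hjm; exact Or.inr hm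
    · exact Or.inl (h j hj hjm)

theorem Tie.card_goodLevels_mul (ht : Tie r S k a b) (hm : Robust r S k a b g) (ha : 1 ≤ a) :
    (goodLevels r S k a).card * a = b := by
  have h1 := hm.sum_eq (K := goodLevels r S k a) (filter_subset _ _)
  have h2 : ∑ j ∈ range (k + a) \ goodLevels r S k a, sx r S k j = 0 := by
    refine sum_eq_zero fun j hj => ?_
    rw [mem_sdiff, mem_range] at hj
    rcases ht.sx_eq hm.scarce hj.1 with h | h
    · exact h
    · exact absurd (mem_goodLevels.2 ⟨hj.1, by rw [h]; exact_mod_cast ha⟩) hj.2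
  have h3 : ∑ j ∈ goodLevels r S k a, sx r S k j = ∑ j ∈ goodLevels r S k a, (a : ℤ) := by
    refine sum_congr rfl fun j hj => ?_
    obtain ⟨h4, h5⟩ := mem_goodLevels.1 hj
    rcases ht.sx_eq hm.scarce h4 with h | h
    · omega
    · exact h
  rw [h2, h3, sum_const, nsmul_eq_mul, sub_zero] at h1
  exact_mod_cast h1

theorem Tie.top_notMem (ht : Tie r S k a b) : k + a - 1 ∉ goodLevels r S k a := fun h => by
  have := (mem_goodLevels.1 h).2
  have := ht.top
  omega

theorem Tie.exc_nonneg (ht : Tie r S k a b) {J : Finset ℕ} (hJ : J ∈ levelSets k a) {i : ℕ}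
    (hi : i ≤ k) : 0 ≤ exc k (sel r S J) i :=
  ht.nonneg _ (mem_range.1 ((mem_levelSets.1 hJ).1
    (enum_mem (by rw [(mem_levelSets.1 hJ).2]; omega))))

/-- Unless there are enough chains, no doubling takes place at all. -/
theorem Tie.state (ht : Tie r S k a b) (hm : Robust r S k a b g) (hp : Params k a b l g) {ρ : ℕ}
    (hρ : (goodLevels r S k a).card = ρ) (hρl : ρ + 10 ≤ 100 * l ^ 2) {J : Finset ℕ}
    (hJ : J ∈ levelSets k a) (hGJ : goodLevels r S k a ⊆ J)
    (htop : enum J k ∉ goodLevels r S k a)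
    (hN : ¬ (2 * ρ + 3) * k ≤ 2 * numPaths r (sel r S J) k) {i : ℕ} (hi : i ≤ k) :
    State r k (sel r S J) 0 i 0 (1 + cnt (idx J (goodLevels r S k a) k) 0 i)
      (cnt (idx J (goodLevels r S k a) k) 0 i * (a + g)) := by
  have hag := hp.a_le
  have hJc := (mem_levelSets.1 hJ).2
  have hT := tower_sel (S := S) hm.scarce.strict hJc
  have hGs : ∀ j ∈ goodLevels r S k a, 1 ≤ sx r S k j := fun j hj => (mem_goodLevels.1 hj).2
  have hcntk := cnt_idx hJc hGJ htop
  set G := goodLevels r S k a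
  induction i with
  | zero => simpa [cnt_self] using state_zero hm.scarce.strict hJ
  | succ i ih =>
    obtain ⟨B, hB, hBc, hf⟩ := ih (by omega)
    have hsum := sum_Ico_succ_top (Nat.zero_le i) (exc k (sel r S J))
    have hexc : exc k (sel r S J) i = (sel r S J i).card - k := rfl
    have hcons := hT.consec i (by omega)
    set c := cnt (idx J G k) 0 i with hc
    by_cases hiG : i ∈ idx J G k
    · obtain ⟨B', hB', hc', hf'⟩ := hcons.add_one hm.scarce hB (fun x hx => (hf x hx).2.1)
          (fun x hx => hT.one_le_pathCount (by omega) hx) (idx_good hGs hiG)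
      rw [cnt_succ (Nat.zero_le _), if_pos hiG]
      refine ⟨B', hB', ?_, fun v hv => ?_⟩
      · rw [hsum]
        zify at hc'
        push_cast
        linarith
      · have h1 : 1 + c + 1 ≤ pathCount r (sel r S J) (i + 1) v := hf' v hv
        exact ⟨by rw [pow_zero]; omega, by omega, by omega⟩
    · have hcnt1 : cnt (idx J G k) 0 (i + 1) = c := by
        rw [cnt_succ (Nat.zero_le _), if_neg hiG, add_zero]
      rw [hcnt1]
      rcases hcons.keep_or_double hm.scarce hB (fun x hx => (hf x hx).2.1) with
        ⟨B', hB', hc', hf'⟩ | ⟨B', hB', hc', hf'⟩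
      · refine ⟨B', hB', ?_, fun v hv => ?_⟩
        · rw [hsum]
          zify at hc'
          linarith
        · have h1 : 1 + c ≤ pathCount r (sel r S J) (i + 1) v := hf' v hv
          exact ⟨by rw [pow_zero]; omega, by omega, by omega⟩
      -- After a doubling, the value at the top exceeds the number of good levels by two.
      · exfalso
        apply hN
        have hpos : ∀ i₀ i, i ≤ k + 1 → 0 ≤ ∑ j ∈ Ico i₀ i, exc k (sel r S J) j :=
          fun i₀ i hi => sum_nonneg fun j hj => ht.exc_nonneg hJ (by rw [mem_Ico] at hj; omega)
        have hcle : c + cnt (idx J G k) (i + 1) k = ρ := by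
          have := cnt_add (idx J G k) (Nat.zero_le (i + 1)) hi
          omega
        have hcb : (c + 1) * (a + g) ≤ 100 * l ^ 2 * (2 * g) :=
          Nat.mul_le_mul (by omega) (by omega)
        have hRg : 100 * l ^ 2 * g ≤ (100 * l ^ 2) ^ 2 * g :=
          Nat.mul_le_mul_right _ (Nat.le_self_pow two_ne_zero _)
        have hX0 := hpos 0 i (by omega)
        have h0 : State r k (sel r S J) (i + 1) (i + 1) 0 (2 + c)
            (((c + 1) * (a + g) : ℕ) : ℤ) := by
          refine ⟨B', hB', ?_, fun v hv => ?_⟩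
          · rw [Ico_self, sum_empty, add_zero]
            zify at hc'
            push_cast
            have := ht.exc_nonneg hJ (show i ≤ k by omega)
            linarith
          · have h1 : 2 * (1 + c) ≤ pathCount r (sel r S J) (i + 1) v := hf' v hv
            exact ⟨by rw [pow_zero]; omega, by omega, by omega⟩
        have hcn : cnt (idx J G k) (i + 1) k ≤ ρ := by omega
        obtain ⟨t, ht', hst⟩ := hm.states hp hJ hGs (by omega)
          (by
            have : (((c + 1) * (a + g) : ℕ) : ℤ) ≤ ((100 * l ^ 2 * (2 * g) : ℕ) : ℤ) := by
              exact_mod_cast hcb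
            push_cast at this ⊢
            nlinarith [sq_nonneg (g : ℤ), sq_nonneg (l : ℤ)]) (by omega)
          (fun i' _ hi' => by
            have := hpos (i + 1) i' (by omega)
            have : (0 : ℤ) ≤ (g : ℤ) ^ 2 := sq_nonneg _
            linarith) h0 k hi le_rfl
        refine hst.of_add_two hp hi hρl ht' (by omega) ?_ ?_ (Or.inl (by omega))
        · have := hpos (i + 1) (k + 1) le_rfl
          have : (0 : ℤ) ≤ ((a * a : ℕ) : ℤ) := by positivity
          linarith
        · have : (((c + 1) * (a + g) : ℕ) : ℤ) ≤ ((100 * l ^ 2 * (2 * g) : ℕ) : ℤ) := by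
            exact_mod_cast hcb
          push_cast at this ⊢
          have : (0 : ℤ) ≤ (l : ℤ) ^ 2 * g := by positivity
          linarith
end

section
variable {r : α → α → Prop} {S : Finset α} {k a b l g : ℕ}

theorem sum_le_sum_push {X Y : Finset α} {f : α → ℕ} (hc : Consec r S X Y) (hs : Scarce r S k a g)
    (hf1 : ∀ x ∈ X, 1 ≤ f x) {x y : Fin k → α} (hx : ∀ p, x p ∈ X) (hy : ∀ p, y p ∈ Y)
    (hinj : Function.Injective y) (hxy : ∀ p, r (x p) (y p)) :
    ∑ p, f (x p) ≤ ∑ p, push r X f (y p) ∧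
      (k + 1 ≤ X.card → ∑ p, f (x p) + k ≤ ∑ p, push r X f (y p) + g) := by
  have h1 : ∀ p, f (x p) ≤ push r X f (y p) := fun p =>
    single_le_sum (f := f) (fun _ _ => Nat.zero_le _) (mem_below.2 ⟨hx p, hxy p⟩)
  refine ⟨sum_le_sum fun p _ => h1 p, fun hX => ?_⟩
  set D := (univ : Finset (Fin k)).filter fun p => (below r X (y p)).card ≤ 1 with hD
  have h2 : D.card < g := by
    refine lt_of_le_of_lt ?_ (hc.card_below_le_one hs hX)
    refine card_le_card_of_injOn y (fun p hp => ?_) hinj.injOn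
    rw [mem_coe, mem_filter] at hp ⊢
    exact ⟨hy p, hp.2⟩
  have h3 : ∀ p, f (x p) + 1 ≤ push r X f (y p) + if p ∈ D then 1 else 0 := by
    intro p
    split_ifs with hp
    · have := h1 p; omega
    · have h4 : 1 < (below r X (y p)).card := by
        by_contra hcon
        exact hp (mem_filter.2 ⟨mem_univ _, by omega⟩)
      obtain ⟨x', hx', hne⟩ := exists_mem_ne h4 (x p)
      have h5 := le_push_of_subset (r := r) (f := f) (Z := {x p, x'})
        (insert_subset (mem_below.2 ⟨hx p, hxy p⟩) (singleton_subset_iff.2 hx'))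
      rw [sum_pair hne.symm] at h5
      have := hf1 x' (mem_below.1 hx').1
      omega
  have h4 := sum_le_sum fun p (_ : p ∈ univ) => h3 p
  rw [sum_add_distrib, sum_add_distrib, sum_ite_mem, univ_inter] at h4
  simp only [sum_const, card_univ, Fintype.card_fin, smul_eq_mul, mul_one] at h4
  omega

theorem Consec.not_rel_of_notMem_biUnion {ι : Type*} {X Y : Finset α} (hc : Consec r S X Y)
    {y : ι → α} (hy : ∀ p, y p ∈ Y) {U : Finset ι} :
    ∀ x ∈ X \ U.biUnion fun p => below r X (y p), ∀ y' ∈ U.image y, ¬ r x y' ∧ ¬ r y' x := by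
  intro x hx y' hy'
  obtain ⟨p, hp, rfl⟩ := mem_image.1 hy'
  rw [mem_sdiff] at hx
  exact ⟨fun h => hx.2 (mem_biUnion.2 ⟨p, hp, mem_below.2 ⟨hx.1, h⟩⟩), hc.not_lt x hx.1 _ (hy p)⟩

theorem Consec.antiOn_sdiff_union {ι : Type*} {X Y : Finset α} (hc : Consec r S X Y)
    {y : ι → α} (hy : ∀ p, y p ∈ Y) (U : Finset ι) :
    AntiOn r ((X \ U.biUnion fun p => below r X (y p)) ∪ U.image y) := by
  have hfree := hc.not_rel_of_notMem_biUnion hy (U := U)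
  have hUY : U.image y ⊆ Y := image_subset_iff.2 fun p _ => hy p
  intro x hx x' hx'
  rcases mem_union.1 hx with hx | hx <;> rcases mem_union.1 hx' with hx' | hx'
  · exact hc.antiX x (sdiff_subset hx) x' (sdiff_subset hx')
  · exact (hfree x hx x' hx').1
  · exact (hfree x' hx' x hx).2
  · exact hc.antiY x (hUY hx) x' (hUY hx')

theorem Consec.card_sdiff_union {ι : Type*} {X Y : Finset α} (hc : Consec r S X Y)
    {y : ι → α} (hy : ∀ p, y p ∈ Y) (hinj : Function.Injective y) (U : Finset ι) :
    ((X \ U.biUnion fun p => below r X (y p)) ∪ U.image y).card +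
      (U.biUnion fun p => below r X (y p)).card = X.card + U.card := by
  have hWX : (U.biUnion fun p => below r X (y p)) ⊆ X :=
    biUnion_subset.2 fun p _ => below_subset _ _ _
  have hUY : U.image y ⊆ Y := image_subset_iff.2 fun p _ => hy p
  rw [card_union_of_disjoint (disjoint_of_subset_left sdiff_subset
    (disjoint_of_subset_right hUY hc.disj)), card_sdiff_of_subset hWX,
    card_image_of_injective _ hinj]
  have := card_le_card hWX
  omega

theorem Consec.card_add_le_of_biUnion {ι : Type*} {X Y : Finset α} (hc : Consec r S X Y)
    (hs : Scarce r S k a g) {y : ι → α} (hy : ∀ p, y p ∈ Y) (hinj : Function.Injective y)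
    (U : Finset ι) : X.card + U.card ≤ (U.biUnion fun p => below r X (y p)).card + k + a := by
  have hUY : U.image y ⊆ Y := image_subset_iff.2 fun p _ => hy p
  have h1 := hs.width _ (union_subset (sdiff_subset.trans hc.subX) (hUY.trans hc.subY))
    (hc.antiOn_sdiff_union hy U)
  have h2 := hc.card_sdiff_union hy hinj U
  omega

/-- If Hall's condition fails for the lower neighbours of `k` elements, these elements are the tops
of many chains: a set `U` with few lower neighbours receives most of them at least twice. -/
theorem sum_push_of_violator {X Y : Finset α} {f : α → ℕ} (hc : Consec r S X Y)
    (hs : Scarce r S k a g) (hf1 : ∀ x ∈ X, 1 ≤ f x) {B : Finset α} (hB : B ⊆ X) {θ : ℕ}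
    (hθ : 1 ≤ θ) (hf : ∀ x ∈ X \ B, θ ≤ f x) (hX : X.card = k) {y : Fin k → α}
    (hy : ∀ p, y p ∈ Y) (hinj : Function.Injective y) {U : Finset (Fin k)}
    (hU : (U.biUnion fun p => below r X (y p)).card < U.card) :
    (θ + 1) * k ≤ ∑ p, push r X f (y p) + (3 * θ + 1) * (B.card + a + g) := by
  set W := U.biUnion fun p => below r X (y p) with hW
  have hWX : W ⊆ X := biUnion_subset.2 fun p _ => below_subset _ _ _
  have himg : (U.image y).card = U.card := card_image_of_injective _ hinj
  have hUY : U.image y ⊆ Y := image_subset_iff.2 fun p _ => hy p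
  have hfree := hc.not_rel_of_notMem_biUnion hy (U := U)
  have hcard : k + 1 ≤ (X \ W).card + (U.image y).card := by
    rw [card_sdiff_of_subset hWX, himg]
    have := card_le_card hWX
    omega
  have hWU : U.card ≤ W.card + a := by
    have := hc.card_add_le_of_biUnion hs hy hinj U
    rw [← hW] at this
    omega
  -- few elements outside `U` have at most one neighbour outside `W`
  set D₁ := Uᶜ.filter fun p => (below r X (y p) \ W).card ≤ 1 with hD₁
  have hD₁c : D₁.card < g := by
    rw [← card_image_of_injective D₁ hinj]
    refine card_lt_of_card_below_le_one hc.subX hc.antiX hc.subY hc.antiY hc.disj hc.not_lt hs.le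
      hs.few (W := W) hUY ?_ ?_ ?_ hcard
    · intro y' hy'
      obtain ⟨p, hp, rfl⟩ := mem_image.1 hy'
      exact subset_biUnion_of_mem (fun p => below r X (y p)) hp
    · intro y' hy'
      obtain ⟨p, hp, rfl⟩ := mem_image.1 hy'
      rw [hD₁, mem_filter, mem_compl] at hp
      refine mem_sdiff.2 ⟨hy p, fun h => hp.1 ?_⟩
      obtain ⟨q, hq, hqp⟩ := mem_image.1 h
      exact hinj hqp ▸ hq
    · intro y' hy'
      obtain ⟨p, hp, rfl⟩ := mem_image.1 hy'
      exact (mem_filter.1 hp).2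
  -- few elements of `W` have at most one neighbour in `U`
  set deg := fun x => (U.filter fun p => r x (y p)).card with hdeg
  set D₂ := W.filter fun x => deg x ≤ 1 with hD₂
  have hD₂c : D₂.card < g := by
    refine card_lt_of_card_below_le_one (r := flip r) (S := S) (X := U.image y) (Y := X)
      (B := X \ W) (W := ∅) (k := k)
      (hUY.trans hc.subY) (antiOn_flip.2 (hc.antiY.mono hUY)) hc.subX (antiOn_flip.2 hc.antiX)
      (disjoint_of_subset_left hUY hc.disj.symm) ?_ hs.le (by rw [antis_flip]; exact hs.few)
      sdiff_subset ?_ ?_ ?_ ?_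
    · exact fun y' hy' x hx h => hc.not_lt x hx y' (hUY hy') h
    · intro x hx y' hy'
      rw [mem_below] at hy'
      exact absurd hy'.2 (hfree x hx y' hy'.1).1
    · intro x hx
      have := (mem_filter.1 hx).1
      simp [this, hWX this]
    · intro x hx
      rw [sdiff_empty]
      refine le_trans (le_of_eq ?_) (mem_filter.1 hx).2
      change _ = (U.filter fun p => r x (y p)).card
      rw [← card_image_of_injective (U.filter fun p => r x (y p)) hinj]
      congr 1
      ext y'
      simp only [mem_below, mem_image, mem_filter, flip]
      constructor
      · rintro ⟨⟨p, hp, rfl⟩, h⟩; exact ⟨p, ⟨hp, h⟩, rfl⟩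
      · rintro ⟨p, ⟨hp, h⟩, rfl⟩; exact ⟨⟨p, hp, rfl⟩, h⟩
    · rw [sdiff_empty]; omega
  have hout : (θ + 1) * (Uᶜ.card - (B.card + a + g)) ≤ ∑ p ∈ Uᶜ, push r X f (y p) := by
    set Sh := Uᶜ.filter fun p => y p ∈ shadow r X Y B with hSh
    have h1 : Sh.card + X.card ≤ B.card + k + a := by
      refine le_trans (Nat.add_le_add_right ?_ _) (hc.card_shadow_le hs hB)
      exact card_le_card_of_injOn y (fun p hp => (mem_filter.1 hp).2) hinj.injOn
    have h2 : ∀ p ∈ Uᶜ \ (D₁ ∪ Sh), θ + 1 ≤ push r X f (y p) := by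
      intro p hp
      rw [mem_sdiff, mem_union, not_or] at hp
      obtain ⟨hpU, hpD, hpS⟩ := hp
      have h3 : 1 < (below r X (y p)).card := by
        by_contra hcon
        refine hpD (mem_filter.2 ⟨hpU, (card_le_card sdiff_subset).trans (by omega)⟩)
      have h4 : ∃ x ∈ below r X (y p), x ∉ B := by
        by_contra! hcon
        exact hpS (mem_filter.2 ⟨hpU, mem_filter.2 ⟨hy p, hcon⟩⟩)
      obtain ⟨x, hx, hxB⟩ := h4
      obtain ⟨x', hx', hne⟩ := exists_mem_ne h3 x
      have h5 := le_push_of_subset (r := r) (f := f) (Z := {x, x'})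
        (insert_subset hx (singleton_subset_iff.2 hx'))
      rw [sum_pair hne.symm] at h5
      have := hf1 x' (mem_below.1 hx').1
      have := hf x (mem_sdiff.2 ⟨(mem_below.1 hx).1, hxB⟩)
      omega
    have h3 : Uᶜ.card - (B.card + a + g) ≤ (Uᶜ \ (D₁ ∪ Sh)).card := by
      have := le_card_sdiff (D₁ ∪ Sh) Uᶜ
      have := card_union_le D₁ Sh
      omega
    calc (θ + 1) * (Uᶜ.card - (B.card + a + g)) ≤ (Uᶜ \ (D₁ ∪ Sh)).card * (θ + 1) := by
          rw [mul_comm]; exact Nat.mul_le_mul_right _ h3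
      _ = ∑ p ∈ Uᶜ \ (D₁ ∪ Sh), (θ + 1) := by rw [sum_const, smul_eq_mul]
      _ ≤ ∑ p ∈ Uᶜ \ (D₁ ∪ Sh), push r X f (y p) := sum_le_sum h2
      _ ≤ _ := sum_le_sum_of_subset sdiff_subset
  have hin : 2 * θ * (U.card - (B.card + a + g)) ≤ ∑ p ∈ U, push r X f (y p) := by
    have h1 : ∑ p ∈ U, push r X f (y p) = ∑ x ∈ W, deg x * f x := by
      have h2 : ∀ p ∈ U, push r X f (y p) = ∑ x ∈ W, if r x (y p) then f x else 0 := by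
        intro p hp
        unfold push
        rw [← sum_filter]
        congr 1
        ext x
        simp only [mem_below, mem_filter]
        constructor
        · exact fun h => ⟨mem_biUnion.2 ⟨p, hp, mem_below.2 h⟩, h.2⟩
        · exact fun h => ⟨hWX h.1, h.2⟩
      rw [sum_congr rfl h2, sum_comm]
      refine sum_congr rfl fun x _ => ?_
      rw [← sum_filter, sum_const, smul_eq_mul]
    have h2 : ∀ x ∈ W \ (D₂ ∪ B), 2 * θ ≤ deg x * f x := by
      intro x hx
      rw [mem_sdiff, mem_union, not_or] at hx
      refine Nat.mul_le_mul ?_ (hf x (mem_sdiff.2 ⟨hWX hx.1, hx.2.2⟩))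
      by_contra hcon
      exact hx.2.1 (mem_filter.2 ⟨hx.1, by omega⟩)
    have h3 : U.card - (B.card + a + g) ≤ (W \ (D₂ ∪ B)).card := by
      have := le_card_sdiff (D₂ ∪ B) W
      have := card_union_le D₂ B
      omega
    rw [h1]
    calc 2 * θ * (U.card - (B.card + a + g)) ≤ (W \ (D₂ ∪ B)).card * (2 * θ) := by
          rw [mul_comm]; exact Nat.mul_le_mul_right _ h3
      _ = ∑ x ∈ W \ (D₂ ∪ B), 2 * θ := by rw [sum_const, smul_eq_mul]
      _ ≤ ∑ x ∈ W \ (D₂ ∪ B), deg x * f x := sum_le_sum h2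
      _ ≤ _ := sum_le_sum_of_subset sdiff_subset
  have hsplit := sum_add_sum_compl U fun p => push r X f (y p)
  have hUc : U.card + Uᶜ.card = k := by rw [card_add_card_compl, Fintype.card_fin]
  rw [← hsplit]
  set e := B.card + a + g
  have h1 : (θ + 1) * Uᶜ.card ≤ (θ + 1) * (Uᶜ.card - e) + (θ + 1) * e := by
    rw [← mul_add]; exact Nat.mul_le_mul_left _ (by omega)
  have h2 : 2 * θ * U.card ≤ 2 * θ * (U.card - e) + 2 * θ * e := by
    rw [← mul_add]; exact Nat.mul_le_mul_left _ (by omega)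
  have h3 : (θ + 1) * U.card ≤ 2 * θ * U.card := Nat.mul_le_mul_right _ (by omega)
  have h4 : (θ + 1) * k = (θ + 1) * U.card + (θ + 1) * Uᶜ.card := by rw [← mul_add, hUc]
  have h5 : (3 * θ + 1) * e = (θ + 1) * e + 2 * θ * e := by ring
  omega

theorem enum_succ {J : Finset ℕ} {i j : ℕ} (hi : i < J.card) (hij : enum J i = j)
    (hj : j + 1 ∈ J) : i + 1 < J.card ∧ enum J (i + 1) = j + 1 := by
  obtain ⟨i', hi', h⟩ := exists_enum hj
  have h1 : i < i' := by
    by_contra hcon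
    rcases eq_or_lt_of_le (not_lt.1 hcon) with rfl | h2
    · omega
    · have := enum_lt h2 hi
      omega
  have h2 : i' = i + 1 := by
    by_contra hne
    have h3 := enum_lt (show i < i + 1 by omega) (show i + 1 < J.card by omega)
    have h4 := enum_lt (show i + 1 < i' by omega) hi'
    omega
  subst h2
  exact ⟨hi', h⟩

/-- Disjoint chains `z p` that pass through each of the levels `j₀, …, h - 1`. -/
structure Strands (r : α → α → Prop) (S : Finset α) (k j₀ h : ℕ) (z : Fin k → ℕ → α) : Prop where
  mem : ∀ p j, j₀ ≤ j → j < h → z p j ∈ level r S j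
  lt : ∀ p j, j₀ ≤ j → j + 1 < h → r (z p j) (z p (j + 1))
  inj : ∀ j, j₀ ≤ j → j < h → Function.Injective (z · j)

theorem Strands.lt_of_lt (hr : StrictRel r) {j₀ h : ℕ} {z : Fin k → ℕ → α}
    (hz : Strands r S k j₀ h z) (p : Fin k) {i j : ℕ} (hi : j₀ ≤ i) (hij : i < j) (hj : j < h) :
    r (z p i) (z p j) := by
  induction j, hij using Nat.le_induction with
  | base => exact hz.lt p i hi hj
  | succ j hij ih => exact hr.trans (ih (by omega)) (hz.lt p j (by omega) hj)

/-- Along the strands, the number of paths grows by almost `k` at each level with more than `k`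
elements. -/
theorem Strands.sum_pathCount_ge (hs : Scarce r S k a g) {j₀ h : ℕ} {z : Fin k → ℕ → α}
    (hz : Strands r S k j₀ h z) {J G : Finset ℕ} (hJ : J.card = k + 1) (hJh : ∀ j ∈ J, j < h)
    (hGs : ∀ j ∈ G, 1 ≤ sx r S k j) {i₀ : ℕ}
    (hi₀ : ∀ i, i₀ ≤ i → i ≤ k → j₀ ≤ enum J i) {i : ℕ} (h1 : i₀ ≤ i) (h2 : i ≤ k) :
    ∑ p, pathCount r (sel r S J) i₀ (z p (enum J i₀)) + cnt (idx J G k) i₀ i * k ≤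
      ∑ p, pathCount r (sel r S J) i (z p (enum J i)) + cnt (idx J G k) i₀ i * g := by
  have hT := tower_sel (S := S) hs.strict hJ
  have hlt : ∀ i, i ≤ k → enum J i < h := fun i hi => hJh _ (enum_mem (by omega))
  induction i, h1 using Nat.le_induction with
  | base => simp [cnt_self]
  | succ i hi ih =>
    have ih := ih (by omega)
    have h3 := sum_le_sum_push (f := pathCount r (sel r S J) i) (hT.consec i (by omega)) hs
      (fun x hx => hT.one_le_pathCount (by omega) hx)
      (x := fun p => z p (enum J i)) (y := fun p => z p (enum J (i + 1)))
      (fun p => hz.mem p _ (hi₀ _ hi (by omega)) (hlt _ (by omega)))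
      (fun p => hz.mem p _ (hi₀ _ (by omega) h2) (hlt _ h2))
      (hz.inj _ (hi₀ _ (by omega) h2) (hlt _ h2))
      (fun p => hz.lt_of_lt hs.strict p (hi₀ _ hi (by omega)) (enum_lt (by omega) (by omega))
        (hlt _ h2))
    rw [cnt_succ hi]
    change _ ≤ ∑ p, push r (sel r S J i) (pathCount r (sel r S J) i) (z p (enum J (i + 1))) + _
    split_ifs with hG
    · have := h3.2 (idx_good hGs hG)
      rw [add_mul, add_mul]
      omega
    · have := h3.1
      rw [add_zero]
      omega

theorem Strands.sum_pathCount_le {j₀ h : ℕ} {z : Fin k → ℕ → α} (hz : Strands r S k j₀ h z)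
    {J : Finset ℕ} (h1 : j₀ ≤ enum J k) (h2 : enum J k < h) :
    ∑ p, pathCount r (sel r S J) k (z p (enum J k)) ≤ numPaths r (sel r S J) k := by
  rw [← sum_image (g := fun p => z p (enum J k)) (f := pathCount r (sel r S J) k)
    (fun p _ q _ h => hz.inj _ h1 h2 h)]
  exact sum_le_sum_of_subset (image_subset_iff.2 fun p _ => hz.mem p _ h1 h2)

/-- A violation of Hall's condition at a level with `k` elements yields many chains through every
choice of levels that contains this level, the next one, the good levels and the top level. -/
theorem Tie.numPaths_of_violator (ht : Tie r S k a b) (hm : Robust r S k a b g)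
    (hp : Params k a b l g) {ρ : ℕ} (hρ : (goodLevels r S k a).card = ρ)
    (hρl : ρ + 10 ≤ 100 * l ^ 2) {J : Finset ℕ} (hJ : J ∈ levelSets k a)
    (hGJ : goodLevels r S k a ⊆ J) (htopJ : k + a - 1 ∈ J) {j : ℕ} (hjJ : j ∈ J) (hj1J : j + 1 ∈ J)
    (hjG : j ∉ goodLevels r S k a) {z : Fin k → ℕ → α} (hz : Strands r S k (j + 1) (k + a) z)
    {U : Finset (Fin k)}
    (hU : (U.biUnion fun p => below r (level r S j) (z p (j + 1))).card < U.card) :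
    (2 * ρ + 3) * k ≤ 2 * numPaths r (sel r S J) k := by
  by_contra hN
  have ha := hp.one_le_a
  obtain ⟨hJs, hJc⟩ := mem_levelSets.1 hJ
  have htop := enum_top hJ htopJ
  have htopG : enum J k ∉ goodLevels r S k a := by rw [htop]; exact ht.top_notMem
  obtain ⟨i, hi, hij⟩ := exists_enum hjJ
  obtain ⟨hi1, hij1⟩ := enum_succ hi hij hj1J
  have hik : i < k := by omega
  have hT := tower_sel (S := S) hm.scarce.strict hJc
  obtain ⟨B, hB, hBc, hf⟩ := ht.state hm hp hρ hρl hJ hGJ htopG hN hik.le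
  have hpos : 0 ≤ ∑ j ∈ Ico 0 i, exc k (sel r S J) j :=
    sum_nonneg fun i' hi' => ht.exc_nonneg hJ (by rw [mem_Ico] at hi'; omega)
  have hjlt : j < k + a := mem_range.1 (hJs hjJ)
  have hXc : (sel r S J i).card = k := by
    unfold sel
    rw [hij]
    have h1 := ht.nonneg j hjlt
    have h2 : ¬ 1 ≤ sx r S k j := fun h => hjG (mem_goodLevels.2 ⟨hjlt, h⟩)
    unfold sx at h1 h2
    omega
  have hiG : i ∉ idx J (goodLevels r S k a) k := by
    intro h
    have := (mem_filter.1 h).2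
    rw [hij] at this
    exact hjG this
  have hj1lt : j + 1 < k + a := mem_range.1 (hJs hj1J)
  have hcnt1 := cnt_add (idx J (goodLevels r S k a) k) (Nat.zero_le (i + 1))
    (show i + 1 ≤ k by omega)
  rw [cnt_succ (Nat.zero_le _), if_neg hiG, add_zero, cnt_idx hJc hGJ htopG, hρ] at hcnt1
  set c := cnt (idx J (goodLevels r S k a) k) 0 i with hc
  have hUi : (U.biUnion fun p => below r (sel r S J i) (z p (enum J (i + 1)))).card < U.card := by
    unfold sel
    rw [hij, hij1]
    exact hU
  have h1 := sum_push_of_violator (f := pathCount r (sel r S J) i) (hT.consec i hik) hm.scarce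
    (fun x hx => hT.one_le_pathCount hik.le hx) hB (by omega) (fun x hx => (hf x hx).2.1) hXc
    (y := fun p => z p (enum J (i + 1)))
    (fun p => hz.mem p _ (by omega) (by omega)) (hz.inj _ (by omega) (by omega)) hUi
  have h2 := hz.sum_pathCount_ge hm.scarce (G := goodLevels r S k a) hJc
    (fun j hj => mem_range.1 (hJs hj))
    (fun j hj => (mem_goodLevels.1 hj).2) (i₀ := i + 1) (i := k)
    (fun i' h1 h2 => by
      rcases eq_or_lt_of_le h1 with rfl | h1
      · exact hij1.ge
      · have := enum_lt h1 (by omega : i' < J.card)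
        omega) (by omega) le_rfl
  have h3 := hz.sum_pathCount_le (J := J) (by omega) (by omega)
  have h4 : ∀ p, pathCount r (sel r S J) (i + 1) (z p (enum J (i + 1))) =
    push r (sel r S J i) (pathCount r (sel r S J) i) (z p (enum J (i + 1))) := fun _ => rfl
  simp only [h4] at h2
  set c' := cnt (idx J (goodLevels r S k a) k) (i + 1) k with hc'
  have hag := hp.a_le
  have hBc' : B.card ≤ c * (a + g) := by
    zify
    linarith
  have h5 := hp.l2_mul_g_le
  set R := 100 * l ^ 2 with hR
  have h6 : (3 * (1 + c) + 1) * (B.card + a + g) ≤ 3 * R * (R * (2 * g)) := by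
    refine Nat.mul_le_mul (by omega) ?_
    calc B.card + a + g ≤ (c + 1) * (a + g) := by rw [add_mul]; omega
      _ ≤ R * (2 * g) := Nat.mul_le_mul (by omega) (by omega)
  have h7 : c' * g ≤ R * (R * g) := by
    rw [← mul_assoc]
    exact Nat.mul_le_mul_right _ ((show c' ≤ R by omega).trans
      (Nat.le_mul_self R))
  have h8 : 3 * R * (R * (2 * g)) = 6 * (R ^ 2 * g) := by ring
  have h9 : R * (R * g) = R ^ 2 * g := by ring
  have h10 : (1 + c + 1) * k + c' * k = (ρ + 2) * k := by rw [← hcnt1]; ring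
  have h11 : (2 * ρ + 3) * k + k = 2 * ((ρ + 2) * k) := by ring
  omega

/-- In the exceptional case, `k` disjoint chains pass through all the levels, or there are many
chains with `k + 1` elements. -/
theorem Tie.exists_strands (ht : Tie r S k a b) (hm : Robust r S k a b g)
    (hp : Params k a b l g) (hρl : (goodLevels r S k a).card + 10 ≤ 100 * l ^ 2) :
    target k a b < (chains r (k + 1) S).card ∨ ∃ z, Strands r S k 0 (k + a) z := by
  have ha := hp.one_le_a
  rw [or_iff_not_imp_left]
  intro hN
  suffices h : ∀ d, d + 1 ≤ k + a → ∃ z, Strands r S k (k + a - 1 - d) (k + a) z by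
    obtain ⟨z, hz⟩ := h (k + a - 1) (by omega)
    exact ⟨z, by rwa [Nat.sub_self] at hz⟩
  intro d
  induction d with
  | zero =>
    intro _
    have h1 : (level r S (k + a - 1)).card = k := by
      have := ht.top
      unfold sx at this
      omega
    refine ⟨fun p _ => ((level r S (k + a - 1)).equivFinOfCardEq h1).symm p, ?_, ?_, ?_⟩
    · intro p j h1 h2
      have : j = k + a - 1 := by omega
      subst this
      exact Subtype.prop _
    · intro p j _ _; omega
    · intro j _ _ p q hpq
      exact Equiv.injective _ (Subtype.ext hpq)
  | succ d ih =>
    intro hd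
    obtain ⟨z, hz⟩ := ih (by omega)
    set j := k + a - 1 - (d + 1) with hj
    have hj1 : k + a - 1 - d = j + 1 := by omega
    rw [hj1] at hz
    have hall : ∀ U : Finset (Fin k),
        U.card ≤ (U.biUnion fun p => below r (level r S j) (z p (j + 1))).card := by
      by_contra! hcon
      obtain ⟨U, hU⟩ := hcon
      by_cases hjG : j ∈ goodLevels r S k a
      · have h1 := (level_consec (S := S) hm.scarce.strict (show j < j + 1 by omega)
          ).card_add_le_of_biUnion hm.scarce (y := fun p => z p (j + 1))
          (fun p => hz.mem p _ le_rfl (by omega)) (hz.inj _ le_rfl (by omega)) U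
        have h2 := (mem_goodLevels.1 hjG).2
        rcases ht.sx_eq hm.scarce (show j < k + a by omega) with h3 | h3
        · omega
        · unfold sx at h3
          omega
      · refine hN (hm.target_lt_of_forall' hp (ρ := (goodLevels r S k a).card) hm.b_le_card hρl
          (W := insert (k + a - 1) (insert j (insert (j + 1) (goodLevels r S k a)))) ?_ ?_ ?_)
        · refine insert_subset (mem_range.2 (by omega)) (insert_subset (mem_range.2 (by omega))
            (insert_subset (mem_range.2 (by omega)) ?_))
          exact fun i hi => mem_range.2 (mem_goodLevels.1 hi).1
        · have h1 := card_insert_le (k + a - 1) (insert j (insert (j + 1) (goodLevels r S k a)))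
          have h2 := card_insert_le j (insert (j + 1) (goodLevels r S k a))
          have h3 := card_insert_le (j + 1) (goodLevels r S k a)
          omega
        · intro J hJ hW
          simp only [insert_subset_iff] at hW
          exact ht.numPaths_of_violator hm hp rfl hρl hJ hW.2.2.2 hW.1 hW.2.1 hW.2.2.1 hjG hz hU
    obtain ⟨f, hf, hfm⟩ := (all_card_le_biUnion_card_iff_exists_injective _).1 hall
    refine ⟨fun p i => if i ≤ j then f p else z p i, ?_, ?_, ?_⟩
    · intro p i h1 h2
      split_ifs with h
      · rw [show i = j by omega]
        exact (mem_below.1 (hfm p)).1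
      · exact hz.mem p i (by omega) h2
    · intro p i h1 h2
      rw [if_neg (show ¬ i + 1 ≤ j by omega)]
      split_ifs with h
      · have : i = j := by omega
        subst this
        exact (mem_below.1 (hfm p)).2
      · exact hz.lt p i (by omega) h2
    · intro i h1 h2 p q hpq
      dsimp only at hpq
      split_ifs at hpq with h
      · exact hf hpq
      · exact hz.inj i (by omega) h2 hpq

end

section
variable {r : α → α → Prop} {S : Finset α} {k a b l g : ℕ}

/-! ### The exceptional case with one large level -/

theorem Robust.target_lt_or_strands (hm : Robust r S k a b g) (hp : Params k a b l g) :
    target k a b < (chains r (k + 1) S).card ∨ (Tie r S k a b ∧ ∃ z, Strands r S k 0 (k + a) z) ∨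
      (Tie (flip r) S k a b ∧ ∃ z, Strands (flip r) S k 0 (k + a) z) := by
  have ha := hp.one_le_a
  rcases Nat.lt_or_ge b (16 * l * (a + g)) with hb | hb
  · have key : ∀ r' : α → α → Prop, Robust r' S k a b g → Tie r' S k a b →
        target k a b < (chains r' (k + 1) S).card ∨ ∃ z, Strands r' S k 0 (k + a) z :=
      fun r' hm' ht => ht.exists_strands hm' hp (hp.rho_le hb (by
        have := ht.card_goodLevels_mul hm' ha
        omega))
    rcases hm.main hp with h | h | h
    · exact Or.inl h
    · exact (key r hm h).imp_right fun h' => Or.inl ⟨h, h'⟩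
    · have := key _ hm.reverse h
      rw [chains_flip] at this
      exact this.imp_right fun h' => Or.inr ⟨h, h'⟩
  · left
    refine hm.target_lt_of_surplus hp (j₀ := 0) ?_
    rw [← range_eq_Ico, hm.sum_sx]
    exact_mod_cast hb

/-- Antichains in two consecutive levels: choose a set `U` of upper elements, and complete it by
lower elements that are not below `U`. -/
theorem Consec.sum_choose_le_antis {ι : Type*} {X Y : Finset α} (hc : Consec r S X Y)
    {y : ι → α} (hy : ∀ p, y p ∈ Y) (hinj : Function.Injective y) {𝒰 : Finset (Finset ι)}
    (h𝒰 : ∀ U ∈ 𝒰, U.card ≤ k + 1) :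
    ∑ U ∈ 𝒰, (X.card - (U.biUnion fun p => below r X (y p)).card).choose (k + 1 - U.card) ≤
      (antis r (k + 1) S).card := by
  set N := fun U : Finset ι => U.biUnion fun p => below r X (y p) with hN
  set F := fun U : Finset ι => (powersetCard (k + 1 - U.card) (X \ N U)).image (· ∪ U.image y)
    with hF
  have hYU : ∀ U : Finset ι, U.image y ⊆ Y := fun U => image_subset_iff.2 fun p _ => hy p
  have hinter : ∀ U, ∀ A ∈ powersetCard (k + 1 - U.card) (X \ N U),
      (A ∪ U.image y) ∩ Y = U.image y ∧ (A ∪ U.image y) ∩ X = A := by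
    intro U A hA
    have hAX : A ⊆ X := (mem_powersetCard.1 hA).1.trans sdiff_subset
    constructor
    · rw [union_inter_distrib_right, inter_eq_left.2 (hYU U),
        disjoint_iff_inter_eq_empty.1 (disjoint_of_subset_left hAX hc.disj), empty_union]
    · rw [union_inter_distrib_right, inter_eq_left.2 hAX,
        disjoint_iff_inter_eq_empty.1 (disjoint_of_subset_left (hYU U) hc.disj.symm), union_empty]
  have h1 : ∀ U, (F U).card = (X.card - (N U).card).choose (k + 1 - U.card) := by
    intro U
    rw [hF, card_image_of_injOn, card_powersetCard, card_sdiff_of_subset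
      (biUnion_subset.2 fun p _ => below_subset _ _ _)]
    intro A hA A' hA' h
    dsimp only at h
    rw [← (hinter U A hA).2, ← (hinter U A' hA').2, h]
  have h2 : (𝒰.biUnion F).card = ∑ U ∈ 𝒰, (F U).card := by
    refine card_biUnion fun U _ U' _ hne => ?_
    change Disjoint (F U) (F U')
    rw [disjoint_left]
    intro T hT hT'
    obtain ⟨A, hA, rfl⟩ := mem_image.1 hT
    obtain ⟨A', hA', h⟩ := mem_image.1 hT'
    refine hne (image_injective hinj ?_)
    rw [← (hinter U A hA).1, ← (hinter U' A' hA').1, h]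
  rw [← sum_congr rfl fun U _ => h1 U, ← h2]
  refine card_le_card (biUnion_subset.2 fun U hU T hT => ?_)
  obtain ⟨A, hA, rfl⟩ := mem_image.1 hT
  obtain ⟨hA1, hA2⟩ := mem_powersetCard.1 hA
  rw [mem_antis]
  refine ⟨union_subset ((hA1.trans sdiff_subset).trans hc.subX) ((hYU U).trans hc.subY), ?_,
    (hc.antiOn_sdiff_union hy U).mono (union_subset_union_left hA1)⟩
  rw [card_union_of_disjoint (disjoint_of_subset_left (hA1.trans sdiff_subset)
    (disjoint_of_subset_right (hYU U) hc.disj)), hA2, card_image_of_injective _ hinj]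
  have := h𝒰 U hU
  omega

/-- Subsets of a level, and one or two elements of the next level completed by elements of the
level. -/
theorem Consec.choose_add_le_antis {X Y : Finset α} (hc : Consec r S X Y)
    {y : Fin k → α} (hy : ∀ p, y p ∈ Y) (hinj : Function.Injective y) (hk : 1 ≤ k)
    {𝒬 : Finset (Finset (Fin k))} (h𝒬 : ∀ U ∈ 𝒬, U.card = 2) {Q : ℕ}
    (hQ : ∀ U ∈ 𝒬, Q ≤ (X.card - (U.biUnion fun p => below r X (y p)).card).choose (k - 1)) :
    X.card.choose (k + 1) + ∑ p, (X.card - (below r X (y p)).card).choose k + 𝒬.card * Q ≤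
      (antis r (k + 1) S).card := by
  have h1 := hc.sum_choose_le_antis (k := k) hy hinj
    (𝒰 := insert ∅ (univ.image (fun p : Fin k => ({p} : Finset (Fin k))) ∪ 𝒬)) (by
      intro U hU
      rw [mem_insert, mem_union, mem_image] at hU
      rcases hU with rfl | ⟨p, -, rfl⟩ | hU
      · simp
      · simp
      · rw [h𝒬 U hU]; omega)
  refine le_trans ?_ h1
  rw [sum_insert, sum_union, sum_image]
  · simp only [biUnion_empty, card_empty, Nat.sub_zero, singleton_biUnion, card_singleton,
      Nat.add_sub_cancel]
    rw [← add_assoc]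
    refine Nat.add_le_add_left ?_ _
    rw [← smul_eq_mul, ← sum_const]
    refine sum_le_sum fun U hU => ?_
    rw [h𝒬 U hU, show k + 1 - 2 = k - 1 by omega]
    exact hQ U hU
  · intro p _ q _ h
    exact singleton_injective h
  · rw [disjoint_left]
    intro U hU hU'
    obtain ⟨p, -, rfl⟩ := mem_image.1 hU
    have := h𝒬 _ hU'
    simp at this
  · intro h
    rw [mem_union, mem_image] at h
    rcases h with ⟨p, -, h⟩ | h
    · simp at h
    · have := h𝒬 _ h
      simp at this

theorem Strands.sum_le_numPaths (hs : Scarce r S k a g) {h : ℕ} {z : Fin k → ℕ → α}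
    (hz : Strands r S k 0 h z) {J : Finset ℕ} (hJ : J.card = k + 1) (hJh : ∀ j ∈ J, j < h)
    {i : ℕ} (hi : i ≤ k) :
    ∑ p, pathCount r (sel r S J) i (z p (enum J i)) ≤ numPaths r (sel r S J) k := by
  have h1 := hz.sum_pathCount_ge hs hJ hJh (G := ∅) (by simp) (i₀ := i)
    (fun _ _ _ => Nat.zero_le _) hi le_rfl
  have h2 : cnt (idx J ∅ k) i k = 0 := by simp [cnt, idx]
  rw [h2, zero_mul, zero_mul, add_zero, add_zero] at h1
  exact h1.trans (hz.sum_pathCount_le (Nat.zero_le _) (hJh _ (enum_mem (by omega))))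

/-- Each element at a level `m < k` with several lower neighbours gives additional chains for all
the sets of levels that contain `m`. -/
theorem Strands.choose_add_le_chains (hs : Scarce r S k a g) (ha : 1 ≤ a) {z : Fin k → ℕ → α}
    (hz : Strands r S k 0 (k + a) z) {m : ℕ} (hmk : m < k) :
    k * (k + a).choose (k + 1) +
      (∑ p, ((below r (level r S m) (z p (m + 1))).card - 1)) * (k + a - 1).choose k ≤
      (chains r (k + 1) S).card := by
  set d := fun p => (below r (level r S m) (z p (m + 1))).card with hd
  have hd1 : ∀ p, 1 ≤ d p := fun p => card_pos.2 ⟨z p m, mem_below.2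
    ⟨hz.mem p m (by omega) (by omega), hz.lt p m (by omega) (by omega)⟩⟩
  have h1 : ∀ J ∈ levelSets k a,
      k + (if m ∈ J then ∑ p, (d p - 1) else 0) ≤ numPaths r (sel r S J) k := by
    intro J hJ
    obtain ⟨hJs, hJc⟩ := mem_levelSets.1 hJ
    have hJlt : ∀ j ∈ J, j < k + a := fun j hj => mem_range.1 (hJs hj)
    split_ifs with hmJ
    · obtain ⟨i, hi, him⟩ := exists_enum hmJ
      have hik : i < k := by
        by_contra hcon
        have h2 : (range (k + 1)).image (enum J) ⊆ range (m + 1) := by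
          intro x hx
          obtain ⟨i', hi', rfl⟩ := mem_image.1 hx
          rw [mem_range] at hi' ⊢
          rcases eq_or_lt_of_le (show i' ≤ i by omega) with rfl | h
          · omega
          · have := enum_lt h hi
            omega
        rw [← hJc, image_enum] at h2
        have := card_le_card h2
        rw [card_range] at this
        omega
      refine le_trans ?_ (hz.sum_le_numPaths hs hJc hJlt (show i + 1 ≤ k by omega))
      have h2 : k + ∑ p, (d p - 1) = ∑ p, d p := by
        have : ∑ p, d p = ∑ p, (d p - 1) + ∑ p : Fin k, 1 := by
          rw [← sum_add_distrib]
          exact sum_congr rfl fun p _ => by have := hd1 p; omega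
        simp only [sum_const, card_univ, Fintype.card_fin, smul_eq_mul, mul_one] at this
        omega
      rw [h2]
      refine sum_le_sum fun p _ => ?_
      have hT := tower_sel (S := S) hs.strict hJc
      calc d p ≤ (below r (sel r S J i) (z p (enum J (i + 1)))).card := by
            refine card_le_card fun x hx => ?_
            rw [mem_below] at hx ⊢
            unfold sel
            rw [him]
            refine ⟨hx.1, ?_⟩
            have h3 : m < enum J (i + 1) := by rw [← him]; exact enum_lt (by omega) (by omega)
            rcases eq_or_lt_of_le (show m + 1 ≤ enum J (i + 1) by omega) with h4 | h4
            · rw [← h4]; exact hx.2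
            · exact hs.strict.trans hx.2 (hz.lt_of_lt hs.strict p (Nat.zero_le _) h4
                (hJlt _ (enum_mem (by omega))))
        _ = ∑ x ∈ below r (sel r S J i) (z p (enum J (i + 1))), 1 := by simp
        _ ≤ _ := sum_le_sum fun x hx => hT.one_le_pathCount (by omega) (mem_below.1 hx).1
    · refine le_trans ?_ (hz.sum_le_numPaths hs hJc hJlt (Nat.zero_le k))
      simp [pathCount]
  have h2 := (sum_le_sum h1).trans
    (sum_numPaths_le (S := S) hs.strict fun J hJ => (mem_levelSets.1 hJ).2)
  rw [sum_add_distrib, sum_const, smul_eq_mul, ← sum_filter, sum_const, smul_eq_mul] at h2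
  have h3 : (levelSets k a).card = (k + a).choose (k + 1) := by
    rw [levelSets, card_powersetCard, card_range]
  have h4 : ((levelSets k a).filter (m ∈ ·)).card = (k + a - 1).choose k := by
    have h5 : k + a = k + a - 1 + 1 := by omega
    rw [levelSets, h5]
    exact card_powersetCard_mem (mem_range.2 (by omega))
  rw [h3, h4] at h2
  calc _ = (k + a).choose (k + 1) * k + (k + a - 1).choose k * ∑ p, (d p - 1) := by ring
    _ ≤ _ := h2

theorem large_level_ineq {k a n₁ n₂ n₃ X Y C P : ℕ} (ha : 2 ≤ a) (hk : 100 * a ^ 2 ≤ k)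
    (hn : n₁ + n₂ + n₃ = k) (hX : 0 < X) (hC : (k + 1) * C = (k + a) * X)
    (hY : (k + a - 1) * Y = (a - 1) * X)
    (hP : 2 ≤ n₁ ∧ n₁ * (k * X) ≤ 2 * ((k + a - 1) * P) ∨
      n₁ ≤ 1 ∧ (1 ≤ n₃ ∨ a * Y ≤ P)) :
    a * X < C + n₂ * Y + n₃ * X + P := by
  have hCX : X < C := by
    by_contra hcon
    have : (k + 1) * C ≤ (k + 1) * X := Nat.mul_le_mul_left _ (by omega)
    have : (k + 1) * X < (k + a) * X := Nat.mul_lt_mul_of_pos_right (by omega) hX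
    omega
  obtain ⟨c, rfl⟩ : ∃ c, a = c + 1 := ⟨a - 1, by omega⟩
  simp only [Nat.add_sub_cancel, show k + (c + 1) - 1 = k + c by omega] at *
  have hc : c ^ 2 + 2 * c ≤ (c + 1) ^ 2 := by nlinarith
  have key : c * X * (n₁ + n₃ + c) ≤ (k + c) * (n₃ * X + P) := by
    rcases hP with ⟨h1, h2⟩ | ⟨h1, h2 | h2⟩
    · have h3 : 2 * c * (n₁ + c) ≤ n₁ * k := by nlinarith
      have h4 : c * n₃ ≤ (k + c) * n₃ := Nat.mul_le_mul_right _ (by omega)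
      have h5 := Nat.mul_le_mul_right X h3
      have h6 := Nat.mul_le_mul_right X h4
      nlinarith
    · have h3 : c * (n₁ + n₃ + c) ≤ (k + c) * n₃ := by nlinarith
      have h5 := Nat.mul_le_mul_right X h3
      nlinarith [Nat.zero_le ((k + c) * P)]
    · have h3 : (k + c) * ((c + 1) * Y) ≤ (k + c) * P := Nat.mul_le_mul_left _ h2
      have h4 : (k + c) * ((c + 1) * Y) = (c + 1) * (c * X) := by rw [← hY]; ring
      have h5 : c * X * (n₁ + n₃ + c) ≤ c * X * (1 + c) + c * X * n₃ := by
        rw [← mul_add]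
        exact Nat.mul_le_mul_left _ (by omega)
      have h6 : c * X * n₃ ≤ (k + c) * (n₃ * X) := by
        calc c * X * n₃ = c * (n₃ * X) := by ring
          _ ≤ _ := Nat.mul_le_mul_right _ (by omega)
      nlinarith
  have h7 : (k + c) * (c * X) ≤ (k + c) * (n₂ * Y + n₃ * X + P) := by
    have h8 : (k + c) * (n₂ * Y) = n₂ * (c * X) := by rw [← hY]; ring
    have h9 : (k + c) * (c * X) = n₂ * (c * X) + c * X * (n₁ + n₃ + c) := by rw [← hn]; ring
    have h10 : (k + c) * (n₂ * Y + n₃ * X + P) = (k + c) * (n₂ * Y) + (k + c) * (n₃ * X + P) := by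
      ring
    omega
  have h8 := Nat.le_of_mul_le_mul_left h7 (by omega)
  have h9 : (c + 1) * X = c * X + X := by ring
  omega

/-- Counting pairs of intersecting sets: among `k` sets with at least two elements each, with one
exception, in a ground set with `k + a` elements, many pairs intersect. -/
theorem card_inter_pairs {X : Finset α} (hX : X.card = k + a) {N : Fin k → Finset α}
    (hN : ∀ p, N p ⊆ X) (hN1 : (univ.filter fun p => (N p).card ≤ 1).card ≤ 1)
    (hN0 : ∀ p, 1 ≤ (N p).card) :
    k ≤ 4 * ((powersetCard 2 (univ : Finset (Fin k))).filter
      fun U => ∃ p ∈ U, ∃ q ∈ U, p ≠ q ∧ ¬ Disjoint (N p) (N q)).card + a + 1 := by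
  set 𝒬 := (powersetCard 2 (univ : Finset (Fin k))).filter
      fun U => ∃ p ∈ U, ∃ q ∈ U, p ≠ q ∧ ¬ Disjoint (N p) (N q) with h𝒬
  set I := (univ : Finset (Fin k)).filter fun p => ∃ q, p ≠ q ∧ ¬ Disjoint (N p) (N q) with hI
  have h1 : I.card ≤ 𝒬.card * 2 := by
    have h2 : I ⊆ 𝒬.biUnion id := by
      intro p hp
      obtain ⟨q, hne, hd⟩ := (mem_filter.1 hp).2
      refine mem_biUnion.2 ⟨{p, q}, mem_filter.2 ⟨mem_powersetCard.2 ⟨subset_univ _, card_pair hne⟩,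
        p, by simp, q, by simp, hne, hd⟩, by simp⟩
    refine (card_le_card h2).trans (card_biUnion_le_card_mul _ _ _ fun U hU => ?_)
    exact (mem_powersetCard.1 (mem_filter.1 hU).1).2.le
  have h2 : ∑ p ∈ Iᶜ, (N p).card ≤ k + a := by
    rw [← hX, ← card_biUnion]
    · exact card_le_card (biUnion_subset.2 fun p _ => hN p)
    · intro p hp q _ hne
      by_contra hcon
      rw [mem_coe, mem_compl] at hp
      exact hp (mem_filter.2 ⟨mem_univ _, q, hne, hcon⟩)
  have h3 : 2 * Iᶜ.card ≤ ∑ p ∈ Iᶜ, (N p).card + 1 := by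
    have h4 : ∑ p ∈ Iᶜ, 2 ≤ ∑ p ∈ Iᶜ, ((N p).card + if (N p).card ≤ 1 then 1 else 0) := by
      refine sum_le_sum fun p _ => ?_
      have := hN0 p
      split_ifs <;> omega
    rw [sum_add_distrib, ← card_filter, sum_const, smul_eq_mul] at h4
    have h5 : (Iᶜ.filter fun p => (N p).card ≤ 1).card ≤ 1 :=
      (card_le_card (filter_subset_filter _ (subset_univ _))).trans hN1
    omega
  have h4 : I.card + Iᶜ.card = k := by rw [card_add_card_compl, Fintype.card_fin]
  omega

/-- If a single level below level `k` has `k + a` elements, with `2 ≤ a`, then the chains and the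
antichains together suffice. -/
theorem Strands.target_lt (hs : Scarce r S k a g) (ha : 2 ≤ a) (hk : 100 * a ^ 2 ≤ k)
    {z : Fin k → ℕ → α} (hz : Strands r S k 0 (k + a) z) {m : ℕ} (hmk : m < k)
    (hL : (level r S m).card = k + a) :
    target k a a < (chains r (k + 1) S).card + (antis r (k + 1) S).card := by
  set X := level r S m with hX
  set N := fun p => below r X (z p (m + 1)) with hN
  have hk1 : 1 ≤ k := by nlinarith
  have hN0 : ∀ p, 1 ≤ (N p).card := fun p => card_pos.2 ⟨z p m, mem_below.2
    ⟨hz.mem p m (by omega) (by omega), hz.lt p m (by omega) (by omega)⟩⟩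
  have hcons : Consec r S X (level r S (m + 1)) := level_consec hs.strict (by omega)
  have hy : ∀ p, z p (m + 1) ∈ level r S (m + 1) := fun p => hz.mem p _ (by omega) (by omega)
  have hinj := hz.inj (m + 1) (by omega) (by omega)
  have hc : k * (k + a).choose (k + 1) + (∑ p, ((N p).card - 1)) * (k + a - 1).choose k ≤ _ :=
    hz.choose_add_le_chains hs (by omega) hmk
  -- The strands are counted according to the number of lower neighbours at the large level: more
  -- neighbours mean more chains, and fewer neighbours mean more antichains.
  set n₁ := ((univ : Finset (Fin k)).filter fun p => (N p).card ≤ 1).card with hn₁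
  set n₂ := ((univ : Finset (Fin k)).filter fun p => (N p).card = 2).card with hn₂
  set n₃ := ((univ : Finset (Fin k)).filter fun p => 3 ≤ (N p).card).card with hn₃
  have hn : n₁ + n₂ + n₃ = k := by
    simp only [hn₁, hn₂, hn₃, card_filter]
    rw [← sum_add_distrib, ← sum_add_distrib]
    calc _ = ∑ p : Fin k, 1 := sum_congr rfl fun p _ => by split_ifs <;> omega
      _ = k := by simp
  set x := (k + a - 1).choose k with hx
  set y := (k + a - 2).choose k with hy'
  set q := (k + a - 2).choose (k - 1) with hq
  have hx0 : 0 < x := Nat.choose_pos (by omega)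
  have hxC : (k + 1) * (k + a).choose (k + 1) = (k + a) * x := by
    have := Nat.add_one_mul_choose_eq (k + a - 1) k
    rw [show k + a - 1 + 1 = k + a by omega] at this
    rw [hx, this]; ring
  have hyx : (k + a - 1) * y = (a - 1) * x := by
    have := Nat.choose_mul_succ_eq (k + a - 2) k
    rw [show k + a - 2 + 1 = k + a - 1 by omega, show k + a - 1 - k = a - 1 by omega] at this
    rw [mul_comm, this, mul_comm]
  have hqx : (k + a - 1) * q = k * x := by
    have := Nat.add_one_mul_choose_eq (k + a - 2) (k - 1)
    rw [show k + a - 2 + 1 = k + a - 1 by omega, show k - 1 + 1 = k by omega] at this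
    rw [this, mul_comm]
  have hsum : k * x + n₂ * y + n₃ * x ≤
      (∑ p, ((N p).card - 1)) * x + ∑ p, (X.card - (N p).card).choose k := by
    rw [sum_mul, ← sum_add_distrib, hn₂, hn₃, card_filter, card_filter, sum_mul, sum_mul]
    have h1 : k * x = ∑ p : Fin k, x := by simp
    rw [h1, ← sum_add_distrib, ← sum_add_distrib]
    refine sum_le_sum fun p _ => ?_
    have h2 := hN0 p
    rw [hL]
    rcases (show (N p).card = 1 ∨ (N p).card = 2 ∨ 3 ≤ (N p).card by omega) with h | h | h
    · rw [h]; simp [hx]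
    · rw [h]; simp [hy']
    · have h3 : 2 * x ≤ ((N p).card - 1) * x := Nat.mul_le_mul_right _ (by omega)
      rw [if_neg (by omega), if_pos h]
      omega
  -- A family `𝒬` of pairs of strands contributes antichains with two elements of the next level.
  have main : ∀ 𝒬 : Finset (Finset (Fin k)), (∀ U ∈ 𝒬, U.card = 2) → ∀ Q : ℕ,
      (∀ U ∈ 𝒬, Q ≤ (X.card - (U.biUnion N).card).choose (k - 1)) →
      (2 ≤ n₁ ∧ n₁ * (k * x) ≤ 2 * ((k + a - 1) * (𝒬.card * Q)) ∨
        n₁ ≤ 1 ∧ (1 ≤ n₃ ∨ a * y ≤ 𝒬.card * Q)) →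
      target k a a < (chains r (k + 1) S).card + (antis r (k + 1) S).card := by
    intro 𝒬 h𝒬 Q hQ hP
    have h1 : X.card.choose (k + 1) + ∑ p, (X.card - (N p).card).choose k + 𝒬.card * Q ≤ _ :=
      hcons.choose_add_le_antis hy hinj hk1 h𝒬 hQ
    have h2 := large_level_ineq ha hk hn hx0 hxC hyx hP
    have h3 := Params.a_mul_choose k a
    rw [hxC] at h3
    have h4 : (k + a) * x = k * x + a * x := by ring
    rw [hL] at h1
    rw [hL] at hsum
    unfold target
    omega
  rcases Nat.lt_or_ge n₁ 2 with h1 | h1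
  · by_cases h3 : 1 ≤ n₃
    · exact main ∅ (by simp) 0 (by simp) (Or.inr ⟨by omega, Or.inl h3⟩)
    -- If nearly all strands have two lower neighbours, many pairs of strands share one of them.
    · have h2 := card_inter_pairs (k := k) (a := a) hL (fun p => below_subset r X (z p (m + 1)))
        (by rw [← hn₁]; omega) hN0
      set 𝒬 := (powersetCard 2 (univ : Finset (Fin k))).filter
        fun U => ∃ p ∈ U, ∃ q ∈ U, p ≠ q ∧ ¬ Disjoint (N p) (N q) with h𝒬
      have hle2 : ∀ p, (N p).card ≤ 2 := by
        intro p
        by_contra hcon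
        have : p ∈ (univ : Finset (Fin k)).filter fun p => 3 ≤ (N p).card :=
          mem_filter.2 ⟨mem_univ _, by omega⟩
        have := card_pos.2 ⟨p, this⟩
        omega
      refine main 𝒬 (fun U hU => (mem_powersetCard.1 (mem_filter.1 hU).1).2)
        ((k + a - 3).choose (k - 1)) (fun U hU => ?_) (Or.inr ⟨by omega, Or.inr ?_⟩)
      · obtain ⟨p, hp, p', hp', hne, hd⟩ := (mem_filter.1 hU).2
        have hUc := (mem_powersetCard.1 (mem_filter.1 hU).1).2
        have hUe : U = {p, p'} := (eq_of_subset_of_card_le (insert_subset hp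
          (singleton_subset_iff.2 hp')) (by rw [card_pair hne, hUc])).symm
        refine Nat.choose_le_choose _ ?_
        rw [hUe, biUnion_insert, singleton_biUnion, hL]
        have h4 := card_union_add_card_inter (N p) (N p')
        have h5 : 0 < (N p ∩ N p').card := card_pos.2 (not_disjoint_iff_nonempty_inter.1 hd)
        have := hle2 p
        have := hle2 p'
        omega
      · have h4 : (k + a - 2) * (k + a - 3).choose (k - 1) = k * y := by
          have := Nat.add_one_mul_choose_eq (k + a - 3) (k - 1)
          rw [show k + a - 3 + 1 = k + a - 2 by omega, show k - 1 + 1 = k by omega] at this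
          rw [this, mul_comm]
        have hak : a ≤ k := by nlinarith
        have h5 : y ≤ 2 * (k + a - 3).choose (k - 1) := by
          have h6 : k * y ≤ k * (2 * (k + a - 3).choose (k - 1)) := by
            rw [← h4]
            calc _ ≤ (k * 2) * (k + a - 3).choose (k - 1) := Nat.mul_le_mul_right _ (by omega)
              _ = _ := by ring
          exact Nat.le_of_mul_le_mul_left h6 (by omega)
        have h6 : 2 * a ≤ 𝒬.card := by nlinarith
        calc a * y ≤ a * (2 * (k + a - 3).choose (k - 1)) := Nat.mul_le_mul_left _ h5
          _ = 2 * a * (k + a - 3).choose (k - 1) := by ring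
          _ ≤ _ := Nat.mul_le_mul_right _ h6
  -- If several strands have a single lower neighbour, all pairs of these are taken.
  · refine main (powersetCard 2 ((univ : Finset (Fin k)).filter fun p => (N p).card ≤ 1))
      (fun U hU => (mem_powersetCard.1 hU).2) q (fun U hU => ?_) (Or.inl ⟨h1, ?_⟩)
    · refine Nat.choose_le_choose _ ?_
      have h2 : (U.biUnion N).card ≤ U.card * 1 := card_biUnion_le_card_mul _ _ _ fun p hp =>
        (mem_filter.1 ((mem_powersetCard.1 hU).1 hp)).2
      rw [(mem_powersetCard.1 hU).2] at h2
      rw [hL]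
      omega
    · rw [card_powersetCard, ← hn₁]
      have h2 : (k + a - 1) * (n₁.choose 2 * q) = n₁.choose 2 * (k * x) := by
        rw [← hqx]; ring
      rw [h2, ← mul_assoc 2]
      refine Nat.mul_le_mul_right _ ?_
      rw [Nat.choose_two_right]
      have h3 : 2 ∣ n₁ * (n₁ - 1) := (Nat.even_mul_pred_self n₁).two_dvd
      rw [Nat.mul_div_cancel' h3]
      exact Nat.le_mul_of_pos_right _ (by omega)

theorem Params.sq_le (hp : Params k a b l g) : 100 * a ^ 2 ≤ k := by
  have h1 := hp.hg2
  have h2 : a ^ 2 ≤ g ^ 2 := Nat.pow_le_pow_left hp.a_le 2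
  omega

/-- Surpluses of at least `2 k` force more homogeneous sets than the target. -/
theorem Robust.target_lt_of_two_le (hm : Robust r S k a b g) (hp : Params k a b l g)
    (ha : 2 ≤ a) : target k a b < (chains r (k + 1) S).card + (antis r (k + 1) S).card := by
  have key : ∀ r' : α → α → Prop, Robust r' S k a b g → Tie r' S k a b →
      (∃ z, Strands r' S k 0 (k + a) z) →
      target k a b < (chains r' (k + 1) S).card + (antis r' (k + 1) S).card ∨
      ∃ m, k ≤ m ∧ m < k + a - 1 ∧ sx r' S k m = a ∧ ∀ j < k + a, j ≠ m → sx r' S k j = 0 := by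
    rintro r' hm' ht ⟨z, hz⟩
    rcases ht.shape with h | ⟨hba, m, hmlt, hma, hm0⟩
    · omega
    rcases Nat.lt_or_ge m k with hmk | hmk
    · left
      rw [hba]
      refine hz.target_lt hm'.scarce ha hp.sq_le hmk ?_
      unfold sx at hma
      omega
    · exact Or.inr ⟨m, hmk, hmlt, hma, hm0⟩
  have key2 : ∀ r' : α → α → Prop, Robust r' S k a b g → Tie r' S k a b →
      (∃ z, Strands r' S k 0 (k + a) z) →
      target k a b < (chains r' (k + 1) S).card + (antis r' (k + 1) S).card := by
    intro r' hm' ht hz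
    rcases key r' hm' ht hz with h | ⟨m, hmk, hmlt, hma, hm0⟩
    · exact h
    -- The large level is among the highest ones. If this holds for the reversed order as well, the
    -- elements above that level in the reversed order are too many for the lowest levels of `r'`.
    have hm'' := hm'.reverse
    have hr' := hm'.scarce.strict
    have hgk := hp.g_le
    have hgpos := hp.g_pos
    have htop : sx (flip r') S k (k + a - 1) ≤ 0 := by
      have h1 := hm0 0 (by omega) (by omega)
      have h2 : level (flip r') S (k + a - 1) ⊆ level r' S 0 := by
        intro v hv
        rw [mem_level] at hv ⊢
        have := lev_add_lev_flip_lt hr' hm'.height hv.1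
        exact ⟨hv.1, by omega⟩
      have := card_le_card h2
      unfold sx at h1 ⊢
      omega
    rcases hm''.target_lt_or_tie hp htop with h | ht'
    · rw [chains_flip] at h; omega
    rcases ht.shape with h | ⟨hba, -⟩
    · omega
    rcases Nat.lt_or_ge b (16 * l * (a + g)) with hb | hb
    · rcases ht'.exists_strands hm'' hp (hp.rho_le hb (by
        have := ht'.card_goodLevels_mul hm'' (by omega)
        omega)) with h | hz'
      · rw [chains_flip] at h; omega
      rcases key _ hm'' ht' hz' with h | ⟨m', hmk', hmlt', hma', hm0'⟩
      · rw [chains_flip, antis_flip] at h; exact h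
      exfalso
      -- the elements of level at least `m'` for the reversed order have level at most `a - 1`
      have hsub : (S.filter fun v => m' ≤ lev (flip r') S v) ⊆
          S.filter fun v => lev r' S v < k + a - m' := by
        intro v hv
        rw [mem_filter] at hv ⊢
        have := lev_add_lev_flip_lt hr' hm'.height hv.1
        exact ⟨hv.1, by omega⟩
      have hle := card_le_card hsub
      have h1 : (S.filter fun v => m' ≤ lev (flip r') S v).card =
          ∑ j ∈ Ico m' (k + a), (level (flip r') S j).card := by
        rw [← card_biUnion (fun i _ j _ h => level_disjoint h)]
        congr 1
        ext v
        simp only [mem_filter, mem_biUnion, mem_level, mem_Ico]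
        constructor
        · rintro ⟨h1, h2⟩
          exact ⟨_, ⟨h2, hm''.height.lev_lt hr'.flip h1⟩, h1, rfl⟩
        · rintro ⟨j, ⟨h1, h2⟩, h3, rfl⟩
          exact ⟨h3, h1⟩
      have h2 : (S.filter fun v => lev r' S v < k + a - m').card =
          ∑ j ∈ range (k + a - m'), (level r' S j).card := by
        rw [← card_biUnion (fun i _ j _ h => level_disjoint h)]
        congr 1
        ext v
        simp only [mem_filter, mem_biUnion, mem_level, mem_range]
        constructor
        · rintro ⟨h1, h2⟩
          exact ⟨_, h2, h1, rfl⟩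
        · rintro ⟨j, h2, h3, rfl⟩
          exact ⟨h3, h2⟩
      have hak := hp.a_le
      have h3 : ∑ j ∈ range (k + a - m'), (level r' S j).card = (k + a - m') * k := by
        rw [sum_congr rfl (g := fun _ => k), sum_const, card_range, smul_eq_mul]
        intro j hj
        rw [mem_range] at hj
        have := hm0 j (by omega) (by omega)
        unfold sx at this
        omega
      have h4 : (k + a - m') * k + a ≤ ∑ j ∈ Ico m' (k + a), (level (flip r') S j).card := by
        have h5 : ∀ j ∈ Ico m' (k + a), k + (if j = m' then a else 0) ≤
            (level (flip r') S j).card := by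
          intro j hj
          rw [mem_Ico] at hj
          split_ifs with h
          · subst h
            unfold sx at hma'
            omega
          · have := hm0' j hj.2 h
            unfold sx at this
            omega
        have h6 := sum_le_sum h5
        rw [sum_add_distrib, sum_const, Nat.card_Ico, smul_eq_mul, sum_ite_eq',
          if_pos (mem_Ico.2 ⟨le_rfl, by omega⟩)] at h6
        exact h6
      omega
    · have := hm.target_lt_of_surplus hp (j₀ := 0) (by
        rw [← range_eq_Ico, hm.sum_sx]
        exact_mod_cast hb)
      have h1 := hp.l_le
      have h2 : b ≤ g := hba ▸ hp.a_le
      have h3 : 1 ≤ l := hp.one_le_l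
      have h4 : 16 * l * (a + g) ≥ 16 * 1 * (a + g) := Nat.mul_le_mul_right _ (by omega)
      omega
  rcases hm.target_lt_or_strands hp with h | ⟨ht, hz⟩ | ⟨ht, hz⟩
  · omega
  · exact key2 r hm ht hz
  · have := key2 _ hm.reverse ht hz
    rwa [chains_flip, antis_flip] at this

end

section
variable {r : α → α → Prop} {S : Finset α} {k a b l g : ℕ}

/-! ### The exceptional case with levels of at most `k + 1` elements -/

/-- The `k² + k + 1` elements lie on `k` disjoint chains with `k + 1` elements and one further
minimal element; there are no other relations between consecutive levels than those of the chains,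
and relations to the minimal elements; and there are very few large antichains. -/
structure Tight (r : α → α → Prop) (S : Finset α) (k : ℕ) (z : Fin k → ℕ → α) : Prop where
  strict : StrictRel r
  height : HeightLE r S (k + 1)
  width : WidthLE r S (k + 1)
  strands : Strands r S k 0 (k + 1) z
  card_zero : (level r S 0).card = k + 1
  card_level : ∀ j, 1 ≤ j → j ≤ k → (level r S j).card = k
  uniq : ∀ p j, 1 ≤ j → j < k → below r (level r S j) (z p (j + 1)) = {z p j}
  le_two : ∀ p, (below r (level r S 0) (z p 1)).card ≤ 2
  antis_eq : ∀ T ∈ antis r (k + 1) S, T = level r S 0 ∨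
    ∃ p, (below r (level r S 0) (z p 1)).card = 1 ∧
      T = insert (z p 1) (level r S 0 \ below r (level r S 0) (z p 1))
  single : ∀ p q, (below r (level r S 0) (z p 1)).card = 1 →
    (below r (level r S 0) (z q 1)).card = 1 → p = q

/-- The paths to the upper ends of the strands that leave the strands in a given step. -/
noncomputable def extra (r : α → α → Prop) (S : Finset α) (z : Fin k → ℕ → α) (j : ℕ)
    (p : Fin k) : ℕ :=
  ∑ x ∈ (below r (level r S j) (z p (j + 1))).erase (z p j), pathCount r (level r S) j x

/-- The strands with a single lower neighbour at level `j`. -/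
noncomputable def singles (r : α → α → Prop) (S : Finset α) (z : Fin k → ℕ → α) (j : ℕ) :
    Finset (Fin k) :=
  univ.filter fun p => (below r (level r S j) (z p (j + 1))).card ≤ 1

theorem mem_singles {z : Fin k → ℕ → α} {j : ℕ} {p : Fin k} :
    p ∈ singles r S z j ↔ (below r (level r S j) (z p (j + 1))).card ≤ 1 := by
  simp [singles]

/-- The antichains that consist of the elements of a level, or of all but one of them and a single
element of the next level. -/
noncomputable def swaps (r : α → α → Prop) (S : Finset α) (z : Fin k → ℕ → α) (j : ℕ) :
    Finset (Finset α) :=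
  insert (level r S j) ((singles r S z j).image fun p =>
    insert (z p (j + 1)) (level r S j \ below r (level r S j) (z p (j + 1))))

theorem Strands.mem_below_self {z : Fin k → ℕ → α} (hz : Strands r S k 0 (k + 1) z)
    (p : Fin k) {j : ℕ} (hj : j < k) :
    z p j ∈ below r (level r S j) (z p (j + 1)) :=
  mem_below.2 ⟨hz.mem p j (Nat.zero_le _) (by omega), hz.lt p j (Nat.zero_le _) (by omega)⟩

theorem one_le_pathCount_level (hr : StrictRel r) {j : ℕ} {x : α} (hx : x ∈ level r S j) :
    1 ≤ pathCount r (level r S) j x :=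
  (tower_level (S := S) hr (e := id) (l := j) fun i _ => Nat.lt_succ_self i).one_le_pathCount le_rfl
    hx

theorem Strands.below_eq_of_extra {z : Fin k → ℕ → α} (hz : Strands r S k 0 (k + 1) z)
    (hr : StrictRel r) {p : Fin k} {j : ℕ} (hj : j < k) (h : extra r S z j p = 0) :
    below r (level r S j) (z p (j + 1)) = {z p j} := by
  rw [extra, sum_eq_zero_iff] at h
  have h1 : (below r (level r S j) (z p (j + 1))).erase (z p j) = ∅ := by
    refine eq_empty_of_forall_notMem fun u hu => ?_
    have := h u hu
    have := one_le_pathCount_level (S := S) hr (mem_below.1 (mem_of_mem_erase hu)).1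
    omega
  rw [← insert_erase (hz.mem_below_self p hj), h1]
  rfl

theorem le_extra {z : Fin k → ℕ → α} (hr : StrictRel r) (p : Fin k) (j : ℕ) :
    (if p ∈ singles r S z j then 0 else 1) ≤ extra r S z j p := by
  split_ifs with h
  · exact Nat.zero_le _
  · rw [mem_singles, not_le] at h
    obtain ⟨x, hx, hne⟩ := exists_mem_ne h (z p j)
    calc 1 ≤ pathCount r (level r S) j x :=
          one_le_pathCount_level hr (mem_below.1 hx).1
      _ ≤ _ := single_le_sum (f := pathCount r (level r S) j) (fun _ _ => Nat.zero_le _)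
          (mem_erase.2 ⟨hne, hx⟩)

theorem le_sum_extra {z : Fin k → ℕ → α} (hr : StrictRel r) (j : ℕ) :
    k ≤ ∑ p, extra r S z j p + (singles r S z j).card := by
  have h1 := sum_le_sum fun p (_ : p ∈ univ) => le_extra (S := S) (z := z) hr p j
  have h2 : ∑ p : Fin k, (if p ∈ singles r S z j then 0 else 1) + (singles r S z j).card = k := by
    rw [← filter_mem_eq_inter.trans (univ_inter (singles r S z j)), card_filter,
      ← sum_add_distrib]
    calc _ = ∑ p : Fin k, 1 := sum_congr rfl fun p _ => by
            simp only [filter_mem_eq_inter, univ_inter]; split_ifs <;> rfl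
      _ = k := by simp
  omega

theorem Strands.add_sum_extra_le {z : Fin k → ℕ → α} (hz : Strands r S k 0 (k + 1) z)
    (hr : StrictRel r) :
    k + ∑ j ∈ range k, ∑ p, extra r S z j p ≤ (chains r (k + 1) S).card := by
  have h1 : ∀ j, j ≤ k → ∑ p, pathCount r (level r S) j (z p j) =
      k + ∑ i ∈ range j, ∑ p, extra r S z i p := by
    intro j hj
    induction j with
    | zero => simp [pathCount]
    | succ j ih =>
      rw [sum_range_succ, ← add_assoc, ← ih (by omega), ← sum_add_distrib]
      refine sum_congr rfl fun p _ => ?_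
      change push _ _ _ _ = _
      unfold push extra
      rw [add_sum_erase _ _ (hz.mem_below_self p (by omega))]
  have h2 : ∑ p, pathCount r (level r S) k (z p k) ≤ numPaths r (level r S) k := by
    rw [← sum_image (g := fun p => z p k) (f := pathCount r (level r S) k)
      (fun p _ q _ h => hz.inj k (Nat.zero_le _) (by omega) h)]
    exact sum_le_sum_of_subset (image_subset_iff.2 fun p _ => hz.mem p k (Nat.zero_le _) (by omega))
  rw [← h1 k le_rfl]
  refine h2.trans ?_
  rw [← card_paths hr]
  exact card_le_card (paths_subset_chains hr fun i _ => level_subset _ _ _)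

theorem Strands.mem_swaps {z : Fin k → ℕ → α} (hz : Strands r S k 0 (k + 1) z)
    {j : ℕ} (hj : j < k) {T : Finset α} (hT : T ∈ swaps r S z j) :
    T = level r S j ∨ ∃ p, (below r (level r S j) (z p (j + 1))).card = 1 ∧
      T = insert (z p (j + 1)) (level r S j \ below r (level r S j) (z p (j + 1))) := by
  rw [swaps, mem_insert, mem_image] at hT
  refine hT.imp_right fun ⟨p, hp, h⟩ => ⟨p, ?_, h.symm⟩
  have h1 := card_pos.2 ⟨_, hz.mem_below_self p hj⟩
  have h2 := mem_singles.1 hp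
  omega

theorem Strands.swaps_subset {z : Fin k → ℕ → α} (hz : Strands r S k 0 (k + 1) z) (hr : StrictRel r)
    {j : ℕ} (hj : j < k) (hL : (level r S j).card = k + 1) :
    swaps r S z j ⊆ antis r (k + 1) S ∧ ∀ T ∈ swaps r S z j, k ≤ (T ∩ level r S j).card := by
  have hc : Consec r S (level r S j) (level r S (j + 1)) := level_consec hr (by omega)
  have hy : ∀ p, z p (j + 1) ∈ level r S (j + 1) := fun p =>
    hz.mem p _ (Nat.zero_le _) (by omega)
  have key : ∀ p, (below r (level r S j) (z p (j + 1))).card = 1 →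
      (level r S j \ below r (level r S j) (z p (j + 1))).card = k := by
    intro p hp
    rw [card_sdiff_of_subset (below_subset _ _ _), hL, hp]
    rfl
  constructor
  · intro T hT
    rcases hz.mem_swaps hj hT with rfl | ⟨p, hp, rfl⟩
    · exact mem_antis.2 ⟨level_subset _ _ _, hL, antiOn_level hr j⟩
    · have h1 := hc.antiOn_sdiff_union hy {p}
      rw [singleton_biUnion, image_singleton, union_comm, ← insert_eq] at h1
      refine mem_antis.2 ⟨insert_subset (hc.subY (hy p)) (sdiff_subset.trans hc.subX), ?_, h1⟩
      rw [card_insert_of_notMem, key p hp]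
      exact fun h => disjoint_left.1 hc.disj (sdiff_subset h) (hy p)
  · intro T hT
    rcases hz.mem_swaps hj hT with rfl | ⟨p, hp, rfl⟩
    · rw [inter_self, hL]; omega
    · refine (key p hp).ge.trans (card_le_card ?_)
      exact subset_inter (subset_insert _ _) sdiff_subset

theorem Strands.card_swaps {z : Fin k → ℕ → α} (hz : Strands r S k 0 (k + 1) z)
    {j : ℕ} (hj : j < k) :
    (swaps r S z j).card = 1 + (singles r S z j).card := by
  have hy : ∀ p, z p (j + 1) ∉ level r S j := fun p h => by
    have h1 := (mem_level.1 h).2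
    have h2 := (mem_level.1 (hz.mem p (j + 1) (Nat.zero_le _) (by omega))).2
    omega
  rw [swaps, card_insert_of_notMem, card_image_of_injOn, add_comm]
  · intro p _ q _ h
    dsimp only at h
    have h1 : z p (j + 1) ∈ insert (z q (j + 1))
        (level r S j \ below r (level r S j) (z q (j + 1))) := h ▸ mem_insert_self _ _
    rcases mem_insert.1 h1 with h2 | h2
    · exact hz.inj (j + 1) (Nat.zero_le _) (by omega) h2
    · exact absurd (sdiff_subset h2) (hy p)
  · intro h
    obtain ⟨p, -, h⟩ := mem_image.1 h
    exact hy p (h ▸ mem_insert_self _ _)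

/-- The case `a = 1`, in which all levels have `k` or `k + 1` elements. Each lower neighbour of a
strand that is not on the strand yields an additional chain, and each element of a strand without
such a neighbour above a good level yields an additional antichain. If there are no other
homogeneous sets, the relations between successive levels are determined, and the only good level
is the lowest one. -/
theorem Tie.target_le_or_tight (ht : Tie r S k 1 b) (hm : Robust r S k 1 b g)
    (hp : Params k 1 b l g) {z : Fin k → ℕ → α} (hz : Strands r S k 0 (k + 1) z) :
    target k 1 b < (chains r (k + 1) S).card + (antis r (k + 1) S).card ∨
      target k 1 b = (chains r (k + 1) S).card + (antis r (k + 1) S).card ∧ b = 1 ∧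
        Tight r S k z := by
  have hr := hm.scarce.strict
  have hk3 : 3 ≤ k := by have := hp.g_le; have := hp.g_pos; omega
  set G := goodLevels r S k 1 with hG
  have hGc : G.card = b := by have := ht.card_goodLevels_mul hm le_rfl; rwa [mul_one] at this
  have hlev : ∀ j ≤ k, if j ∈ G then (level r S j).card = k + 1 else (level r S j).card = k := by
    intro j hj
    have h1 := ht.sx_eq hm.scarce (show j < k + 1 by omega)
    have h2 : j ∈ G ↔ j < k + 1 ∧ 1 ≤ sx r S k j := mem_goodLevels
    unfold sx at h1 h2
    split_ifs with h
    · have := (h2.1 h).2; omega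
    · rcases h1 with h1 | h1
      · omega
      · exact absurd (h2.2 ⟨by omega, by omega⟩) h
  have hGlev : ∀ j ∈ G, j < k ∧ (level r S j).card = k + 1 := by
    intro j hj
    have h1 := (mem_goodLevels.1 hj).1
    have h2 : j ≠ k := fun h => ht.top_notMem (by simpa [h] using hj)
    have h3 := hlev j (by omega)
    rw [if_pos hj] at h3
    exact ⟨by omega, h3⟩
  have hGk : G ⊆ range k := fun j hj => mem_range.2 (hGlev j hj).1
  -- The antichains `𝒜` and the chains counted by `extra` add up to the target exactly.
  set 𝒜 := G.biUnion (swaps r S z) with h𝒜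
  have h𝒜sub : 𝒜 ⊆ antis r (k + 1) S := biUnion_subset.2 fun j hj =>
    (hz.swaps_subset hr (hGlev j hj).1 (hGlev j hj).2).1
  have h𝒜c : 𝒜.card = ∑ j ∈ G, (1 + (singles r S z j).card) := by
    rw [h𝒜, card_biUnion]
    · exact sum_congr rfl fun j hj => hz.card_swaps (hGlev j hj).1
    · intro i hi j hj hij
      change Disjoint (swaps r S z i) (swaps r S z j)
      rw [disjoint_left]
      intro T hT hT'
      have h1 := (hz.swaps_subset hr (hGlev i hi).1 (hGlev i hi).2).2 T hT
      have h2 := (hz.swaps_subset hr (hGlev j hj).1 (hGlev j hj).2).2 T hT'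
      have h3 := (mem_antis.1 ((hz.swaps_subset hr (hGlev i hi).1 (hGlev i hi).2).1 hT)).2.1
      have h4 : (T ∩ level r S i ∪ T ∩ level r S j).card ≤ T.card :=
        card_le_card (union_subset inter_subset_left inter_subset_left)
      rw [card_union_of_disjoint (disjoint_of_subset_left inter_subset_right
        (disjoint_of_subset_right inter_subset_right (level_disjoint hij)))] at h4
      omega
  have hNc := hz.add_sum_extra_le hr
  have hNa := card_le_card h𝒜sub
  have hex : ∀ j ∈ range k, (if j ∈ G then k - (singles r S z j).card else 0) ≤
      ∑ p, extra r S z j p := by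
    intro j hj
    have := le_sum_extra (S := S) (z := z) hr j
    split_ifs <;> omega
  have hsing : ∀ j, (singles r S z j).card ≤ k := fun j =>
    (card_le_univ _).trans (by simp)
  have htarget : target k 1 b = k + ∑ j ∈ range k,
      (if j ∈ G then k - (singles r S z j).card else 0) + 𝒜.card := by
    rw [sum_ite_mem, inter_eq_right.2 hGk, h𝒜c, add_assoc, ← sum_add_distrib]
    have h1 : ∑ j ∈ G, (k - (singles r S z j).card + (1 + (singles r S z j).card)) =
        ∑ j ∈ G, (k + 1) := sum_congr rfl fun j _ => by have := hsing j; omega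
    rw [h1, sum_const, hGc, smul_eq_mul]
    simp [target]
  have hexs := sum_le_sum hex
  rcases lt_or_eq_of_le (show target k 1 b ≤
      (chains r (k + 1) S).card + (antis r (k + 1) S).card by omega) with h | h
  · exact Or.inl h
  refine Or.inr ⟨h, ?_⟩
  -- In the case of equality there are no large antichains other than those in `𝒜`, and no strand
  -- has more than one lower neighbour beside itself in a step.
  have hanti : antis r (k + 1) S = 𝒜 := (eq_of_subset_of_card_le h𝒜sub (by omega)).symm
  have hexeq := (sum_eq_sum_iff_of_le hex).1 (by omega)
  have hp_extra : ∀ j < k, ∀ p, (j ∉ G → extra r S z j p = 0) ∧ extra r S z j p ≤ 1 ∧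
      (p ∈ singles r S z j → extra r S z j p = 0) := by
    intro j hj p
    have h1 := hexeq j (mem_range.2 hj)
    by_cases hjG : j ∈ G
    · rw [if_pos hjG] at h1
      have h2 : ∑ p : Fin k, (if p ∈ singles r S z j then 0 else 1) = ∑ p, extra r S z j p := by
        rw [← h1]
        have h3 : ∑ p : Fin k, (if p ∈ singles r S z j then 0 else 1) =
            ((singles r S z j)ᶜ).card := by
          rw [← sum_filter_add_sum_filter_not univ (· ∈ singles r S z j)]
          rw [card_eq_sum_ones, sum_eq_zero (fun p hp => by simp [(mem_filter.1 hp).2]), zero_add]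
          refine sum_congr (by ext; simp) fun p hp => ?_
          rw [if_neg (by simpa using hp)]
        rw [h3, card_compl, Fintype.card_fin]
      have h3 := (sum_eq_sum_iff_of_le fun p (_ : p ∈ univ) =>
        le_extra (S := S) (z := z) hr p j).1 h2 p (mem_univ _)
      refine ⟨fun h => absurd hjG h, ?_, fun h => ?_⟩
      · rw [← h3]; split_ifs <;> omega
      · rw [← h3, if_pos h]
    · rw [if_neg hjG] at h1
      have h2 := (sum_eq_zero_iff.1 h1.symm) p (mem_univ _)
      exact ⟨fun _ => h2, by omega, fun _ => h2⟩
  -- Hence a large antichain lies in a good level up to at most one element, which is on a strand.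
  have hlist : ∀ T ⊆ S, T.card = k + 1 → AntiOn r T →
      ∃ j ∈ G, ∃ p, ∀ t ∈ T, lev r S t = j ∨ t = z p (j + 1) := by
    intro T hTS hTc hTa
    have h1 : T ∈ 𝒜 := hanti ▸ mem_antis.2 ⟨hTS, hTc, hTa⟩
    obtain ⟨j, hj, h2⟩ := mem_biUnion.1 h1
    refine ⟨j, hj, ?_⟩
    rcases hz.mem_swaps (hGlev j hj).1 h2 with rfl | ⟨p, -, rfl⟩
    · exact ⟨⟨0, by omega⟩, fun t ht => Or.inl (mem_level.1 ht).2⟩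
    · refine ⟨p, fun t ht => ?_⟩
      rcases mem_insert.1 ht with rfl | ht
      · exact Or.inr rfl
      · exact Or.inl (mem_level.1 (sdiff_subset ht)).2
  have hlist2 : ∀ T ⊆ S, T.card = k + 1 → AntiOn r T → ∀ i, 2 ≤ (T ∩ level r S i).card →
      ∃ p, i ∈ G ∧ ∀ t ∈ T, lev r S t = i ∨ t = z p (i + 1) := by
    intro T hTS hTc hTa i h2
    obtain ⟨j, hj, p, h⟩ := hlist T hTS hTc hTa
    have hji : j = i := by
      obtain ⟨s, hs, t, ht, hne⟩ := one_lt_card.1 h2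
      rw [mem_inter, mem_level] at hs ht
      rcases h s hs.1 with h2 | h2
      · omega
      · rcases h t ht.1 with h3 | h3
        · omega
        · exact absurd (h2.trans h3.symm) hne
    subst hji
    exact ⟨p, hj, h⟩
  have honZ : ∀ j ≤ k, j ∉ G → ∀ w ∈ level r S j, ∃ p, z p j = w := by
    intro j hj hjG w hw
    have h1 := hlev j hj
    rw [if_neg hjG] at h1
    have h2 : univ.image (fun p => z p j) = level r S j := by
      refine eq_of_subset_of_card_le
        (image_subset_iff.2 fun p _ => hz.mem p j (Nat.zero_le _) (by omega)) ?_
      rw [card_image_of_injective _ (hz.inj j (Nat.zero_le _) (by omega)), h1]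
      simp
    rw [← h2] at hw
    obtain ⟨p, -, hp⟩ := mem_image.1 hw
    exact ⟨p, hp⟩
  -- A good level `m > 0` contains an element `x` off the strands. It lies below some strand, since
  -- otherwise `x` and the next level contain an antichain that is not in `𝒜`.
  have hG0 : ∀ m ∈ G, m = 0 := by
    intro m hmG
    by_contra hm0
    obtain ⟨hmk, hmc⟩ := hGlev m hmG
    obtain ⟨x, hxm, hxz⟩ : ∃ x ∈ level r S m, x ∉ univ.image (fun p => z p m) := by
      apply exists_mem_notMem_of_card_lt_card
      refine card_image_le.trans_lt ?_
      rw [hmc]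
      simp
    have hxz' : ∀ p, x ≠ z p m := fun p h => hxz (mem_image.2 ⟨p, mem_univ _, h.symm⟩)
    have hxlev := (mem_level.1 hxm).2
    obtain ⟨p, hxp⟩ : ∃ p, r x (z p (m + 1)) := by
      by_contra! hcon
      have hc : Consec r S (level r S m) (level r S (m + 1)) := level_consec hr (by omega)
      have hy : ∀ p, z p (m + 1) ∈ level r S (m + 1) := fun p =>
        hz.mem p _ (Nat.zero_le _) (by omega)
      have hinj := hz.inj (m + 1) (Nat.zero_le _) (by omega)
      have hYs : univ.image (fun p => z p (m + 1)) ⊆ level r S (m + 1) :=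
        image_subset_iff.2 fun p _ => hy p
      have h1 := hc.antiOn_sdiff_union hy univ
      have hT : insert x (univ.image fun p => z p (m + 1)) ⊆
          (level r S m \ univ.biUnion fun p => below r (level r S m) (z p (m + 1))) ∪
            univ.image fun p => z p (m + 1) := by
        refine insert_subset (mem_union_left _ (mem_sdiff.2 ⟨hxm, fun h => ?_⟩))
          subset_union_right
        obtain ⟨p, -, h⟩ := mem_biUnion.1 h
        exact hcon p (mem_below.1 h).2
      have hcard : (univ.image fun p => z p (m + 1)).card = k := by
        rw [card_image_of_injective _ hinj]; simp
      obtain ⟨p, hmp, h2⟩ := hlist2 _ (insert_subset (level_subset _ _ _ hxm)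
        (hYs.trans (level_subset _ _ _))) (by
          rw [card_insert_of_notMem (fun h => disjoint_left.1 hc.disj hxm (hYs h)), hcard])
        (h1.mono hT) (m + 1) (by
          refine le_trans ?_ (card_le_card (subset_inter (subset_insert _ _) hYs))
          omega)
      rcases h2 x (mem_insert_self _ _) with h3 | h3
      · omega
      · have h4 := (hGlev _ hmp).1
        have h5 := (mem_level.1 (hz.mem p (m + 1 + 1) (Nat.zero_le _) (by omega))).2
        rw [← h3] at h5
        omega
    obtain ⟨m, rfl⟩ : ∃ m', m = m' + 1 := ⟨m - 1, by omega⟩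
    -- The element `x` tops a single chain. So it has a single lower neighbour `w`. Replacing `w`
    -- by `x`, together with the next element of the strand through `w` if the level of `w` is not
    -- good, gives an antichain not in `𝒜`.
    have hfx : pathCount r (level r S) (m + 1) x ≤ 1 :=
      (single_le_sum (f := pathCount r (level r S) (m + 1)) (fun _ _ => Nat.zero_le _)
        (mem_erase.2 ⟨hxz' p, mem_below.2 ⟨hxm, hxp⟩⟩)).trans (hp_extra (m + 1) hmk p).2.1
    have hbx : (below r (level r S m) x).card ≤ 1 := by
      refine le_trans ?_ hfx
      change _ ≤ ∑ u ∈ below r (level r S m) x, pathCount r (level r S) m u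
      rw [card_eq_sum_ones]
      exact sum_le_sum fun u hu => one_le_pathCount_level hr (mem_below.1 hu).1
    obtain ⟨w, hwS, hwx, hwlev⟩ := exists_below hr hxlev
    have hwm : w ∈ level r S m := mem_level.2 ⟨hwS, hwlev⟩
    have hbw : below r (level r S m) x = {w} := by
      have h1 : w ∈ below r (level r S m) x := mem_below.2 ⟨hwm, hwx⟩
      exact (eq_of_subset_of_card_le (singleton_subset_iff.2 h1) (by rwa [card_singleton])).symm
    have hc : Consec r S (level r S m) (level r S (m + 1)) := level_consec hr (by omega)
    have finish : ∀ (ι : Type) (U : Finset ι) (y : ι → α), (∀ i, y i ∈ level r S (m + 1)) →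
        Function.Injective y → (∃ i ∈ U, y i = x) →
        (U.biUnion fun i => below r (level r S m) (y i)) = {w} →
        (level r S m).card + U.card = k + 2 → False := by
      intro ι U y hy hinj hx hN hcard
      obtain ⟨i, hiU, hix⟩ := hx
      have h1 := hc.antiOn_sdiff_union hy U
      have h2 := hc.card_sdiff_union hy hinj U
      rw [hN] at h1 h2
      rw [card_singleton] at h2
      have hlm := hlev m (by omega)
      obtain ⟨p, hmp, h3⟩ := hlist2 _ (union_subset (sdiff_subset.trans hc.subX)
        ((image_subset_iff.2 fun p _ => hy p).trans hc.subY)) (by omega) h1 m (by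
          refine le_trans ?_ (card_le_card (subset_inter subset_union_left sdiff_subset))
          rw [card_sdiff_of_subset (singleton_subset_iff.2 hwm), card_singleton]
          split_ifs at hlm <;> omega)
      rcases h3 x (mem_union_right _ (mem_image.2 ⟨i, hiU, hix⟩)) with h4 | h4
      · omega
      · exact hxz' p h4
    by_cases hmG' : m ∈ G
    · exact finish Unit univ (fun _ => x) (fun _ => hxm) (fun _ _ _ => rfl) ⟨(), mem_univ _, rfl⟩
        (by simp [hbw]) (by rw [(hGlev m hmG').2]; simp)
    · obtain ⟨q, hq⟩ := honZ m (by omega) hmG' w hwm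
      have hbq : below r (level r S m) (z q (m + 1)) = {w} := by
        have h1 := hz.below_eq_of_extra hr (by omega) ((hp_extra m (by omega) q).1 hmG')
        rwa [hq] at h1
      have hlm := hlev m (by omega)
      rw [if_neg hmG'] at hlm
      refine finish Bool univ (fun i => cond i x (z q (m + 1))) ?_ ?_ ⟨true, mem_univ _, rfl⟩ ?_
        (by rw [hlm]; simp)
      · rintro (_ | _)
        · exact hz.mem q _ (Nat.zero_le _) (by omega)
        · exact hxm
      · rintro (_ | _) (_ | _) h
        · rfl
        · exact absurd h.symm (hxz' q)
        · exact absurd h (hxz' q)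
        · rfl
      · ext u
        simp [hbw, hbq]
  have hGeq : G = {0} := by
    have h1 : G ⊆ {0} := fun m hm => mem_singleton.2 (hG0 m hm)
    refine eq_of_subset_of_card_le h1 ?_
    have := hp.one_le_b
    rw [card_singleton]
    omega
  have hb1 : b = 1 := by rw [← hGc, hGeq, card_singleton]
  have h0G : 0 ∈ G := by rw [hGeq]; exact mem_singleton_self _
  have hnG : ∀ j, 1 ≤ j → j ∉ G := fun j hj h => by have := hG0 j h; omega
  have hc0 : Consec r S (level r S 0) (level r S 1) := level_consec hr (by omega)
  have hy0 : ∀ p, z p 1 ∈ level r S 1 := fun p => hz.mem p _ (Nat.zero_le _) (by omega)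
  have hinj0 := hz.inj 1 (Nat.zero_le _) (by omega)
  refine ⟨hb1, hr, hm.height, hm.scarce.width, hz, (hGlev 0 h0G).2, ?_, ?_, ?_, ?_, ?_⟩
  · intro j hj hjk
    have := hlev j hjk
    rwa [if_neg (hnG j hj)] at this
  · intro q j hj hjk
    exact hz.below_eq_of_extra hr hjk ((hp_extra j hjk q).1 (hnG j hj))
  · intro q
    have h1 := (hp_extra 0 (by omega) q).2.1
    have h2 : z q 0 ∈ below r (level r S 0) (z q 1) :=
      hz.mem_below_self q (show 0 < k by omega)
    rw [extra] at h1
    simp only [pathCount, sum_const, smul_eq_mul, mul_one, zero_add] at h1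
    rw [card_erase_of_mem h2] at h1
    omega
  · intro T hT
    rw [hanti, h𝒜, hGeq, singleton_biUnion] at hT
    exact hz.mem_swaps (by omega) hT
  -- Two strands with single lower neighbours could replace these in the antichain of level `0`.
  · intro q q' h1 h2
    by_contra hne
    set N := ({q, q'} : Finset (Fin k)).biUnion fun p => below r (level r S 0) (z p 1) with hN
    have h3 := hc0.antiOn_sdiff_union hy0 {q, q'}
    have h4 := hc0.card_sdiff_union hy0 hinj0 {q, q'}
    rw [← hN] at h3 h4
    have h5 : N.card ≤ 2 := by
      rw [hN, biUnion_insert, singleton_biUnion]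
      have := card_union_le (below r (level r S 0) (z q 1)) (below r (level r S 0) (z q' 1))
      omega
    have hTS : (level r S 0 \ N) ∪ ({q, q'} : Finset (Fin k)).image (fun p => z p 1) ⊆ S :=
      union_subset (sdiff_subset.trans hc0.subX)
        ((image_subset_iff.2 fun p _ => hy0 p).trans hc0.subY)
    have h6 := hm.scarce.width _ hTS h3
    rw [card_pair hne, (hGlev 0 h0G).2] at h4
    obtain ⟨p, -, h7⟩ := hlist2 _ hTS (by omega) h3 0 (by
      refine le_trans ?_ (card_le_card (subset_inter subset_union_left sdiff_subset))
      have := le_card_sdiff N (level r S 0)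
      have := (hGlev 0 h0G).2
      omega)
    have h8 : ∀ s ∈ ({q, q'} : Finset (Fin k)), s = p := by
      intro s hs
      rcases h7 (z s 1) (mem_union_right _ (mem_image.2 ⟨s, hs, rfl⟩)) with h9 | h9
      · have := (mem_level.1 (hy0 s)).2
        omega
      · exact hinj0 h9
    exact hne ((h8 q (by simp)).trans (h8 q' (by simp)).symm)

/-- The final estimate for sets of robust height. -/
theorem Robust.target_le_or_tight (hm : Robust r S k a b g) (hp : Params k a b l g) :
    target k a b < (chains r (k + 1) S).card + (antis r (k + 1) S).card ∨
      target k a b = (chains r (k + 1) S).card + (antis r (k + 1) S).card ∧ a = 1 ∧ b = 1 ∧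
        ∃ z, Tight r S k z ∨ Tight (flip r) S k z := by
  rcases Nat.lt_or_ge a 2 with ha | ha
  · obtain rfl : a = 1 := by have := hp.one_le_a; omega
    rcases hm.target_lt_or_strands hp with h | ⟨ht, z, hz⟩ | ⟨ht, z, hz⟩
    · left; omega
    · exact (ht.target_le_or_tight hm hp hz).imp_right fun h => ⟨h.1, rfl, h.2.1, z, Or.inl h.2.2⟩
    · have := ht.target_le_or_tight hm.reverse hp hz
      rw [chains_flip, antis_flip] at this
      exact this.imp_right fun h => ⟨h.1, rfl, h.2.1, z, Or.inr h.2.2⟩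
  · exact Or.inl (hm.target_lt_of_two_le hp ha)

end

section
variable {r r' : α → α → Prop} {S : Finset α} {k a b l g : ℕ}

/-! ### Sets without large chains, or without large antichains -/

/-- Two strict orders such that any two distinct elements are comparable in exactly one of them. -/
structure Conj (r r' : α → α → Prop) : Prop where
  left : StrictRel r
  right : StrictRel r'
  compl : ∀ x y, x ≠ y → ((r' x y ∨ r' y x) ↔ ¬ (r x y ∨ r y x))

theorem Conj.symm (h : Conj r r') : Conj r' r :=
  ⟨h.right, h.left, fun x y hxy => by rw [h.compl x y hxy, not_not]⟩

theorem Conj.chainOn_iff (h : Conj r r') {T : Finset α} : ChainOn r' T ↔ AntiOn r T := by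
  constructor
  · intro hT x hx y hy hxy
    have hne := h.left.ne hxy
    exact (h.compl x y hne).1 (hT x hx y hy hne) (Or.inl hxy)
  · intro hT x hx y hy hne
    exact (h.compl x y hne).2 fun h' => h'.elim (hT x hx y hy) (hT y hy x hx)

theorem Conj.antiOn_iff (h : Conj r r') {T : Finset α} : AntiOn r' T ↔ ChainOn r T :=
  h.symm.chainOn_iff.symm

theorem Conj.chains_eq (h : Conj r r') (m : ℕ) : chains r' m S = antis r m S := by
  ext T; rw [mem_chains, mem_antis, h.chainOn_iff]

theorem Conj.antis_eq (h : Conj r r') (m : ℕ) : antis r' m S = chains r m S :=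
  (h.symm.chains_eq m).symm

theorem Conj.heightLE_iff (h : Conj r r') {m : ℕ} : HeightLE r' S m ↔ WidthLE r S m := by
  simp only [HeightLE, WidthLE, h.chainOn_iff]

theorem Conj.widthLE_iff (h : Conj r r') {m : ℕ} : WidthLE r' S m ↔ HeightLE r S m :=
  h.symm.heightLE_iff.symm

/-- The number of homogeneous subsets with `k + 1` elements. -/
noncomputable def hom (r : α → α → Prop) (k : ℕ) (S : Finset α) : ℕ :=
  (chains r (k + 1) S).card + (antis r (k + 1) S).card

theorem Conj.hom_eq (h : Conj r r') : hom r' k S = hom r k S := by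
  rw [hom, hom, h.chains_eq, h.antis_eq, add_comm]

/-- The number of homogeneous `(k + 1)`-sets in a union of `k` chains of almost equal sizes without
relations between them. -/
def opt (k n : ℕ) : ℕ := k * (n / k).choose (k + 1) + n % k * (n / k).choose k

theorem opt_eq_target (hk : 0 < k) (hb : b ≤ k) : opt k (k ^ 2 + (a * k + b)) = target k a b := by
  have h1 : k ^ 2 + (a * k + b) = b + k * (k + a) := by ring
  rw [opt, target, h1, Nat.add_mul_div_left _ _ hk, Nat.add_mul_mod_self_left]
  rcases eq_or_lt_of_le hb with rfl | hb
  · rw [Nat.div_self hk, Nat.mod_self, zero_mul, add_zero, add_comm 1, Nat.choose_succ_succ]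
    ring
  · rw [Nat.div_eq_of_lt hb, Nat.mod_eq_of_lt hb, zero_add]

theorem opt_eq_zero {n : ℕ} (hk : 0 < k) (hn : n ≤ k ^ 2) : opt k n = 0 := by
  have h1 := Nat.div_add_mod n k
  have h2 : n / k ≤ k := by
    have := Nat.div_le_div_right (c := k) hn
    rwa [pow_two, Nat.mul_div_cancel _ hk] at this
  rw [opt, Nat.choose_eq_zero_of_lt (by omega : n / k < k + 1), mul_zero, zero_add]
  rcases eq_or_lt_of_le h2 with h3 | h3
  · rw [h3] at h1
    have : n % k = 0 := by rw [pow_two] at hn; omega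
    rw [this, zero_mul]
  · rw [Nat.choose_eq_zero_of_lt h3, mul_zero]

/-- The tangent inequality for the convex function `c ↦ c.choose (k + 1)` on the integers. -/
theorem choose_tangent (hk : 1 ≤ k) (m c : ℕ) :
    m.choose (k + 1) + c * m.choose k ≤ c.choose (k + 1) + m * m.choose k ∧
      (k ≤ m → m.choose (k + 1) + c * m.choose k = c.choose (k + 1) + m * m.choose k →
        c = m ∨ c = m + 1) := by
  have hstep : ∀ i, k ≤ i + 1 → i.choose k < (i + 1).choose k := by
    intro i hi
    obtain ⟨k, rfl⟩ : ∃ k', k = k' + 1 := ⟨k - 1, by omega⟩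
    rw [show (i + 1).choose (k + 1) = i.choose k + i.choose (k + 1) from Nat.choose_succ_succ _ _]
    have := Nat.choose_pos (show k ≤ i by omega)
    omega
  rcases le_total c m with h | h
  · have key : ∀ d, (c + d).choose (k + 1) + c * (c + d).choose k ≤
        c.choose (k + 1) + (c + d) * (c + d).choose k ∧ (1 ≤ d → k ≤ c + d →
        (c + d).choose (k + 1) + c * (c + d).choose k <
        c.choose (k + 1) + (c + d) * (c + d).choose k) := by
      intro d
      induction d with
      | zero => exact ⟨le_rfl, fun h => by omega⟩
      | succ d ih =>
        have e1 : (c + (d + 1)).choose (k + 1) = (c + d).choose k + (c + d).choose (k + 1) :=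
          Nat.choose_succ_succ _ _
        have e2 : (c + d).choose k ≤ (c + (d + 1)).choose k :=
          Nat.choose_le_choose _ (by omega)
        have e3 : (d + 1) * (c + d).choose k ≤ (d + 1) * (c + (d + 1)).choose k :=
          Nat.mul_le_mul_left _ e2
        have e4 : (c + d) * (c + d).choose k = c * (c + d).choose k + d * (c + d).choose k := by
          ring
        have e5 : (c + (d + 1)) * (c + (d + 1)).choose k =
          c * (c + (d + 1)).choose k + (d + 1) * (c + (d + 1)).choose k := by ring
        have e6 : (d + 1) * (c + d).choose k = d * (c + d).choose k + (c + d).choose k := by ring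
        refine ⟨by omega, fun _ hkm => ?_⟩
        have e7 : (d + 1) * (c + d).choose k < (d + 1) * (c + (d + 1)).choose k :=
          Nat.mul_lt_mul_of_pos_left (hstep (c + d) (by omega)) (by omega)
        omega
    obtain ⟨d, rfl⟩ := Nat.exists_eq_add_of_le h
    refine ⟨(key d).1, fun hkm heq => ?_⟩
    rcases Nat.eq_zero_or_pos d with rfl | hd
    · exact Or.inl rfl
    · have := (key d).2 hd hkm
      omega
  · have key : ∀ d, m.choose (k + 1) + d * m.choose k ≤ (m + d).choose (k + 1) ∧
        (2 ≤ d → k ≤ m → m.choose (k + 1) + d * m.choose k < (m + d).choose (k + 1)) := by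
      intro d
      induction d with
      | zero => exact ⟨by simp, fun h => by omega⟩
      | succ d ih =>
        have e1 : (m + (d + 1)).choose (k + 1) = (m + d).choose k + (m + d).choose (k + 1) :=
          Nat.choose_succ_succ _ _
        have e2 : m.choose k ≤ (m + d).choose k := Nat.choose_le_choose _ (by omega)
        have e3 : (d + 1) * m.choose k = d * m.choose k + m.choose k := by ring
        refine ⟨by omega, fun hd hkm => ?_⟩
        have e4 : (m + 1).choose k ≤ (m + d).choose k := Nat.choose_le_choose _ (by omega)
        have e5 := hstep m (by omega)
        omega
    obtain ⟨d, rfl⟩ := Nat.exists_eq_add_of_le h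
    have e1 : (m + d) * m.choose k = m * m.choose k + d * m.choose k := by ring
    refine ⟨by have := (key d).1; omega, fun hkm heq => ?_⟩
    by_contra hcon
    have := (key d).2 (by omega) hkm
    omega

theorem sum_choose_level_le (hr : StrictRel r) {m h : ℕ} :
    ∑ j ∈ range h, (level r S j).card.choose (m + 1) ≤ (antis r (m + 1) S).card := by
  have h1 : ((range h).biUnion fun j => powersetCard (m + 1) (level r S j)).card =
      ∑ j ∈ range h, (level r S j).card.choose (m + 1) := by
    rw [card_biUnion]
    · exact sum_congr rfl fun j _ => card_powersetCard _ _
    · intro i _ j _ hij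
      change Disjoint _ _
      rw [disjoint_left]
      intro T hT hT'
      rw [mem_powersetCard] at hT hT'
      obtain ⟨t, ht⟩ := card_pos.1 (show 0 < T.card by omega)
      exact disjoint_left.1 (level_disjoint hij) (hT.1 ht) (hT'.1 ht)
  rw [← h1]
  refine card_le_card (biUnion_subset.2 fun j _ T hT => ?_)
  rw [mem_powersetCard] at hT
  exact mem_antis.2 ⟨hT.1.trans (level_subset _ _ _), hT.2, (antiOn_level hr j).mono hT.1⟩

/-- A decomposition into `k` chains or into `k` antichains, with parts of almost equal sizes if the
set is not too small. -/
def Splits (r : α → α → Prop) (S : Finset α) (k : ℕ) : Prop :=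
  ∃ C : Fin k → Finset α, (∀ i j, i ≠ j → Disjoint (C i) (C j)) ∧ univ.biUnion C = S ∧
    ((∀ i, ChainOn r (C i)) ∨ ∀ i, AntiOn r (C i)) ∧
    (k ^ 2 ≤ S.card + 2 → ∀ i, (C i).card = S.card / k ∨ (C i).card = S.card ⌈/⌉ k)

theorem Conj.splits (h : Conj r r') (hs : Splits r' S k) : Splits r S k := by
  obtain ⟨C, h1, h2, h3, h4⟩ := hs
  refine ⟨C, h1, h2, ?_, h4⟩
  simp only [h.chainOn_iff, h.antiOn_iff] at h3
  exact h3.symm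

theorem splits_of_levels (hr : StrictRel r) (hh : HeightLE r S k)
    (h : k ^ 2 ≤ S.card + 2 → ∀ j < k, (level r S j).card = S.card / k ∨
      (level r S j).card = S.card ⌈/⌉ k) : Splits r S k := by
  refine ⟨fun i => level r S i, fun i j hij => level_disjoint (Fin.val_ne_of_ne hij), ?_,
    Or.inr fun i => antiOn_level hr _, fun hn i => h hn i i.2⟩
  ext v
  simp only [mem_biUnion, mem_univ, true_and, mem_level]
  exact ⟨fun ⟨_, h, _⟩ => h, fun hv => ⟨⟨_, hh.lev_lt hr hv⟩, hv, rfl⟩⟩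

theorem ceilDiv_eq_of_mod_ne_zero {n k : ℕ} (hk : 0 < k) (h : n % k ≠ 0) :
    n ⌈/⌉ k = n / k + 1 := by
  rw [Nat.ceilDiv_eq_add_pred_div]
  have h1 := Nat.div_add_mod n k
  have h2 := Nat.mod_lt n hk
  have h3 : n + k - 1 = (n % k - 1) + k * (n / k + 1) := by rw [mul_add, mul_one]; omega
  rw [h3, Nat.add_mul_div_left _ _ hk, Nat.div_eq_of_lt (by omega), zero_add]

/-- With `k² - 2` or `k² - 1` elements, height and width at most `k`, the parts of a decomposition
can be chosen to be of almost equal sizes. -/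
theorem card_level_of_small (hc : Conj r r') (hk : 3 ≤ k) (hh : HeightLE r S k)
    (hw : WidthLE r S k) (h1 : k ^ 2 ≤ S.card + 2) (h2 : S.card < k ^ 2) : Splits r S k := by
  have hk2 : k ^ 2 = k * (k - 1) + k := by
    obtain ⟨c, rfl⟩ : ∃ c, k = c + 1 := ⟨k - 1, by omega⟩
    simp only [Nat.add_sub_cancel]; ring
  have hdiv : S.card / k = k - 1 := by
    refine Nat.div_eq_of_lt_le ?_ ?_
    · rw [mul_comm]; omega
    · rw [show k - 1 + 1 = k by omega, ← pow_two]; exact h2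
  have hmod : S.card % k ≠ 0 := by
    have := Nat.div_add_mod S.card k
    rw [hdiv] at this
    omega
  have hceil := ceilDiv_eq_of_mod_ne_zero (show 0 < k by omega) hmod
  rw [hdiv] at hceil
  have hle : ∀ j, (level r S j).card ≤ k := fun j =>
    hw _ (level_subset _ _ _) (antiOn_level hc.left j)
  by_cases hall : ∀ j < k, k - 1 ≤ (level r S j).card
  · refine splits_of_levels hc.left hh fun _ j hj => ?_
    rw [hdiv, hceil]
    have := hall j hj
    have := hle j
    omega
  push Not at hall
  obtain ⟨j₀, hj₀, hlt⟩ := hall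
  have hsum := sum_card_level hc.left hh
  -- all the other levels are antichains with `k` elements and meet all the levels of `r'`
  have hfull : ∀ j < k, j ≠ j₀ → (level r S j).card = k := by
    intro j hj hne
    by_contra hcon
    have h3 : ∑ i ∈ range k, ((level r S i).card + (if i = j₀ then 2 else 0) +
        if i = j then 1 else 0) ≤ ∑ i ∈ range k, k := by
      refine sum_le_sum fun i _ => ?_
      have := hle i
      split_ifs with h4 h5 h5
      · omega
      · subst h4; omega
      · subst h5; omega
      · omega
    rw [sum_add_distrib, sum_add_distrib, hsum, sum_ite_eq', sum_ite_eq', if_pos (mem_range.2 hj₀),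
      if_pos (mem_range.2 hj), sum_const, card_range, smul_eq_mul, ← pow_two] at h3
    omega
  refine hc.splits (splits_of_levels hc.right (hc.heightLE_iff.2 hw) fun _ i hi => ?_)
  have hle' : (level r' S i).card ≤ k :=
    hc.widthLE_iff.2 hh _ (level_subset _ _ _) (antiOn_level hc.right i)
  have hge : ((range k).erase j₀).card ≤ (level r' S i).card := by
    refine (card_le_card (t := (level r' S i).image (lev r S)) fun j hj => ?_).trans card_image_le
    rw [mem_erase, mem_range] at hj
    have h3 := (hc.chainOn_iff.2 (antiOn_level hc.left j)).image_lev hc.right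
      (hc.heightLE_iff.2 hw) (level_subset r S j) (hfull j hj.2 hj.1)
    have h4 : i ∈ (level r S j).image (lev r' S) := by rw [h3]; exact mem_range.2 hi
    obtain ⟨v, hv, hvi⟩ := mem_image.1 h4
    rw [mem_level] at hv
    exact mem_image.2 ⟨v, mem_level.2 ⟨hv.1, hvi⟩, hv.2⟩
  rw [card_erase_of_mem (mem_range.2 hj₀), card_range] at hge
  rw [hdiv, hceil]
  omega

theorem opt_le_hom_of_heightLE (hc : Conj r r') (hk : 3 ≤ k) (hh : HeightLE r S k) :
    opt k S.card ≤ hom r k S ∧ (hom r k S = opt k S.card → Splits r S k) := by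
  set n := S.card with hn
  set m := n / k with hm
  have hdm := Nat.div_add_mod n k
  rw [← hm] at hdm
  have hsum := sum_card_level hc.left hh
  have ht := fun j => choose_tangent (show 1 ≤ k by omega) m (level r S j).card
  have h1 := sum_le_sum fun j (_ : j ∈ range k) => (ht j).1
  have h2 : ∑ j ∈ range k, (m.choose (k + 1) + (level r S j).card * m.choose k) =
      k * m.choose (k + 1) + n * m.choose k := by
    rw [sum_add_distrib, ← sum_mul, hsum, sum_const, card_range, smul_eq_mul]
  have h3 : ∑ j ∈ range k, ((level r S j).card.choose (k + 1) + m * m.choose k) =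
      ∑ j ∈ range k, (level r S j).card.choose (k + 1) + k * m * m.choose k := by
    rw [sum_add_distrib, sum_const, card_range, smul_eq_mul, mul_assoc]
  have h4 : n * m.choose k = k * m * m.choose k + n % k * m.choose k := by
    rw [← add_mul, hdm]
  have h5 := sum_choose_level_le (S := S) (m := k) (h := k) hc.left
  have hopt : opt k n = k * m.choose (k + 1) + n % k * m.choose k := rfl
  have hhom : hom r k S = (chains r (k + 1) S).card + (antis r (k + 1) S).card := rfl
  refine ⟨by omega, fun heq => ?_⟩
  rcases Nat.lt_or_ge n (k ^ 2) with hlt | hge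
  · rcases Nat.lt_or_ge (n + 2) (k ^ 2) with hlt2 | hge2
    · exact splits_of_levels hc.left hh fun h => by omega
    · refine card_level_of_small hc hk hh ?_ hge2 hlt
      rw [opt_eq_zero (by omega) hlt.le] at heq
      intro T hT hTa
      by_contra hcon
      obtain ⟨U, hU, hUc⟩ := exists_subset_card_eq (show k + 1 ≤ T.card by omega)
      have := card_pos.2 ⟨U, mem_antis.2 ⟨hU.trans hT, hUc, hTa.mono hU⟩⟩
      omega
  · refine splits_of_levels hc.left hh fun _ j hj => ?_
    have hkm : k ≤ m := by rw [hm, Nat.le_div_iff_mul_le (by omega), ← pow_two]; exact hge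
    have h6 := (sum_eq_sum_iff_of_le fun j (_ : j ∈ range k) => (ht j).1).1 (by omega)
    have h7 : ∀ j < k, (level r S j).card = m ∨ (level r S j).card = m + 1 := fun j hj =>
      (ht j).2 hkm (h6 j (mem_range.2 hj))
    by_cases hmod : n % k = 0
    · left
      have h8 : ∑ j ∈ range k, m = ∑ j ∈ range k, (level r S j).card := by
        rw [hsum, sum_const, card_range, smul_eq_mul]; omega
      exact ((sum_eq_sum_iff_of_le fun j hj => by
        have := h7 j (mem_range.1 hj); omega).1 h8 j (mem_range.2 hj)).symm
    · rw [ceilDiv_eq_of_mod_ne_zero (by omega) hmod]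
      exact h7 j hj

theorem heightLE_of_chains_eq_empty (h : chains r (k + 1) S = ∅) : HeightLE r S k := by
  intro T hT hc
  by_contra hcon
  obtain ⟨U, hU, hUc⟩ := exists_subset_card_eq (show k + 1 ≤ T.card by omega)
  have : U ∈ chains r (k + 1) S := mem_chains.2 ⟨hU.trans hT, hUc, hc.mono hU⟩
  rw [h] at this
  simp at this

/-- If one of the two kinds of homogeneous sets is absent, the set is a union of `k` chains or of
`k` antichains, and the bound follows by convexity. -/
theorem opt_le_hom_of_not_both (hc : Conj r r') (hk : 3 ≤ k)
    (h : chains r (k + 1) S = ∅ ∨ antis r (k + 1) S = ∅) :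
    opt k S.card ≤ hom r k S ∧ (hom r k S = opt k S.card → Splits r S k) := by
  rcases h with h | h
  · exact opt_le_hom_of_heightLE hc hk (heightLE_of_chains_eq_empty h)
  · rw [← hc.chains_eq] at h
    have := opt_le_hom_of_heightLE hc.symm hk (heightLE_of_chains_eq_empty h)
    rw [hc.hom_eq] at this
    exact ⟨this.1, fun h' => hc.splits (this.2 h')⟩

end

section
variable {r r' : α → α → Prop} {S : Finset α} {k a b l g : ℕ}

/-! ### Sets with both kinds of homogeneous sets -/

/-- The number of homogeneous `(k + 1)`-sets that contain `x`. -/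
noncomputable def deg (r : α → α → Prop) (k : ℕ) (S : Finset α) (x : α) : ℕ :=
  ((chains r (k + 1) S).filter (x ∈ ·)).card + ((antis r (k + 1) S).filter (x ∈ ·)).card

theorem hom_erase_add_deg (r : α → α → Prop) (k : ℕ) (S : Finset α) (x : α) :
    hom r k (S.erase x) + deg r k S x = hom r k S := by
  have h1 : chains r (k + 1) (S.erase x) = (chains r (k + 1) S).filter (x ∉ ·) := by
    ext T
    simp only [mem_filter, mem_chains, subset_erase]
    tauto
  have h2 : antis r (k + 1) (S.erase x) = (antis r (k + 1) S).filter (x ∉ ·) := by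
    ext T
    simp only [mem_filter, mem_antis, subset_erase]
    tauto
  have h3 := card_filter_add_card_filter_not (s := chains r (k + 1) S) (x ∈ ·)
  have h4 := card_filter_add_card_filter_not (s := antis r (k + 1) S) (x ∈ ·)
  unfold hom deg
  rw [h1, h2]
  omega

theorem choose_le_filter_antis {A : Finset α} (hAS : A ⊆ S) (hA : AntiOn r A) {x : α}
    (hx : x ∈ A) : (A.card - 1).choose k ≤ ((antis r (k + 1) S).filter (x ∈ ·)).card := by
  have h1 : ((powersetCard k (A.erase x)).image (insert x)).card = (A.card - 1).choose k := by
    rw [card_image_of_injOn, card_powersetCard, card_erase_of_mem hx]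
    intro T hT U hU h
    have hxT : x ∉ T := fun h => by simpa using (mem_powersetCard.1 hT).1 h
    have hxU : x ∉ U := fun h => by simpa using (mem_powersetCard.1 hU).1 h
    rw [← erase_insert hxT, ← erase_insert hxU, h]
  rw [← h1]
  refine card_le_card fun T hT => ?_
  obtain ⟨U, hU, rfl⟩ := mem_image.1 hT
  rw [mem_powersetCard] at hU
  have hUA : insert x U ⊆ A := insert_subset hx (hU.1.trans (erase_subset _ _))
  rw [mem_filter, mem_antis]
  refine ⟨⟨hUA.trans hAS, ?_, hA.mono hUA⟩, mem_insert_self _ _⟩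
  rw [card_insert_of_notMem fun h => by simpa using hU.1 h, hU.2]

theorem card_filter_chains_pos {T : Finset α} {x : α} (hT : T ∈ chains r (k + 1) S) (hx : x ∈ T) :
    0 < ((chains r (k + 1) S).filter (x ∈ ·)).card :=
  card_pos.2 ⟨T, mem_filter.2 ⟨hT, hx⟩⟩

theorem card_filter_antis_pos {T : Finset α} {x : α} (hT : T ∈ antis r (k + 1) S) (hx : x ∈ T) :
    0 < ((antis r (k + 1) S).filter (x ∈ ·)).card :=
  card_pos.2 ⟨T, mem_filter.2 ⟨hT, hx⟩⟩

theorem exists_hom_of_card (hc : Conj r r') (h : k ^ 2 < S.card) :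
    (chains r (k + 1) S).Nonempty ∨ (antis r (k + 1) S).Nonempty := by
  by_contra hcon
  rw [not_or, not_nonempty_iff_eq_empty, not_nonempty_iff_eq_empty, ← hc.chains_eq] at hcon
  have := card_le_mul hc.left (heightLE_of_chains_eq_empty hcon.1)
    (hc.heightLE_iff.1 (heightLE_of_chains_eq_empty hcon.2))
  rw [← pow_two] at this
  omega

/-- Removing an element of a homogeneous set lowers the surplus by one and the count by at least
one. -/
theorem le_hom (hc : Conj r r') {q : ℕ} (h : k ^ 2 + q ≤ S.card) : q ≤ hom r k S := by
  induction q generalizing S with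
  | zero => exact Nat.zero_le _
  | succ q ih =>
    have key : ∀ x ∈ S, 1 ≤ deg r k S x → q + 1 ≤ hom r k S := by
      intro x hx hd
      have h1 := ih (S := S.erase x) (by rw [card_erase_of_mem hx]; omega)
      have h2 := hom_erase_add_deg r k S x
      omega
    rcases exists_hom_of_card hc (show k ^ 2 < S.card by omega) with ⟨T, hT⟩ | ⟨T, hT⟩
    · have hT' := mem_chains.1 hT
      obtain ⟨x, hx⟩ := card_pos.1 (show 0 < T.card by omega)
      have := card_filter_chains_pos hT hx
      exact key x (hT'.1 hx) (by unfold deg; omega)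
    · have hT' := mem_antis.1 hT
      obtain ⟨x, hx⟩ := card_pos.1 (show 0 < T.card by omega)
      have := card_filter_antis_pos hT hx
      exact key x (hT'.1 hx) (by unfold deg; omega)

/-- A set with more than `k² + 1` elements cannot have exactly one large chain and exactly one
large antichain, if these are disjoint. -/
theorem not_unique_chain_anti (hc : Conj r r') (hk : 1 ≤ k) (hS : k ^ 2 + 2 ≤ S.card)
    {C A : Finset α} (hC : chains r (k + 1) S = {C}) (hA : antis r (k + 1) S = {A})
    (hd : Disjoint C A) : False := by
  have hC' := mem_chains.1 (hC ▸ mem_singleton_self C)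
  have hA' := mem_antis.1 (hA ▸ mem_singleton_self A)
  obtain ⟨y, hy⟩ := card_pos.1 (show 0 < A.card by omega)
  -- Without `y` there is no large antichain, so that the set decomposes into `k` chains, namely the
  -- levels of `r'`. One of these contains `k + 1` elements and is contained in `C`.
  set S' := S.erase y with hS'
  have hSc : S'.card = S.card - 1 := card_erase_of_mem (hA'.1 hy)
  have hh : HeightLE r' S' k := by
    refine heightLE_of_chains_eq_empty ?_
    rw [hc.chains_eq, eq_empty_iff_forall_notMem]
    intro T hT
    have h1 : T ∈ antis r (k + 1) S := antis_mono (erase_subset _ _) hT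
    rw [hA, mem_singleton] at h1
    subst h1
    exact notMem_erase y S ((mem_antis.1 hT).1 hy)
  have hsum := sum_card_level hc.right hh
  obtain ⟨j, hj, hjc⟩ : ∃ j ∈ range k, k + 1 ≤ (level r' S' j).card := by
    by_contra! hcon
    have h1 : ∑ j ∈ range k, (level r' S' j).card ≤ ∑ j ∈ range k, k :=
      sum_le_sum fun j hj => by have := hcon j hj; omega
    rw [hsum, sum_const, card_range, smul_eq_mul, ← pow_two] at h1
    omega
  have hLS : level r' S' j ⊆ S := (level_subset _ _ _).trans (erase_subset _ _)
  have hLc : ChainOn r (level r' S' j) := hc.antiOn_iff.1 (antiOn_level hc.right j)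
  have huniq : ∀ T ⊆ level r' S' j, T.card = k + 1 → T = C := fun T hT hTc => by
    have h1 : T ∈ chains r (k + 1) S := mem_chains.2 ⟨hT.trans hLS, hTc, hLc.mono hT⟩
    rwa [hC, mem_singleton] at h1
  have hLC : level r' S' j ⊆ C := by
    intro v hv
    obtain ⟨T, hvT, hT, hTc⟩ := exists_subsuperset_card_eq (n := k + 1)
      (singleton_subset_iff.2 hv) (by simp) hjc
    rw [← huniq T hT hTc]
    exact hvT (mem_singleton_self v)
  -- the other `k - 1` levels of `r'` contain the `k` elements of `A` other than `y`
  have h2 : (A.erase y).card ≤ ((range k).erase j).card := by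
    have h3 : Set.InjOn (lev r' S') (A.erase y : Set α) :=
      ((hc.chainOn_iff.2 hA'.2.2).mono (erase_subset _ _)).lev_inj hc.right
        (erase_subset_erase _ hA'.1)
    refine card_le_card_of_injOn (lev r' S') (fun v hv => ?_) h3
    have hv' := mem_coe.1 hv
    have hvS : v ∈ S' := erase_subset_erase _ hA'.1 hv'
    rw [mem_coe, mem_erase, mem_range]
    refine ⟨fun h => ?_, hh.lev_lt hc.right hvS⟩
    exact disjoint_left.1 hd (hLC (mem_level.2 ⟨hvS, h⟩)) (mem_of_mem_erase hv')
  rw [card_erase_of_mem hy, card_erase_of_mem hj, card_range, hA'.2.1] at h2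
  omega

/-- A weak bound for small surpluses, by removing elements one at a time until the large chains and
antichains become unique and disjoint. -/
theorem lt_hom_of_both (hc : Conj r r') (hk : 1 ≤ k) {q : ℕ} (hq : 1 ≤ q)
    (hS : S.card = k ^ 2 + q) (h1 : (chains r (k + 1) S).Nonempty)
    (h2 : (antis r (k + 1) S).Nonempty) : q < hom r k S := by
  induction q, hq using Nat.le_induction generalizing S with
  | base =>
    have := card_pos.2 h1
    have := card_pos.2 h2
    unfold hom
    omega
  | succ q hq ih =>
    by_contra hcon
    -- If there are at most `q + 1` homogeneous sets, then no element lies in two of them.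
    have hdeg : ∀ x ∈ S, deg r k S x ≤ 1 := by
      intro x hx
      have h3 := le_hom (q := q) (S := S.erase x) (k := k) hc (by
        rw [card_erase_of_mem hx]; omega)
      have h4 := hom_erase_add_deg r k S x
      omega
    -- By induction, no element of a homogeneous set can be removed that leaves sets of both kinds.
    have hstep : ∀ x ∈ S, 1 ≤ deg r k S x → (∃ C ∈ chains r (k + 1) S, x ∉ C) →
        (∃ A ∈ antis r (k + 1) S, x ∉ A) → False := by
      rintro x hx hd ⟨C, hC, hxC⟩ ⟨A, hA, hxA⟩
      have hC' := mem_chains.1 hC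
      have hA' := mem_antis.1 hA
      have h3 := ih (S := S.erase x) (by rw [card_erase_of_mem hx]; omega)
        ⟨C, mem_chains.2 ⟨subset_erase.2 ⟨hC'.1, hxC⟩, hC'.2⟩⟩
        ⟨A, mem_antis.2 ⟨subset_erase.2 ⟨hA'.1, hxA⟩, hA'.2⟩⟩
      have h4 := hom_erase_add_deg r k S x
      omega
    obtain ⟨C, hC⟩ := h1
    obtain ⟨A, hA⟩ := h2
    have hC' := mem_chains.1 hC
    have hA' := mem_antis.1 hA
    have hd : ∀ C ∈ chains r (k + 1) S, ∀ A ∈ antis r (k + 1) S, Disjoint C A := by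
      intro C hC A hA
      rw [disjoint_left]
      intro x hxC hxA
      have h3 := hdeg x ((mem_chains.1 hC).1 hxC)
      have h4 := card_filter_chains_pos hC hxC
      have h5 := card_filter_antis_pos hA hxA
      unfold deg at h3
      omega
    refine not_unique_chain_anti (S := S) hc hk (by omega) (C := C) (A := A) ?_ ?_ (hd C hC A hA)
    · refine eq_singleton_iff_unique_mem.2 ⟨hC, fun C₂ hC₂ => ?_⟩
      by_contra hne
      have hC₂' := mem_chains.1 hC₂
      obtain ⟨x, hx, hxC⟩ : ∃ x ∈ C₂, x ∉ C := by
        by_contra! hsub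
        exact hne (eq_of_subset_of_card_le hsub (by omega))
      have := card_filter_chains_pos hC₂ hx
      exact hstep x (hC₂'.1 hx) (by unfold deg; omega) ⟨C, hC, hxC⟩
        ⟨A, hA, disjoint_left.1 (hd C₂ hC₂ A hA) hx⟩
    · refine eq_singleton_iff_unique_mem.2 ⟨hA, fun A₂ hA₂ => ?_⟩
      by_contra hne
      have hA₂' := mem_antis.1 hA₂
      obtain ⟨x, hx, hxA⟩ : ∃ x ∈ A₂, x ∉ A := by
        by_contra! hsub
        exact hne (eq_of_subset_of_card_le hsub (by omega))
      have := card_filter_antis_pos hA₂ hx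
      exact hstep x (hA₂'.1 hx) (by unfold deg; omega)
        ⟨C, hC, disjoint_right.1 (hd C hC A₂ hA₂) hx⟩ ⟨A, hA, hxA⟩

/-- A set with `k² + ak + b` elements has robust height or robust width: otherwise one could lower
both the height and the width to `k` by removing few elements, which would leave at most `k²`
elements. -/
theorem robust_or_robust (hc : Conj r r') (hp : Params k a b l g)
    (hS : S.card = k ^ 2 + (a * k + b)) (hh : HeightLE r S (k + a)) (hw : WidthLE r S (k + a))
    (hfew : hom r k S < 2 ^ g) :
    Robust r S k a b g ∨ Robust r' S k a b g := by
  have hak := hp.a_le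
  have hgk := hp.g_le
  have ha := hp.one_le_a
  have hfc : (chains r (k + 1) S).card < 2 ^ g := by unfold hom at hfew; omega
  have hfa : (antis r (k + 1) S).card < 2 ^ g := by unfold hom at hfew; omega
  have hs : Scarce r S k a g := ⟨hc.left, hw, hfa, by omega⟩
  have hs' : Scarce r' S k a g := ⟨hc.right, hc.widthLE_iff.2 hh, by rwa [hc.antis_eq], by omega⟩
  have hfc' : (chains r' (k + 1) S).card < 2 ^ g := by rwa [hc.chains_eq]
  by_contra hcon
  rw [not_or] at hcon
  have hgag : g * (a + g) ≤ 2 * g ^ 2 := by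
    calc g * (a + g) ≤ g * (2 * g) := Nat.mul_le_mul_left _ (by omega)
      _ = _ := by ring
  have haa : a * a ≤ g ^ 2 := by rw [pow_two]; exact Nat.mul_le_mul hak hak
  have hg2 := hp.hg2
  have hgg : g ≤ g ^ 2 := Nat.le_self_pow two_ne_zero _
  have key : ∀ r' : α → α → Prop, Scarce r' S k a g → HeightLE r' S (k + a) →
      (chains r' (k + 1) S).card < 2 ^ g → ¬ Robust r' S k a b g →
      ∃ V ⊆ S, 4 * V.card ≤ a * k ∧ HeightLE r' (S \ V) k := by
    intro r' hs hh hf hnot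
    have : ∃ V ⊆ S, 8 * V.card ≤ k ∧ HeightLE r' (S \ V) (k + a - 1) := by
      by_contra! hall
      exact hnot ⟨hs, hh, fun V hV h8 h => hall V hV h8 h, hf, by omega⟩
    obtain ⟨V, hV, hV8, hVh⟩ := this
    have hVc := card_sdiff_of_subset hV
    have hVle := card_le_card hV
    obtain ⟨V₂, hV₂, hV₂c, hV₂h⟩ := hs.exists_height_le hf (show g * (a + g) ≤ k by omega)
      (d := a - 1) (by omega) (S' := S \ V) sdiff_subset
      (by rwa [show k + (a - 1) = k + a - 1 by omega]) (fun _ => by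
        have e1 : (k + (a - 1)) * k + k = k ^ 2 + a * k := by
          obtain ⟨c, rfl⟩ : ∃ c, a = c + 1 := ⟨a - 1, by omega⟩
          simp only [Nat.add_sub_cancel]; ring
        omega)
    refine ⟨V ∪ V₂, union_subset hV (hV₂.trans sdiff_subset), ?_, ?_⟩
    · have h1 := card_union_le V V₂
      have h2 : (a - 1) * (g * (a + g)) ≤ a * (2 * g ^ 2) := Nat.mul_le_mul (by omega) hgag
      have h3 : a * (16 * g ^ 2) ≤ a * k := Nat.mul_le_mul_left _ (by omega)
      have h4 : a * (16 * g ^ 2) = 8 * (a * (2 * g ^ 2)) := by ring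
      have h5 : k ≤ a * k := Nat.le_mul_of_pos_left _ ha
      omega
    · rwa [← sup_eq_union, ← sdiff_sdiff_left]
  obtain ⟨V, hV, hVc, hVh⟩ := key r hs hh hfc hcon.1
  obtain ⟨V', hV', hVc', hVh'⟩ := key r' hs' (hc.heightLE_iff.2 hw) hfc' hcon.2
  have h1 := card_le_mul hc.left (hVh.mono (sdiff_subset_sdiff Subset.rfl subset_union_left))
    (hc.heightLE_iff.1 (hVh'.mono (sdiff_subset_sdiff Subset.rfl subset_union_right)))
  have h2 := le_card_sdiff (V ∪ V') S
  have h3 := card_union_le V V'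
  have h4 : k ≤ a * k := Nat.le_mul_of_pos_left _ ha
  rw [← pow_two] at h1
  have := hp.one_le_b
  omega

/-- In a tight set, every large antichain meets a large chain. -/
theorem Tight.exists_chain_meets {z : Fin k → ℕ → α} (ht : Tight r S k z) (hk : 2 ≤ k)
    {A : Finset α} (hA : A ∈ antis r (k + 1) S) :
    ∃ T ∈ chains r (k + 1) S, ¬ Disjoint T A := by
  have hr := ht.strict
  have hz := ht.strands
  obtain ⟨p, hpA⟩ : ∃ p, z p 0 ∈ A := by
    rcases ht.antis_eq A hA with rfl | ⟨p, hp, rfl⟩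
    · exact ⟨⟨0, by omega⟩, hz.mem _ 0 le_rfl (by omega)⟩
    · obtain ⟨q, hq⟩ : ∃ q : Fin k, q ≠ p := by
        have : Nontrivial (Fin k) := Fin.nontrivial_iff_two_le.2 hk
        exact exists_ne p
      refine ⟨q, mem_insert_of_mem (mem_sdiff.2 ⟨hz.mem _ 0 le_rfl (by omega), fun h => hq ?_⟩)⟩
      obtain ⟨w, hw⟩ := card_eq_one.1 hp
      have h1 := hz.mem_below_self p (show 0 < k by omega)
      rw [zero_add] at h1
      rw [hw, mem_singleton] at h h1
      exact hz.inj 0 le_rfl (by omega) (h.trans h1.symm)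
  refine ⟨(range (k + 1)).image (z p), ?_, ?_⟩
  · rw [mem_chains]
    refine ⟨image_subset_iff.2 fun j hj => level_subset _ _ _ (hz.mem p j (Nat.zero_le _)
      (mem_range.1 hj)), ?_, ?_⟩
    · rw [card_image_of_injOn, card_range]
      intro i hi j hj hij
      have h1 := (mem_level.1 (hz.mem p i (Nat.zero_le _) (by simpa using hi))).2
      have h2 := (mem_level.1 (hz.mem p j (Nat.zero_le _) (by simpa using hj))).2
      rw [← h1, ← h2, hij]
    · intro x hx y hy hne
      obtain ⟨i, hi, rfl⟩ := mem_image.1 hx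
      obtain ⟨j, hj, rfl⟩ := mem_image.1 hy
      rw [mem_range] at hi hj
      rcases lt_trichotomy i j with h | rfl | h
      · exact Or.inl (hz.lt_of_lt hr p (Nat.zero_le _) h hj)
      · exact absurd rfl hne
      · exact Or.inr (hz.lt_of_lt hr p (Nat.zero_le _) h hi)
  · rw [not_disjoint_iff]
    exact ⟨z p 0, mem_image.2 ⟨0, by simp, rfl⟩, hpA⟩

theorem Tight.exists_anti_meets {z : Fin k → ℕ → α} (ht : Tight r S k z)
    {T : Finset α} (hT : T ∈ chains r (k + 1) S) :
    ∃ A ∈ antis r (k + 1) S, ¬ Disjoint A T := by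
  have hT' := mem_chains.1 hT
  have h1 := hT'.2.2.image_lev ht.strict ht.height hT'.1 hT'.2.1
  have h2 : 0 ∈ T.image (lev r S) := by rw [h1]; simp
  obtain ⟨x, hx, hx0⟩ := mem_image.1 h2
  refine ⟨level r S 0, mem_antis.2 ⟨level_subset _ _ _, ht.card_zero, antiOn_level ht.strict 0⟩,
    not_disjoint_iff.2 ⟨x, mem_level.2 ⟨hT'.1 hx, hx0⟩, hx⟩⟩

/-- One of the two orders, or its reverse, is tight. -/
def TightPair (r r' : α → α → Prop) (S : Finset α) (k : ℕ) : Prop :=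
  ∃ z, Tight r S k z ∨ Tight (flip r) S k z ∨ Tight r' S k z ∨ Tight (flip r') S k z

theorem TightPair.symm (h : TightPair r r' S k) : TightPair r' r S k := by
  obtain ⟨z, h⟩ := h
  exact ⟨z, by tauto⟩

theorem TightPair.exists_chain_meets (h : TightPair r r' S k) (hc : Conj r r') (hk : 2 ≤ k)
    {A : Finset α} (hA : A ∈ antis r (k + 1) S) :
    ∃ T ∈ chains r (k + 1) S, ¬ Disjoint T A := by
  obtain ⟨z, h | h | h | h⟩ := h
  · exact h.exists_chain_meets hk hA
  · rw [← antis_flip] at hA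
    rw [← chains_flip]
    exact h.exists_chain_meets hk hA
  · rw [← hc.chains_eq] at hA
    rw [← hc.antis_eq]
    exact h.exists_anti_meets hA
  · rw [← hc.chains_eq, ← chains_flip] at hA
    rw [← hc.antis_eq, ← antis_flip]
    exact h.exists_anti_meets hA

end

section
variable {r r' : α → α → Prop} {S : Finset α} {k a b l g q : ℕ}

/-- The lower bound for sets with `k² + q` elements that have both a chain and an antichain of
`k + 1` elements: the bound is strict except for tight sets. The average surplus `q / k` is
restricted by `m`. -/
def BothBound (r r' : α → α → Prop) (k m q : ℕ) : Prop :=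
  ∀ a b, q = a * k + b → 1 ≤ b → b ≤ k → a ≤ m → ∀ S : Finset α, S.card = k ^ 2 + q →
    (chains r (k + 1) S).Nonempty → (antis r (k + 1) S).Nonempty →
    target k a b < hom r k S ∨
      (a = 1 ∧ b = 1 ∧ target k a b = hom r k S ∧ TightPair r r' S k)

theorem BothBound.symm {m : ℕ} (hc : Conj r r') (h : BothBound r r' k m q) :
    BothBound r' r k m q := by
  intro a b hq hb hbk ha S hS h1 h2
  rw [hc.chains_eq] at h1
  rw [hc.antis_eq] at h2
  rw [hc.hom_eq]
  exact (h a b hq hb hbk ha S hS h2 h1).imp_right fun ⟨e1, e2, e3, e4⟩ => ⟨e1, e2, e3, e4.symm⟩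

theorem target_succ (k a b : ℕ) : target k a (b + 1) = target k a b + (k + a).choose k := by
  unfold target; ring

theorem target_one (k a : ℕ) :
    target k (a + 1) 1 = target k a k + (k + (a + 1)).choose k := by
  have : (k + (a + 1)).choose (k + 1) = (k + a).choose k + (k + a).choose (k + 1) :=
    Nat.choose_succ_succ _ _
  unfold target
  rw [this]
  ring

/-- Sets of large width: removing an element of a large antichain, one reduces the surplus by one,
and loses many antichains. -/
theorem BothBound.of_large_anti {m : ℕ} (hc : Conj r r') (hk : 3 ≤ k)
    (ih : BothBound r r' k m (a * k + b - 1)) (ha : 1 ≤ a) (hb : 1 ≤ b) (hbk : b ≤ k) (ham : a ≤ m)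
    (hS : S.card = k ^ 2 + (a * k + b)) (h1 : (chains r (k + 1) S).Nonempty) {A : Finset α}
    (hAS : A ⊆ S) (hA : AntiOn r A) (hAc : A.card = k + a + 1) : target k a b < hom r k S := by
  obtain ⟨C, hC⟩ := h1
  have hC' := mem_chains.1 hC
  obtain ⟨x, hxA, hxC⟩ : ∃ x ∈ A, x ∉ C := by
    by_contra! hsub
    have := hC'.2.2.card_inter_le hA
    rw [inter_eq_right.2 hsub] at this
    omega
  have hdeg : ∀ y ∈ A, (k + a).choose k ≤ ((antis r (k + 1) S).filter (y ∈ ·)).card := by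
    intro y hy
    have := choose_le_filter_antis (k := k) hAS hA hy
    rwa [hAc, Nat.add_sub_cancel] at this
  have hcard : ∀ y ∈ S, (S.erase y).card = k ^ 2 + (a * k + b - 1) := by
    intro y hy
    rw [card_erase_of_mem hy]
    omega
  have hCx : (chains r (k + 1) (S.erase x)).Nonempty :=
    ⟨C, mem_chains.2 ⟨subset_erase.2 ⟨hC'.1, hxC⟩, hC'.2⟩⟩
  have hAx : (antis r (k + 1) (S.erase x)).Nonempty := by
    obtain ⟨U, hU, hUc⟩ := exists_subset_card_eq (s := A.erase x) (n := k + 1) (by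
      rw [card_erase_of_mem hxA]; omega)
    exact ⟨U, mem_antis.2 ⟨hU.trans (erase_subset_erase _ hAS), hUc,
      hA.mono (hU.trans (erase_subset _ _))⟩⟩
  obtain ⟨a', b', hq, hb', hbk', ham', hta⟩ : ∃ a' b', a * k + b - 1 = a' * k + b' ∧ 1 ≤ b' ∧
      b' ≤ k ∧ a' ≤ m ∧ target k a b = target k a' b' + (k + a).choose k ∧
      (b = 1 → b' = k) ∧ (b ≠ 1 → a' = a ∧ b = b' + 1) := by
    by_cases hb1 : b = 1
    · obtain ⟨c, rfl⟩ : ∃ c, a = c + 1 := ⟨a - 1, by omega⟩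
      subst hb1
      exact ⟨c, k, by rw [Nat.add_sub_cancel]; ring, by omega, le_rfl, by omega, target_one k c,
        fun _ => rfl, fun h => absurd rfl h⟩
    · obtain ⟨c, rfl⟩ : ∃ c, b = c + 1 := ⟨b - 1, by omega⟩
      exact ⟨a, c, by omega, by omega, by omega, ham, target_succ k a c, fun h => absurd h hb1,
        fun _ => ⟨rfl, rfl⟩⟩
  obtain ⟨hta, hbb, hbb'⟩ := hta
  have hx := hom_erase_add_deg r k S x
  have hdx : (k + a).choose k ≤ deg r k S x := (hdeg x hxA).trans (Nat.le_add_left _ _)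
  rcases ih a' b' hq hb' hbk' ham' _ (hcard x (hAS hxA)) hCx hAx with h | ⟨rfl, rfl, h, ht⟩
  · omega
  -- Equality for `S.erase x` is possible only in the tight case, in which some element `y` of `A`
  -- lies on a large chain as well. Removing `y` instead of `x` gives one more homogeneous set.
  by_contra hcon
  obtain ⟨rfl, rfl⟩ := hbb' (fun h => by have := hbb h; omega)
  obtain ⟨T, hT, hmeet⟩ := ht.exists_chain_meets hc (by omega) (A := A.erase x)
    (mem_antis.2 ⟨erase_subset_erase _ hAS, by rw [card_erase_of_mem hxA]; omega,
      hA.mono (erase_subset _ _)⟩)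
  obtain ⟨y, hyT, hyA⟩ := not_disjoint_iff.1 hmeet
  have hyA' := mem_of_mem_erase hyA
  have hy := hom_erase_add_deg r k S y
  have hdy : (k + 1).choose k + 1 ≤ deg r k S y := by
    have h1 := hdeg y hyA'
    have h2 := card_filter_chains_pos (chains_mono (erase_subset _ _) hT) hyT
    unfold deg
    omega
  have hge : target k 1 1 ≤ hom r k (S.erase y) := by
    by_cases hboth : (chains r (k + 1) (S.erase y)).Nonempty ∧
        (antis r (k + 1) (S.erase y)).Nonempty
    · rcases ih 1 1 hq le_rfl hbk' ham' _ (hcard y (hAS hyA')) hboth.1 hboth.2 with h | h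
      · omega
      · exact h.2.2.1.le
    · have h1 := (opt_le_hom_of_not_both (S := S.erase y) hc hk (by
        rw [not_and_or, not_nonempty_iff_eq_empty, not_nonempty_iff_eq_empty] at hboth
        exact hboth)).1
      rwa [hcard y (hAS hyA'), hq, opt_eq_target (by omega) hbk'] at h1
  omega

/-- Induction on the surplus `q`: either the set has robust height or width, or an element can be
removed. -/
theorem bothBound (hc : Conj r r') (hk : 3 ≤ k) {m : ℕ}
    (hP : ∀ a b, 1 ≤ a → a ≤ m → 1 ≤ b → b ≤ k → Params k a b l (l * (a + 2))) (q : ℕ) :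
    BothBound r r' k m q := by
  induction q with
  | zero => intro a b hq hb; omega
  | succ q ih =>
    intro a b hq hb hbk ham S hS h1 h2
    rw [hq] at hS
    rcases Nat.eq_zero_or_pos a with rfl | ha
    · left
      have h3 := lt_hom_of_both hc (by omega) hb (by rw [hS]; omega) h1 h2
      have h4 : target k 0 b = b := by
        simp [target]
      rwa [h4]
    have hp := hP a b ha ham hb hbk
    have hq' : q = a * k + b - 1 := by omega
    rw [hq'] at ih
    by_cases hw : WidthLE r S (k + a)
    · by_cases hh : HeightLE r S (k + a)
      · rcases Nat.lt_or_ge (target k a b) (hom r k S) with h | h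
        · exact Or.inl h
        rcases robust_or_robust hc hp hS hh hw (h.trans_lt hp.target_lt) with hm | hm
        · rcases hm.target_le_or_tight hp with h' | ⟨h', ha1, hb1, z, h3⟩
          · exact Or.inl h'
          · exact Or.inr ⟨ha1, hb1, h', z, by tauto⟩
        · have h4 := hc.hom_eq (k := k) (S := S)
          rcases hm.target_le_or_tight hp with h' | ⟨h', ha1, hb1, z, h3⟩
          · rw [← h4]; exact Or.inl h'
          · rw [← h4]; exact Or.inr ⟨ha1, hb1, h', z, by tauto⟩
      · left
        obtain ⟨A, hAS, hA, hAc⟩ := exists_chain_of_not_heightLE hh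
        rw [← hc.antis_eq] at h1
        rw [← hc.chains_eq] at h2
        rw [← hc.hom_eq]
        exact (ih.symm hc).of_large_anti hc.symm hk ha hb hbk ham hS h2 hAS
          (hc.antiOn_iff.2 hA) hAc
    · left
      rw [← hc.heightLE_iff] at hw
      obtain ⟨A, hAS, hA, hAc⟩ := exists_chain_of_not_heightLE hw
      exact ih.of_large_anti hc hk ha hb hbk ham hS h1 hAS (hc.chainOn_iff.1 hA) hAc

/-- The lower bound and the extremal sets in terms of a pair of orders. -/
theorem opt_le_hom (hc : Conj r r') (hk : 3 ≤ k) {m : ℕ}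
    (hP : ∀ a b, 1 ≤ a → a ≤ m → 1 ≤ b → b ≤ k → Params k a b l (l * (a + 2)))
    (hS : S.card ≤ k ^ 2 + m * k + k) :
    opt k S.card ≤ hom r k S ∧ (hom r k S = opt k S.card →
      Splits r S k ∨ (S.card = k ^ 2 + k + 1 ∧ TightPair r r' S k)) := by
  by_cases hboth : (chains r (k + 1) S).Nonempty ∧ (antis r (k + 1) S).Nonempty
  · rcases Nat.lt_or_ge (k ^ 2) S.card with hlt | hge
    · obtain ⟨a, b, hab, hb, hbk⟩ : ∃ a b, S.card - k ^ 2 = a * k + b ∧ 1 ≤ b ∧ b ≤ k := by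
        refine ⟨(S.card - k ^ 2 - 1) / k, (S.card - k ^ 2 - 1) % k + 1, ?_, by omega,
          Nat.mod_lt _ (by omega)⟩
        have := Nat.div_add_mod (S.card - k ^ 2 - 1) k
        rw [mul_comm] at this
        omega
      have ham : a ≤ m := by
        by_contra hcon
        have : (m + 1) * k ≤ a * k := Nat.mul_le_mul_right _ (by omega)
        rw [add_mul, one_mul] at this
        omega
      have hcard : S.card = k ^ 2 + (a * k + b) := by omega
      have hopt : opt k S.card = target k a b := by rw [hcard, opt_eq_target (by omega) hbk]
      rw [hopt]
      rcases bothBound hc hk hP _ a b rfl hb hbk ham S hcard hboth.1 hboth.2 with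
        h | ⟨rfl, rfl, h, ht⟩
      · exact ⟨h.le, fun h' => by omega⟩
      · exact ⟨h.le, fun _ => Or.inr ⟨by omega, ht⟩⟩
    · rw [opt_eq_zero (by omega) hge]
      refine ⟨Nat.zero_le _, fun h => ?_⟩
      have := card_pos.2 hboth.1
      unfold hom at h
      omega
  · rw [not_and_or, not_nonempty_iff_eq_empty, not_nonempty_iff_eq_empty] at hboth
    have := opt_le_hom_of_not_both hc hk hboth
    exact ⟨this.1, fun h => Or.inl (this.2 h)⟩

end

section
variable {r r' : α → α → Prop} {S : Finset α} {k a b l g q : ℕ}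

/-! ### The structure of the extremal sets -/

theorem rank_lt_iff (hr : StrictRel r) {A : Finset α} (hA : ChainOn r A) {x y : α} (hx : x ∈ A)
    (hy : y ∈ A) : lev r A x < lev r A y ↔ r x y := by
  refine ⟨fun h => ?_, fun h => lev_lt hr hx h⟩
  have hne : x ≠ y := by rintro rfl; omega
  rcases hA x hx y hy hne with h' | h'
  · exact h'
  · have := lev_lt hr hy h'
    omega

theorem exists_rank (hr : StrictRel r) {A : Finset α} (hA : ChainOn r A) {i : ℕ}
    (hi : i < A.card) : ∃ x ∈ A, lev r A x = i := by
  have h := hA.image_lev hr (S := A) (h := A.card) (fun T hT _ => card_le_card hT) Subset.rfl rfl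
  exact mem_image.1 (by rw [h]; exact mem_range.2 hi)

theorem rank_lt (hr : StrictRel r) {A : Finset α} {x : α} (hx : x ∈ A) : lev r A x < A.card :=
  HeightLE.lev_lt hr (fun _ hT _ => card_le_card hT) hx

/-- The lower neighbours of an element of the second level form an interval in the first level,
ordered by the conjugate order. -/
theorem Conj.mem_below_of_between (hc : Conj r r') {y x x' w : α} (hx : x ∈ below r (level r S 0) y)
    (hx' : x' ∈ below r (level r S 0) y) (hw : w ∈ level r S 0) (hyS : y ∈ level r S 1)
    (h1 : r' x w) (h2 : r' w x') : w ∈ below r (level r S 0) y := by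
  refine mem_below.2 ⟨hw, ?_⟩
  rw [mem_below] at hx hx'
  rw [mem_level] at hw hyS
  have hne : w ≠ y := by rintro rfl; omega
  by_contra hcon
  have hnot : ¬ r y w := fun h => by have := lev_lt hc.left hyS.1 h; omega
  have hexcl : ∀ v, r v y → ¬ r' v y ∧ ¬ r' y v := fun v hv => by
    have h3 := (hc.compl v y (hc.left.ne hv)).not.2 (not_not.2 (Or.inl hv))
    exact not_or.1 h3
  rcases (hc.compl w y hne).2 (by tauto) with h | h
  · exact (hexcl x hx.2).1 (hc.right.trans h1 h)
  · exact (hexcl x' hx'.2).2 (hc.right.trans h h2)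

/-- Two elements of the second level have at least three lower neighbours altogether: otherwise they
could replace two elements in the antichain of minimal elements, which would give a
further large antichain. -/
theorem Tight.three_le_card_union {z : Fin k → ℕ → α} (ht : Tight r S k z) (hk : 1 ≤ k)
    {p q : Fin k} (hpq : p ≠ q) :
    3 ≤ (below r (level r S 0) (z p 1) ∪ below r (level r S 0) (z q 1)).card := by
  by_contra hcon
  have hz := ht.strands
  have hc : Consec r S (level r S 0) (level r S 1) := level_consec ht.strict (by omega)
  have hy : ∀ p, z p 1 ∈ level r S 1 := fun p => hz.mem p _ (Nat.zero_le _) (by omega)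
  have hinj := hz.inj 1 (Nat.zero_le _) (by omega)
  have h1 := hc.antiOn_sdiff_union hy {p, q}
  have h2 := hc.card_sdiff_union hy hinj {p, q}
  rw [biUnion_insert, singleton_biUnion] at h1 h2
  rw [card_pair hpq, ht.card_zero] at h2
  set T := level r S 0 \ (below r (level r S 0) (z p 1) ∪ below r (level r S 0) (z q 1)) ∪
    ({p, q} : Finset (Fin k)).image fun p => z p 1 with hT
  have hTS : T ⊆ S := union_subset (sdiff_subset.trans hc.subX)
    ((image_subset_iff.2 fun p _ => hy p).trans hc.subY)
  have h3 := ht.width _ hTS h1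
  have hmem : ∀ s ∈ ({p, q} : Finset (Fin k)), z s 1 ∈ T := fun s hs =>
    mem_union_right _ (mem_image.2 ⟨s, hs, rfl⟩)
  have hnot : ∀ s, z s 1 ∉ level r S 0 := fun s hs => disjoint_left.1 hc.disj hs (hy s)
  rcases ht.antis_eq T (mem_antis.2 ⟨hTS, by omega, h1⟩) with h | ⟨s, -, h⟩
  · exact hnot p (h ▸ hmem p (by simp))
  · have h4 : ∀ t ∈ ({p, q} : Finset (Fin k)), t = s := by
      intro t ht
      have h5 := hmem t ht
      rw [h] at h5
      rcases mem_insert.1 h5 with h5 | h5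
      · exact hinj h5
      · exact absurd (sdiff_subset h5) (hnot t)
    exact hpq ((h4 p (by simp)).trans (h4 q (by simp)).symm)

/-- An element of the second level with two lower neighbours lies above two elements of the first
level that are consecutive for the conjugate order. -/
theorem Tight.exists_index {z : Fin k → ℕ → α} (ht : Tight r S k z) (hc : Conj r r') (hk : 1 ≤ k)
    {p : Fin k} (hp : (below r (level r S 0) (z p 1)).card = 2) :
    ∃ i, i + 1 ≤ k ∧ ∀ x ∈ level r S 0, r x (z p 1) ↔
      lev r' (level r S 0) x = i ∨ lev r' (level r S 0) x = i + 1 := by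
  set A := level r S 0 with hA
  have hAc : ChainOn r' A := hc.chainOn_iff.2 (antiOn_level hc.left 0)
  have hr' := hc.right
  have key : ∀ x x', x ∈ A → x' ∈ A → below r A (z p 1) = {x, x'} → r' x x' →
      ∃ i, i + 1 ≤ k ∧ ∀ x ∈ A, r x (z p 1) ↔ lev r' A x = i ∨ lev r' A x = i + 1 := by
    intro x x' hx hx' hb hlt
    have h1 := (rank_lt_iff hr' hAc hx hx').2 hlt
    have h2 : lev r' A x' = lev r' A x + 1 := by
      by_contra hne
      have h4 := rank_lt hr' hx'
      obtain ⟨w, hw, hwr⟩ := exists_rank hr' hAc (show lev r' A x + 1 < A.card by omega)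
      have h3 := hc.mem_below_of_between (x := x) (x' := x') (y := z p 1) (S := S) (w := w)
        (by rw [← hA, hb]; simp) (by rw [← hA, hb]; simp) hw
        (ht.strands.mem p 1 (Nat.zero_le _) (by omega))
        ((rank_lt_iff hr' hAc hx hw).1 (by omega)) ((rank_lt_iff hr' hAc hw hx').1 (by omega))
      rw [← hA, hb] at h3
      simp only [mem_insert, mem_singleton] at h3
      rcases h3 with rfl | rfl <;> omega
    have h3 := rank_lt hr' hx'
    rw [hA, ht.card_zero, ← hA] at h3
    refine ⟨lev r' A x, by omega, fun v hv => ?_⟩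
    have h4 : r v (z p 1) ↔ v ∈ below r A (z p 1) := by rw [mem_below]; tauto
    rw [h4, hb]
    simp only [mem_insert, mem_singleton]
    rw [← h2]
    have hinj := hAc.lev_inj hr' (S := A) Subset.rfl
    constructor
    · rintro (rfl | rfl) <;> tauto
    · rintro (h | h)
      · exact Or.inl (hinj hv hx h)
      · exact Or.inr (hinj hv hx' h)
  obtain ⟨x, x', hne, hb⟩ := card_eq_two.1 hp
  have hx : x ∈ A := below_subset r A (z p 1) (by rw [hb]; simp)
  have hx' : x' ∈ A := below_subset r A (z p 1) (by rw [hb]; simp)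
  rcases hAc x hx x' hx' hne with h | h
  · exact key x x' hx hx' hb h
  · exact key x' x hx' hx (by rw [hb, pair_comm]) h

/-- The exceptional element with a single lower neighbour leaves that neighbour at one of the ends
of the first level, without loss of generality at the upper end. -/
theorem Tight.rank_eq_of_single {z : Fin k → ℕ → α} (ht : Tight r S k z) (hc : Conj r r')
    (hk : 1 ≤ k) {p₀ : Fin k} {u : α} (hu : below r (level r S 0) (z p₀ 1) = {u}) :
    lev r' (level r S 0) u = k ∨ lev (flip r') (level r S 0) u = k := by
  set A := level r S 0 with hA
  have hAc : ChainOn r' A := hc.chainOn_iff.2 (antiOn_level hc.left 0)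
  have hr' := hc.right
  have huA : u ∈ A := below_subset r A (z p₀ 1) (by rw [hu]; simp)
  have hAcard : A.card = k + 1 := ht.card_zero
  have hult := rank_lt hr' huA
  by_contra hcon
  rw [not_or] at hcon
  have hpos : lev r' A u ≠ 0 := by
    intro h0
    have h1 : ∀ x ∈ A.erase u, flip r' x u := by
      intro x hx
      obtain ⟨hne, hx⟩ := mem_erase.1 hx
      rcases hAc x hx u huA hne with h | h
      · have := lev_lt hr' hx h
        omega
      · exact h
    have h2 := le_lev (erase_subset _ _) ((chainOn_flip.2 hAc).mono (erase_subset u A)) h1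
    rw [card_erase_of_mem huA] at h2
    have h3 := rank_lt hr'.flip huA
    omega
  have hcard2 : ∀ p, p ≠ p₀ → (below r A (z p 1)).card = 2 := by
    intro p hp
    have h1 := ht.le_two p
    have h2 : (below r A (z p 1)).card ≠ 1 := fun h =>
      hp (ht.single p p₀ h (by rw [← hA, hu, card_singleton]))
    have h3 := card_pos.2 ⟨_, ht.strands.mem_below_self p (show 0 < k by omega)⟩
    rw [zero_add, ← hA] at h3
    rw [← hA] at h1
    omega
  choose! idx hidx using fun p (hp : p ≠ p₀) => ht.exists_index hc hk (hcard2 p hp)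
  -- The `k - 1` other elements of the second level occupy different pairs of consecutive ranks.
  -- None of these pairs contains the rank of `u`, which rules out two of the `k` pairs unless `u`
  -- is at an end.
  have hinj : Set.InjOn idx (univ.erase p₀ : Finset (Fin k)) := by
    intro p hp q hq hpq
    rw [mem_coe, mem_erase] at hp hq
    by_contra hne
    have h1 := ht.three_le_card_union hk hne
    have h2 : below r A (z p 1) = below r A (z q 1) := by
      ext x
      rw [mem_below, mem_below]
      refine and_congr_right fun hx => ?_
      rw [(hidx p hp.1).2 x hx, (hidx q hq.1).2 x hx, hpq]
    rw [← hA, h2, union_self, hcard2 q hq.1] at h1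
    omega
  have hmaps : ∀ p ∈ univ.erase p₀,
      idx p ∈ ((range k).erase (lev r' A u)).erase (lev r' A u - 1) := by
    intro p hp
    obtain ⟨hp, -⟩ := mem_erase.1 hp
    have h1 : ¬ r u (z p 1) := by
      intro h
      have h2 := ht.three_le_card_union hk hp
      rw [← hA, hu, union_eq_left.2 (singleton_subset_iff.2 (mem_below.2 ⟨huA, h⟩)),
        hcard2 p hp] at h2
      omega
    rw [(hidx p hp).2 u huA] at h1
    change ¬ (lev r' A u = idx p ∨ lev r' A u = idx p + 1) at h1
    have := (hidx p hp).1
    rw [mem_erase, mem_erase, mem_range]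
    omega
  have hne : lev r' A u ≠ k := hcon.1
  have h1 := card_le_card_of_injOn idx hmaps hinj
  rw [card_erase_of_mem (mem_univ _), card_univ, Fintype.card_fin, card_erase_of_mem,
    card_erase_of_mem, card_range] at h1
  · omega
  · exact mem_range.2 (by omega)
  · rw [mem_erase, mem_range]; omega

end

/-! ### Recognizing paths -/

theorem nonempty_iso_pathGraph {V : Type*} [Finite V] {G : SimpleGraph V} {m : ℕ} {f : V → ℕ}
    (hlt : ∀ v, f v < m) (hinj : Function.Injective f) (hcard : Nat.card V = m)
    (hadj : ∀ u v, G.Adj u v ↔ f u + 1 = f v ∨ f v + 1 = f u) :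
    Nonempty (G ≃g SimpleGraph.pathGraph m) := by
  have : Fintype V := Fintype.ofFinite V
  have hbij : Function.Bijective fun v => (⟨f v, hlt v⟩ : Fin m) := by
    rw [Fintype.bijective_iff_injective_and_card, Fintype.card_fin, ← Nat.card_eq_fintype_card]
    exact ⟨fun u v h => hinj (Fin.mk.inj_iff.1 h), hcard⟩
  refine ⟨⟨Equiv.ofBijective _ hbij, ?_⟩⟩
  intro u v
  rw [hadj, SimpleGraph.pathGraph_adj]
  rfl

theorem exists_iso_pathGraph_sum {V : Type*} [Finite V] {G : SimpleGraph V} {m : ℕ} {f : V → ℕ}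
    {a b : V} (hab : a ≠ b) (hlt : ∀ v, v ≠ a → v ≠ b → f v < m)
    (hinj : ∀ u v, u ≠ a → u ≠ b → v ≠ a → v ≠ b → f u = f v → u = v)
    (hcard : Nat.card V = m + 2)
    (hadj : ∀ u v, u ≠ a → u ≠ b → v ≠ a → v ≠ b →
      (G.Adj u v ↔ f u + 1 = f v ∨ f v + 1 = f u))
    (hadjab : G.Adj a b) (hna : ∀ v, v ≠ a → v ≠ b → ¬ G.Adj a v ∧ ¬ G.Adj b v) :
    ∃ e : G ≃g SimpleGraph.pathGraph m ⊕g SimpleGraph.pathGraph 2,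
      (∀ v, v ≠ a → v ≠ b → (e v).isLeft = true) ∧ (e b).isRight = true := by
  have : Fintype V := Fintype.ofFinite V
  set F : V → Fin m ⊕ Fin 2 := fun v =>
    if h : v = a then Sum.inr 0 else if h' : v = b then Sum.inr 1 else Sum.inl ⟨f v, hlt v h h'⟩
    with hF
  have hFa : F a = Sum.inr 0 := by simp [hF]
  have hFb : F b = Sum.inr 1 := by simp [hF, hab.symm]
  have hFv : ∀ v (h : v ≠ a) (h' : v ≠ b), F v = Sum.inl ⟨f v, hlt v h h'⟩ := by
    intro v h h'
    simp [hF, h, h']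
  have hbij : Function.Bijective F := by
    rw [Fintype.bijective_iff_injective_and_card, Fintype.card_sum, Fintype.card_fin,
      Fintype.card_fin, ← Nat.card_eq_fintype_card]
    refine ⟨fun u v h => ?_, hcard⟩
    rcases eq_or_ne u a with hua | hua <;> rcases eq_or_ne v a with hva | hva
    · rw [hua, hva]
    · rcases eq_or_ne v b with hvb | hvb
      · rw [hua, hvb, hFa, hFb] at h; simp at h
      · rw [hua, hFa, hFv v hva hvb] at h; simp at h
    · rcases eq_or_ne u b with hub | hub
      · rw [hva, hub, hFa, hFb] at h; simp at h
      · rw [hva, hFa, hFv u hua hub] at h; simp at h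
    · rcases eq_or_ne u b with hub | hub <;> rcases eq_or_ne v b with hvb | hvb
      · rw [hub, hvb]
      · rw [hub, hFb, hFv v hva hvb] at h; simp at h
      · rw [hvb, hFb, hFv u hua hub] at h; simp at h
      · rw [hFv u hua hub, hFv v hva hvb] at h
        exact hinj u v hua hub hva hvb (by simpa using h)
  refine ⟨⟨Equiv.ofBijective F hbij, ?_⟩, fun v h h' => ?_, ?_⟩
  · intro u v
    change (SimpleGraph.pathGraph m ⊕g SimpleGraph.pathGraph 2).Adj (F u) (F v) ↔ _
    have h01 : (SimpleGraph.pathGraph 2).Adj 0 1 := by simp [SimpleGraph.pathGraph_adj]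
    rcases eq_or_ne u a with hua | hua <;> rcases eq_or_ne v a with hva | hva
    · rw [hua, hva]; simp
    · rcases eq_or_ne v b with hvb | hvb
      · rw [hua, hvb, hFa, hFb]; simp [hadjab, h01]
      · rw [hua, hFa, hFv v hva hvb]; simp [(hna v hva hvb).1]
    · rcases eq_or_ne u b with hub | hub
      · rw [hva, hub, hFa, hFb]; simp [hadjab.symm, h01.symm]
      · rw [hva, hFa, hFv u hua hub, G.adj_comm]; simp [(hna u hua hub).1]
    · rcases eq_or_ne u b with hub | hub <;> rcases eq_or_ne v b with hvb | hvb
      · rw [hub, hvb]; simp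
      · rw [hub, hFb, hFv v hva hvb]; simp [(hna v hva hvb).2]
      · rw [hvb, hFb, hFv u hua hub, G.adj_comm]; simp [(hna u hua hub).2]
      · rw [hFv u hua hub, hFv v hva hvb, hadj u v hua hub hva hvb]
        simp [SimpleGraph.pathGraph_adj]
  · change (F v).isLeft = true
    rw [hFv v h h']; rfl
  · change (F b).isRight = true
    rw [hFb]; rfl

/-! ### Translation to posets -/

/-- The part of a strand above the minimal elements. -/
noncomputable def upperStrand {k : ℕ} (z : Fin k → ℕ → α) (p : Fin k) : Finset α :=
  (Icc 1 k).image (z p)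

theorem mem_upperStrand {k : ℕ} {z : Fin k → ℕ → α} {p : Fin k} {x : α} :
    x ∈ upperStrand z p ↔ ∃ j, 1 ≤ j ∧ j ≤ k ∧ z p j = x := by
  simp [upperStrand, and_assoc]

section
variable {P : Type u} [PartialOrder P]

theorem strictRel_lt (P : Type u) [PartialOrder P] : StrictRel (fun x y : P => x < y) :=
  ⟨fun x => lt_irrefl x, fun h h' => lt_trans h h'⟩

theorem isChain_coe_iff {T : Finset P} :
    IsChain (· ≤ ·) (T : Set P) ↔ ChainOn (fun x y : P => x < y) T := by
  constructor
  · intro h x hx y hy hne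
    exact (h hx hy hne).imp (fun h' => lt_of_le_of_ne h' hne) fun h' => lt_of_le_of_ne h' hne.symm
  · intro h x hx y hy hne
    exact (h x hx y hy hne).imp le_of_lt le_of_lt

theorem isAntichain_coe_iff {T : Finset P} :
    IsAntichain (· ≤ ·) (T : Set P) ↔ AntiOn (fun x y : P => x < y) T := by
  constructor
  · intro h x hx y hy hlt
    exact h hx hy hlt.ne hlt.le
  · intro h x hx y hy hne hle
    exact h x hx y hy (lt_of_le_of_ne hle hne)

end

section
variable {P : Type u} [Fintype P] [PartialOrder P] {k : ℕ} {z : Fin k → ℕ → P}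
  {r' : P → P → Prop}

theorem mem_level_zero_iff {x : P} :
    x ∈ level (fun x y : P => x < y) univ 0 ↔ x ∈ firstLevel P := by
  rw [mem_level, firstLevel, Set.mem_ofPred_eq]
  constructor
  · rintro ⟨-, h⟩
    refine ⟨trivial, fun y _ hy => ?_⟩
    by_contra hcon
    have := lev_lt (strictRel_lt P) (mem_univ y) (lt_of_le_not_ge hy hcon)
    omega
  · rintro ⟨-, h⟩
    refine ⟨mem_univ _, ?_⟩
    by_contra hcon
    obtain ⟨y, -, hy, -⟩ := exists_below_of_lt (S := univ) (strictRel_lt P) (v := x) rfl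
      (Nat.pos_of_ne_zero hcon)
    exact not_lt_of_ge (h trivial hy.le) hy

theorem mem_level_one_iff {x : P} :
    x ∈ level (fun x y : P => x < y) univ 1 ↔ x ∈ secondLevel P := by
  have hr := strictRel_lt P
  rw [mem_level, secondLevel, Set.mem_ofPred_eq]
  constructor
  · rintro ⟨-, h⟩
    refine ⟨fun hx => ?_, fun y hy hyx => ?_⟩
    · rw [← mem_level_zero_iff, mem_level] at hx
      omega
    · by_contra hcon
      have := lev_lt hr (mem_univ y) (lt_of_le_not_ge hyx hcon)
      exact hy (mem_level_zero_iff.1 (mem_level.2 ⟨mem_univ _, by omega⟩))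
  · rintro ⟨h0, h⟩
    refine ⟨mem_univ _, ?_⟩
    have h1 : lev (fun x y : P => x < y) univ x ≠ 0 := fun h2 =>
      h0 (mem_level_zero_iff.1 (mem_level.2 ⟨mem_univ _, h2⟩))
    by_contra hcon
    obtain ⟨y, -, hy, hy1⟩ := exists_below_of_lt (S := univ) hr (v := x) (i := 1) rfl (by omega)
    refine not_lt_of_ge (h (fun hy0 => ?_) hy.le) hy
    rw [← mem_level_zero_iff, mem_level] at hy0
    omega

theorem coe_level_zero :
    (level (fun x y : P => x < y) univ 0 : Set P) = firstLevel P :=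
  Set.ext fun _ => mem_level_zero_iff

theorem coe_level_one :
    (level (fun x y : P => x < y) univ 1 : Set P) = secondLevel P :=
  Set.ext fun _ => mem_level_one_iff

theorem Tight.lev_eq (ht : Tight (fun x y : P => x < y) univ k z) (p : Fin k) {j : ℕ}
    (hj : j ≤ k) : lev (fun x y : P => x < y) univ (z p j) = j :=
  (mem_level.1 (ht.strands.mem p j (Nat.zero_le _) (by omega))).2

/-- The strands cover the levels with `k` elements. -/
theorem Tight.exists_strand (ht : Tight (fun x y : P => x < y) univ k z) {x : P}
    (hx : lev (fun x y : P => x < y) univ x ≠ 0) :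
    ∃ p j, 1 ≤ j ∧ j ≤ k ∧ z p j = x := by
  have hlt := ht.height.lev_lt ht.strict (mem_univ x)
  set j := lev (fun x y : P => x < y) univ x with hj
  have h2 : univ.image (fun p => z p j) = level (fun x y : P => x < y) univ j := by
    refine eq_of_subset_of_card_le (image_subset_iff.2 fun p _ =>
      ht.strands.mem p j (Nat.zero_le _) (by omega)) ?_
    rw [card_image_of_injective _ (ht.strands.inj j (Nat.zero_le _) (by omega)),
      ht.card_level j (by omega) (by omega)]
    simp
  have h3 : x ∈ univ.image (fun p => z p j) := by
    rw [h2]; exact mem_level.2 ⟨mem_univ _, rfl⟩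
  obtain ⟨p, -, hp⟩ := mem_image.1 h3
  exact ⟨p, j, by omega, by omega, hp⟩

theorem Tight.lt_of_lt (ht : Tight (fun x y : P => x < y) univ k z) (p : Fin k) {i j : ℕ}
    (hij : i < j) (hj : j ≤ k) : z p i < z p j :=
  ht.strands.lt_of_lt ht.strict p (Nat.zero_le _) hij (by omega)

theorem Tight.card_upperStrand (ht : Tight (fun x y : P => x < y) univ k z) (p : Fin k) :
    (upperStrand z p).card = k := by
  rw [upperStrand, card_image_of_injOn, Nat.card_Icc, Nat.add_sub_cancel]
  intro i hi j hj h
  rw [coe_Icc, Set.mem_Icc] at hi hj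
  rw [← ht.lev_eq p hi.2, ← ht.lev_eq p hj.2, h]

theorem Tight.isChain_upperStrand (ht : Tight (fun x y : P => x < y) univ k z) (p : Fin k) :
    IsChain (· ≤ ·) (upperStrand z p : Set P) := by
  intro x hx y hy _
  rw [mem_coe, mem_upperStrand] at hx hy
  obtain ⟨i, -, hi, rfl⟩ := hx
  obtain ⟨j, -, hj, rfl⟩ := hy
  rcases lt_trichotomy i j with h | rfl | h
  · exact Or.inl (ht.lt_of_lt p h hj).le
  · exact Or.inl le_rfl
  · exact Or.inr (ht.lt_of_lt p h hi).le

theorem Tight.upperStrand_subset (ht : Tight (fun x y : P => x < y) univ k z) (p : Fin k) :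
    (upperStrand z p : Set P) ⊆ (firstLevel P)ᶜ := by
  intro x hx hx0
  rw [mem_coe, mem_upperStrand] at hx
  obtain ⟨i, hi, hi', rfl⟩ := hx
  rw [← mem_level_zero_iff, mem_level, ht.lev_eq p hi'] at hx0
  omega

theorem Tight.upperStrand_injective (ht : Tight (fun x y : P => x < y) univ k z)
    {p q : Fin k} {x : P} (hp : x ∈ upperStrand z p) (hq : x ∈ upperStrand z q) : p = q := by
  rw [mem_upperStrand] at hp hq
  obtain ⟨i, hi, hi', rfl⟩ := hp
  obtain ⟨j, hj, hj', h⟩ := hq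
  have : i = j := by rw [← ht.lev_eq p hi', ← ht.lev_eq q hj', h]
  subst this
  exact ht.strands.inj i (Nat.zero_le _) (by omega) h.symm

/-- Above the lowest level, the relations between successive levels are those of the strands only.
Hence the chains that meet all these levels are the strands. -/
theorem Tight.eq_upperStrand (ht : Tight (fun x y : P => x < y) univ k z) (hk : 1 ≤ k)
    {C : Finset P} (hC0 : ∀ x ∈ C, lev (fun x y : P => x < y) univ x ≠ 0)
    (hC : ChainOn (fun x y : P => x < y) C) (hCc : C.card = k) : ∃ p, C = upperStrand z p := by
  have hr := ht.strict
  have himg : C.image (lev (fun x y : P => x < y) univ) = Icc 1 k := by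
    refine eq_of_subset_of_card_le (fun j hj => ?_) ?_
    · obtain ⟨x, hx, rfl⟩ := mem_image.1 hj
      have h1 := ht.height.lev_lt hr (mem_univ x)
      have h2 := hC0 x hx
      rw [mem_Icc]
      omega
    · rw [card_image_of_injOn (hC.lev_inj hr (subset_univ _)), hCc, Nat.card_Icc,
        Nat.add_sub_cancel]
  have hmem : ∀ j, 1 ≤ j → j ≤ k → ∃ x ∈ C, lev (fun x y : P => x < y) univ x = j :=
    fun j h1 h2 => mem_image.1 (by rw [himg]; exact mem_Icc.2 ⟨h1, h2⟩)
  obtain ⟨x, hxC, hx⟩ := hmem k hk le_rfl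
  obtain ⟨p, j, hj1, hjk, hpx⟩ := ht.exists_strand (hC0 x hxC)
  have hjeq : j = k := by rw [← hx, ← hpx, ht.lev_eq p hjk]
  subst hjeq
  have key : ∀ d, d + 1 ≤ j → z p (j - d) ∈ C := by
    intro d
    induction d with
    | zero => intro _; rw [Nat.sub_zero, hpx]; exact hxC
    | succ d ih =>
      intro hd
      have ih := ih (by omega)
      obtain ⟨w, hwC, hw⟩ := hmem (j - (d + 1)) (by omega) (by omega)
      have h1 : j - d = j - (d + 1) + 1 := by omega
      have h2 : lev (fun x y : P => x < y) univ (z p (j - d)) = j - d := ht.lev_eq p (by omega)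
      have h3 : w < z p (j - d) := by
        rcases hC w hwC _ ih (by rintro rfl; omega) with h | h
        · exact h
        · have := lev_lt hr (mem_univ (z p (j - d))) h
          omega
      have h4 := ht.uniq p (j - (d + 1)) (by omega) (by omega)
      rw [← h1] at h4
      have h5 : w ∈ below (fun x y : P => x < y) (level (fun x y : P => x < y) univ (j - (d + 1)))
          (z p (j - d)) := mem_below.2 ⟨mem_level.2 ⟨mem_univ _, hw⟩, h3⟩
      rw [h4, mem_singleton] at h5
      rwa [← h5]
  refine ⟨p, (eq_of_subset_of_card_le (fun y hy => ?_) ?_).symm⟩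
  · obtain ⟨i, hi1, hij, rfl⟩ := mem_upperStrand.1 hy
    have := key (j - i) (by omega)
    rwa [show j - (j - i) = i by omega] at this
  · rw [hCc, ht.card_upperStrand p]

theorem Tight.card_eq (ht : Tight (fun x y : P => x < y) univ k z) :
    Nat.card P = k ^ 2 + k + 1 := by
  have h1 := sum_card_level ht.strict ht.height
  rw [sum_range_succ', ht.card_zero, sum_congr rfl (g := fun _ => k) fun j hj =>
    ht.card_level (j + 1) (by omega) (mem_range.1 hj), sum_const, card_range, smul_eq_mul,
    card_univ, ← Nat.card_eq_fintype_card] at h1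
  rw [← h1, pow_two, add_assoc]

theorem Tight.chain_decomposition (ht : Tight (fun x y : P => x < y) univ k z) :
    ∃ C : Fin k → Set P, IsDecomposition (firstLevel P)ᶜ C ∧ ∀ i, IsChain (· ≤ ·) (C i) := by
  refine ⟨fun p => upperStrand z p, ⟨fun p q hpq => ?_, ?_⟩, ht.isChain_upperStrand⟩
  · change Disjoint (upperStrand z p : Set P) (upperStrand z q)
    rw [Set.disjoint_left]
    exact fun x hx hx' => hpq (ht.upperStrand_injective hx hx')
  · refine Set.Subset.antisymm (Set.iUnion_subset ht.upperStrand_subset) fun x hx => ?_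
    have h1 : lev (fun x y : P => x < y) univ x ≠ 0 := fun h =>
      hx (mem_level_zero_iff.1 (mem_level.2 ⟨mem_univ _, h⟩))
    obtain ⟨p, j, h2, h3, h4⟩ := ht.exists_strand h1
    exact Set.mem_iUnion.2 ⟨p, mem_coe.2 (mem_upperStrand.2 ⟨j, h2, h3, h4⟩)⟩

theorem Tight.antichain_decomposition (ht : Tight (fun x y : P => x < y) univ k z) :
    ∃ C : Fin k → Set P, IsDecomposition (firstLevel P)ᶜ C ∧ ∀ i, IsAntichain (· ≤ ·) (C i) := by
  refine ⟨fun i => level (fun x y : P => x < y) univ (i + 1), ⟨fun i j hij => ?_, ?_⟩, fun i =>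
    isAntichain_coe_iff.2 (antiOn_level ht.strict _)⟩
  · change Disjoint _ _
    rw [disjoint_coe]
    exact level_disjoint (by rw [Ne, Nat.add_right_cancel_iff]; exact Fin.val_ne_of_ne hij)
  · ext x
    rw [Set.mem_iUnion, Set.mem_compl_iff, ← mem_level_zero_iff, mem_level]
    constructor
    · rintro ⟨i, hi⟩ h
      rw [mem_coe, mem_level] at hi
      omega
    · intro h
      have h1 := ht.height.lev_lt ht.strict (mem_univ x)
      have h2 : lev (fun x y : P => x < y) univ x ≠ 0 := fun h' => h ⟨mem_univ _, h'⟩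
      refine ⟨⟨lev (fun x y : P => x < y) univ x - 1, by omega⟩, mem_coe.2 (mem_level.2
        ⟨mem_univ _, ?_⟩)⟩
      change _ = _ - 1 + 1
      omega

theorem Tight.ncard_chains (ht : Tight (fun x y : P => x < y) univ k z) (hk : 1 ≤ k) :
    {C : Set P | C ⊆ (firstLevel P)ᶜ ∧ IsChain (· ≤ ·) C ∧ C.ncard = k}.ncard = k := by
  have h1 : {C : Set P | C ⊆ (firstLevel P)ᶜ ∧ IsChain (· ≤ ·) C ∧ C.ncard = k} =
      Set.range fun p => (upperStrand z p : Set P) := by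
    ext C
    constructor
    · rintro ⟨h1, h2, h3⟩
      have hfin : C.toFinset.card = k := by rw [← h3, Set.ncard_eq_toFinset_card']
      have hC2 : ChainOn (fun x y : P => x < y) C.toFinset :=
        isChain_coe_iff.1 (by rwa [Set.coe_toFinset])
      obtain ⟨p, hp⟩ := ht.eq_upperStrand hk (C := C.toFinset) (fun x hx h => h1
        (Set.mem_toFinset.1 hx) (mem_level_zero_iff.1 (mem_level.2 ⟨mem_univ _, h⟩))) hC2 hfin
      exact ⟨p, by dsimp only; rw [← hp, Set.coe_toFinset]⟩
    · rintro ⟨p, rfl⟩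
      exact ⟨ht.upperStrand_subset p, ht.isChain_upperStrand p, by
        rw [Set.ncard_coe_finset, ht.card_upperStrand p]⟩
  rw [h1, ← Set.image_univ, Set.ncard_image_of_injective, Set.ncard_univ, Nat.card_fin]
  intro p q hpq
  have h2 : z p 1 ∈ upperStrand z p := mem_upperStrand.2 ⟨1, le_rfl, hk, rfl⟩
  have h3 : (upperStrand z p : Set P) = upperStrand z q := hpq
  exact ht.upperStrand_injective h2 (by rwa [← coe_inj.1 h3])

end

section
variable {P : Type u} [Fintype P] [PartialOrder P] {k : ℕ} {z : Fin k → ℕ → P}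
  {r' : P → P → Prop}

theorem Tight.exists_eq_of_mem_level_one (ht : Tight (fun x y : P => x < y) univ k z) {x : P}
    (hx : x ∈ level (fun x y : P => x < y) univ 1) : ∃ p, z p 1 = x := by
  have hx1 := (mem_level.1 hx).2
  obtain ⟨p, j, -, hjk, rfl⟩ := ht.exists_strand (x := x) (by omega)
  rw [ht.lev_eq p hjk] at hx1
  exact ⟨p, by rw [hx1]⟩

theorem Tight.ncard_firstLevel (ht : Tight (fun x y : P => x < y) univ k z) :
    (firstLevel P).ncard = k + 1 := by
  rw [← coe_level_zero, Set.ncard_coe_finset, ht.card_zero]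

theorem Tight.ncard_secondLevel (ht : Tight (fun x y : P => x < y) univ k z) (hk : 1 ≤ k) :
    (secondLevel P).ncard = k := by
  rw [← coe_level_one, Set.ncard_coe_finset, ht.card_level 1 le_rfl hk]

theorem Tight.card_low (ht : Tight (fun x y : P => x < y) univ k z) (hk : 1 ≤ k) :
    Nat.card ↥(firstLevel P ∪ secondLevel P) = 2 * k + 1 := by
  rw [Nat.card_coe_set_eq, Set.ncard_union_eq, ht.ncard_firstLevel, ht.ncard_secondLevel hk]
  · omega
  · rw [← coe_level_zero, ← coe_level_one, disjoint_coe]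
    exact level_disjoint (by omega)

/-- The positions of the elements of the two lowest levels on a path: the minimal elements have
even positions, given by `ρ`, and the elements `z p 1` have odd positions, given by `idx`. -/
noncomputable def lowPos (z : Fin k → ℕ → P) (ρ : P → ℕ) (idx : Fin k → ℕ) (x : P) : ℕ :=
  if h : ∃ p, z p 1 = x then 2 * idx h.choose + 1 else 2 * ρ x

theorem Tight.lowPos_strand (ht : Tight (fun x y : P => x < y) univ k z) (hk : 1 ≤ k) (ρ : P → ℕ)
    (idx : Fin k → ℕ) (p : Fin k) : lowPos z ρ idx (z p 1) = 2 * idx p + 1 := by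
  have h : ∃ q, z q 1 = z p 1 := ⟨p, rfl⟩
  rw [lowPos, dif_pos h, ht.strands.inj 1 (Nat.zero_le _) (by omega) h.choose_spec]

theorem Tight.lowPos_zero (ht : Tight (fun x y : P => x < y) univ k z) (hk : 1 ≤ k) (ρ : P → ℕ)
    (idx : Fin k → ℕ) {x : P} (hx : x ∈ level (fun x y : P => x < y) univ 0) :
    lowPos z ρ idx x = 2 * ρ x := by
  rw [lowPos, dif_neg]
  rintro ⟨p, rfl⟩
  have h1 := (mem_level.1 hx).2
  rw [ht.lev_eq p hk] at h1
  omega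

/-- Comparability in the two lowest levels is adjacency of positions, as far as the lower
neighbours of `z p 1` are the minimal elements at the ranks `idx p` and `idx p + 1`. -/
theorem Tight.comparable_iff_lowPos (ht : Tight (fun x y : P => x < y) univ k z) (hk : 1 ≤ k)
    {ρ : P → ℕ} {idx : Fin k → ℕ} {Q : Set (Fin k)}
    (hidx : ∀ p ∈ Q, ∀ x ∈ level (fun x y : P => x < y) univ 0,
      x < z p 1 ↔ ρ x = idx p ∨ ρ x = idx p + 1) {v w : P}
    (hv : v ∈ level (fun x y : P => x < y) univ 0 ∨ ∃ p ∈ Q, z p 1 = v)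
    (hw : w ∈ level (fun x y : P => x < y) univ 0 ∨ ∃ p ∈ Q, z p 1 = w) :
    v < w ∨ w < v ↔ lowPos z ρ idx v + 1 = lowPos z ρ idx w ∨
      lowPos z ρ idx w + 1 = lowPos z ρ idx v := by
  have hnot : ∀ {x y : P}, lev (fun x y : P => x < y) univ y ≤ lev (fun x y : P => x < y) univ x →
      ¬ x < y := fun {x y} hxy h => by
    have := lev_lt ht.strict (mem_univ x) h
    omega
  rcases hv with hv | ⟨p, hp, rfl⟩ <;> rcases hw with hw | ⟨q, hq, rfl⟩
  · have h1 := (mem_level.1 hv).2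
    have h2 := (mem_level.1 hw).2
    rw [ht.lowPos_zero hk ρ idx hv, ht.lowPos_zero hk ρ idx hw]
    refine iff_of_false (fun h => h.elim (hnot (by omega)) (hnot (by omega))) (by omega)
  · have h1 := (mem_level.1 hv).2
    have h2 := ht.lev_eq q hk
    rw [ht.lowPos_zero hk ρ idx hv, ht.lowPos_strand hk, or_iff_left (hnot (by omega)),
      hidx q hq v hv]
    omega
  · have h1 := (mem_level.1 hw).2
    have h2 := ht.lev_eq p hk
    rw [ht.lowPos_zero hk ρ idx hw, ht.lowPos_strand hk, or_iff_right (hnot (by omega)),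
      hidx p hp w hw]
    omega
  · have h1 := ht.lev_eq p hk
    have h2 := ht.lev_eq q hk
    rw [ht.lowPos_strand hk, ht.lowPos_strand hk]
    refine iff_of_false (fun h => h.elim (hnot (by omega)) (hnot (by omega))) (by omega)

theorem Tight.eq_of_lowPos_eq (ht : Tight (fun x y : P => x < y) univ k z) (hk : 1 ≤ k)
    {ρ : P → ℕ} {idx : Fin k → ℕ} {Q : Set (Fin k)}
    (hρ : ∀ x ∈ level (fun x y : P => x < y) univ 0, ∀ y ∈ level (fun x y : P => x < y) univ 0,
      ρ x = ρ y → x = y) (hinj : ∀ p ∈ Q, ∀ q ∈ Q, idx p = idx q → p = q) {v w : P}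
    (hv : v ∈ level (fun x y : P => x < y) univ 0 ∨ ∃ p ∈ Q, z p 1 = v)
    (hw : w ∈ level (fun x y : P => x < y) univ 0 ∨ ∃ p ∈ Q, z p 1 = w)
    (h : lowPos z ρ idx v = lowPos z ρ idx w) : v = w := by
  rcases hv with hv | ⟨p, hp, rfl⟩ <;> rcases hw with hw | ⟨q, hq, rfl⟩
  · rw [ht.lowPos_zero hk ρ idx hv, ht.lowPos_zero hk ρ idx hw] at h
    exact hρ v hv w hw (by omega)
  · rw [ht.lowPos_zero hk ρ idx hv, ht.lowPos_strand hk] at h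
    omega
  · rw [ht.lowPos_zero hk ρ idx hw, ht.lowPos_strand hk] at h
    omega
  · rw [ht.lowPos_strand hk, ht.lowPos_strand hk] at h
    rw [hinj p hp q hq (by omega)]

theorem Tight.chainOn_level_zero (ht : Tight (fun x y : P => x < y) univ k z)
    (hc : Conj (fun x y : P => x < y) r') : ChainOn r' (level (fun x y : P => x < y) univ 0) :=
  hc.chainOn_iff.2 (antiOn_level ht.strict 0)

theorem Tight.rank_inj (ht : Tight (fun x y : P => x < y) univ k z)
    (hc : Conj (fun x y : P => x < y) r') {x y : P}
    (hx : x ∈ level (fun x y : P => x < y) univ 0) (hy : y ∈ level (fun x y : P => x < y) univ 0)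
    (h : lev r' (level (fun x y : P => x < y) univ 0) x =
      lev r' (level (fun x y : P => x < y) univ 0) y) : x = y := by
  by_contra hne
  have hA := ht.chainOn_level_zero hc
  rcases hA x hx y hy hne with h1 | h1
  · have := (rank_lt_iff hc.right hA hx hy).2 h1
    omega
  · have := (rank_lt_iff hc.right hA hy hx).2 h1
    omega

theorem Tight.index_inj (ht : Tight (fun x y : P => x < y) univ k z) (hk : 1 ≤ k)
    {ρ : P → ℕ} {p q : Fin k} {i : ℕ}
    (hp : ∀ x ∈ level (fun x y : P => x < y) univ 0, x < z p 1 ↔ ρ x = i ∨ ρ x = i + 1)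
    (hq : ∀ x ∈ level (fun x y : P => x < y) univ 0, x < z q 1 ↔ ρ x = i ∨ ρ x = i + 1) :
    p = q := by
  by_contra hne
  have h1 := ht.three_le_card_union hk hne
  have h2 : below (fun x y : P => x < y) (level (fun x y : P => x < y) univ 0) (z p 1) =
      below (fun x y : P => x < y) (level (fun x y : P => x < y) univ 0) (z q 1) := by
    ext x
    rw [mem_below, mem_below]
    exact and_congr_right fun hx => by rw [hp x hx, hq x hx]
  rw [h2, union_self] at h1
  have := ht.le_two q
  omega

/-- If every element of the second level has two lower neighbours, then the two lowest levels form
a path: the lower neighbours are consecutive in the linear order that the conjugate order induces on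
the lowest level. -/
theorem Tight.lowGraphIsPath (ht : Tight (fun x y : P => x < y) univ k z)
    (hc : Conj (fun x y : P => x < y) r') (hk : 1 ≤ k)
    (h2 : ∀ p, (below (fun x y : P => x < y) (level (fun x y : P => x < y) univ 0)
      (z p 1)).card = 2) : LowGraphIsPath k P := by
  set A := level (fun x y : P => x < y) univ 0 with hA
  choose idx hidx hadj using fun p => ht.exists_index hc hk (h2 p)
  have hmem : ∀ v : ↥(firstLevel P ∪ secondLevel P),
      v.1 ∈ A ∨ ∃ p ∈ (Set.univ : Set (Fin k)), z p 1 = v.1 := by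
    rintro ⟨v, hv | hv⟩
    · exact Or.inl (mem_level_zero_iff.2 hv)
    · obtain ⟨p, hp⟩ := ht.exists_eq_of_mem_level_one (mem_level_one_iff.2 hv)
      exact Or.inr ⟨p, trivial, hp⟩
  refine nonempty_iso_pathGraph (f := fun v => lowPos z (lev r' A) idx v.1) (fun v => ?_)
    (fun v w h => ?_) (ht.card_low hk) (fun v w => ?_)
  · rcases hmem v with hv | ⟨p, -, hp⟩
    · have h1 := rank_lt hc.right hv
      rw [ht.card_zero] at h1
      rw [ht.lowPos_zero hk _ _ hv]
      omega
    · have := hidx p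
      rw [← hp, ht.lowPos_strand hk]
      omega
  · refine Subtype.ext (ht.eq_of_lowPos_eq hk (fun x hx y hy => ht.rank_inj hc hx hy)
      (fun p _ q _ hpq => ht.index_inj hk (i := idx p) (hadj p) ?_) (hmem v) (hmem w) h)
    rw [hpq]
    exact hadj q
  · exact ht.comparable_iff_lowPos hk (fun p _ => hadj p) (hmem v) (hmem w)

/-- If the element `z p₀ 1` of the second level has a single lower neighbour, and if this is the
last element of the lowest level in the conjugate order, then the two lowest levels form a path and
an edge. -/
theorem Tight.lowGraphIsPathAndEdge (ht : Tight (fun x y : P => x < y) univ k z)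
    (hc : Conj (fun x y : P => x < y) r') (hk : 2 ≤ k) {p₀ : Fin k} {u : P}
    (hu : below (fun x y : P => x < y) (level (fun x y : P => x < y) univ 0) (z p₀ 1) = {u})
    (huk : lev r' (level (fun x y : P => x < y) univ 0) u = k) : LowGraphIsPathAndEdge k P := by
  have hk1 : 1 ≤ k := by omega
  set A := level (fun x y : P => x < y) univ 0 with hA
  have huA : u ∈ A ∧ u < z p₀ 1 := mem_below.1 (by rw [hu]; exact mem_singleton_self u)
  have hle : ∀ p, (below (fun x y : P => x < y) A (z p 1)).card ≤ 2 := ht.le_two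
  have h3u : ∀ p, p ≠ p₀ → 3 ≤ (below (fun x y : P => x < y) A (z p 1) ∪ {u}).card := fun p hp => by
    rw [← hu]
    exact ht.three_le_card_union hk1 hp
  have huN : ∀ p, p ≠ p₀ → ¬ u < z p 1 := fun p hp h => by
    have h1 : {u} ⊆ below (fun x y : P => x < y) A (z p 1) :=
      singleton_subset_iff.2 (mem_below.2 ⟨huA.1, h⟩)
    have h4 := h3u p hp
    rw [union_eq_left.2 h1] at h4
    have := hle p
    omega
  have h2 : ∀ p, p ≠ p₀ → (below (fun x y : P => x < y) A (z p 1)).card = 2 := fun p hp => by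
    have h1 := h3u p hp
    have h3 := card_union_le (below (fun x y : P => x < y) A (z p 1)) {u}
    rw [card_singleton] at h3
    have := hle p
    omega
  have h3 : ∀ p, ∃ i, p ≠ p₀ → i + 1 ≤ k ∧ ∀ x ∈ A, x < z p 1 ↔ lev r' A x = i ∨
      lev r' A x = i + 1 := fun p => by
    by_cases hp : p = p₀
    · exact ⟨0, fun h => absurd hp h⟩
    · obtain ⟨i, hi⟩ := ht.exists_index hc hk1 (h2 p hp)
      exact ⟨i, fun _ => hi⟩
  choose idx hidx using h3
  have hchain := ht.chainOn_level_zero hc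
  have hidx' : ∀ p, p ≠ p₀ → idx p + 2 ≤ k := fun p hp => by
    obtain ⟨h1, h4⟩ := hidx p hp
    by_contra hcon
    refine huN p hp ((h4 u huA.1).2 (Or.inr ?_))
    omega
  let a : ↥(firstLevel P ∪ secondLevel P) := ⟨u, Or.inl (mem_level_zero_iff.1 huA.1)⟩
  have hzmem : ∀ p, z p 1 ∈ level (fun x y : P => x < y) univ 1 := fun p =>
    ht.strands.mem p 1 (Nat.zero_le _) (by omega)
  let b : ↥(firstLevel P ∪ secondLevel P) := ⟨z p₀ 1, Or.inr (mem_level_one_iff.1 (hzmem p₀))⟩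
  have hmem : ∀ v : ↥(firstLevel P ∪ secondLevel P), v ≠ a → v ≠ b →
      (v.1 ∈ A ∧ v.1 ≠ u) ∨ ∃ p ∈ {p | p ≠ p₀}, z p 1 = v.1 := by
    rintro ⟨v, hv | hv⟩ hva hvb
    · exact Or.inl ⟨mem_level_zero_iff.2 hv, fun h => hva (Subtype.ext h)⟩
    · obtain ⟨p, hp⟩ := ht.exists_eq_of_mem_level_one (mem_level_one_iff.2 hv)
      refine Or.inr ⟨p, fun h => hvb (Subtype.ext ?_), hp⟩
      change v = z p₀ 1
      rw [← hp, h]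
  have hmem' : ∀ v : ↥(firstLevel P ∪ secondLevel P), v ≠ a → v ≠ b →
      v.1 ∈ A ∨ ∃ p ∈ {p | p ≠ p₀}, z p 1 = v.1 := fun v hva hvb =>
    (hmem v hva hvb).imp_left And.left
  have hnot : ∀ {x y : P}, lev (fun x y : P => x < y) univ y ≤ lev (fun x y : P => x < y) univ x →
      ¬ x < y := fun {x y} hxy h => by
    have := lev_lt ht.strict (mem_univ x) h
    omega
  have hl0 : ∀ {x}, x ∈ A → lev (fun x y : P => x < y) univ x = 0 := fun hx => (mem_level.1 hx).2
  obtain ⟨e, he, heb⟩ := exists_iso_pathGraph_sum (G := lowGraph P) (m := 2 * k - 1) (a := a)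
    (b := b) (f := fun v => lowPos z (lev r' A) idx v.1)
    (fun h => huA.2.ne (congrArg Subtype.val h))
    (fun v hva hvb => by
      rcases hmem v hva hvb with ⟨hv, hvu⟩ | ⟨p, hp, hpv⟩
      · have h1 := rank_lt hc.right hv
        have h4 : lev r' A v.1 ≠ k := fun h => hvu (ht.rank_inj hc hv huA.1 (h.trans huk.symm))
        rw [ht.card_zero] at h1
        rw [ht.lowPos_zero hk1 _ _ hv]
        omega
      · have := hidx' p hp
        rw [← hpv, ht.lowPos_strand hk1]
        omega)
    (fun v w hva hvb hwa hwb h => Subtype.ext (ht.eq_of_lowPos_eq hk1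
      (fun x hx y hy => ht.rank_inj hc hx hy)
      (fun p hp q hq hpq => ht.index_inj hk1 (i := idx p) (hidx p hp).2
        (by rw [hpq]; exact (hidx q hq).2)) (hmem' v hva hvb) (hmem' w hwa hwb) h))
    (by rw [ht.card_low hk1]; omega)
    (fun v w hva hvb hwa hwb => ht.comparable_iff_lowPos hk1 (fun p hp => (hidx p hp).2)
      (hmem' v hva hvb) (hmem' w hwa hwb))
    (Or.inl huA.2)
    (fun v hva hvb => by
      have hzl := ht.lev_eq p₀ hk1
      have hul := hl0 huA.1
      rcases hmem v hva hvb with ⟨hv, hvu⟩ | ⟨p, hp, hpv⟩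
      · have hvl := hl0 hv
        refine ⟨fun h => h.elim (hnot ?_) (hnot ?_), fun h => h.elim (hnot ?_) fun h4 => hvu ?_⟩
        · change lev _ _ v.1 ≤ lev _ _ u; omega
        · change lev _ _ u ≤ lev _ _ v.1; omega
        · change lev _ _ v.1 ≤ lev _ _ (z p₀ 1); omega
        · exact mem_singleton.1 (by rw [← hu]; exact mem_below.2 ⟨hv, h4⟩)
      · have hvl := ht.lev_eq p hk1
        rw [hpv] at hvl
        refine ⟨fun h => h.elim (fun h4 => huN p hp ?_) (hnot ?_),
          fun h => h.elim (hnot ?_) (hnot ?_)⟩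
        · rw [hpv]; exact h4
        · change lev _ _ u ≤ lev _ _ v.1; omega
        · change lev _ _ v.1 ≤ lev _ _ (z p₀ 1); omega
        · change lev _ _ (z p₀ 1) ≤ lev _ _ v.1; omega)
  -- Otherwise `z p₀ 2` could replace `u` in the antichain of minimal elements.
  have hx : ∃ x ∈ A, x ≠ u ∧ x < z p₀ 2 := by
    by_contra! hcon
    have h2l := ht.lev_eq p₀ hk
    have h2A : z p₀ 2 ∉ A := fun h => by have := hl0 h; omega
    have hT : insert (z p₀ 2) (A.erase u) ∈ antis (fun x y : P => x < y) (k + 1) univ := by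
      refine mem_antis.2 ⟨subset_univ _, ?_, ?_⟩
      · rw [card_insert_of_notMem fun h => h2A (mem_of_mem_erase h), card_erase_of_mem huA.1,
          ht.card_zero, Nat.add_sub_cancel]
      · intro x hx y hy
        rw [mem_insert, mem_erase] at hx hy
        rcases hx with rfl | ⟨hxu, hx⟩ <;> rcases hy with rfl | ⟨hyu, hy⟩
        · exact lt_irrefl _
        · have := hl0 hy
          exact hnot (by omega)
        · exact hcon x hx hxu
        · have h4 := hl0 hy
          have h5 := hl0 hx
          exact hnot (by omega)
    rcases ht.antis_eq _ hT with h | ⟨p, -, h⟩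
    · have h4 := mem_insert_self (z p₀ 2) (A.erase u)
      rw [h] at h4
      exact h2A h4
    · have h4 := mem_insert_self (z p₀ 2) (A.erase u)
      rw [h, mem_insert, mem_sdiff] at h4
      rcases h4 with h4 | h4
      · have := ht.lev_eq p hk1
        rw [← h4] at this
        omega
      · exact h2A h4.1
  obtain ⟨x, hxA, hxu, hxz⟩ := hx
  refine ⟨e, b, mem_level_one_iff.1 (hzmem p₀), heb, upperStrand z p₀, ht.upperStrand_subset p₀,
    ht.isChain_upperStrand p₀, by rw [Set.ncard_coe_finset, ht.card_upperStrand],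
    ⟨mem_coe.2 (mem_upperStrand.2 ⟨1, le_rfl, hk1, rfl⟩), fun y hy => ?_⟩, z p₀ 2,
    ⟨⟨mem_coe.2 (mem_upperStrand.2 ⟨2, by omega, hk, rfl⟩), ?_⟩, fun y hy => ?_⟩,
    ⟨x, Or.inl (mem_level_zero_iff.1 hxA)⟩, mem_level_zero_iff.1 hxA,
    he _ (fun h => hxu (congrArg Subtype.val h)) (fun h => ?_), hxz⟩
  · obtain ⟨j, hj1, hjk, rfl⟩ := mem_upperStrand.1 (mem_coe.1 hy)
    rcases hj1.eq_or_lt with rfl | hj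
    · exact le_rfl
    · exact (ht.lt_of_lt p₀ hj hjk).le
  · exact (ht.lt_of_lt p₀ one_lt_two hk).ne'
  · obtain ⟨hy, hy1⟩ := hy
    obtain ⟨j, hj1, hjk, rfl⟩ := mem_upperStrand.1 (mem_coe.1 hy)
    rcases hj1.eq_or_lt with rfl | hj
    · exact absurd rfl hy1
    · rcases (Nat.succ_le_of_lt hj).eq_or_lt with rfl | hj
      · exact le_rfl
      · exact (ht.lt_of_lt p₀ hj hjk).le
  · have h4 : x = z p₀ 1 := congrArg Subtype.val h
    have h5 := hl0 hxA
    rw [h4, ht.lev_eq p₀ hk1] at h5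
    omega

theorem Tight.isSpecial (ht : Tight (fun x y : P => x < y) univ k z)
    (hc : Conj (fun x y : P => x < y) r') (hk : 2 ≤ k) : IsSpecial k P where
  card_eq := ht.card_eq
  card_firstLevel := ht.ncard_firstLevel
  chains := ht.chain_decomposition
  antichains := ht.antichain_decomposition
  card_chains := ht.ncard_chains (by omega)
  card_secondLevel := ht.ncard_secondLevel (by omega)
  lowGraph_eq := by
    have hk1 : 1 ≤ k := by omega
    by_cases h : ∀ p, (below (fun x y : P => x < y) (level (fun x y : P => x < y) univ 0)
      (z p 1)).card = 2
    · exact Or.inl (ht.lowGraphIsPath hc hk1 h)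
    · push Not at h
      obtain ⟨p₀, hp₀⟩ := h
      have h1 := ht.le_two p₀
      have h2 := card_pos.2 ⟨_, ht.strands.mem_below_self p₀ (j := 0) (by omega)⟩
      rw [Nat.zero_add] at h2
      obtain ⟨u, hu⟩ := card_eq_one.1 (by omega : (below (fun x y : P => x < y)
        (level (fun x y : P => x < y) univ 0) (z p₀ 1)).card = 1)
      have hc' : Conj (fun x y : P => x < y) (flip r') :=
        ⟨hc.left, ⟨hc.right.irrefl, fun h h' => hc.right.trans h' h⟩, fun x y hxy => by
          rw [← hc.compl x y hxy]
          exact or_comm⟩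
      exact Or.inr ((ht.rank_eq_of_single hc hk1 hu).elim
        (ht.lowGraphIsPathAndEdge hc hk hu) (ht.lowGraphIsPathAndEdge hc' hk hu))

end

section
variable {P : Type u} {k : ℕ} {r' : P → P → Prop}

/-- The partial order with the strict part `ρ`. -/
@[reducible] def StrictRel.toPartialOrder {ρ : α → α → Prop} (h : StrictRel ρ) :
    PartialOrder α where
  le x y := x = y ∨ ρ x y
  lt := ρ
  le_refl x := Or.inl rfl
  le_trans x y z := by
    rintro (rfl | h1) (rfl | h2)
    · exact Or.inl rfl
    · exact Or.inr h2
    · exact Or.inr h1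
    · exact Or.inr (h.trans h1 h2)
  le_antisymm x y := by
    rintro (rfl | h1) (h2 | h2)
    · rfl
    · rfl
    · exact h2.symm
    · exact absurd (h.trans h1 h2) (h.irrefl x)
  lt_iff_le_not_ge x y := by
    constructor
    · intro h1
      refine ⟨Or.inr h1, ?_⟩
      rintro (rfl | h2)
      · exact h.irrefl _ h1
      · exact h.irrefl _ (h.trans h1 h2)
    · rintro ⟨rfl | h1, h2⟩
      · exact absurd (Or.inl rfl) h2
      · exact h1

theorem Conj.isDualOrder [o : PartialOrder P] {ρ : P → P → Prop}
    (hc : Conj (fun x y : P => x < y) ρ) : IsDualOrder o hc.right.toPartialOrder := by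
  intro x y hne
  have h1 : Comparable o x y ↔ x < y ∨ y < x :=
    ⟨Or.imp (fun h => lt_of_le_of_ne h hne) (fun h => lt_of_le_of_ne h hne.symm),
      Or.imp le_of_lt le_of_lt⟩
  have h2 : Comparable hc.right.toPartialOrder x y ↔ ρ x y ∨ ρ y x :=
    ⟨Or.imp (fun h => h.resolve_left hne) (fun h => h.resolve_left hne.symm),
      Or.imp Or.inr Or.inr⟩
  rw [h1, h2]
  exact hc.compl x y hne

/-- A tight reversed order makes the order dual special, and a tight conjugate order makes a dual
in the sense of comparability special. -/
theorem TightPair.isSpecial [Fintype P] [o : PartialOrder P]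
    (hc : Conj (fun x y : P => x < y) r') (hk : 2 ≤ k)
    (h : TightPair (fun x y : P => x < y) r' univ k) :
    IsSpecial k P ∨ IsSpecial k Pᵒᵈ ∨
      ∃ o' : PartialOrder P, IsDualOrder o o' ∧ @IsSpecial k P o' := by
  have hflip : ∀ {ρ : P → P → Prop}, StrictRel ρ → StrictRel (flip ρ) :=
    fun h => ⟨h.irrefl, fun h1 h2 => h.trans h2 h1⟩
  have dual : ∀ {ρ : P → P → Prop} {z : Fin k → ℕ → P} (hρ : Conj (fun x y : P => x < y) ρ),
      Tight ρ univ k z → ∃ o' : PartialOrder P, IsDualOrder o o' ∧ @IsSpecial k P o' := by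
    intro ρ z hρ ht
    refine ⟨hρ.right.toPartialOrder, hρ.isDualOrder, ?_⟩
    have hs : Conj ρ (fun x y : P => x < y) := hρ.symm
    let _ : PartialOrder P := hρ.right.toPartialOrder
    exact Tight.isSpecial (P := P) (z := z) ht hs hk
  obtain ⟨z, ht | ht | ht | ht⟩ := h
  · exact Or.inl (ht.isSpecial hc hk)
  · refine Or.inr (Or.inl ?_)
    have hs : Conj (flip fun x y : P => x < y) r' :=
      ⟨hflip hc.left, hc.right, fun x y hne => by
        rw [hc.compl x y hne]
        exact not_congr or_comm⟩
    exact Tight.isSpecial (P := Pᵒᵈ) (r' := r') (z := z) ht hs hk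
  · exact Or.inr (Or.inr (dual hc ht))
  · refine Or.inr (Or.inr (dual (ρ := flip r') ⟨hc.left, hflip hc.right, fun x y hne => ?_⟩ ht))
    rw [← hc.compl x y hne]
    exact or_comm

theorem homogenousCount_eq_hom [Fintype P] [PartialOrder P] (hk : 1 ≤ k) :
    homogenousCount k P = hom (fun x y : P => x < y) k univ := by
  have h1 : {s : Set P | s.ncard = k + 1 ∧ (IsChain (· ≤ ·) s ∨ IsAntichain (· ≤ ·) s)} =
      (fun T : Finset P => (T : Set P)) '' ((chains (fun x y : P => x < y) (k + 1) univ ∪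
        antis (fun x y : P => x < y) (k + 1) univ : Finset (Finset P)) : Set (Finset P)) := by
    ext s
    constructor
    · rintro ⟨h1, h2⟩
      refine ⟨s.toFinset, ?_, Set.coe_toFinset s⟩
      have h3 : s.toFinset.card = k + 1 := by rw [← h1, Set.ncard_eq_toFinset_card']
      rw [← Set.coe_toFinset s, isChain_coe_iff, isAntichain_coe_iff] at h2
      rw [mem_coe, mem_union, mem_chains, mem_antis]
      exact h2.imp (fun h => ⟨subset_univ _, h3, h⟩) fun h => ⟨subset_univ _, h3, h⟩
    · rintro ⟨T, hT, rfl⟩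
      rw [mem_coe, mem_union, mem_chains, mem_antis] at hT
      change (T : Set P).ncard = k + 1 ∧ (IsChain _ (T : Set P) ∨ IsAntichain _ (T : Set P))
      rw [Set.ncard_coe_finset, isChain_coe_iff, isAntichain_coe_iff]
      exact hT.elim (fun h => ⟨h.2.1, Or.inl h.2.2⟩) fun h => ⟨h.2.1, Or.inr h.2.2⟩
  rw [homogenousCount, h1, Set.ncard_image_of_injective _ coe_injective, Set.ncard_coe_finset,
    hom, card_union_of_disjoint]
  rw [disjoint_left]
  intro T hT hT'
  rw [mem_chains] at hT
  rw [mem_antis] at hT'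
  obtain ⟨x, hx, y, hy, hne⟩ := one_lt_card.1 (by omega : 1 < T.card)
  exact (hT.2.2 x hx y hy hne).elim (hT'.2.2 x hx y hy) (hT'.2.2 y hy x hx)

/-- If the order is the intersection of two linear orders, reversing the second one yields an order
in which exactly the incomparable pairs are comparable. -/
theorem OrderDimLE.exists_conj [PartialOrder P] (h : OrderDimLE P 2) :
    ∃ r' : P → P → Prop, Conj (fun x y : P => x < y) r' := by
  obtain ⟨L, hL⟩ := h
  have hle : ∀ x y : P, x ≤ y ↔ (L 0).le x y ∧ (L 1).le x y := fun x y => by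
    rw [hL, Fin.forall_fin_two]
  refine ⟨fun x y => x ≠ y ∧ (L 0).le x y ∧ (L 1).le y x, strictRel_lt P,
    ⟨fun x h => h.1 rfl, ?_⟩, ?_⟩
  · rintro x y z ⟨h1, h2, h3⟩ ⟨-, h5, h6⟩
    refine ⟨?_, (L 0).le_trans _ _ _ h2 h5, (L 1).le_trans _ _ _ h6 h3⟩
    rintro rfl
    exact h1 ((L 0).le_antisymm _ _ h2 h5)
  · intro x y hne
    have e1 : x < y ↔ (L 0).le x y ∧ (L 1).le x y := by
      rw [← hle]; exact ⟨le_of_lt, fun h => lt_of_le_of_ne h hne⟩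
    have e2 : y < x ↔ (L 0).le y x ∧ (L 1).le y x := by
      rw [← hle]; exact ⟨le_of_lt, fun h => lt_of_le_of_ne h hne.symm⟩
    have a0 := (L 0).le_total x y
    have a1 := (L 1).le_total x y
    have b0 : ¬ ((L 0).le x y ∧ (L 0).le y x) := fun h => hne ((L 0).le_antisymm _ _ h.1 h.2)
    have b1 : ¬ ((L 1).le x y ∧ (L 1).le y x) := fun h => hne ((L 1).le_antisymm _ _ h.1 h.2)
    have hne' := hne.symm
    rw [e1, e2]
    tauto

theorem Splits.exists_isDecomposition [Fintype P] [PartialOrder P]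
    (h : Splits (fun x y : P => x < y) univ k) :
    ∃ C : Fin k → Set P, IsDecomposition Set.univ C ∧
      ((∀ i, IsChain (· ≤ ·) (C i)) ∨ (∀ i, IsAntichain (· ≤ ·) (C i))) ∧
      (k ^ 2 ≤ Nat.card P + 2 → ∀ i, (C i).ncard = Nat.card P / k ∨
        (C i).ncard = Nat.card P ⌈/⌉ k) := by
  obtain ⟨C, h1, h2, h3, h4⟩ := h
  refine ⟨fun i => C i, ⟨fun i j hij => disjoint_coe.2 (h1 i j hij), ?_⟩,
    h3.imp (fun h i => isChain_coe_iff.2 (h i)) fun h i => isAntichain_coe_iff.2 (h i),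
    fun hn i => ?_⟩
  · rw [Set.eq_univ_iff_forall]
    intro x
    obtain ⟨i, -, hi⟩ := mem_biUnion.1 (by rw [h2]; exact mem_univ x)
    exact Set.mem_iUnion.2 ⟨i, mem_coe.2 hi⟩
  · rw [Nat.card_eq_fintype_card, ← card_univ] at hn ⊢
    rw [Set.ncard_coe_finset]
    exact h4 hn i

end

/-! ### Monotone subsequences of `τ_{k,n}` -/

section
variable {k n : ℕ}

/-- An increasing subsequence of a concatenation of blocks with decreasing values lies in a single
block. -/
theorem exists_sublist_of_increasing {Ls : List (List ℕ)}
    (h : Ls.Pairwise fun l l' => ∀ x ∈ l, ∀ y ∈ l', y < x) {s : List ℕ} (hs : s.Sublist Ls.flatten)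
    (hinc : s.Pairwise (· < ·)) (hne : s ≠ []) : ∃ l ∈ Ls, s.Sublist l := by
  induction Ls generalizing s with
  | nil => exact absurd (List.sublist_nil.1 hs) hne
  | cons l Ls ih =>
    rw [List.pairwise_cons] at h
    rw [List.flatten_cons, List.sublist_append_iff] at hs
    obtain ⟨s₁, s₂, rfl, h1, h2⟩ := hs
    rw [List.pairwise_append] at hinc
    rcases s₁ with - | ⟨x, s₁⟩
    · obtain ⟨l', hl', hs⟩ := ih h.2 h2 hinc.2.1 hne
      exact ⟨l', List.mem_cons_of_mem _ hl', hs⟩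
    · rcases s₂ with - | ⟨y, s₂⟩
      · exact ⟨l, List.mem_cons_self, by simpa using h1⟩
      · obtain ⟨l', hl', hy⟩ := List.mem_flatten.1 (h2.subset List.mem_cons_self)
        have h3 := h.1 l' hl' x (h1.subset List.mem_cons_self) y hy
        have h4 := hinc.2.2 x List.mem_cons_self y List.mem_cons_self
        omega

/-- A decreasing subsequence contains at most one element of each increasing block. -/
theorem length_le_of_decreasing {Ls : List (List ℕ)} (h : ∀ l ∈ Ls, l.Pairwise (· < ·))
    {s : List ℕ} (hs : s.Sublist Ls.flatten) (hdec : s.Pairwise (· > ·)) :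
    s.length ≤ Ls.length := by
  induction Ls generalizing s with
  | nil => simp [List.sublist_nil.1 hs]
  | cons l Ls ih =>
    rw [List.flatten_cons, List.sublist_append_iff] at hs
    obtain ⟨s₁, s₂, rfl, h1, h2⟩ := hs
    rw [List.pairwise_append] at hdec
    have h3 := ih (fun l' hl' => h l' (List.mem_cons_of_mem _ hl')) h2 hdec.2.1
    have h4 := (h l List.mem_cons_self).sublist h1
    have h5 : s₁.length ≤ 1 := by
      rcases s₁ with - | ⟨x, - | ⟨y, s₁⟩⟩
      · simp
      · simp
      · have h6 := List.rel_of_pairwise_cons h4 (a' := y) List.mem_cons_self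
        have h7 := List.rel_of_pairwise_cons hdec.1 (a' := y) List.mem_cons_self
        omega
    rw [List.length_append, List.length_cons]
    omega

/-- For block lengths `q` and `q + 1`, the number of `(k + 1)`-subsets is an affine function of the
total length. -/
theorem sum_choose_add {q : ℕ} {L : List ℕ} (h : ∀ a ∈ L, a = q ∨ a = q + 1) :
    (L.map fun a => a.choose (k + 1)).sum + L.length * q * q.choose k =
      L.length * q.choose (k + 1) + L.sum * q.choose k := by
  induction L with
  | nil => simp
  | cons a L ih =>
    have ih := ih fun b hb => h b (List.mem_cons_of_mem _ hb)
    rw [List.map_cons, List.sum_cons, List.sum_cons, List.length_cons]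
    rcases h a List.mem_cons_self with rfl | rfl
    · linarith
    · rw [Nat.choose_succ_succ]
      linarith

/-- The blocks of `τ_{k,n}`. -/
def runs (k n : ℕ) : List (List ℕ) :=
  (List.range k).reverse.map
    fun j => List.range' (j * n / k + 1) ((j + 1) * n / k - j * n / k)

theorem tau_eq_flatten_runs : tau k n = (runs k n).flatten := List.flatMap_def

theorem runs_pairwise : (runs k n).Pairwise fun l l' => ∀ x ∈ l, ∀ y ∈ l', y < x := by
  rw [runs, List.pairwise_map, List.pairwise_reverse]
  refine List.pairwise_lt_range.imp fun {i j} hij x hx y hy => ?_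
  rw [List.mem_range'_1] at hx hy
  have h1 : (i + 1) * n / k ≤ j * n / k := Nat.div_le_div_right (Nat.mul_le_mul_right n hij)
  have h2 : i * n / k ≤ (i + 1) * n / k :=
    Nat.div_le_div_right (Nat.mul_le_mul_right n (Nat.le_succ i))
  omega

theorem length_run (hk : 1 ≤ k) (j : ℕ) :
    (j + 1) * n / k - j * n / k = n / k ∨ (j + 1) * n / k - j * n / k = n / k + 1 := by
  rw [add_mul, one_mul, Nat.add_div (by omega : 0 < k)]
  generalize j * n / k = x
  generalize n / k = y
  split_ifs <;> omega

/-- Only the monotone subsequences inside a block have length `k + 1`. (Equality holds, but is not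
needed.) -/
theorem monotoneCount_tau_le (hk : 1 ≤ k) : monotoneCount k (tau k n) ≤ opt k n := by
  have hinc : ∀ l ∈ runs k n, l.Pairwise (· < ·) := by
    intro l hl
    obtain ⟨j, -, rfl⟩ := List.mem_map.1 hl
    exact List.pairwise_lt_range'
  have hlen : (runs k n).length = k := by simp [runs]
  have hnodup : (tau k n).Nodup := (tau_perm k n hk).nodup_iff.2 List.nodup_range'
  have h1 : monotoneCount k (tau k n) ≤ ((runs k n).flatMap (List.sublistsLen (k + 1))).length := by
    rw [monotoneCount, List.countP_eq_length_filter]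
    refine (List.subperm_of_subset (((List.nodup_sublists'.2 hnodup).sublist
      (List.sublistsLen_sublist_sublists' _ _)).filter _) fun s hs => ?_).length_le
    rw [List.mem_filter, List.mem_sublistsLen, decide_eq_true_eq] at hs
    obtain ⟨⟨hs, hsl⟩, hmono⟩ := hs
    rw [tau_eq_flatten_runs] at hs
    rcases hmono with hmono | hmono
    · obtain ⟨l, hl, hsl'⟩ := exists_sublist_of_increasing runs_pairwise hs hmono
        (by rintro rfl; simp at hsl)
      exact List.mem_flatMap.2 ⟨l, hl, List.mem_sublistsLen.2 ⟨hsl', hsl⟩⟩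
    · have := length_le_of_decreasing hinc hs hmono
      omega
  have h2 : ((runs k n).map List.length).sum = n := by
    rw [← List.length_flatten, ← tau_eq_flatten_runs, (tau_perm k n hk).length_eq,
      List.length_range']
  have h3 := sum_choose_add (k := k) (q := n / k) (L := (runs k n).map List.length) (by
    intro a ha
    obtain ⟨l, hl, rfl⟩ := List.mem_map.1 ha
    obtain ⟨j, -, rfl⟩ := List.mem_map.1 hl
    rw [List.length_range']
    exact length_run hk j)
  have h4 : ((runs k n).flatMap (List.sublistsLen (k + 1))).length =
      (((runs k n).map List.length).map fun a => a.choose (k + 1)).sum := by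
    rw [List.length_flatMap, List.map_map]
    congr 2
    funext l
    exact List.length_sublistsLen _ _
  rw [h2, List.length_map, hlen] at h3
  have h5 : n = k * (n / k) + n % k := (Nat.div_add_mod n k).symm
  have h6 : n * (n / k).choose k = k * (n / k) * (n / k).choose k + n % k * (n / k).choose k := by
    rw [← add_mul, ← h5]
  rw [h6] at h3
  rw [h4] at h1
  rw [opt]
  omega

end

/-! ### The range of the parameters -/

/-- For `n ≤ k² + c k^{3/2} / log k`, the surplus per level is at most `m = ⌊c √k / log k⌋`, and
`l = ⌈log₂ (2 (k + 1))⌉` satisfies the conditions of `Params` for all `a ≤ m`. -/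
theorem exists_params : ∃ k₀ : ℕ, ∀ k n : ℕ, k₀ ≤ k →
    (n : ℝ) ≤ (k : ℝ) ^ 2 + 1 / 6000 * (k : ℝ) ^ (3 / 2 : ℝ) / Real.log k →
    3 ≤ k ∧ ∃ l m : ℕ, n ≤ k ^ 2 + m * k + k ∧
      ∀ a b, 1 ≤ a → a ≤ m → 1 ≤ b → b ≤ k → Params k a b l (l * (a + 2)) := by
  have hlittle : ∀ᶠ x : ℝ in Filter.atTop, Real.log x ^ (4 : ℝ) ≤ 1 / 10 ^ 7 * x ^ (1 / 2 : ℝ) := by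
    have h := (isLittleO_log_rpow_rpow_atTop (4 : ℝ) (by norm_num : (0 : ℝ) < 1 / 2)).bound
      (by norm_num : (0 : ℝ) < 1 / 10 ^ 7)
    filter_upwards [h, Filter.eventually_ge_atTop 1] with x hx hx1
    rwa [Real.norm_of_nonneg (Real.rpow_nonneg (Real.log_nonneg hx1) _),
      Real.norm_of_nonneg (Real.rpow_nonneg (by linarith) _)] at hx
  have hlog : ∀ᶠ x : ℝ in Filter.atTop, 1 ≤ Real.log x :=
    Real.tendsto_log_atTop.eventually_ge_atTop 1
  obtain ⟨k₁, hk₁⟩ := Filter.eventually_atTop.1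
    (tendsto_natCast_atTop_atTop.eventually (hlittle.and hlog))
  refine ⟨max k₁ 10, fun k n hk hn => ?_⟩
  have hk10 : 10 ≤ k := (le_max_right _ _).trans hk
  obtain ⟨hL4, hL1⟩ := hk₁ k ((le_max_left _ _).trans hk)
  rw [← Real.sqrt_eq_rpow, show (4 : ℝ) = ((4 : ℕ) : ℝ) by norm_num, Real.rpow_natCast] at hL4
  set L := Real.log k with hL
  set s := √(k : ℝ) with hs
  have hs0 : 0 ≤ s := Real.sqrt_nonneg _
  have hsk : s ^ 2 = k := Real.sq_sqrt (Nat.cast_nonneg k)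
  have hk0 : (0 : ℝ) < k := by exact_mod_cast (by omega : 0 < k)
  have h32 : (k : ℝ) ^ (3 / 2 : ℝ) = k * s := by
    rw [hs, Real.sqrt_eq_rpow, show (3 / 2 : ℝ) = 1 + 1 / 2 by norm_num, Real.rpow_add hk0,
      Real.rpow_one]
  have hLL : L ≤ L ^ 4 := by
    calc L = L ^ 1 := (pow_one L).symm
      _ ≤ L ^ 4 := pow_le_pow_right₀ hL1 (by norm_num)
  set l := Nat.clog 2 (2 * (k + 1)) with hl
  have hl1 : 2 * (k + 1) ≤ 2 ^ l := Nat.le_pow_clog (by norm_num) _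
  have hl0 : 1 ≤ l := Nat.clog_pos (by norm_num) (by omega)
  have hl2 : 2 ^ (l - 1) < 2 * (k + 1) :=
    Nat.pow_pred_clog_lt_self (x := 2 * (k + 1)) Nat.one_lt_two (by omega)
  have hl3 : (l : ℝ) ≤ 3 * L := by
    have h1 : 2 ^ l ≤ k ^ 2 := by
      have h2 : 2 ^ l = 2 * 2 ^ (l - 1) := by
        rw [← pow_succ', Nat.sub_add_cancel hl0]
      nlinarith
    have h2 : (l : ℝ) * Real.log 2 ≤ 2 * L := by
      have h3 : ((2 : ℝ) ^ l) ≤ (k : ℝ) ^ 2 := by exact_mod_cast h1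
      have h4 := Real.log_le_log (by positivity) h3
      rw [Real.log_pow, Real.log_pow] at h4
      exact_mod_cast h4
    have h3 := Real.log_two_gt_d9
    have h4 : (0 : ℝ) ≤ l := Nat.cast_nonneg l
    nlinarith
  set m := ⌊1 / 6000 * s / L⌋₊ with hm
  have hx0 : 0 ≤ 1 / 6000 * s / L := by positivity
  have hmle : (m : ℝ) ≤ 1 / 6000 * s / L := Nat.floor_le hx0
  have hmlt : 1 / 6000 * s / L < m + 1 := Nat.lt_floor_add_one _
  refine ⟨by omega, l, m, ?_, fun a b ha ham hb hbk => ⟨ha, hb, hbk, hl1, rfl, ?_, ?_⟩⟩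
  · rw [h32, show 1 / 6000 * ((k : ℝ) * s) / L = k * (1 / 6000 * s / L) by ring] at hn
    have h1 : (n : ℝ) ≤ (k : ℝ) ^ 2 + m * k + k := by nlinarith
    exact_mod_cast h1
  all_goals
    have hg : ((l * (a + 2) : ℕ) : ℝ) ≤ s / 1000 := by
      have h1 : (a : ℝ) ≤ 1 / 6000 * s / L := le_trans (by exact_mod_cast ham) hmle
      have h2 : L * (1 / 6000 * s / L) = 1 / 6000 * s := by field_simp
      push_cast
      calc (l : ℝ) * (a + 2) ≤ 3 * L * (1 / 6000 * s / L + 2) := by gcongr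
        _ = 3 * (L * (1 / 6000 * s / L)) + 6 * L := by ring
        _ ≤ s / 1000 := by rw [h2]; linarith
    have hg0 : (0 : ℝ) ≤ (l * (a + 2) : ℕ) := Nat.cast_nonneg _
  · have h1 : (10 : ℝ) ^ 6 * ((l * (a + 2) : ℕ) : ℝ) ^ 2 ≤ k := by
      calc (10 : ℝ) ^ 6 * ((l * (a + 2) : ℕ) : ℝ) ^ 2 ≤ 10 ^ 6 * (s / 1000) ^ 2 := by gcongr
        _ = (k : ℝ) := by rw [← hsk]; ring
    exact_mod_cast h1
  · have h1 : (10 : ℝ) ^ 8 * (l : ℝ) ^ 4 * ((l * (a + 2) : ℕ) : ℝ) ≤ k := by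
      calc (10 : ℝ) ^ 8 * (l : ℝ) ^ 4 * ((l * (a + 2) : ℕ) : ℝ)
          ≤ 10 ^ 8 * (3 * L) ^ 4 * (s / 1000) := by gcongr
        _ = 81 * 10 ^ 5 * L ^ 4 * s := by ring
        _ ≤ 81 * 10 ^ 5 * (1 / 10 ^ 7 * s) * s := by gcongr
        _ ≤ s ^ 2 := by nlinarith
        _ = (k : ℝ) := hsk
    exact_mod_cast h1

end MonoPosets

theorem mainTheorem1 :
    ∃ k₀ : ℕ, ∃ c : ℝ, 0 < c ∧
      ∀ k n : ℕ, k₀ ≤ k →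
        (n : ℝ) ≤ (k : ℝ) ^ 2 + c * (k : ℝ) ^ (3 / 2 : ℝ) / Real.log k →
        ∀ (P : Type*) [Finite P] [o : PartialOrder P],
          Nat.card P = n → MonoPosets.OrderDimLE P 2 →
          MonoPosets.monotoneCount k (MonoPosets.tau k n) ≤ MonoPosets.homogenousCount k P ∧
          (MonoPosets.homogenousCount k P = MonoPosets.monotoneCount k (MonoPosets.tau k n) →
            (∃ C : Fin k → Set P, MonoPosets.IsDecomposition Set.univ C ∧
              ((∀ i, IsChain (· ≤ ·) (C i)) ∨ (∀ i, IsAntichain (· ≤ ·) (C i))) ∧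
              (k ^ 2 ≤ n + 2 → ∀ i, (C i).ncard = n / k ∨ (C i).ncard = n ⌈/⌉ k)) ∨
            (n = k ^ 2 + k + 1 ∧
              (MonoPosets.IsSpecial k P ∨ MonoPosets.IsSpecial k Pᵒᵈ ∨
                ∃ o' : PartialOrder P, MonoPosets.IsDualOrder o o' ∧
                  @MonoPosets.IsSpecial k P o'))) := by
  obtain ⟨k₀, hk₀⟩ := MonoPosets.exists_params
  refine ⟨k₀, 1 / 6000, by norm_num, fun k n hk hn P _ o hP hdim => ?_⟩
  obtain ⟨hk3, l, m, hnm, hpar⟩ := hk₀ k n hk hn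
  have := Fintype.ofFinite P
  subst hP
  obtain ⟨r', hc⟩ := hdim.exists_conj
  have hcard : (Finset.univ : Finset P).card = Nat.card P := by
    rw [Finset.card_univ, Nat.card_eq_fintype_card]
  obtain ⟨h1, h2⟩ := MonoPosets.opt_le_hom hc hk3 hpar (S := Finset.univ) (by rw [hcard]; exact hnm)
  rw [hcard] at h1 h2
  have hle := MonoPosets.monotoneCount_tau_le (n := Nat.card P) (by omega : 1 ≤ k)
  rw [MonoPosets.homogenousCount_eq_hom (by omega)]
  refine ⟨hle.trans h1, fun heq => ?_⟩
  rcases h2 (by omega) with h | ⟨h3, h4⟩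
  · exact Or.inl h.exists_isDecomposition
  · exact Or.inr ⟨h3, h4.isSpecial hc (by omega)⟩
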